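/- **Setting.** Let $\Omega=(0,R)\times(0,L)$ with coordinates $(r,z)$ and $\Gamma=\partial\Omega$. Let $\Omega_0\subset\Omega$ (the workpiece) be a nonempty polygonal open set with Lipschitz boundary, not necessarily convex, and let $\Omega_1,\dots,\Omega_m\subset\Omega$ (the coil rings) be nonempty open sets, with $\Omega_0,\dots,\Omega_m$ pairwise disjoint. Put $\Omega_C=\bigcup_{k=0}^m\Omega_k$, $\Omega_a=\Omega\setminus\Omega_C$ and $\widehat\Gamma_1=\partial\Omega_0\cap\{r>0\}$. Let $L^2_\alpha(D)$ be the space $L^2(D;r^\alpha\,dr\,dz)$, and $L^2_1(\widehat\Gamma_1)=L^2(\widehat\Gamma_1;r\,dl)$. Let $H^1_1(D)$ be the space of functions in $L^2_1(D)$ with distributional first derivatives in $L^2_1(D)$. Put $\widetilde H^1_1(\Omega)=H^1_1(\Omega)\cap L^2_{-1}(\Omega)$ (complex valued), with norm $(\|Z\|_{H^1_1}^2+\|Z\|_{L^2_{-1}}^2)^{1/2}$, and let $\widetilde H^1_{1,\Gamma}(\Omega)$ be the subspace of functions vanishing on $\Gamma$. Temperatures are real valued. $H^1_1(\Omega_0)'$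 is the dual space, and $u\in L^2_1(\Omega_0)$ is identified with the functional $W\mapsto\int_{\Omega_0}uWr\,dr\,dz$. **Data.** Let $\omega,\mathcal T,\nu_0>0$. The functions $\sigma$ on $\Omega\times\mathbb R$ and $\kappa$ on $\Omega_0\times\mathbb R$ are Carathéodory, and $\eta$ is measurable. With positive constants, $\eta_*\le\eta\le\eta^*$ a.e. on $\widehat\Gamma_1$, and $\kappa_*\le\kappa(x,u)\le\kappa^*$, $\sigma_*\le\sigma(x,u)\le\sigma^*$ for a.e. $x\in\Omega_0$ and all $u\in\mathbb R$. For all $u$, $\sigma(\cdot,u)=\sigma_k>0$ a.e. in $\Omega_k$ ($1\le k\le m$; $\sigma_k$ constant) and $\sigma(\cdot,u)=0$ a.e. in $\Omega_a$. The reluctivity $\nu_C:[0,\infty)\to\mathbb R$ satisfies, with positive constants and for all $p,q\ge0$, $$\nu_{\min}\le\nu_C(p)\le\nu_0,\quad |\nu_C(p)p-\nu_C(q)q|\le\xi|p-q|,\quad (\nu_C(p)p-\nu_C(q)q)(p-q)\ge\varrho|p-q|^2 .$$ Put $\nu=\nu_C$ in $\Omega_C$, $\nu=\nu_0$ in $\Omega_a$,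 and $$\langle\mathcal A(G),Z\rangle=\int_\Omega\nu(|\mathbf{curl}(G e_\theta)|)\Big(\tfrac1r\partial_r(rG)\,\tfrac1r\partial_r(r\bar Z)+\partial_zG\,\partial_z\bar Z\Big)r\,dr\,dz,\qquad |\mathbf{curl}(Ge_\theta)|^2=\big|\tfrac1r\partial_r(rG)\big|^2+|\partial_zG|^2 .$$ **Problem.** Given $\mathbf V\in\mathbb C^m$, $T_c\in L^2(0,\mathcal T;L^2_1(\widehat\Gamma_1))$, $T_0\in L^2_1(\Omega_0)$ and $\mathring\kappa:\Omega_0\to\mathbb R$, find $$A\in L^2(0,\mathcal T;\widetilde H^1_{1,\Gamma}(\Omega)),\qquad T\in L^2(0,\mathcal T;H^1_1(\Omega_0))\cap H^1(0,\mathcal T;H^1_1(\Omega_0)')$$ such that $T(0)=T_0$ (for the representative in $C([0,\mathcal T];L^2_1(\Omega_0))$) and, for a.e. $t\in(0,\mathcal T)$, all $Z\in\widetilde H^1_{1,\Gamma}(\Omega)$ and all $W\in H^1_1(\Omega_0)$, $$i\omega\int_{\Omega_C}\sigma(\cdot,T)A\bar Z\,r\,dr\,dz+\langle\mathcal A(A),Z\rangle=\sum_{k=1}^m\int_{\Omega_k}\sigma_kV_k\bar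 Z\,dr\,dz,$$ $$\langle\partial_tT,W\rangle+\int_{\Omega_0}\mathring\kappa\,\nabla T\cdot\nabla W\,r\,dr\,dz+\int_{\widehat\Gamma_1}\eta TW\,r\,dl=\frac12\int_{\Omega_0}\omega^2\sigma(\cdot,T)|A|^2W\,r\,dr\,dz+\int_{\widehat\Gamma_1}\eta T_cW\,r\,dl .$$ A solution is called *regular* if $T\in H^1(0,\mathcal T;L^2_1(\Omega_0))$, the equations being understood with $\langle\partial_tT,W\rangle=\int_{\Omega_0}\partial_tT\,W\,r\,dr\,dz$. **Theorem.** Assume * $\mathbf H_\kappa$: $\kappa(x,u)=\mathring\kappa(x)$ for a.e. $x\in\Omega_0$ and all $u\in\mathbb R$; * $\mathbf H_\sigma$: there is $\sigma_p>0$ with $|\sigma(x,u)-\sigma(x,v)|\le\sigma_p|u-v|$ for all $u,v\in\mathbb R$ and a.e. $x\in\Omega_0$. Then for all $\mathbf V$, $T_c$ and $T_0$ as above the problem has a unique solution $(A,T)$ (as classes of functions of $t$ up to a.e. equality). Moreover, the regular solutions are exactly the solutions with $T\in H^1(0,\mathcal T;L^2_1(\Omega_0))$, and any two regular solutions coincide.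 -/

import Mathlib

open MeasureTheory Set Filter Topology
open scoped NNReal ContDiff ComplexConjugate

noncomputable section

namespace InductionHeating

/-- The meridian plane, with coordinates `x 0 = r`, `x 1 = z` and the Euclidean metric. -/
abbrev Plane := EuclideanSpace ℝ (Fin 2)

/-- The measure `r dr dz` on `D ⊆ {r > 0}`. -/
def rMeasure (D : Set Plane) : Measure Plane :=
  (volume.restrict D).withDensity fun x => ENNReal.ofReal (x 0)

/-- The measure `r dl` (`dl` is arc length) on the part of the boundary of `D` off the axis. -/
def rBoundaryMeasure (D : Set Plane) : Measure Plane :=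
  ((Measure.hausdorffMeasure 1 : Measure Plane).restrict
    (frontier D ∩ {x | 0 < x 0})).withDensity fun x => ENNReal.ofReal (x 0)

/-! ### Weighted Sobolev spaces -/

/-- Smooth functions with compact support in `D ∩ {r > 0}` (that is, in `D` if `D ⊆ {r > 0}`). -/
def IsTest {F : Type*} [NormedAddCommGroup F] [NormedSpace ℝ F]
    (D : Set Plane) (φ : Plane → F) : Prop :=
  ContDiff ℝ ∞ φ ∧ HasCompactSupport φ ∧ tsupport φ ⊆ D ∩ {x | 0 < x 0}

/-- `v` is the partial derivative of `u` in direction `i` (`0` for `r`, `1` for `z`) in the sense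
of distributions on `D`. -/
def IsWeakPartial {F : Type*} [NormedAddCommGroup F] [NormedSpace ℝ F]
    (D : Set Plane) (i : Fin 2) (u v : Plane → F) : Prop :=
  ∀ φ : Plane → ℝ, IsTest D φ →
    ∫ x in D, (fderiv ℝ φ x (EuclideanSpace.single i 1)) • u x = -∫ x in D, φ x • v x

theorem integrable_smul_of_support {𝕜 : Type*} [RCLike 𝕜] {D : Set Plane} {ψ : Plane → ℝ}
    (hc : Continuous ψ) (hK : HasCompactSupport ψ) (hs : tsupport ψ ⊆ D ∩ {x | 0 < x 0})
    (u : Lp 𝕜 2 (rMeasure D)) : Integrable (fun x => ψ x • u x) (volume.restrict D) := by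
  have hx0 : Continuous fun x : Plane => x 0 := by fun_prop
  have hh : Continuous fun x => ψ x / x 0 := by
    rw [continuous_iff_continuousAt]
    intro x
    by_cases hx : x ∈ tsupport ψ
    · exact hc.continuousAt.div hx0.continuousAt (ne_of_gt (hs hx).2)
    · have : (fun x => ψ x / x 0) =ᶠ[𝓝 x] fun _ => 0 := by
        filter_upwards [notMem_tsupport_iff_eventuallyEq.1 hx] with y hy
        simp [hy]
      exact (continuousAt_const (y := (0 : ℝ))).congr this.symm
  have hsupp : ∀ x, x ∉ tsupport ψ → ψ x = 0 := fun x hx => image_eq_zero_of_notMem_tsupport hx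
  have hcs : HasCompactSupport fun x => ψ x / x 0 :=
    HasCompactSupport.intro hK fun x hx => by simp [hsupp x hx]
  obtain ⟨C, hC⟩ := hcs.exists_bound_of_continuous hh
  have hfin : rMeasure D (tsupport ψ) < ⊤ := by
    obtain ⟨M, hM⟩ := (hK.isCompact.image hx0).bddAbove
    rw [rMeasure, withDensity_apply _ (isClosed_tsupport ψ).measurableSet]
    calc ∫⁻ x in tsupport ψ, ENNReal.ofReal (x 0) ∂(volume.restrict D)
        ≤ ∫⁻ x in tsupport ψ, ENNReal.ofReal M ∂(volume.restrict D) :=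
          setLIntegral_mono measurable_const fun x hx =>
            ENNReal.ofReal_le_ofReal (hM ⟨x, hx, rfl⟩)
      _ < ⊤ := by
          rw [setLIntegral_const]
          exact ENNReal.mul_lt_top ENNReal.ofReal_lt_top
            ((Measure.restrict_apply_le _ _).trans_lt hK.isCompact.measure_lt_top)
  have h1 : Integrable (fun x => (ψ x / x 0) • u x) (rMeasure D) := by
    have hsub : Function.support (fun x => (ψ x / x 0) • u x) ⊆ tsupport ψ := by
      intro x hx
      by_contra h
      exact hx (by simp [hsupp x h])
    rw [← integrableOn_iff_integrable_of_support_subset hsub]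
    have : IsFiniteMeasure ((rMeasure D).restrict (tsupport ψ)) :=
      ⟨by simpa using hfin⟩
    have hu : Integrable u ((rMeasure D).restrict (tsupport ψ)) :=
      ((Lp.memLp u).restrict _).integrable (by norm_num)
    exact hu.bdd_smul C hh.aestronglyMeasurable (Eventually.of_forall hC)
  have h2 := (integrable_withDensity_iff_integrable_smul' (μ := volume.restrict D)
    (f := fun x : Plane => ENNReal.ofReal (x 0)) (by fun_prop)
    (Eventually.of_forall fun x => ENNReal.ofReal_lt_top)).1 h1
  refine h2.congr (Eventually.of_forall fun x => ?_)
  by_cases hx : x ∈ tsupport ψ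
  · have hp : 0 < x 0 := (hs hx).2
    simp only [ENNReal.toReal_ofReal hp.le, smul_smul]
    rw [mul_div_cancel₀ _ hp.ne']
  · simp [hsupp x hx]

theorem smul_congr_of_support {𝕜 : Type*} [RCLike 𝕜] {D : Set Plane} {ψ : Plane → ℝ}
    (hs : tsupport ψ ⊆ D ∩ {x | 0 < x 0}) {u v : Plane → 𝕜} (h : u =ᵐ[rMeasure D] v) :
    (fun x => ψ x • u x) =ᵐ[volume.restrict D] fun x => ψ x • v x := by
  have h' := (ae_withDensity_iff (μ := volume.restrict D)
    (f := fun x : Plane => ENNReal.ofReal (x 0)) (by fun_prop)).1 h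
  filter_upwards [h'] with x hx
  by_cases hxs : x ∈ tsupport ψ
  · rw [hx (by simpa using (hs hxs).2)]
  · simp [image_eq_zero_of_notMem_tsupport hxs]

theorem IsTest.partial {D : Set Plane} {φ : Plane → ℝ} (h : IsTest D φ) (i : Fin 2) :
    Continuous (fun x => fderiv ℝ φ x (EuclideanSpace.single i 1)) ∧
      HasCompactSupport (fun x => fderiv ℝ φ x (EuclideanSpace.single i 1)) ∧
      tsupport (fun x => fderiv ℝ φ x (EuclideanSpace.single i 1)) ⊆ D ∩ {x | 0 < x 0} := by
  refine ⟨(h.1.continuous_fderiv (by simp)).clm_apply continuous_const,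
    h.2.1.fderiv_apply ℝ _, (tsupport_fderiv_apply_subset ℝ _).trans h.2.2⟩

theorem IsWeakPartial.add {𝕜 : Type*} [RCLike 𝕜] {D : Set Plane} {i : Fin 2}
    {u v u' v' : Lp 𝕜 2 (rMeasure D)} (h : IsWeakPartial D i u v) (h' : IsWeakPartial D i u' v') :
    IsWeakPartial D i (u + u' : Lp 𝕜 2 (rMeasure D)) (v + v' : Lp 𝕜 2 (rMeasure D)) := by
  intro φ hφ
  obtain ⟨hc, hK, hs⟩ := hφ.partial i
  rw [integral_congr_ae (smul_congr_of_support hs (Lp.coeFn_add u u')),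
    integral_congr_ae (smul_congr_of_support hφ.2.2 (Lp.coeFn_add v v'))]
  simp only [Pi.add_apply, smul_add]
  rw [integral_add (integrable_smul_of_support hc hK hs u)
      (integrable_smul_of_support hc hK hs u'),
    integral_add (integrable_smul_of_support hφ.1.continuous hφ.2.1 hφ.2.2 v)
      (integrable_smul_of_support hφ.1.continuous hφ.2.1 hφ.2.2 v'), h φ hφ, h' φ hφ]
  ring

theorem IsWeakPartial.zero {𝕜 : Type*} [RCLike 𝕜] {D : Set Plane} {i : Fin 2} :
    IsWeakPartial D i (0 : Lp 𝕜 2 (rMeasure D)) (0 : Lp 𝕜 2 (rMeasure D)) := by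
  intro φ hφ
  rw [integral_congr_ae (smul_congr_of_support (hφ.partial i).2.2 (Lp.coeFn_zero 𝕜 2 _)),
    integral_congr_ae (smul_congr_of_support hφ.2.2 (Lp.coeFn_zero 𝕜 2 _))]
  simp

theorem IsWeakPartial.smul {𝕜 : Type*} [RCLike 𝕜] {D : Set Plane} {i : Fin 2}
    {u v : Lp 𝕜 2 (rMeasure D)} (c : 𝕜) (h : IsWeakPartial D i u v) :
    IsWeakPartial D i (c • u : Lp 𝕜 2 (rMeasure D)) (c • v : Lp 𝕜 2 (rMeasure D)) := by
  intro φ hφ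
  rw [integral_congr_ae (smul_congr_of_support (hφ.partial i).2.2 (Lp.coeFn_smul c u)),
    integral_congr_ae (smul_congr_of_support hφ.2.2 (Lp.coeFn_smul c v))]
  simp only [Pi.smul_apply, smul_comm _ c]
  rw [integral_smul, integral_smul, h φ hφ, smul_neg]

/-- The weighted Sobolev space `H¹₁(D)` (real valued): triples `(u, ∂_r u, ∂_z u)` in
`L²₁(D)`, with norm `(‖u‖² + ‖∂_r u‖² + ‖∂_z u‖²)^(1/2)`. -/
def H1 (D : Set Plane) : Submodule ℝ (PiLp 2 fun _ : Fin 3 => Lp ℝ 2 (rMeasure D)) where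
  carrier := {U | IsWeakPartial D 0 (U 0) (U 1) ∧ IsWeakPartial D 1 (U 0) (U 2)}
  add_mem' h h' := ⟨h.1.add h'.1, h.2.add h'.2⟩
  zero_mem' := ⟨IsWeakPartial.zero, IsWeakPartial.zero⟩
  smul_mem' c _ h := ⟨h.1.smul c, h.2.smul c⟩

/-- The space `H̃¹₁(D) = H¹₁(D) ∩ L²₋₁(D)` (complex valued): quadruples
`(u, ∂_r u, ∂_z u, u / r)` in `L²₁(D)`. Since `∫ |u / r|² r = ∫ |u|² r⁻¹`, the last component lies in
`L²₁(D)` exactly if `u` lies in `L²₋₁(D)`, and the norm is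
`(‖u‖²_{H¹₁} + ‖u‖²_{L²₋₁})^(1/2)`. -/
def HTilde (D : Set Plane) : Submodule ℂ (PiLp 2 fun _ : Fin 4 => Lp ℂ 2 (rMeasure D)) where
  carrier := {U | IsWeakPartial D 0 (U 0) (U 1) ∧ IsWeakPartial D 1 (U 0) (U 2) ∧
    ∀ᵐ x ∂(rMeasure D), U 3 x = U 0 x / (x 0 : ℂ)}
  add_mem' {U V} h h' := by
    refine ⟨h.1.add h'.1, h.2.1.add h'.2.1, ?_⟩
    filter_upwards [Lp.coeFn_add (U 3) (V 3), Lp.coeFn_add (U 0) (V 0), h.2.2, h'.2.2]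
      with x h1 h2 h3 h4
    rw [PiLp.add_apply, PiLp.add_apply, h1, h2, Pi.add_apply, Pi.add_apply, h3, h4, add_div]
  zero_mem' := by
    refine ⟨IsWeakPartial.zero, IsWeakPartial.zero, ?_⟩
    filter_upwards [Lp.coeFn_zero ℂ 2 (rMeasure D)] with x h1
    rw [PiLp.zero_apply, PiLp.zero_apply, h1]
    simp
  smul_mem' c U h := by
    refine ⟨h.1.smul c, h.2.1.smul c, ?_⟩
    filter_upwards [Lp.coeFn_smul c (U 3), Lp.coeFn_smul c (U 0), h.2.2] with x h1 h2 h3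
    rw [PiLp.smul_apply, PiLp.smul_apply, h1, h2, Pi.smul_apply, Pi.smul_apply, h3,
      smul_eq_mul, smul_eq_mul, mul_div_assoc]

/-- `H̃¹_{1,Γ}(D)`: the elements of `H̃¹₁(D)` that vanish on the boundary of `D`, that is, the
closure of the smooth functions with compact support in `D`. -/
def HTildeZero (D : Set Plane) : Set (HTilde D) :=
  closure {U | ∃ φ : Plane → ℂ, IsTest D φ ∧ U.1 0 =ᵐ[rMeasure D] φ}

/-- `g` is the trace of `U ∈ H¹₁(D)` on the part of the boundary of `D` off the axis: the graph of
the trace is the closure, in `H¹₁ × L²₁`, of the pairs of restrictions of smooth functions. -/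
def IsTrace {D : Set Plane} (U : H1 D) (g : Lp ℝ 2 (rBoundaryMeasure D)) : Prop :=
  (U, g) ∈ closure {p : H1 D × Lp ℝ 2 (rBoundaryMeasure D) | ∃ φ : Plane → ℝ, ContDiff ℝ ∞ φ ∧
    p.1.1 0 =ᵐ[rMeasure D] φ ∧ p.2 =ᵐ[rBoundaryMeasure D] φ}

/-- The map `H¹₁(D) → L²₁(D)` that forgets the derivatives. -/
def H1.toL2 (D : Set Plane) : H1 D →L[ℝ] Lp ℝ 2 (rMeasure D) :=
  (PiLp.proj 2 (fun _ : Fin 3 => Lp ℝ 2 (rMeasure D)) 0).comp (H1 D).subtypeL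

/-- The functional `W ↦ ∫_D u W r dr dz` on `H¹₁(D)`. -/
def pairing {D : Set Plane} (u : Lp ℝ 2 (rMeasure D)) : StrongDual ℝ (H1 D) :=
  (innerSL ℝ u).comp (H1.toL2 D)

/-! ### Functions of time -/

/-- `g ∈ L²(0, τ; X)`. -/
def L2Time {X : Type*} [NormedAddCommGroup X] (τ : ℝ) (g : ℝ → X) : Prop :=
  MemLp g 2 (volume.restrict (Ioo 0 τ))

/-- `g'` is the derivative of `g` in the sense of `X`-valued distributions on `(0, τ)`. -/
def IsWeakTimeDeriv {X : Type*} [NormedAddCommGroup X] [NormedSpace ℝ X]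
    (τ : ℝ) (g g' : ℝ → X) : Prop :=
  ∀ φ : ℝ → ℝ, ContDiff ℝ ∞ φ → HasCompactSupport φ → tsupport φ ⊆ Ioo 0 τ →
    ∫ t in Ioo 0 τ, deriv φ t • g t = -∫ t in Ioo 0 τ, φ t • g' t

/-- `g(0) = g₀` for the continuous representative of `g` on `[0, τ]` (part of the claim is that
there is one). -/
def HasInitialValue {X : Type*} [NormedAddCommGroup X] (τ : ℝ) (g : ℝ → X) (g₀ : X) : Prop :=
  ∃ h : ℝ → X, ContinuousOn h (Icc 0 τ) ∧ g =ᵐ[volume.restrict (Ioo 0 τ)] h ∧ h 0 = g₀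

/-! ### Geometry -/

/-- A (possibly nonconvex) polygon: a nonempty bounded open set whose boundary lies in a finite
union of segments and is locally the graph of a Lipschitz function, with the set on one side. -/
structure IsPolygon (D : Set Plane) : Prop where
  isOpen : IsOpen D
  nonempty : D.Nonempty
  isBounded : Bornology.IsBounded D
  frontier_subset : ∃ S : Finset (Plane × Plane), frontier D ⊆ ⋃ p ∈ S, segment ℝ p.1 p.2
  lipschitz : ∀ x ∈ frontier D, ∃ (b : OrthonormalBasis (Fin 2) ℝ Plane) (γ : ℝ → ℝ) (K : ℝ≥0)
    (δ : ℝ), LipschitzWith K γ ∧ 0 < δ ∧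
      ∀ s t : ℝ, |s| < δ → |t| < δ → (x + s • b 0 + t • b 1 ∈ D ↔ γ s < t)

/-- The rectangle `(0, R) × (0, L)`. -/
def rectangle (R L : ℝ) : Set Plane := {x | x 0 ∈ Ioo 0 R ∧ x 1 ∈ Ioo 0 L}

/-- The meridian section `Ω = (0, R) × (0, L)` of the computational cylinder, the workpiece section
`Ω₀` and the sections `Ω_k` of the `m` coil rings. -/
structure Geometry (m : ℕ) where
  R : ℝ
  L : ℝ
  R_pos : 0 < R
  L_pos : 0 < L
  workpiece : Set Plane
  coil : Fin m → Set Plane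
  workpiece_polygon : IsPolygon workpiece
  workpiece_subset : workpiece ⊆ rectangle R L
  coil_open : ∀ k, IsOpen (coil k)
  coil_nonempty : ∀ k, (coil k).Nonempty
  coil_subset : ∀ k, coil k ⊆ rectangle R L
  coil_disjoint : Pairwise fun j k => Disjoint (coil j) (coil k)
  coil_disjoint_workpiece : ∀ k, Disjoint (coil k) workpiece

/-- `Ω`. -/
def Geometry.domain {m : ℕ} (G : Geometry m) : Set Plane := rectangle G.R G.L

/-- `Ω_C`, the union of the workpiece and the coil rings. -/
def Geometry.conductors {m : ℕ} (G : Geometry m) : Set Plane :=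
  G.workpiece ∪ ⋃ k, G.coil k

/-- `Ω_a`. -/
def Geometry.air {m : ℕ} (G : Geometry m) : Set Plane := G.domain \ G.conductors

/-! ### The coupled problem -/

/-- The data of the coupled problem (density and specific heat are `1`). -/
structure ProblemData {m : ℕ} (G : Geometry m) where
  /-- angular frequency -/
  freq : ℝ
  /-- final time -/
  τ : ℝ
  /-- vacuum reluctivity -/
  ν₀ : ℝ
  /-- reluctivity of the conductors, used on `[0, ∞)` -/
  νC : ℝ → ℝ
  /-- electrical conductivity, a function of position and temperature -/
  σ : Plane → ℝ → ℝ
  /-- conductivities of the coil rings -/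
  σcoil : Fin m → ℝ
  /-- thermal conductivity, a function of position and temperature -/
  κ : Plane → ℝ → ℝ
  /-- heat transfer coefficient -/
  η : Plane → ℝ
  /-- voltages -/
  V : Fin m → ℂ
  /-- convection temperature -/
  Tc : ℝ → Lp ℝ 2 (rBoundaryMeasure G.workpiece)
  /-- initial temperature -/
  T₀ : Lp ℝ 2 (rMeasure G.workpiece)

/-- A Carathéodory function on `D × ℝ`. -/
def IsCaratheodory (D : Set Plane) (f : Plane → ℝ → ℝ) : Prop :=
  (∀ u, AEMeasurable (fun x => f x u) (volume.restrict D)) ∧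
    ∀ᵐ x ∂(volume.restrict D), Continuous (f x)

/-- The standing assumptions on the data. -/
structure ProblemData.Admissible {m : ℕ} {G : Geometry m} (P : ProblemData G) : Prop where
  freq_pos : 0 < P.freq
  τ_pos : 0 < P.τ
  ν₀_pos : 0 < P.ν₀
  σ_caratheodory : IsCaratheodory G.domain P.σ
  κ_caratheodory : IsCaratheodory G.workpiece P.κ
  η_measurable : AEMeasurable P.η (rBoundaryMeasure G.workpiece)
  η_bounds : ∃ a b : ℝ, 0 < a ∧
    ∀ᵐ x ∂(rBoundaryMeasure G.workpiece), a ≤ P.η x ∧ P.η x ≤ b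
  κ_bounds : ∃ a b : ℝ, 0 < a ∧
    ∀ᵐ x ∂(volume.restrict G.workpiece), ∀ u, a ≤ P.κ x u ∧ P.κ x u ≤ b
  σ_bounds : ∃ a b : ℝ, 0 < a ∧
    ∀ᵐ x ∂(volume.restrict G.workpiece), ∀ u, a ≤ P.σ x u ∧ P.σ x u ≤ b
  σcoil_pos : ∀ k, 0 < P.σcoil k
  σ_coil : ∀ k, ∀ᵐ x ∂(volume.restrict (G.coil k)), ∀ u, P.σ x u = P.σcoil k
  σ_air : ∀ᵐ x ∂(volume.restrict G.air), ∀ u, P.σ x u = 0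
  νC_bounds : ∃ νmin : ℝ, 0 < νmin ∧ ∀ p, 0 ≤ p → νmin ≤ P.νC p ∧ P.νC p ≤ P.ν₀
  νC_lipschitz : ∃ ξ : ℝ, 0 < ξ ∧ ∀ p q, 0 ≤ p → 0 ≤ q →
    |P.νC p * p - P.νC q * q| ≤ ξ * |p - q|
  νC_monotone : ∃ ρ : ℝ, 0 < ρ ∧ ∀ p q, 0 ≤ p → 0 ≤ q →
    ρ * |p - q| ^ 2 ≤ (P.νC p * p - P.νC q * q) * (p - q)
  Tc_mem : L2Time P.τ P.Tc

/-- The hypothesis `H_κ`: in the workpiece the thermal conductivity is a function `κ₀` of position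
only (which inherits the bounds and the measurability of `κ`). -/
def ProblemData.HKappa {m : ℕ} {G : Geometry m} (P : ProblemData G) (κ₀ : Plane → ℝ) : Prop :=
  ∀ᵐ x ∂(volume.restrict G.workpiece), ∀ u, P.κ x u = κ₀ x

/-- The hypothesis `H_σ`: in the workpiece the electrical conductivity is Lipschitz in the
temperature, uniformly in the position. -/
def ProblemData.HSigma {m : ℕ} {G : Geometry m} (P : ProblemData G) : Prop :=
  ∃ σp : ℝ, 0 < σp ∧
    ∀ᵐ x ∂(volume.restrict G.workpiece), ∀ u v : ℝ, |P.σ x u - P.σ x v| ≤ σp * |u - v|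

/-- `(1 / r) ∂_r (r U) = ∂_r U + U / r`, the axial component of `curl (U e_θ)`. -/
def curlZ {D : Set Plane} (U : HTilde D) (x : Plane) : ℂ := U.1 1 x + U.1 0 x / (x 0 : ℂ)

/-- `∂_z U`, the negative of the radial component of `curl (U e_θ)`. -/
def partialZ {D : Set Plane} (U : HTilde D) (x : Plane) : ℂ := U.1 2 x

/-- `|curl (U e_θ)|`. -/
def curlNorm {D : Set Plane} (U : HTilde D) (x : Plane) : ℝ :=
  Real.sqrt (‖curlZ U x‖ ^ 2 + ‖partialZ U x‖ ^ 2)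

open Classical in
/-- The reluctivity at the point `x` and field strength `p`. -/
def ProblemData.reluctivity {m : ℕ} {G : Geometry m} (P : ProblemData G) (x : Plane) (p : ℝ) : ℝ :=
  if x ∈ G.conductors then P.νC p else P.ν₀

/-- `⟨𝒜(U), Z⟩`. -/
def ProblemData.magneticForm {m : ℕ} {G : Geometry m} (P : ProblemData G)
    (U Z : HTilde G.domain) : ℂ :=
  ∫ x, (P.reluctivity x (curlNorm U x) : ℂ) *
    (curlZ U x * conj (curlZ Z x) + partialZ U x * conj (partialZ Z x)) ∂(rMeasure G.domain)

/-- The electromagnetic equation at a fixed time, for the potential `A` and the temperature `T`.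
In the coil rings `σ` does not depend on its second argument, so the values of (a representative
of) `T` outside the workpiece do not matter. -/
def ProblemData.MagneticEq {m : ℕ} {G : Geometry m} (P : ProblemData G)
    (A : HTilde G.domain) (T : H1 G.workpiece) : Prop :=
  ∀ Z ∈ HTildeZero G.domain,
    Complex.I * (P.freq : ℂ) *
        ∫ x, (P.σ x (T.1 0 x) : ℂ) * A.1 0 x * conj (Z.1 0 x) ∂(rMeasure G.conductors)
      + P.magneticForm A Z
    = ∑ k, ∫ x in G.coil k, (P.σcoil k : ℂ) * P.V k * conj (Z.1 0 x)

/-- The thermal equation at a fixed time, for the potential `A`, the temperature `T`, the time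
derivative `T'` of the temperature as a functional on `H¹₁(Ω₀)`, and the convection temperature
`Tc`. -/
def ProblemData.HeatEq {m : ℕ} {G : Geometry m} (P : ProblemData G) (κ₀ : Plane → ℝ)
    (A : HTilde G.domain) (T : H1 G.workpiece) (T' : StrongDual ℝ (H1 G.workpiece))
    (Tc : Lp ℝ 2 (rBoundaryMeasure G.workpiece)) : Prop :=
  ∃ g, IsTrace T g ∧ ∀ W w, IsTrace W w →
    T' W
      + (∫ x, κ₀ x * (T.1 1 x * W.1 1 x + T.1 2 x * W.1 2 x) ∂(rMeasure G.workpiece)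
        + ∫ x, P.η x * g x * w x ∂(rBoundaryMeasure G.workpiece))
    = 1 / 2 * ∫ x, P.freq ^ 2 * P.σ x (T.1 0 x) * ‖A.1 0 x‖ ^ 2 * W.1 0 x ∂(rMeasure G.workpiece)
      + ∫ x, P.η x * Tc x * w x ∂(rBoundaryMeasure G.workpiece)

/-- `(A, T)` solves the coupled problem, with
`A ∈ L²(0, τ; H̃¹_{1,Γ}(Ω))` and `T ∈ L²(0, τ; H¹₁(Ω₀)) ∩ H¹(0, τ; H¹₁(Ω₀)')`. -/
def ProblemData.IsSolution {m : ℕ} {G : Geometry m} (P : ProblemData G) (κ₀ : Plane → ℝ)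
    (A : ℝ → HTilde G.domain) (T : ℝ → H1 G.workpiece) : Prop :=
  L2Time P.τ A ∧ (∀ᵐ t ∂(volume.restrict (Ioo 0 P.τ)), A t ∈ HTildeZero G.domain) ∧
  L2Time P.τ T ∧
  ∃ T' : ℝ → StrongDual ℝ (H1 G.workpiece), L2Time P.τ T' ∧
    IsWeakTimeDeriv P.τ (fun t => pairing (H1.toL2 G.workpiece (T t))) T' ∧
    (∀ᵐ t ∂(volume.restrict (Ioo 0 P.τ)),
      P.MagneticEq (A t) (T t) ∧ P.HeatEq κ₀ (A t) (T t) (T' t) (P.Tc t)) ∧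
    HasInitialValue P.τ (fun t => H1.toL2 G.workpiece (T t)) P.T₀

/-- `(A, T)` solves the coupled problem and the time derivative of the temperature is square
integrable: `T ∈ L²(0, τ; H¹₁(Ω₀)) ∩ H¹(0, τ; L²₁(Ω₀))`. -/
def ProblemData.IsRegularSolution {m : ℕ} {G : Geometry m} (P : ProblemData G) (κ₀ : Plane → ℝ)
    (A : ℝ → HTilde G.domain) (T : ℝ → H1 G.workpiece) : Prop :=
  L2Time P.τ A ∧ (∀ᵐ t ∂(volume.restrict (Ioo 0 P.τ)), A t ∈ HTildeZero G.domain) ∧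
  L2Time P.τ T ∧
  ∃ T' : ℝ → Lp ℝ 2 (rMeasure G.workpiece), L2Time P.τ T' ∧
    IsWeakTimeDeriv P.τ (fun t => H1.toL2 G.workpiece (T t)) T' ∧
    (∀ᵐ t ∂(volume.restrict (Ioo 0 P.τ)),
      P.MagneticEq (A t) (T t) ∧ P.HeatEq κ₀ (A t) (T t) (pairing (T' t)) (P.Tc t)) ∧
    HasInitialValue P.τ (fun t => H1.toL2 G.workpiece (T t)) P.T₀

end InductionHeating

end

open MeasureTheory Set Filter Topology
open scoped NNReal ContDiff ComplexConjugate

noncomputable section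

set_option linter.unusedSectionVars false

namespace InductionHeating

/-! ### Primitives and distributional derivatives of functions of time. -/

section TimeCalculus

variable {X Y Z : Type*} [NormedAddCommGroup X] [NormedSpace ℝ X]
  [NormedAddCommGroup Y] [NormedSpace ℝ Y] [NormedAddCommGroup Z] [NormedSpace ℝ Z]

/-! At each time the electromagnetic equation determines the potential from the temperature, A =
S(T). The system is therefore a single semilinear parabolic equation T' + B T = F(T) + f over V =
H¹₁(Ω₀) ⊂ H = L²₁(Ω₀), in which F(T) is the Joule heat of S(T).

The map S (`exists_potential_map`). The curl is coercive on H̃¹_{1,Γ}(Ω): in ∫ |∂_r U + U/r|² r dr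
dz the cross term is the integral of ∂_r |U|², which vanishes for compactly supported functions and,
by density, on the whole space. The assumptions on ν_C make a ↦ ν(|a|) a Lipschitz and strongly
monotone, and the conductivity term is purely imaginary on the diagonal, so it leaves the
monotonicity of the real part alone. Hence S(T) exists, is unique, and is bounded independently of
T.

The decisive estimate (`exists_product_estimate`) is of Ladyzhenskaya type: ‖u a‖² ≤ C ‖u‖_H ‖u‖_V
‖a‖², with the first norm in L²₁(Ω₀) and a in H̃¹_{1,Γ}(Ω). In the rotated coordinates (s, t) of a
Lipschitz chart, r |u|² is bounded by a function of s alone (integrate the derivative along the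
fiber that runs into the domain), and |a|² by a function of t alone (integrate along the whole
line); Fubini multiplies the two integrals. The weight r is spent on u, and the unweighted ∫ |a|
|∇a| equals ∫ |a/r| |∇a| r, which is where L²₋₁ enters. Since σ is Lipschitz in the temperature, it
follows that ‖S(u) - S(v)‖² ≤ C ‖u - v‖_H ‖u - v‖_V and ⟨F(u) - F(v), w⟩² ≤ C ‖u - v‖_H ‖u - v‖_V
‖w‖_H ‖w‖_V.

By Young's inequality the last bound splits into V-norms with a constant that the coercivity of B
absorbs, and H-norms with a large constant. Passing to e^{-lt} T adds l times the H-norm to the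
coercivity and absorbs the rest, so the fixed point map is a contraction on the whole of (0, τ)
(`existsUnique_nonlinear_evolution`). The linear theory (`exists_linear_evolution`) is obtained from
the operator f ↦ ∫₀ᵗ f: solutions that are differentiable in time with values in V exist for a dense
set of data, and the energy estimate passes to the limit.

The boundary terms have a meaning because smooth functions are dense in H¹₁(Ω₀) (`H1.dense_smooth`)
and satisfy a trace inequality; both rest on charts in which moving into the domain does not
substantially decrease r. The statements on regular solutions follow from the uniqueness of
distributional time derivatives. -/

/-- The primitive `t ↦ ∫₀ᵗ g`. -/
def prim (g : ℝ → X) (t : ℝ) : X := ∫ s in Ioo 0 t, g s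

theorem prim_eq_integral_indicator {τ t : ℝ} (ht : t ∈ Ioo 0 τ) (g : ℝ → X) :
    prim g t = ∫ s in Ioo 0 τ, {s | s < t}.indicator g s := by
  have hm : MeasurableSet {s : ℝ | s < t} := measurableSet_Iio
  rw [prim, integral_indicator hm, Measure.restrict_restrict hm]
  congr 2
  ext s
  simp only [mem_Ioo, mem_inter_iff, mem_ofPred_eq]
  have := ht.2
  constructor
  · rintro ⟨h, h'⟩; exact ⟨h', h, h'.trans this⟩
  · rintro ⟨h, h'⟩; exact ⟨h'.1, h⟩

theorem prim_zero (g : ℝ → X) : prim g 0 = 0 := by simp [prim]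

theorem prim_continuousOn {τ : ℝ} {g : ℝ → X} (hg : IntegrableOn g (Ioo 0 τ)) :
    ContinuousOn (prim g) (Icc 0 τ) := by
  have h : IntegrableOn g (Icc 0 τ) := (integrableOn_Icc_iff_integrableOn_Ioo).2 hg
  refine (intervalIntegral.continuousOn_primitive h).congr fun t _ => ?_
  simp only [prim, integral_Ioc_eq_integral_Ioo]

theorem prim_congr {τ t : ℝ} (ht : t ≤ τ) {g g' : ℝ → X}
    (h : g =ᵐ[volume.restrict (Ioo 0 τ)] g') : prim g t = prim g' t :=
  integral_congr_ae (ae_restrict_of_ae_restrict_of_subset (Ioo_subset_Ioo_right ht) h)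

/-- Integration by parts through Fubini: the two terms are the integrals of `L (f t) (g s)` over the
triangles s < t and t < s of the square, which exhaust it up to the diagonal, a null set. -/
theorem integral_bilin_prim_add [CompleteSpace X] [CompleteSpace Y] [CompleteSpace Z]
    (L : X →L[ℝ] Y →L[ℝ] Z) {τ : ℝ} {f : ℝ → X} {g : ℝ → Y}
    (hf : IntegrableOn f (Ioo 0 τ)) (hg : IntegrableOn g (Ioo 0 τ)) :
    (∫ t in Ioo 0 τ, L (f t) (prim g t)) + ∫ t in Ioo 0 τ, L (prim f t) (g t)
      = L (∫ t in Ioo 0 τ, f t) (∫ t in Ioo 0 τ, g t) := by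
  set μ := volume.restrict (Ioo (0 : ℝ) τ) with hμ
  have hfg : Integrable (fun p : ℝ × ℝ => L (f p.1) (g p.2)) (μ.prod μ) :=
    Integrable.op_fst_snd (op := fun x y => L x y) (by fun_prop) ⟨‖L‖, L.le_opNorm₂⟩ hf hg
  have hS : MeasurableSet {p : ℝ × ℝ | p.2 < p.1} := measurableSet_lt measurable_snd measurable_fst
  have hS' : MeasurableSet {p : ℝ × ℝ | p.1 < p.2} := measurableSet_lt measurable_fst measurable_snd
  have hgt : ∀ t, Integrable ({s | s < t}.indicator g) μ := fun t =>
    Integrable.indicator hg (measurableSet_lt measurable_id measurable_const)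
  have hft : ∀ t, Integrable ({s | s < t}.indicator f) μ := fun t =>
    Integrable.indicator hf (measurableSet_lt measurable_id measurable_const)
  have h1 : ∫ t, L (f t) (prim g t) ∂μ =
      ∫ p, {p : ℝ × ℝ | p.2 < p.1}.indicator (fun p : ℝ × ℝ => L (f p.1) (g p.2)) p ∂(μ.prod μ) := by
    rw [integral_prod _ (hfg.indicator hS)]
    refine setIntegral_congr_fun measurableSet_Ioo fun t ht => ?_
    rw [prim_eq_integral_indicator ht, ← (L (f t)).integral_comp_comm (hgt t)]
    refine integral_congr_ae (Eventually.of_forall fun s => ?_)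
    by_cases h : s < t <;> simp [indicator, h]
  have h2 : ∫ t, L (prim f t) (g t) ∂μ =
      ∫ p, {p : ℝ × ℝ | p.1 < p.2}.indicator (fun p : ℝ × ℝ => L (f p.1) (g p.2)) p ∂(μ.prod μ) := by
    rw [integral_prod_symm _ (hfg.indicator hS')]
    refine setIntegral_congr_fun measurableSet_Ioo fun t ht => ?_
    have : L (prim f t) (g t) = L.flip (g t) (prim f t) := rfl
    rw [this, prim_eq_integral_indicator ht, ← (L.flip (g t)).integral_comp_comm (hft t)]
    refine integral_congr_ae (Eventually.of_forall fun s => ?_)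
    by_cases h : s < t <;> simp [indicator, h]
  have h3 : ∫ p, L (f p.1) (g p.2) ∂(μ.prod μ) = L (∫ t, f t ∂μ) (∫ t, g t ∂μ) := by
    rw [integral_prod _ hfg]
    have : ∀ t, ∫ s, L (f t) (g s) ∂μ = L.flip (∫ s, g s ∂μ) (f t) := fun t =>
      (L (f t)).integral_comp_comm hg
    simp only [this]
    rw [(L.flip (∫ s, g s ∂μ)).integral_comp_comm hf]
    rfl
  rw [h1, h2, ← integral_add (hfg.indicator hS) (hfg.indicator hS'), ← h3]
  have hdiag : ∀ᵐ p ∂(μ.prod μ), p.1 ≠ p.2 := by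
    refine (Measure.ae_prod_iff_ae_ae (p := fun p : ℝ × ℝ => p.1 ≠ p.2) (measurableSet_eq_fun measurable_fst measurable_snd).compl).2 ?_
    refine Eventually.of_forall fun t => ?_
    have : ∀ᵐ s ∂μ, s ≠ t := ae_restrict_of_ae (Measure.ae_ne volume t)
    filter_upwards [this] with s hs using hs.symm
  refine integral_congr_ae ?_
  filter_upwards [hdiag] with p hp
  rcases lt_or_gt_of_ne hp with h | h
  · simp [indicator, h, h.not_gt]
  · simp [indicator, h, h.not_gt]

theorem prim_deriv_of_tsupport {τ t : ℝ} {φ : ℝ → ℝ} (hφ : ContDiff ℝ ∞ φ)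
    (hs : tsupport φ ⊆ Ioo 0 τ) (ht : 0 ≤ t) : prim (deriv φ) t = φ t := by
  have h0 : φ 0 = 0 := image_eq_zero_of_notMem_tsupport fun h => (lt_irrefl _ (hs h).1)
  have hd : Continuous (deriv φ) := hφ.continuous_deriv (by simp)
  rw [prim, ← integral_Ioc_eq_integral_Ioo, ← intervalIntegral.integral_of_le ht,
    intervalIntegral.integral_deriv_eq_sub
      (fun x _ => (hφ.differentiable (by simp)) x) (hd.intervalIntegrable _ _), h0, sub_zero]

/-- Integration by parts against φ', the primitive of which is φ. The constant `c` drops out because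
φ' has integral zero. -/
theorem isWeakTimeDeriv_of_eq_prim [CompleteSpace X] {τ : ℝ} {y w : ℝ → X} {c : X}
    (hτ : 0 < τ) (hw : IntegrableOn w (Ioo 0 τ))
    (h : y =ᵐ[volume.restrict (Ioo 0 τ)] fun t => c + prim w t) : IsWeakTimeDeriv τ y w := by
  intro φ hφ hc hs
  have hd : Continuous (deriv φ) := hφ.continuous_deriv (by simp)
  have hdi : IntegrableOn (deriv φ) (Ioo 0 τ) :=
    (hd.integrableOn_Icc (a := 0) (b := τ)).mono_set Ioo_subset_Icc_self
  have hL := integral_bilin_prim_add (ContinuousLinearMap.lsmul ℝ ℝ (E := X)) hdi hw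
  simp only [ContinuousLinearMap.lsmul_apply] at hL
  have h0 : ∫ t in Ioo 0 τ, deriv φ t = 0 := by
    have := prim_deriv_of_tsupport hφ hs hτ.le
    rw [prim] at this
    rw [this]
    exact image_eq_zero_of_notMem_tsupport fun h => (lt_irrefl _ (hs h).2)
  have h1 : ∫ t in Ioo 0 τ, prim (deriv φ) t • w t = ∫ t in Ioo 0 τ, φ t • w t :=
    setIntegral_congr_fun measurableSet_Ioo fun t ht => by
      simp only [prim_deriv_of_tsupport hφ hs ht.1.le]
  rw [h0, zero_smul, h1] at hL
  rw [← eq_neg_of_add_eq_zero_left hL]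
  have h2 : ∫ t in Ioo 0 τ, deriv φ t • y t
      = ∫ t in Ioo 0 τ, (deriv φ t • c + deriv φ t • prim w t) := by
    refine integral_congr_ae ?_
    filter_upwards [h] with t ht
    rw [ht, smul_add]
  rw [h2, integral_add, integral_smul_const, h0, zero_smul, zero_add]
  · exact hdi.smul_const c
  · have : ContinuousOn (fun t => deriv φ t • prim w t) (Icc 0 τ) :=
      hd.continuousOn.smul (prim_continuousOn hw)
    exact (this.integrableOn_Icc).mono_set Ioo_subset_Icc_self

/-- The primitive from 0 vanishes to the left of the support trivially and to the right of it
because the total integral is zero. -/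
theorem exists_test_primitive {τ : ℝ} {θ : ℝ → ℝ} (hθ : ContDiff ℝ ∞ θ)
    (hc : HasCompactSupport θ) (hs : tsupport θ ⊆ Ioo 0 τ) (h0 : ∫ t, θ t = 0) :
    ∃ φ : ℝ → ℝ, ContDiff ℝ ∞ φ ∧ HasCompactSupport φ ∧ tsupport φ ⊆ Ioo 0 τ ∧
      deriv φ = θ := by
  have hd : ∀ t, HasDerivAt (fun t => ∫ s in (0 : ℝ)..t, θ s) (θ t) t := fun t =>
    intervalIntegral.integral_hasDerivAt_right (hθ.continuous.intervalIntegrable _ _)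
      hθ.continuous.stronglyMeasurable.stronglyMeasurableAtFilter hθ.continuous.continuousAt
  have hderiv : deriv (fun t => ∫ s in (0 : ℝ)..t, θ s) = θ := funext fun t => (hd t).deriv
  have hcd : ContDiff ℝ ∞ (fun t => ∫ s in (0 : ℝ)..t, θ s) := by
    rw [contDiff_infty_iff_deriv, hderiv]
    exact ⟨fun t => (hd t).differentiableAt, hθ⟩
  rcases (tsupport θ).eq_empty_or_nonempty with he | hne
  · have : θ = 0 := by rwa [tsupport_eq_empty_iff] at he
    subst this
    exact ⟨0, contDiff_const, HasCompactSupport.zero, by simp [tsupport], by ext; simp⟩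
  obtain ⟨a, ha, hamin⟩ := hc.isCompact.exists_isMinOn hne continuousOn_id
  obtain ⟨b, hb, hbmax⟩ := hc.isCompact.exists_isMaxOn hne continuousOn_id
  have hsub : ∀ t, t ∈ tsupport θ → a ≤ t ∧ t ≤ b := fun t ht => ⟨hamin ht, hbmax ht⟩
  have hza : ∀ t, t < a → θ t = 0 := fun t ht =>
    image_eq_zero_of_notMem_tsupport fun h => absurd (hsub t h).1 (not_le.2 ht)
  have hzb : ∀ t, b < t → θ t = 0 := fun t ht =>
    image_eq_zero_of_notMem_tsupport fun h => absurd (hsub t h).2 (not_le.2 ht)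
  have hz1 : ∀ t, t < a → ∫ s in (0 : ℝ)..t, θ s = 0 := by
    intro t ht
    refine intervalIntegral.integral_zero_ae (Eventually.of_forall fun s hs' => hza s ?_)
    have ha0 := (hs ha).1
    rcases mem_uIoc.1 hs' with h | h
    · exact h.2.trans_lt ht
    · exact h.2.trans_lt ha0
  have hint : Integrable θ := hθ.continuous.integrable_of_hasCompactSupport hc
  have hz2 : ∀ t, b < t → ∫ s in (0 : ℝ)..t, θ s = 0 := by
    intro t ht
    have hb0 := (hs hb).1
    rw [intervalIntegral.integral_of_le (hb0.trans ht).le]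
    refine Eq.trans ?_ h0
    refine setIntegral_eq_integral_of_forall_compl_eq_zero fun s hs' => ?_
    by_contra hne
    have := hs (subset_tsupport θ hne)
    refine hs' ⟨this.1, ?_⟩
    exact (hsub s (subset_tsupport θ hne)).2.trans ht.le
  have hsupp : tsupport (fun t => ∫ s in (0 : ℝ)..t, θ s) ⊆ Icc a b := by
    refine closure_minimal (fun t ht => ?_) isClosed_Icc
    by_contra h
    rw [mem_Icc, not_and_or, not_le, not_le] at h
    rcases h with h | h
    · exact ht (hz1 t h)
    · exact ht (hz2 t h)
  refine ⟨_, hcd, isCompact_Icc.of_isClosed_subset (isClosed_tsupport _) hsupp, ?_, hderiv⟩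
  exact hsupp.trans fun t ht => ⟨(hs ha).1.trans_le ht.1, ht.2.trans_lt (hs hb).2⟩

theorem exists_test_integral_one {τ : ℝ} (hτ : 0 < τ) :
    ∃ θ : ℝ → ℝ, ContDiff ℝ ∞ θ ∧ HasCompactSupport θ ∧ tsupport θ ⊆ Ioo 0 τ ∧ ∫ t, θ t = 1 := by
  let f : ContDiffBump (τ / 2) := ⟨τ / 8, τ / 4, by linarith, by linarith⟩
  refine ⟨f.normed volume, f.contDiff_normed, f.hasCompactSupport_normed, ?_, f.integral_normed⟩
  rw [f.tsupport_normed_eq]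
  intro t ht
  rw [Metric.mem_closedBall, Real.dist_eq, abs_le] at ht
  have : f.rOut = τ / 4 := rfl
  rw [this] at ht
  constructor <;> linarith

/-- The du Bois-Reymond lemma: `y - prim w` annihilates all derivatives of test functions, that is,
all test functions of mean zero, and is therefore constant. -/
theorem exists_eq_const_add_prim [CompleteSpace X] {τ : ℝ} {y w : ℝ → X} (hτ : 0 < τ)
    (hy : IntegrableOn y (Ioo 0 τ)) (hw : IntegrableOn w (Ioo 0 τ))
    (h : IsWeakTimeDeriv τ y w) :
    ∃ c, y =ᵐ[volume.restrict (Ioo 0 τ)] fun t => c + prim w t := by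
  have hp : IntegrableOn (prim w) (Ioo 0 τ) :=
    ((prim_continuousOn hw).integrableOn_Icc).mono_set Ioo_subset_Icc_self
  have hz : IntegrableOn (fun t => y t - prim w t) (Ioo 0 τ) := hy.sub hp
  have hbd : ∀ {u : ℝ → X} {ψ : ℝ → ℝ}, IntegrableOn u (Ioo 0 τ) → Continuous ψ →
      HasCompactSupport ψ → IntegrableOn (fun t => ψ t • u t) (Ioo 0 τ) := by
    intro u ψ hu hψ hc
    obtain ⟨C, hC⟩ := hc.exists_bound_of_continuous hψ
    exact Integrable.bdd_smul (hf := hu) C hψ.aestronglyMeasurable (Eventually.of_forall hC)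
  have hz0 : ∀ φ : ℝ → ℝ, ContDiff ℝ ∞ φ → HasCompactSupport φ → tsupport φ ⊆ Ioo 0 τ →
      ∫ t in Ioo 0 τ, deriv φ t • (y t - prim w t) = 0 := by
    intro φ hφ hc hs
    have hd : Continuous (deriv φ) := hφ.continuous_deriv (by simp)
    simp only [smul_sub]
    rw [integral_sub (hbd hy hd hc.deriv) (hbd hp hd hc.deriv), h φ hφ hc hs,
      isWeakTimeDeriv_of_eq_prim (c := 0) hτ hw (by simp) φ hφ hc hs, sub_self]
  obtain ⟨θ, hθ, hθc, hθs, hθ1⟩ := exists_test_integral_one hτ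
  set c := ∫ t in Ioo 0 τ, θ t • (y t - prim w t) with hcdef
  refine ⟨c, ?_⟩
  have hzc : IntegrableOn (fun t => y t - prim w t - c) (Ioo 0 τ) := hz.sub (integrableOn_const (by simp))
  have key := isOpen_Ioo.ae_eq_zero_of_integral_contDiff_smul_eq_zero
    (U := Ioo (0 : ℝ) τ) (μ := volume) (f := fun t => y t - prim w t - c)
    hzc.locallyIntegrableOn ?_
  · rw [EventuallyEq, ae_restrict_iff' measurableSet_Ioo]
    filter_upwards [key] with t ht hmem
    have := ht hmem
    rw [sub_sub, sub_eq_zero] at this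
    rw [this, add_comm]
  intro ψ hψ hψc hψs
  have hset : ∀ {u : ℝ → X}, ∫ t, ψ t • u t = ∫ t in Ioo 0 τ, ψ t • u t := by
    intro u
    refine (setIntegral_eq_integral_of_forall_compl_eq_zero fun t ht => ?_).symm
    rw [image_eq_zero_of_notMem_tsupport fun h => ht (hψs h), zero_smul]
  rw [hset]
  set k := ∫ t, ψ t with hk
  have hk' : ∫ t in Ioo 0 τ, ψ t = k :=
    setIntegral_eq_integral_of_forall_compl_eq_zero fun t ht =>
      image_eq_zero_of_notMem_tsupport fun h => ht (hψs h)
  have hψi : Integrable ψ := hψ.continuous.integrable_of_hasCompactSupport hψc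
  have hθi : Integrable θ := hθ.continuous.integrable_of_hasCompactSupport hθc
  -- Subtracting k θ with ∫ θ = 1 leaves a test function of mean zero, which is a derivative. So `y
  -- - prim w` sees ψ only through k = ∫ ψ, with the factor c.
  obtain ⟨φ, h1, h2, h3, h4⟩ := exists_test_primitive (τ := τ) (θ := fun t => ψ t - k * θ t)
    (hψ.sub (contDiff_const.mul hθ)) (hψc.sub (hθc.mul_left))
    ((tsupport_sub ψ (fun t => k * θ t)).trans
      (union_subset hψs ((tsupport_mul_subset_right).trans hθs)))
    (by rw [integral_sub hψi (hθi.const_mul k), integral_const_mul, hθ1]; simp [hk])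
  have h5 := hz0 φ h1 h2 h3
  rw [h4] at h5
  simp only [sub_smul, mul_smul] at h5
  rw [integral_sub (g := fun t => k • θ t • (y t - prim w t)) (hbd hz hψ.continuous hψc)
    (Integrable.smul k (hbd hz hθ.continuous hθc)),
    integral_smul, ← hcdef] at h5
  simp only [smul_sub _ (_ - _) c]
  rw [integral_sub (hbd hz hψ.continuous hψc) (hψi.integrableOn.smul_const c),
    integral_smul_const, hk', h5]

end TimeCalculus

/-! ### General facts on L² spaces and on the range of an operator. -/

section LpGeneral

variable {α : Type*} [MeasurableSpace α] {μ : Measure α} {X Y : Type*} [NormedAddCommGroup X]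
  [NormedAddCommGroup Y]

theorem exists_subseq_ae_tendsto {u : ℕ → Lp X 2 μ} {v : Lp X 2 μ}
    (h : Tendsto u atTop (𝓝 v)) :
    ∃ ns : ℕ → ℕ, StrictMono ns ∧ ∀ᵐ x ∂μ, Tendsto (fun k => u (ns k) x) atTop (𝓝 (v x)) :=
  (tendstoInMeasure_of_tendsto_Lp h).exists_seq_tendsto_ae

theorem integral_norm_le_Lp [IsFiniteMeasure μ] (f : Lp X 2 μ) :
    ∫ x, ‖f x‖ ∂μ ≤ Real.sqrt (μ.real univ) * ‖f‖ := by
  have h1 := eLpNorm_le_eLpNorm_mul_rpow_measure_univ (μ := μ) (f := f) (p := 1) (q := 2)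
    (by norm_num) (Lp.aestronglyMeasurable f)
  rw [eLpNorm_one_eq_lintegral_enorm] at h1
  rw [integral_norm_eq_lintegral_enorm (Lp.aestronglyMeasurable f), Lp.norm_def]
  have h2 : (1 / (1 : ENNReal).toReal - 1 / (2 : ENNReal).toReal) = 1 / 2 := by norm_num
  rw [h2] at h1
  have h3 := ENNReal.toReal_mono (by
    refine ENNReal.mul_ne_top (Lp.eLpNorm_ne_top f) ?_
    exact ENNReal.rpow_ne_top_of_nonneg (by norm_num) (measure_ne_top _ _)) h1
  rw [ENNReal.toReal_mul, ← ENNReal.toReal_rpow, ← Real.sqrt_eq_rpow] at h3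
  rw [mul_comm]
  exact h3

variable {𝕜 : Type*} [RCLike 𝕜]

theorem inner_compLpL [InnerProductSpace 𝕜 X] [InnerProductSpace 𝕜 Y] [CompleteSpace X]
    [CompleteSpace Y] (T : X →L[𝕜] Y) (f : Lp X 2 μ) (g : Lp Y 2 μ) :
    inner 𝕜 (T.compLpL 2 μ f) g = inner 𝕜 f ((ContinuousLinearMap.adjoint T).compLpL 2 μ g) := by
  rw [L2.inner_def, L2.inner_def]
  refine integral_congr_ae ?_
  filter_upwards [T.coeFn_compLpL (p := 2) f,
    (ContinuousLinearMap.adjoint T).coeFn_compLpL (p := 2) g] with x h1 h2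
  rw [h1, h2, ContinuousLinearMap.adjoint_inner_right]

theorem compLpL_comp_apply {Z : Type*} [NormedAddCommGroup Z] [NormedSpace 𝕜 X] [NormedSpace 𝕜 Y]
    [NormedSpace 𝕜 Z] (S : Y →L[𝕜] Z) (T : X →L[𝕜] Y) (f : Lp X 2 μ) :
    (S.comp T).compLpL 2 μ f = S.compLpL 2 μ (T.compLpL 2 μ f) := by
  refine Lp.ext ?_
  filter_upwards [(S.comp T).coeFn_compLpL (p := 2) f, T.coeFn_compLpL (p := 2) f,
    S.coeFn_compLpL (p := 2) (T.compLpL 2 μ f)] with x h1 h2 h3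
  rw [h1, h3, h2, ContinuousLinearMap.comp_apply]

end LpGeneral

theorem cauchySeq_of_dist_le_mul {E F : Type*} [PseudoMetricSpace E] [PseudoMetricSpace F]
    {x : ℕ → E} {y : ℕ → F} (K : ℝ) (hx : CauchySeq x)
    (h : ∀ n m, dist (y n) (y m) ≤ K * dist (x n) (x m)) : CauchySeq y := by
  rw [Metric.cauchySeq_iff] at hx ⊢
  intro ε hε
  obtain ⟨N, hN⟩ := hx (ε / (|K| + 1)) (by positivity)
  refine ⟨N, fun m hm n hn => ?_⟩
  have h1 := hN m hm n hn
  rw [lt_div_iff₀ (by positivity)] at h1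
  calc dist (y m) (y n) ≤ K * dist (x m) (x n) := h m n
    _ ≤ dist (x m) (x n) * (|K| + 1) := by
        nlinarith [le_abs_self K, dist_nonneg (x := x m) (y := x n)]
    _ < ε := h1

/-- A vector on which `M†` dominates lies in the range of `M`. -/
theorem exists_apply_eq_of_abs_inner_le {E : Type*} [NormedAddCommGroup E] [InnerProductSpace ℝ E]
    [CompleteSpace E] (M : E →L[ℝ] E) (g : E) (C : ℝ)
    (h : ∀ w, |inner ℝ g w| ≤ C * ‖ContinuousLinearMap.adjoint M w‖) : ∃ u, M u = g := by
  set N := ContinuousLinearMap.adjoint M with hN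
  -- `s` is a linear section of M†, in general not continuous. The functional r ↦ ⟨g, s r⟩ on the
  -- range of M† is nevertheless bounded, by hypothesis; Hahn–Banach extends it and Riesz represents
  -- it by the solution u.
  obtain ⟨s, hs⟩ := N.toLinearMap.rangeRestrict.exists_rightInverse_of_surjective
    (LinearMap.range_rangeRestrict _)
  have hs' : ∀ r, N (s r) = r := fun r => congrArg Subtype.val (LinearMap.congr_fun hs r)
  let ℓ : StrongDual ℝ (LinearMap.range N.toLinearMap) :=
    ((innerSL ℝ g).toLinearMap.comp s).mkContinuous C fun r => by
      have := h (s r)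
      rw [hs'] at this
      simpa using this
  obtain ⟨L, hL, -⟩ := exists_extension_norm_eq _ ℓ
  refine ⟨(InnerProductSpace.toDual ℝ E).symm L, ext_inner_right ℝ fun w => ?_⟩
  rw [← ContinuousLinearMap.adjoint_inner_right, InnerProductSpace.toDual_symm_apply]
  have h1 : L (N w) = inner ℝ g (s ⟨N w, ⟨w, rfl⟩⟩) := hL ⟨N w, ⟨w, rfl⟩⟩
  rw [← hN, h1]
  -- The argument lies in the kernel of M†, so the hypothesis forces g to be orthogonal to it: the
  -- choice of the section does not matter.
  have h2 := h (s ⟨N w, ⟨w, rfl⟩⟩ - w)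
  rw [map_sub, hs', sub_self, norm_zero, mul_zero, inner_sub_right] at h2
  linarith [abs_nonpos_iff.1 h2]

/-! ### Integration in time as a bounded operator on L²(0, τ; X). -/

section Primitive

/-- `L²(0, τ; X)`. -/
abbrev L2T (τ : ℝ) (X : Type*) [NormedAddCommGroup X] := Lp X 2 (volume.restrict (Ioo (0 : ℝ) τ))

variable {X Y : Type*} [NormedAddCommGroup X] [NormedSpace ℝ X] [CompleteSpace X]
  [NormedAddCommGroup Y] [NormedSpace ℝ Y] [CompleteSpace Y] {τ : ℝ}

theorem integrableOn_of_memLp {f : ℝ → X} (hf : MemLp f 2 (volume.restrict (Ioo 0 τ))) : IntegrableOn f (Ioo 0 τ) :=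
  MemLp.integrable (by norm_num) hf

theorem L2T.integrableOn (f : L2T τ X) : IntegrableOn f (Ioo 0 τ) :=
  integrableOn_of_memLp (Lp.memLp f)

theorem memLp_of_continuousOn {f : ℝ → X} (hf : ContinuousOn f (Icc 0 τ)) :
    MemLp f 2 (volume.restrict (Ioo 0 τ)) := by
  obtain ⟨C, hC⟩ := isCompact_Icc.exists_bound_of_continuousOn hf
  refine MemLp.of_bound ((hf.mono Ioo_subset_Icc_self).aestronglyMeasurable measurableSet_Ioo) C ?_
  exact ae_restrict_of_forall_mem measurableSet_Ioo fun t ht => hC t (Ioo_subset_Icc_self ht)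

theorem L2T.prim_mem (f : L2T τ X) : MemLp (prim f) 2 (volume.restrict (Ioo 0 τ)) :=
  memLp_of_continuousOn (prim_continuousOn (L2T.integrableOn f))

theorem norm_prim_le (f : L2T τ X) {t : ℝ} (ht : t ≤ τ) :
    ‖prim f t‖ ≤ Real.sqrt (volume.real (Ioo 0 τ)) * ‖f‖ := by
  calc ‖prim f t‖ ≤ ∫ s in Ioo 0 t, ‖f s‖ := norm_integral_le_integral_norm _
    _ ≤ ∫ s in Ioo 0 τ, ‖f s‖ := setIntegral_mono_set (L2T.integrableOn f).norm
        (Eventually.of_forall fun _ => norm_nonneg _) (Ioo_subset_Ioo_right ht).eventuallyLE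
    _ ≤ _ := by simpa using integral_norm_le_Lp f

/-- `f ↦ ∫₀ᵗ f` as an operator on `L²(0, τ; X)`. -/
def primL (τ : ℝ) (X : Type*) [NormedAddCommGroup X] [NormedSpace ℝ X] [CompleteSpace X] :
    L2T τ X →L[ℝ] L2T τ X :=
  LinearMap.mkContinuous
    { toFun := fun f => (L2T.prim_mem f).toLp
      map_add' := fun f g => by
        rw [← MemLp.toLp_add]
        refine MemLp.toLp_congr _ _ (ae_restrict_of_forall_mem measurableSet_Ioo fun t ht => ?_)
        rw [prim_congr ht.2.le (Lp.coeFn_add f g)]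
        exact integral_add ((L2T.integrableOn f).mono_set (Ioo_subset_Ioo_right ht.2.le))
          ((L2T.integrableOn g).mono_set (Ioo_subset_Ioo_right ht.2.le))
      map_smul' := fun c f => by
        rw [RingHom.id_apply, ← MemLp.toLp_const_smul]
        refine MemLp.toLp_congr _ _ (ae_restrict_of_forall_mem measurableSet_Ioo fun t ht => ?_)
        rw [prim_congr ht.2.le (Lp.coeFn_smul c f)]
        exact integral_smul c _ }
    ((measureUnivNNReal (volume.restrict (Ioo (0 : ℝ) τ)) : ℝ) ^ ((2 : ENNReal).toReal⁻¹) *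
      Real.sqrt (volume.real (Ioo 0 τ)))
    fun f => by
      rw [mul_assoc]
      refine Lp.norm_le_of_ae_bound (by positivity) ?_
      filter_upwards [(L2T.prim_mem f).coeFn_toLp,
        ae_restrict_mem (μ := volume) (measurableSet_Ioo (a := (0 : ℝ)) (b := τ))] with t h1 h2
      exact h1 ▸ norm_prim_le f h2.2.le

theorem coeFn_primL (f : L2T τ X) : primL τ X f =ᵐ[volume.restrict (Ioo 0 τ)] prim f :=
  (L2T.prim_mem f).coeFn_toLp

theorem primL_compLpL (T : X →L[ℝ] Y) (f : L2T τ X) :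
    primL τ Y (T.compLpL 2 _ f) = T.compLpL 2 _ (primL τ X f) := by
  refine Lp.ext ?_
  filter_upwards [coeFn_primL (T.compLpL 2 _ f), T.coeFn_compLpL (p := 2) (primL τ X f),
    coeFn_primL f, ae_restrict_mem (μ := volume) (measurableSet_Ioo (a := (0 : ℝ)) (b := τ))]
    with t h1 h2 h3 ht
  rw [h1, h2, h3, prim_congr ht.2.le (T.coeFn_compLpL f)]
  exact T.integral_comp_comm ((L2T.integrableOn f).mono_set (Ioo_subset_Ioo_right ht.2.le))

theorem ae_eq_zero_of_test {w : ℝ → X} (hw : IntegrableOn w (Ioo 0 τ))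
    (h : ∀ φ : ℝ → ℝ, ContDiff ℝ ∞ φ → HasCompactSupport φ → tsupport φ ⊆ Ioo 0 τ →
      ∫ t in Ioo 0 τ, φ t • w t = 0) : w =ᵐ[volume.restrict (Ioo 0 τ)] 0 := by
  have key := isOpen_Ioo.ae_eq_zero_of_integral_contDiff_smul_eq_zero
    (U := Ioo (0 : ℝ) τ) (μ := volume) hw.locallyIntegrableOn fun ψ h1 h2 h3 => by
      rw [← h ψ h1 h2 h3]
      refine (setIntegral_eq_integral_of_forall_compl_eq_zero fun t ht => ?_).symm
      rw [image_eq_zero_of_notMem_tsupport fun h => ht (h3 h), zero_smul]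
  rw [EventuallyEq, ae_restrict_iff' measurableSet_Ioo]
  exact key

theorem isWeakTimeDeriv_unique {y w w' : ℝ → X} (hw : IntegrableOn w (Ioo 0 τ))
    (hw' : IntegrableOn w' (Ioo 0 τ)) (h : IsWeakTimeDeriv τ y w) (h' : IsWeakTimeDeriv τ y w') :
    w =ᵐ[volume.restrict (Ioo 0 τ)] w' := by
  have hbd : ∀ {u : ℝ → X} {ψ : ℝ → ℝ}, IntegrableOn u (Ioo 0 τ) → Continuous ψ →
      HasCompactSupport ψ → IntegrableOn (fun t => ψ t • u t) (Ioo 0 τ) := by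
    intro u ψ hu hψ hc
    obtain ⟨C, hC⟩ := hc.exists_bound_of_continuous hψ
    exact Integrable.bdd_smul (hf := hu) C hψ.aestronglyMeasurable (Eventually.of_forall hC)
  have : (fun t => w t - w' t) =ᵐ[volume.restrict (Ioo 0 τ)] 0 :=
    ae_eq_zero_of_test (hw.sub hw') fun φ h1 h2 h3 => by
      simp only [smul_sub]
      rw [integral_sub (hbd hw h1.continuous h2) (hbd hw' h1.continuous h2), sub_eq_zero]
      exact neg_injective ((h φ h1 h2 h3).symm.trans (h' φ h1 h2 h3))
  filter_upwards [this] with t ht using sub_eq_zero.1 ht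

/-- If the primitive vanishes, then f is a distributional derivative of the zero function. -/
theorem primL_injective (hτ : 0 < τ) (f : L2T τ X) (h : primL τ X f = 0) : f = 0 := by
  have h0 : prim f =ᵐ[volume.restrict (Ioo 0 τ)] fun _ => 0 := by
    have := coeFn_primL f
    rw [h] at this
    exact this.symm.trans (Lp.coeFn_zero _ _ _)
  refine (Lp.eq_zero_iff_ae_eq_zero).2 (ae_eq_zero_of_test (L2T.integrableOn f) fun φ h1 h2 h3 => ?_)
  have := isWeakTimeDeriv_of_eq_prim (c := 0) (y := fun _ => (0 : X)) hτ (L2T.integrableOn f)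
    (by filter_upwards [h0] with t ht; rw [ht, add_zero]) φ h1 h2 h3
  simpa using this

end Primitive

/-! ### The primitive of functions with values in a Hilbert space. -/

section PrimitiveInner

variable {X : Type*} [NormedAddCommGroup X] [InnerProductSpace ℝ X] [CompleteSpace X] {τ : ℝ}

/-- The chain rule for ½ ‖c + ∫₀ᵗ f‖² in integrated form: `integral_bilin_prim_add` for the inner
product, where the two terms on the left coincide. -/
theorem integral_inner_add_prim {f : ℝ → X} (hf : IntegrableOn f (Ioo 0 τ)) (c : X) :
    ∫ t in Ioo 0 τ, inner ℝ (f t) (c + prim f t) =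
      (‖c + ∫ t in Ioo 0 τ, f t‖ ^ 2 - ‖c‖ ^ 2) / 2 := by
  have h := integral_bilin_prim_add (innerSL ℝ) hf hf
  change (∫ t in Ioo 0 τ, inner ℝ (f t) (prim f t)) + ∫ t in Ioo 0 τ, inner ℝ (prim f t) (f t) =
    inner ℝ (∫ t in Ioo 0 τ, f t) (∫ t in Ioo 0 τ, f t) at h
  have h1 : ∀ t, inner ℝ (prim f t) (f t) = inner ℝ (f t) (prim f t) := fun t =>
    real_inner_comm _ _
  simp only [h1] at h
  have hp := prim_continuousOn hf
  obtain ⟨C, hC⟩ := isCompact_Icc.exists_bound_of_continuousOn hp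
  have hi : IntegrableOn (fun t => inner ℝ (f t) (prim f t)) (Ioo 0 τ) := by
    refine Integrable.mono' (hf.norm.mul_const C) ?_ ?_
    · exact hf.1.inner ((hp.mono Ioo_subset_Icc_self).aestronglyMeasurable measurableSet_Ioo)
    · refine ae_restrict_of_forall_mem measurableSet_Ioo fun t ht => ?_
      refine (norm_inner_le_norm _ _).trans ?_
      gcongr
      exact hC t (Ioo_subset_Icc_self ht)
  simp only [inner_add_right]
  rw [integral_add (hf.inner_const c) hi, norm_add_sq_real]
  have h2 : ∫ t in Ioo 0 τ, inner ℝ (f t) c = inner ℝ c (∫ t in Ioo 0 τ, f t) := by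
    rw [← integral_inner hf]
    simp only [real_inner_comm]
  rw [h2]
  rw [real_inner_self_eq_norm_sq] at h
  linarith

theorem inner_primL_self_nonneg (f : L2T τ X) : 0 ≤ inner ℝ f (primL τ X f) := by
  have h := integral_inner_add_prim (L2T.integrableOn f) 0
  rw [L2.inner_def]
  have h1 : ∫ t in Ioo 0 τ, inner ℝ (f t) (primL τ X f t) =
      ∫ t in Ioo 0 τ, inner ℝ (f t) (0 + prim f t) := by
    refine integral_congr_ae ?_
    filter_upwards [coeFn_primL f] with t ht
    rw [ht, zero_add]
  rw [h1, h]
  simp only [zero_add, norm_zero]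
  have := sq_nonneg ‖∫ t in Ioo 0 τ, f t‖
  linarith

/-- Every φ(t) x with a test function φ is the primitive of φ'(t) x and so lies in the range. An
element orthogonal to all of these vanishes. -/
theorem primL_denseRange : DenseRange (primL τ X) := by
  have key : (LinearMap.range (primL τ X).toLinearMap)ᗮ = ⊥ := by
    rw [eq_bot_iff]
    intro g hg
    rw [Submodule.mem_orthogonal] at hg
    rw [Submodule.mem_bot]
    refine (Lp.eq_zero_iff_ae_eq_zero).2
      (ae_eq_zero_of_test (L2T.integrableOn g) fun φ h1 h2 h3 => ?_)
    refine ext_inner_left ℝ fun x => ?_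
    have hd : Continuous (deriv φ) := h1.continuous_deriv (by simp)
    have hmem : MemLp (fun t => deriv φ t • x) 2 (volume.restrict (Ioo 0 τ)) := memLp_of_continuousOn (by fun_prop)
    have h4 := hg (primL τ X hmem.toLp) ⟨_, rfl⟩
    rw [L2.inner_def] at h4
    have h5 : ∫ t in Ioo 0 τ, inner ℝ (primL τ X hmem.toLp t) (g t) =
        ∫ t in Ioo 0 τ, inner ℝ x (φ t • g t) := by
      refine integral_congr_ae ?_
      filter_upwards [coeFn_primL hmem.toLp,
        ae_restrict_mem (μ := volume) (measurableSet_Ioo (a := (0 : ℝ)) (b := τ))] with t ht ht'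
      rw [ht, prim_congr ht'.2.le hmem.coeFn_toLp, prim, integral_smul_const]
      have := prim_deriv_of_tsupport h1 h3 ht'.1.le
      rw [prim] at this
      rw [this, inner_smul_left, inner_smul_right]
      simp
    rw [h5] at h4
    obtain ⟨C, hC⟩ := h2.exists_bound_of_continuous h1.continuous
    have hi : IntegrableOn (fun t => φ t • g t) (Ioo 0 τ) :=
      Integrable.bdd_smul (hf := L2T.integrableOn g) C h1.continuous.aestronglyMeasurable
        (Eventually.of_forall hC)
    rw [integral_inner hi] at h4
    rw [h4, inner_zero_right]
  have := (Submodule.dense_iff_topologicalClosure_eq_top).2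
    ((Submodule.topologicalClosure_eq_top_iff).2 key)
  exact this

end PrimitiveInner

theorem integral_norm_mul_norm_le {α X Y : Type*} [MeasurableSpace α] {μ : Measure α}
    [NormedAddCommGroup X] [NormedAddCommGroup Y] (f : Lp X 2 μ) (g : Lp Y 2 μ) :
    ∫ x, ‖f x‖ * ‖g x‖ ∂μ ≤ ‖f‖ * ‖g‖ := by
  set F := (Lp.memLp f).norm.toLp with hF
  set G := (Lp.memLp g).norm.toLp with hG
  have h1 : ‖F‖ = ‖f‖ := by rw [hF, Lp.norm_toLp, eLpNorm_norm, Lp.norm_def]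
  have h2 : ‖G‖ = ‖g‖ := by rw [hG, Lp.norm_toLp, eLpNorm_norm, Lp.norm_def]
  have h3 := real_inner_le_norm F G
  rw [h1, h2, L2.inner_def] at h3
  refine le_of_eq_of_le (integral_congr_ae ?_) h3
  filter_upwards [(Lp.memLp f).norm.coeFn_toLp, (Lp.memLp g).norm.coeFn_toLp] with x h4 h5
  rw [h4, h5]
  simp [mul_comm]

/-! ### Linear evolution equations in a triple V ⊂ H ⊂ V'. -/

section LinearEvolution

variable {V H : Type*} [NormedAddCommGroup V] [InnerProductSpace ℝ V] [CompleteSpace V]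
  [NormedAddCommGroup H] [InnerProductSpace ℝ H] [CompleteSpace H] {τ : ℝ}

/-- The operator `ι† ι`, by which the pivot space is seen in `V`. -/
def gram (ι : V →L[ℝ] H) : V →L[ℝ] V := (ContinuousLinearMap.adjoint ι).comp ι

theorem inner_gram (ι : V →L[ℝ] H) (x y : V) : inner ℝ (gram ι x) y = inner ℝ (ι x) (ι y) := by
  rw [gram, ContinuousLinearMap.comp_apply, ContinuousLinearMap.adjoint_inner_left]

/-- Pointwise application of an operator on `L²(0, τ; V)`. -/
abbrev lift (τ : ℝ) {X Y : Type*} [NormedAddCommGroup X] [NormedSpace ℝ X] [NormedAddCommGroup Y]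
    [NormedSpace ℝ Y] (T : X →L[ℝ] Y) : L2T τ X →L[ℝ] L2T τ Y :=
  T.compLpL 2 (volume.restrict (Ioo (0 : ℝ) τ))

theorem inner_lift_gram (ι : V →L[ℝ] H) (x y : L2T τ V) :
    inner ℝ (lift τ (gram ι) x) y = inner ℝ x (lift τ (gram ι) y) := by
  rw [inner_compLpL]
  simp [gram, ContinuousLinearMap.adjoint_comp]

/-- ι commutes with integration in time, so this is ⟨ι w, ∫₀ᵗ ι w⟩, half the squared norm of the
final value of the primitive. -/
theorem inner_lift_gram_primL_nonneg (ι : V →L[ℝ] H) (w : L2T τ V) :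
    0 ≤ inner ℝ (lift τ (gram ι) w) (primL τ V w) := by
  rw [gram, compLpL_comp_apply, inner_compLpL, ContinuousLinearMap.adjoint_adjoint,
    ← primL_compLpL]
  exact inner_primL_self_nonneg _

theorem inner_lift_self_ge {B : V →L[ℝ] V} {c : ℝ} (hB : ∀ x, c * ‖x‖ ^ 2 ≤ inner ℝ (B x) x)
    (u : L2T τ V) : c * ‖u‖ ^ 2 ≤ inner ℝ (lift τ B u) u := by
  rw [L2.inner_def, ← real_inner_self_eq_norm_sq, L2.inner_def, ← integral_const_mul]
  refine integral_mono_ae ((L2.integrable_inner u u).const_mul c)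
    (L2.integrable_inner (𝕜 := ℝ) _ _) ?_
  filter_upwards [B.coeFn_compLpL (p := 2) u] with t ht
  rw [ht, real_inner_self_eq_norm_sq]
  exact hB _

/-- Pair the equation with p = ∫₀ᵗ d: the Gram term is nonnegative, and it equals -⟨B p, p⟩ ≤ -c
‖p‖². So p = 0, and hence d = 0. -/
theorem evolution_eq_zero (hτ : 0 < τ) (ι : V →L[ℝ] H) {B : V →L[ℝ] V} {c : ℝ} (hc : 0 < c)
    (hB : ∀ x, c * ‖x‖ ^ 2 ≤ inner ℝ (B x) x) {d : L2T τ V}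
    (h : lift τ (gram ι) d + primL τ V (lift τ B d) = 0) : d = 0 := by
  have h1 := inner_lift_gram_primL_nonneg ι d
  have h2 := inner_lift_self_ge hB (primL τ V d)
  rw [eq_neg_of_add_eq_zero_left h, primL_compLpL, inner_neg_left] at h1
  have h3 : ‖primL τ V d‖ ^ 2 ≤ 0 := by
    by_contra hcon
    nlinarith
  refine primL_injective hτ d ?_
  have : ‖primL τ V d‖ = 0 := by nlinarith [norm_nonneg (primL τ V d)]
  exact norm_eq_zero.1 this

/-- Existence by duality, for right-hand sides that are primitives: with G = ι† ι and P the
primitive operator, the vector P g is shown to lie in the range of M = G + P B. -/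
theorem exists_evolution_primL (ι : V →L[ℝ] H) {B : V →L[ℝ] V} {c : ℝ} (hc : 0 < c)
    (hB : ∀ x, c * ‖x‖ ^ 2 ≤ inner ℝ (B x) x) (g : L2T τ V) :
    ∃ u, lift τ (gram ι) u + primL τ V (lift τ B u) = primL τ V g := by
  set M : L2T τ V →L[ℝ] L2T τ V := lift τ (gram ι) + (primL τ V).comp (lift τ B) with hM
  refine exists_apply_eq_of_abs_inner_le M (primL τ V g) (‖g‖ / c) fun w => ?_
  -- The test element is φ = P† w. Then ⟨M† w, φ⟩ = ⟨w, G P† w⟩ + ⟨B φ, φ⟩, where the first term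
  -- equals ⟨G w, P w⟩ ≥ 0. Hence c ‖φ‖ ≤ ‖M† w‖, and ⟨P g, w⟩ = ⟨g, φ⟩.
  set φ := ContinuousLinearMap.adjoint (primL τ V) w with hφ
  rw [← ContinuousLinearMap.adjoint_inner_right, ← hφ]
  have h1 : c * ‖φ‖ ^ 2 ≤ inner ℝ (ContinuousLinearMap.adjoint M w) φ := by
    rw [ContinuousLinearMap.adjoint_inner_left, hM, add_apply,
      ContinuousLinearMap.comp_apply, inner_add_right]
    have h2 : inner ℝ w (primL τ V (lift τ B φ)) = inner ℝ (lift τ B φ) φ := by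
      rw [hφ, ← ContinuousLinearMap.adjoint_inner_left, real_inner_comm]
    have h3 : inner ℝ w (lift τ (gram ι) φ) = inner ℝ (lift τ (gram ι) w) (primL τ V w) := by
      rw [← inner_lift_gram, hφ, ContinuousLinearMap.adjoint_inner_right, primL_compLpL,
        inner_lift_gram, real_inner_comm]
    rw [h2, h3]
    linarith [inner_lift_self_ge hB φ, inner_lift_gram_primL_nonneg ι w]
  have h4 := (h1.trans (real_inner_le_norm _ _))
  have h5 : c * ‖φ‖ ≤ ‖ContinuousLinearMap.adjoint M w‖ := by
    rcases (norm_nonneg φ).eq_or_lt with h0 | h0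
    · rw [← h0, mul_zero]; exact norm_nonneg _
    · nlinarith
  calc |inner ℝ g φ| ≤ ‖g‖ * ‖φ‖ := abs_real_inner_le_norm _ _
    _ = ‖g‖ / c * (c * ‖φ‖) := by field_simp
    _ ≤ _ := by gcongr

/-- `v + ∫₀ᵗ w`, in `L²(0, τ; V)`. -/
def addPrim (v : V) (w : L2T τ V) : L2T τ V := Lp.const 2 _ v + primL τ V w

theorem coeFn_addPrim (v : V) (w : L2T τ V) :
    addPrim v w =ᵐ[volume.restrict (Ioo 0 τ)] fun t => v + prim w t := by
  filter_upwards [Lp.coeFn_add (Lp.const 2 _ v) (primL τ V w), coeFn_primL w,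
    Lp.coeFn_const (p := 2) (μ := volume.restrict (Ioo (0 : ℝ) τ)) v] with t h1 h2 h3
  rw [addPrim, h1, Pi.add_apply, h2, h3]
  rfl

/-- The energy identity for u = v + ∫₀ᵗ w, whose time derivative w still takes values in V; in this
class no approximation is needed. -/
theorem norm_sq_add_prim (ι : V →L[ℝ] H) (w : L2T τ V) (v : V) {t : ℝ} (ht : t ≤ τ) :
    ‖ι (v + prim w t)‖ ^ 2 =
      ‖ι v‖ ^ 2 + 2 * ∫ s in Ioo 0 t, inner ℝ (lift τ (gram ι) w s) (addPrim v w s) := by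
  have hsub : Ioo 0 t ⊆ Ioo 0 τ := Ioo_subset_Ioo_right ht
  have hιw : IntegrableOn (fun s => ι (w s)) (Ioo 0 t) :=
    ι.integrable_comp ((L2T.integrableOn w).mono_set hsub)
  have hp : ∀ s ≤ τ, prim (fun s => ι (w s)) s = ι (prim w s) := fun s hs =>
    ι.integral_comp_comm ((L2T.integrableOn w).mono_set (Ioo_subset_Ioo_right hs))
  have h1 := integral_inner_add_prim hιw (ι v)
  have h2 : ∫ s in Ioo 0 t, ι (w s) = ι (prim w t) := hp t ht
  rw [h2, ← map_add] at h1
  have h3 : ∫ s in Ioo 0 t, inner ℝ (ι (w s)) (ι v + prim (fun s => ι (w s)) s) =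
      ∫ s in Ioo 0 t, inner ℝ (lift τ (gram ι) w s) (addPrim v w s) := by
    refine integral_congr_ae ?_
    filter_upwards [ae_restrict_of_ae_restrict_of_subset hsub (coeFn_addPrim v w),
      ae_restrict_of_ae_restrict_of_subset hsub ((gram ι).coeFn_compLpL (p := 2) w),
      ae_restrict_mem measurableSet_Ioo] with s h4 h5 hs
    rw [h4, h5, hp s (hs.2.le.trans ht), ← map_add, inner_gram]
  rw [← h3, h1]
  ring

theorem norm_sq_add_prim_le {ι : V →L[ℝ] H} {B : V →L[ℝ] V} (hB : ∀ x, 0 ≤ inner ℝ (B x) x)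
    {f w : L2T τ V} {v : V} (h : lift τ (gram ι) w + lift τ B (addPrim v w) = f) {t : ℝ}
    (ht : t ≤ τ) :
    ‖ι (v + prim w t)‖ ^ 2 ≤ ‖ι v‖ ^ 2 + 2 * (‖f‖ * ‖addPrim v w‖) := by
  have hsub : Ioo 0 t ⊆ Ioo 0 τ := Ioo_subset_Ioo_right ht
  rw [norm_sq_add_prim ι w v ht]
  have hi : IntegrableOn (fun s => ‖f s‖ * ‖addPrim v w s‖) (Ioo 0 τ) :=
    (Lp.memLp f).norm.integrable_mul (Lp.memLp (addPrim v w)).norm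
  have h3 : ∫ s in Ioo 0 t, inner ℝ (lift τ (gram ι) w s) (addPrim v w s) ≤
      ∫ s in Ioo 0 t, ‖f s‖ * ‖addPrim v w s‖ := by
    refine integral_mono_ae
      (IntegrableOn.mono_set (L2.integrable_inner (𝕜 := ℝ) _ _) hsub) (hi.mono_set hsub) ?_
    have h4 := Lp.coeFn_add (lift τ (gram ι) w) (lift τ B (addPrim v w))
    rw [h] at h4
    filter_upwards [ae_restrict_of_ae_restrict_of_subset hsub h4,
      ae_restrict_of_ae_restrict_of_subset hsub (B.coeFn_compLpL (p := 2) (addPrim v w))]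
      with s h5 h6
    have h7 : lift τ (gram ι) w s = f s - B (addPrim v w s) := by
      rw [h5, Pi.add_apply, h6, add_sub_cancel_right]
    rw [h7, inner_sub_left]
    linarith [hB (addPrim v w s), real_inner_le_norm (f s) (addPrim v w s)]
  have h4 : ∫ s in Ioo 0 t, ‖f s‖ * ‖addPrim v w s‖ ≤ ∫ s in Ioo 0 τ, ‖f s‖ * ‖addPrim v w s‖ :=
    setIntegral_mono_set hi (Eventually.of_forall fun _ => by positivity) hsub.eventuallyLE
  linarith [integral_norm_mul_norm_le f (addPrim v w)]

theorem addPrim_energy {ι : V →L[ℝ] H} {B : V →L[ℝ] V} {c : ℝ}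
    (hB : ∀ x, c * ‖x‖ ^ 2 ≤ inner ℝ (B x) x)
    {f w : L2T τ V} {v : V} (h : lift τ (gram ι) w + lift τ B (addPrim v w) = f) :
    c * ‖addPrim v w‖ ^ 2 ≤ ‖ι v‖ ^ 2 / 2 + inner ℝ f (addPrim v w) := by
  have h1 := norm_sq_add_prim ι w v le_rfl (τ := τ)
  have h2 : ∫ s in Ioo 0 τ, inner ℝ (lift τ (gram ι) w s) (addPrim v w s) =
    inner ℝ (lift τ (gram ι) w) (addPrim v w) := (L2.inner_def _ _).symm
  rw [h2] at h1
  rw [← h, inner_add_left]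
  nlinarith [inner_lift_self_ge hB (addPrim v w), sq_nonneg ‖ι (v + prim w τ)‖]

theorem addPrim_sub (v v' : V) (w w' : L2T τ V) :
    addPrim v w - addPrim v' w' = addPrim (v - v') (w - w') := by
  have : Lp.const 2 (volume.restrict (Ioo (0 : ℝ) τ)) (v - v') =
      Lp.const 2 (volume.restrict (Ioo (0 : ℝ) τ)) v -
        Lp.const 2 (volume.restrict (Ioo (0 : ℝ) τ)) v' := map_sub _ _ _
  simp only [addPrim]
  rw [map_sub (primL τ V)]
  refine Eq.trans ?_ (congrArg (· + _) this.symm)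
  abel

/-- `u` solves `(ι† ι u)' = w` with initial value `u₀`, in integrated form. -/
def IsEvolution (ι : V →L[ℝ] H) (u₀ : H) (u w : L2T τ V) : Prop :=
  lift τ (gram ι) u = addPrim (ContinuousLinearMap.adjoint ι u₀) w

theorem isEvolution_addPrim {ι : V →L[ℝ] H} {B : V →L[ℝ] V} {f w : L2T τ V} {v : V}
    (h : lift τ (gram ι) w + lift τ B (addPrim v w) = f) :
    IsEvolution ι (ι v) (addPrim v w) (f - lift τ B (addPrim v w)) := by
  rw [IsEvolution, ← h, add_sub_cancel_right, addPrim, addPrim, map_add, primL_compLpL]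
  refine congrArg (· + _) ?_
  refine Lp.ext ?_
  filter_upwards [Lp.coeFn_const (p := 2) (μ := volume.restrict (Ioo (0 : ℝ) τ)) v,
    Lp.coeFn_const (p := 2) (μ := volume.restrict (Ioo (0 : ℝ) τ))
      (ContinuousLinearMap.adjoint ι (ι v)),
    (gram ι).coeFn_compLpL (p := 2) (Lp.const 2 (volume.restrict (Ioo (0 : ℝ) τ)) v)]
    with t h1 h2 h3
  rw [h3, h2, h1]
  rfl

/-- Data with a V-valued differentiable solution are dense. Choose v with ι v near u₀ and g with P g
near f - B v, and solve G w + P B w = P g; then G w + B (v + P w) = P g + B v is near f. -/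
theorem exists_addPrim_near {ι : V →L[ℝ] H} {B : V →L[ℝ] V} {c : ℝ} (hc : 0 < c)
    (hB : ∀ x, c * ‖x‖ ^ 2 ≤ inner ℝ (B x) x) (hι : DenseRange ι) (f : L2T τ V) (u₀ : H)
    {ε : ℝ} (hε : 0 < ε) :
    ∃ (v : V) (w : L2T τ V),
      dist (ι v, lift τ (gram ι) w + lift τ B (addPrim v w)) (u₀, f) < ε := by
  obtain ⟨v, hv⟩ := Metric.denseRange_iff.1 hι u₀ ε hε
  obtain ⟨g, hg⟩ := Metric.denseRange_iff.1 (primL_denseRange (X := V) (τ := τ))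
    (f - lift τ B (Lp.const 2 _ v)) ε hε
  obtain ⟨w, hw⟩ := exists_evolution_primL ι hc hB g
  refine ⟨v, w, ?_⟩
  rw [addPrim, map_add, ← primL_compLpL B]
  have : lift τ (gram ι) w + (lift τ B (Lp.const 2 _ v) + primL τ V (lift τ B w)) =
      primL τ V g + lift τ B (Lp.const 2 _ v) := by rw [← hw]; abel
  rw [this, Prod.dist_eq]
  refine max_lt (by rwa [dist_comm]) ?_
  rw [dist_eq_norm] at hg ⊢
  rw [← norm_neg]
  refine lt_of_eq_of_lt (congrArg norm ?_) hg
  exact (neg_sub _ _).trans ((congrArg _ (add_comm _ _)).trans (sub_sub _ _ _).symm)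

/-- Existence for the linear problem `(ι† ι u)' + B u = f`, `u(0) = u₀`. -/
theorem exists_linear_evolution {ι : V →L[ℝ] H} {B : V →L[ℝ] V} {c : ℝ} (hτ : 0 < τ) (hc : 0 < c)
    (hB : ∀ x, c * ‖x‖ ^ 2 ≤ inner ℝ (B x) x) (hι : DenseRange ι) (f : L2T τ V) (u₀ : H) :
    ∃ u : L2T τ V, IsEvolution ι u₀ u (f - lift τ B u) ∧
      HasInitialValue τ (fun t => ι (u t)) u₀ ∧ c * ‖u‖ ^ 2 ≤ ‖u₀‖ ^ 2 / 2 + inner ℝ f u := by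
  -- Differentiable solutions with data converging to (u₀, f). The energy estimate, applied to
  -- differences, makes them Cauchy in L²(0, τ; V) and their images under ι Cauchy in C([0, τ]; H).
  choose v w hvw using fun n : ℕ => exists_addPrim_near hc hB hι f u₀
    (Nat.one_div_pos_of_nat (n := n) (α := ℝ))
  set F : ℕ → L2T τ V := fun n => lift τ (gram ι) (w n) + lift τ B (addPrim (v n) (w n)) with hF
  set x : ℕ → H × L2T τ V := fun n => (ι (v n), F n) with hx
  have hxlim : Tendsto x atTop (𝓝 (u₀, f)) := by
    rw [tendsto_iff_dist_tendsto_zero]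
    exact squeeze_zero (fun _ => dist_nonneg) (fun n => (hvw n).le)
      tendsto_one_div_add_atTop_nhds_zero_nat
  have hB0 : ∀ x, 0 ≤ inner ℝ (B x) x := fun x => le_trans (by positivity) (hB x)
  have hcont : ∀ n, Continuous fun t : Icc (0 : ℝ) τ => ι (v n + prim (w n) t) := fun n =>
    ι.continuous.comp (continuous_const.add
      (continuousOn_iff_continuous_domRestrict.1 (prim_continuousOn (L2T.integrableOn (w n)))))
  let h : ℕ → C(Icc (0 : ℝ) τ, H) := fun n => ⟨_, hcont n⟩
  let y : ℕ → L2T τ V × C(Icc (0 : ℝ) τ, H) := fun n => (addPrim (v n) (w n), h n)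
  have hbd : ∀ n m, ‖addPrim (v n) (w n) - addPrim (v m) (w m)‖ ≤
        (1 + 2 / c) * ‖x n - x m‖ ∧ ‖h n - h m‖ ≤ (3 + 4 / c) * ‖x n - x m‖ := by
    intro n m
    set D := ‖x n - x m‖ with hD
    have hD1 : ‖ι (v n - v m)‖ ≤ D := by rw [map_sub]; exact norm_fst_le (x n - x m)
    have hD2 : ‖F n - F m‖ ≤ D := norm_snd_le (x n - x m)
    have hD0 : 0 ≤ D := norm_nonneg _
    have he : lift τ (gram ι) (w n - w m) + lift τ B (addPrim (v n - v m) (w n - w m)) =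
        F n - F m := by
      rw [← addPrim_sub, map_sub, map_sub]
      exact sub_add_sub_comm _ _ _ _
    have h1 := addPrim_energy hB he
    have h2 := real_inner_le_norm (F n - F m) (addPrim (v n - v m) (w n - w m))
    rw [addPrim_sub]
    set U := ‖addPrim (v n - v m) (w n - w m)‖ with hU
    have hU0 : 0 ≤ U := norm_nonneg _
    -- The energy inequality gives c U² ≤ D²/2 + D U. If the claim failed, then D ≤ U, so that c U²
    -- ≤ (3/2) D U, while also c U² > (c + 2) D U.
    have h3 : U ≤ (1 + 2 / c) * D := by
      by_contra hcon
      push Not at hcon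
      have hcU : (c + 2) * D < c * U := by
        have : (1 + 2 / c) * D * c = (c + 2) * D := by field_simp
        nlinarith
      have hU1 : 0 < U := lt_of_le_of_lt (by positivity) hcon
      have hDU : D ≤ U := by nlinarith [div_pos two_pos hc]
      have h6 : ‖ι (v n - v m)‖ ^ 2 ≤ D * U :=
        (pow_le_pow_left₀ (norm_nonneg _) hD1 2).trans (by nlinarith)
      have h7 : ‖F n - F m‖ * U ≤ D * U := by gcongr
      nlinarith [mul_lt_mul_of_pos_left hcU hU1, mul_nonneg hD0 hU0,
        mul_nonneg hc.le (mul_nonneg hD0 hU0)]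
    refine ⟨h3, ?_⟩
    rw [ContinuousMap.norm_le _ (by positivity)]
    intro t
    have h4 := norm_sq_add_prim_le hB0 he t.2.2
    have h5 : (h n - h m) t = ι (v n - v m + prim (w n - w m : L2T τ V) t) := by
      rw [prim_congr t.2.2 (Lp.coeFn_sub (w n) (w m))]
      have : prim (⇑(w n) - ⇑(w m)) t = prim (w n) t - prim (w m) t :=
        integral_sub ((L2T.integrableOn _).mono_set (Ioo_subset_Ioo_right t.2.2))
          ((L2T.integrableOn _).mono_set (Ioo_subset_Ioo_right t.2.2))
      rw [this, ContinuousMap.sub_apply]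
      change ι _ - ι _ = _
      rw [← map_sub]
      congr 1
      abel
    rw [h5]
    refine abs_le_of_sq_le_sq' ?_ (by positivity) |>.2
    have h6 : ‖ι (v n - v m)‖ ^ 2 ≤ D ^ 2 := pow_le_pow_left₀ (norm_nonneg _) hD1 2
    have h7 : ‖F n - F m‖ * U ≤ D * ((1 + 2 / c) * D) := mul_le_mul hD2 h3 hU0 hD0
    have h8 : 0 < 4 / c := by positivity
    calc _ ≤ ‖ι (v n - v m)‖ ^ 2 + 2 * (‖F n - F m‖ * U) := h4
      _ ≤ D ^ 2 * (3 + 4 / c) := by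
          have : 4 / c = 2 * (2 / c) := by ring
          rw [this]
          nlinarith
      _ ≤ ((3 + 4 / c) * D) ^ 2 := by
          rw [mul_pow, mul_comm]
          gcongr
          nlinarith
  have hy : CauchySeq y := by
    refine cauchySeq_of_dist_le_mul (3 + 4 / c) hxlim.cauchySeq fun n m => ?_
    rw [dist_eq_norm, dist_eq_norm]
    refine norm_prod_le_iff.2 ⟨(hbd n m).1.trans ?_, (hbd n m).2⟩
    have : 1 + 2 / c ≤ 3 + 4 / c := by gcongr <;> norm_num
    gcongr
  obtain ⟨⟨u, k⟩, hlim⟩ := cauchySeq_tendsto_of_complete hy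
  have hu : Tendsto (fun n => addPrim (v n) (w n)) atTop (𝓝 u) := (Prod.tendsto_iff _ _).1 hlim |>.1
  have hk : Tendsto h atTop (𝓝 k) := (Prod.tendsto_iff _ _).1 hlim |>.2
  have hv0 : Tendsto (fun n => ι (v n)) atTop (𝓝 u₀) := (Prod.tendsto_iff _ _).1 hxlim |>.1
  have hf0 : Tendsto F atTop (𝓝 f) := (Prod.tendsto_iff _ _).1 hxlim |>.2
  refine ⟨u, ?_, ?_, ?_⟩
  · have hcst : Continuous fun p : H × L2T τ V =>
        addPrim (ContinuousLinearMap.adjoint ι p.1) p.2 := by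
      have : Continuous fun x : V => Lp.const 2 (volume.restrict (Ioo (0 : ℝ) τ)) x :=
        (Lp.constL 2 (volume.restrict (Ioo (0 : ℝ) τ)) ℝ (E := V)).continuous
      unfold addPrim
      fun_prop
    refine tendsto_nhds_unique (((lift τ (gram ι)).continuous.tendsto u).comp hu) ?_
    have h1 : Tendsto (fun n => (ι (v n), F n - lift τ B (addPrim (v n) (w n)))) atTop
        (𝓝 (u₀, f - lift τ B u)) :=
      hv0.prodMk_nhds (hf0.sub (((lift τ B).continuous.tendsto u).comp hu))
    refine ((hcst.tendsto _).comp h1).congr fun n => ?_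
    exact (isEvolution_addPrim (B := B) rfl).symm
  · refine ⟨IccExtend hτ.le k, (k.continuous.Icc_extend').continuousOn, ?_, ?_⟩
    · obtain ⟨ns, hns, hae⟩ := exists_subseq_ae_tendsto hu
      filter_upwards [hae, ae_all_iff.2 fun n => coeFn_addPrim (v n) (w n),
        ae_restrict_mem measurableSet_Ioo] with t h1 h2 ht
      have ht' : t ∈ Icc 0 τ := Ioo_subset_Icc_self ht
      rw [IccExtend_of_mem hτ.le _ ht']
      refine tendsto_nhds_unique ((ι.continuous.tendsto _).comp h1) ?_
      have h3 : Tendsto (fun n => h n ⟨t, ht'⟩) atTop (𝓝 (k ⟨t, ht'⟩)) :=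
        ((continuous_eval_const (⟨t, ht'⟩ : Icc (0 : ℝ) τ)).tendsto k).comp hk
      refine (h3.comp hns.tendsto_atTop).congr fun n => ?_
      simp only [Function.comp, h2]
      rfl
    · have h0 : (0 : ℝ) ∈ Icc 0 τ := ⟨le_rfl, hτ.le⟩
      rw [IccExtend_of_mem hτ.le _ h0]
      have h3 : Tendsto (fun n => h n ⟨0, h0⟩) atTop (𝓝 (k ⟨0, h0⟩)) :=
        ((continuous_eval_const (⟨0, h0⟩ : Icc (0 : ℝ) τ)).tendsto k).comp hk
      refine tendsto_nhds_unique h3 (hv0.congr fun n => ?_)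
      change _ = ι (v n + prim (w n) 0)
      rw [prim_zero, add_zero]
  · refine le_of_tendsto_of_tendsto' ((hu.norm.pow 2).const_mul c)
      (((hv0.norm.pow 2).div_const 2).add (hf0.inner hu)) fun n => addPrim_energy hB rfl

theorem IsEvolution.sub {ι : V →L[ℝ] H} {u₀ u₀' : H} {u w u' w' : L2T τ V}
    (h : IsEvolution ι u₀ u w) (h' : IsEvolution ι u₀' u' w') :
    IsEvolution ι (u₀ - u₀') (u - u') (w - w') := by
  rw [IsEvolution] at *
  rw [map_sub, h, h', addPrim_sub, map_sub]

theorem isEvolution_zero_iff {ι : V →L[ℝ] H} {u w : L2T τ V} :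
    IsEvolution ι 0 u w ↔ lift τ (gram ι) u = primL τ V w := by
  have : Lp.const 2 (volume.restrict (Ioo (0 : ℝ) τ)) (0 : V) = 0 := map_zero _
  rw [IsEvolution, addPrim, map_zero, this, zero_add]

/-- The energy inequality for zero initial values. -/
theorem IsEvolution.inner_nonneg {ι : V →L[ℝ] H} {u w : L2T τ V} (hτ : 0 < τ) (hι : DenseRange ι)
    (h : IsEvolution ι 0 u w) : 0 ≤ inner ℝ w u := by
  have hB : ∀ x : V, 1 * ‖x‖ ^ 2 ≤ inner ℝ (ContinuousLinearMap.id ℝ V x) x := fun x => by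
    simp
  have hid : ∀ x : L2T τ V, lift τ (ContinuousLinearMap.id ℝ V) x = x := fun x =>
    Lp.ext ((ContinuousLinearMap.id ℝ V).coeFn_compLpL (p := 2) x)
  -- u solves (ι† ι u)' + u = w + u with zero initial value. The constructed solution U of this
  -- problem coincides with u by uniqueness, and its energy inequality ‖u‖² ≤ ⟨w + u, u⟩ is the
  -- claim.
  obtain ⟨U, hU, -, hE⟩ := exists_linear_evolution hτ one_pos hB hι (w + u) 0
  rw [hid] at hU
  have h1 := hU.sub h
  rw [sub_zero, isEvolution_zero_iff] at h1
  have h2 : w + u - U - w = -(U - u) := by abel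
  rw [h2, map_neg, eq_neg_iff_add_eq_zero] at h1
  nth_rw 2 [← hid (U - u)] at h1
  have h3 := sub_eq_zero.1 (evolution_eq_zero hτ ι one_pos hB h1)
  rw [h3, norm_zero, inner_add_left, real_inner_self_eq_norm_sq] at hE
  linarith

end LinearEvolution

/-! ### Distributional derivatives and initial values under exponential weights and linear maps. -/

section WeakForm

variable {X : Type*} [NormedAddCommGroup X] [NormedSpace ℝ X] [CompleteSpace X] {τ : ℝ}

theorem memLp_exp_smul (l : ℝ) {u : ℝ → X} (hu : MemLp u 2 (volume.restrict (Ioo 0 τ))) :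
    MemLp (fun t => Real.exp (l * t) • u t) 2 (volume.restrict (Ioo 0 τ)) := by
  have hc : Continuous fun t : ℝ => Real.exp (l * t) := by fun_prop
  obtain ⟨C, hC⟩ := isCompact_Icc.exists_bound_of_continuousOn
    (hc.continuousOn (s := Icc (0 : ℝ) τ))
  refine hu.of_le_mul (c := C) (hc.aestronglyMeasurable.smul hu.1) ?_
  refine ae_restrict_of_forall_mem measurableSet_Ioo fun t ht => ?_
  rw [norm_smul]
  gcongr
  exact hC t (Ioo_subset_Icc_self ht)

/-- The product rule: φ(t) e^{lt} is again a test function. -/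
theorem IsWeakTimeDeriv.exp_smul (l : ℝ) {y w : ℝ → X}
    (hy : MemLp y 2 (volume.restrict (Ioo 0 τ))) (hw : MemLp w 2 (volume.restrict (Ioo 0 τ)))
    (h : IsWeakTimeDeriv τ y w) :
    IsWeakTimeDeriv τ (fun t => Real.exp (l * t) • y t)
      (fun t => Real.exp (l * t) • w t + l • Real.exp (l * t) • y t) := by
  intro φ h1 h2 h3
  have hbd : ∀ {u : ℝ → X} {ψ : ℝ → ℝ}, MemLp u 2 (volume.restrict (Ioo 0 τ)) → Continuous ψ →
      HasCompactSupport ψ → IntegrableOn (fun t => ψ t • u t) (Ioo 0 τ) := by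
    intro u ψ hu hψ hc
    obtain ⟨C, hC⟩ := hc.exists_bound_of_continuous hψ
    exact Integrable.bdd_smul (hf := integrableOn_of_memLp hu) C hψ.aestronglyMeasurable
      (Eventually.of_forall hC)
  have hE : ContDiff ℝ ∞ fun t : ℝ => Real.exp (l * t) := by fun_prop
  have hd : ∀ t, deriv (fun t => φ t * Real.exp (l * t)) t =
      deriv φ t * Real.exp (l * t) + φ t * (l * Real.exp (l * t)) := by
    intro t
    have e1 : HasDerivAt (fun t : ℝ => Real.exp (l * t)) (l * Real.exp (l * t)) t := by
      have := ((hasDerivAt_id t).const_mul l).exp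
      simpa [mul_comm] using this
    exact (((h1.differentiable (by simp)) t).hasDerivAt.mul e1).deriv
  have h4 := h (fun t => φ t * Real.exp (l * t)) (h1.mul hE) h2.mul_right
    ((tsupport_mul_subset_left).trans h3)
  have hcd : Continuous (deriv φ) := h1.continuous_deriv (by simp)
  have i1 := hbd (memLp_exp_smul l hy) hcd h2.deriv
  have i2 := hbd (memLp_exp_smul l hy) h1.continuous h2
  have i3 := hbd (memLp_exp_smul l hw) h1.continuous h2
  have e2 : ∫ t in Ioo 0 τ, deriv (fun t => φ t * Real.exp (l * t)) t • y t =
      (∫ t in Ioo 0 τ, deriv φ t • Real.exp (l * t) • y t) +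
        l • ∫ t in Ioo 0 τ, φ t • Real.exp (l * t) • y t := by
    rw [← integral_smul, ← integral_add (g := fun t => l • φ t • Real.exp (l * t) • y t) i1
      (i2.smul l)]
    refine integral_congr_ae (Eventually.of_forall fun t => ?_)
    simp only [hd, add_smul, smul_smul]
    congr 2
    ring
  have e3 : ∫ t in Ioo 0 τ, φ t • (Real.exp (l * t) • w t + l • Real.exp (l * t) • y t) =
      (∫ t in Ioo 0 τ, φ t • Real.exp (l * t) • w t) +
        l • ∫ t in Ioo 0 τ, φ t • Real.exp (l * t) • y t := by
    rw [← integral_smul, ← integral_add (g := fun t => l • φ t • Real.exp (l * t) • y t) i3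
      (i2.smul l)]
    refine integral_congr_ae (Eventually.of_forall fun t => ?_)
    simp only [smul_add]
    congr 1
    rw [smul_comm]
  rw [e2] at h4
  simp only [mul_smul] at h4
  rw [e3, neg_add, ← h4]
  abel

theorem HasInitialValue.exp_smul (l : ℝ) {g : ℝ → X} {g₀ : X} (h : HasInitialValue τ g g₀) :
    HasInitialValue τ (fun t => Real.exp (l * t) • g t) g₀ := by
  obtain ⟨k, h1, h2, h3⟩ := h
  refine ⟨fun t => Real.exp (l * t) • k t, ContinuousOn.smul (by fun_prop) h1, ?_, by simp [h3]⟩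
  filter_upwards [h2] with t ht
  rw [ht]

theorem HasInitialValue.congr {g g' : ℝ → X} {g₀ : X} (h : HasInitialValue τ g g₀)
    (h' : g =ᵐ[volume.restrict (Ioo 0 τ)] g') : HasInitialValue τ g' g₀ := by
  obtain ⟨k, h1, h2, h3⟩ := h
  exact ⟨k, h1, h'.symm.trans h2, h3⟩

theorem IsWeakTimeDeriv.congr {y w y' w' : ℝ → X} (h : IsWeakTimeDeriv τ y w)
    (hy : y =ᵐ[volume.restrict (Ioo 0 τ)] y') (hw : w =ᵐ[volume.restrict (Ioo 0 τ)] w') :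
    IsWeakTimeDeriv τ y' w' := by
  intro φ h1 h2 h3
  have e1 : ∫ t in Ioo 0 τ, deriv φ t • y' t = ∫ t in Ioo 0 τ, deriv φ t • y t :=
    integral_congr_ae (by filter_upwards [hy] with t ht; rw [ht])
  have e2 : ∫ t in Ioo 0 τ, φ t • w' t = ∫ t in Ioo 0 τ, φ t • w t :=
    integral_congr_ae (by filter_upwards [hw] with t ht; rw [ht])
  rw [e1, e2, h φ h1 h2 h3]

theorem IsWeakTimeDeriv.clm_comp {Y : Type*} [NormedAddCommGroup Y] [NormedSpace ℝ Y]
    [CompleteSpace Y] (T : X →L[ℝ] Y) {y w : ℝ → X}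
    (hy : MemLp y 2 (volume.restrict (Ioo 0 τ))) (hw : MemLp w 2 (volume.restrict (Ioo 0 τ)))
    (h : IsWeakTimeDeriv τ y w) : IsWeakTimeDeriv τ (fun t => T (y t)) (fun t => T (w t)) := by
  intro φ h1 h2 h3
  have hbd : ∀ {u : ℝ → X} {ψ : ℝ → ℝ}, MemLp u 2 (volume.restrict (Ioo 0 τ)) → Continuous ψ →
      HasCompactSupport ψ → IntegrableOn (fun t => ψ t • u t) (Ioo 0 τ) := by
    intro u ψ hu hψ hc
    obtain ⟨C, hC⟩ := hc.exists_bound_of_continuous hψ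
    exact Integrable.bdd_smul (hf := integrableOn_of_memLp hu) C hψ.aestronglyMeasurable
      (Eventually.of_forall hC)
  simp only [← map_smul]
  rw [T.integral_comp_comm (hbd hy (h1.continuous_deriv (by simp)) h2.deriv),
    T.integral_comp_comm (hbd hw h1.continuous h2), h φ h1 h2 h3, map_neg]

end WeakForm

/-! ### Semilinear evolution equations by a weighted contraction. -/

section NonlinearEvolution

variable {V H : Type*} [NormedAddCommGroup V] [InnerProductSpace ℝ V] [CompleteSpace V]
  [NormedAddCommGroup H] [InnerProductSpace ℝ H] [CompleteSpace H] {τ : ℝ}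

theorem IsEvolution.isWeakTimeDeriv {ι : V →L[ℝ] H} {u₀ : H} {u w : L2T τ V} (hτ : 0 < τ)
    (h : IsEvolution ι u₀ u w) : IsWeakTimeDeriv τ (fun t => gram ι (u t)) w := by
  refine isWeakTimeDeriv_of_eq_prim (c := ContinuousLinearMap.adjoint ι u₀) hτ
    (L2T.integrableOn w) ?_
  have h1 := (gram ι).coeFn_compLpL (p := 2) (μ := volume.restrict (Ioo (0 : ℝ) τ)) u
  have h2 := coeFn_addPrim (ContinuousLinearMap.adjoint ι u₀) w
  rw [IsEvolution] at h
  rw [← h] at h2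
  exact h1.symm.trans h2

/-- The distributional equation gives ι† ι u = c + ∫₀ᵗ w. Both sides have continuous
representatives, and comparing them at t = 0 gives c = ι† u₀. -/
theorem isEvolution_of_isWeakTimeDeriv {ι : V →L[ℝ] H} {u₀ : H} {u w : L2T τ V} (hτ : 0 < τ)
    (h : IsWeakTimeDeriv τ (fun t => gram ι (u t)) w)
    (h0 : HasInitialValue τ (fun t => ι (u t)) u₀) : IsEvolution ι u₀ u w := by
  have h1 := (gram ι).coeFn_compLpL (p := 2) (μ := volume.restrict (Ioo (0 : ℝ) τ)) u
  obtain ⟨c, hc⟩ := exists_eq_const_add_prim hτ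
    ((gram ι).integrable_comp (L2T.integrableOn u)) (L2T.integrableOn w) h
  obtain ⟨k, hk, hku, hk0⟩ := h0
  have hcc : ContinuousLinearMap.adjoint ι u₀ = c := by
    have e1 : EqOn (fun t => ContinuousLinearMap.adjoint ι (k t)) (fun t => c + prim w t)
        (Ioo 0 τ) := by
      refine Measure.eqOn_open_of_ae_eq (μ := volume) ?_ isOpen_Ioo ?_ ?_
      · filter_upwards [hc, hku] with t h2 h3
        rw [← h3, ← h2]
        rfl
      · exact ((ContinuousLinearMap.continuous _).comp_continuousOn hk).mono Ioo_subset_Icc_self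
      · exact (continuousOn_const.add (prim_continuousOn (L2T.integrableOn w))).mono
          Ioo_subset_Icc_self
    have e2 : EqOn (fun t => ContinuousLinearMap.adjoint ι (k t)) (fun t => c + prim w t)
        (Icc 0 τ) := by
      refine e1.of_subset_closure ((ContinuousLinearMap.continuous _).comp_continuousOn hk)
        (continuousOn_const.add (prim_continuousOn (L2T.integrableOn w))) Ioo_subset_Icc_self ?_
      rw [closure_Ioo hτ.ne]
    have e3 := e2 (left_mem_Icc.2 hτ.le)
    simpa [hk0, prim_zero] using e3
  rw [IsEvolution, hcc]
  exact Lp.ext (h1.trans (hc.trans (coeFn_addPrim c w).symm))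

/-- Take w = F u - F v and bound both H-norms by V-norms. This Lipschitz bound serves only to keep
F(u) in L²(0, τ; V); the contraction needs the finer hypothesis. -/
theorem norm_sub_le_of_inner_sq_le {ι : V →L[ℝ] H} {F : V → V} {C : ℝ}
    (hF : ∀ u v w, inner ℝ (F u - F v) w ^ 2 ≤
      C ^ 2 * (‖ι (u - v)‖ * ‖u - v‖ * (‖ι w‖ * ‖w‖))) (u v : V) :
    ‖F u - F v‖ ≤ |C| * ‖ι‖ * ‖u - v‖ := by
  have h := hF u v (F u - F v)
  rw [real_inner_self_eq_norm_sq] at h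
  have h1 := ι.le_opNorm (u - v)
  have h2 := ι.le_opNorm (F u - F v)
  set x := ‖F u - F v‖
  set y := ‖u - v‖
  have hx : 0 ≤ x := norm_nonneg _
  have hy : 0 ≤ y := norm_nonneg _
  have h3 : (x ^ 2) ^ 2 ≤ C ^ 2 * (‖ι‖ * y * y * (‖ι‖ * x * x)) := by
    refine h.trans ?_
    gcongr
  rcases hx.eq_or_lt with h0 | h0
  · rw [← h0]; positivity
  refine abs_le_of_sq_le_sq' ?_ (by positivity) |>.2
  rw [mul_pow, mul_pow, sq_abs]
  have : x ^ 2 * x ^ 2 ≤ (C ^ 2 * ‖ι‖ ^ 2 * y ^ 2) * x ^ 2 := by nlinarith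
  exact le_of_mul_le_mul_right this (by positivity)

theorem memLp_comp_of_lipschitz {E E' : Type*} [NormedAddCommGroup E] [NormedAddCommGroup E']
    {F : E → E'} {K : ℝ} (hF : ∀ u v, ‖F u - F v‖ ≤ K * ‖u - v‖) {u : ℝ → E} (hu : MemLp u 2 (volume.restrict (Ioo 0 τ))) :
    MemLp (fun t => F (u t)) 2 (volume.restrict (Ioo 0 τ)) := by
  have hc : Continuous F := by
    have : LipschitzWith K.toNNReal F := LipschitzWith.of_dist_le_mul fun x y => by
      rw [dist_eq_norm, dist_eq_norm]
      refine (hF x y).trans ?_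
      gcongr
      exact Real.le_coe_toNNReal K
    exact this.continuous
  have h1 : MemLp (fun t => F (u t) - F 0) 2 (volume.restrict (Ioo 0 τ)) := by
    refine hu.of_le_mul (c := K) ((hc.comp_aestronglyMeasurable hu.1).sub
      aestronglyMeasurable_const) (Eventually.of_forall fun t => ?_)
    simpa using hF (u t) 0
  have h2 := h1.add (memLp_const (F 0))
  refine h2.ae_eq (Eventually.of_forall fun t => ?_)
  simp

/-- `v ↦ e^{-lt} F(e^{lt} v)` on `L²(0, τ; V)`. -/
def expConj {F : V → V} {K : ℝ} (hF : ∀ u v, ‖F u - F v‖ ≤ K * ‖u - v‖) (l : ℝ) (v : L2T τ V) :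
    L2T τ V :=
  (memLp_exp_smul (-l) (memLp_comp_of_lipschitz hF (memLp_exp_smul l (Lp.memLp v)))).toLp

theorem norm_sq_eq_integral {Y : Type*} [NormedAddCommGroup Y] [InnerProductSpace ℝ Y]
    (f : L2T τ Y) : ‖f‖ ^ 2 = ∫ t in Ioo 0 τ, ‖f t‖ ^ 2 := by
  rw [← real_inner_self_eq_norm_sq, L2.inner_def]
  simp only [real_inner_self_eq_norm_sq]

theorem integrable_norm_sq {Y : Type*} [NormedAddCommGroup Y] [InnerProductSpace ℝ Y]
    (f : L2T τ Y) : Integrable (fun t => ‖f t‖ ^ 2) (volume.restrict (Ioo 0 τ)) := by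
  simpa only [real_inner_self_eq_norm_sq] using L2.integrable_inner (𝕜 := ℝ) f f

/-- The two exponentials cancel since the bound on F is homogeneous in u - v. With S = Λ‖ι(a - b)‖²
+ c‖a - b‖² and S' the same expression for d, C² ≤ Λ c gives 2|C| xy ≤ Λ x² + c y², so the pointwise
inner product is at most √(S S')/2 ≤ (S + S')/4. -/
theorem abs_inner_expConj_sub_le {ι : V →L[ℝ] H} {F : V → V} {K C Λ c : ℝ}
    (hK : ∀ u v, ‖F u - F v‖ ≤ K * ‖u - v‖)
    (hF : ∀ u v w, inner ℝ (F u - F v) w ^ 2 ≤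
      C ^ 2 * (‖ι (u - v)‖ * ‖u - v‖ * (‖ι w‖ * ‖w‖)))
    (hc : 0 < c) (hΛ : 0 ≤ Λ) (hΛc : C ^ 2 ≤ Λ * c) (l : ℝ) (a b d : L2T τ V) :
    inner ℝ (expConj hK l a - expConj hK l b) d ≤
      ((Λ * ‖lift τ ι (a - b)‖ ^ 2 + c * ‖a - b‖ ^ 2) +
        (Λ * ‖lift τ ι d‖ ^ 2 + c * ‖d‖ ^ 2)) / 4 := by
  have i1 : Integrable (fun t => Λ * ‖lift τ ι (a - b) t‖ ^ 2 + c * ‖(a - b : L2T τ V) t‖ ^ 2)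
      (volume.restrict (Ioo 0 τ)) := ((integrable_norm_sq (lift τ ι (a - b))).const_mul Λ).add ((integrable_norm_sq (a - b)).const_mul c)
  have i2 : Integrable (fun t => Λ * ‖lift τ ι d t‖ ^ 2 + c * ‖d t‖ ^ 2)
      (volume.restrict (Ioo 0 τ)) := ((integrable_norm_sq (lift τ ι d)).const_mul Λ).add ((integrable_norm_sq d).const_mul c)
  have e : ((Λ * ‖lift τ ι (a - b)‖ ^ 2 + c * ‖a - b‖ ^ 2) +
        (Λ * ‖lift τ ι d‖ ^ 2 + c * ‖d‖ ^ 2)) / 4 =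
      ∫ t in Ioo 0 τ, ((Λ * ‖lift τ ι (a - b) t‖ ^ 2 + c * ‖(a - b : L2T τ V) t‖ ^ 2) +
        (Λ * ‖lift τ ι d t‖ ^ 2 + c * ‖d t‖ ^ 2)) / 4 := by
    rw [integral_div, integral_add i1 i2, integral_add ((integrable_norm_sq _).const_mul Λ)
      ((integrable_norm_sq _).const_mul c), integral_add ((integrable_norm_sq _).const_mul Λ) ((integrable_norm_sq _).const_mul c)]
    simp only [integral_const_mul, ← norm_sq_eq_integral]
  rw [e, L2.inner_def]
  refine integral_mono_ae (L2.integrable_inner (𝕜 := ℝ) _ _) ((i1.add i2).div_const 4) ?_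
  filter_upwards [Lp.coeFn_sub (expConj hK l a) (expConj hK l b), Lp.coeFn_sub a b,
    ι.coeFn_compLpL (p := 2) (a - b), ι.coeFn_compLpL (p := 2) d,
    (memLp_exp_smul (-l) (memLp_comp_of_lipschitz hK (memLp_exp_smul l (Lp.memLp a)))).coeFn_toLp,
    (memLp_exp_smul (-l) (memLp_comp_of_lipschitz hK (memLp_exp_smul l (Lp.memLp b)))).coeFn_toLp]
    with t h1 h2 h3 h4 h5 h6
  rw [h1, Pi.sub_apply, h3, h4, h2, Pi.sub_apply]
  have h5' : expConj hK l a t = Real.exp (-l * t) • F (Real.exp (l * t) • a t) := h5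
  have h6' : expConj hK l b t = Real.exp (-l * t) • F (Real.exp (l * t) • b t) := h6
  rw [h5', h6', ← smul_sub, real_inner_smul_left]
  have key := hF (Real.exp (l * t) • a t) (Real.exp (l * t) • b t) (d t)
  rw [← smul_sub, map_smul, norm_smul, norm_smul, Real.norm_eq_abs, Real.abs_exp] at key
  set I := inner ℝ (F (Real.exp (l * t) • a t) - F (Real.exp (l * t) • b t)) (d t)
  set E := Real.exp (l * t)
  set E' := Real.exp (-l * t)
  have hEE : E' * E = 1 := by rw [← Real.exp_add]; simp
  set p := ‖ι (a t - b t)‖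
  set q := ‖a t - b t‖
  set p' := ‖ι (d t)‖
  set q' := ‖d t‖
  have hp : 0 ≤ p := norm_nonneg _
  have hq : 0 ≤ q := norm_nonneg _
  have hp' : 0 ≤ p' := norm_nonneg _
  have hq' : 0 ≤ q' := norm_nonneg _
  have k1 : (E' * I) ^ 2 ≤ C ^ 2 * (p * q) * (p' * q') := by
    calc (E' * I) ^ 2 = E' ^ 2 * I ^ 2 := by ring
      _ ≤ E' ^ 2 * (C ^ 2 * (E * p * (E * q) * (p' * q'))) := by gcongr
      _ = (E' * E) ^ 2 * (C ^ 2 * (p * q) * (p' * q')) := by ring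
      _ = _ := by rw [hEE]; ring
  have k2 : ∀ x y : ℝ, 0 ≤ x → 0 ≤ y → 2 * |C| * (x * y) ≤ Λ * x ^ 2 + c * y ^ 2 := by
    intro x y hx hy
    refine abs_le_of_sq_le_sq' ?_ (by positivity) |>.2
    have : (2 * |C| * (x * y)) ^ 2 = 4 * C ^ 2 * (x ^ 2 * y ^ 2) := by
      rw [mul_pow, mul_pow, sq_abs]; ring
    rw [this]
    nlinarith [sq_nonneg (Λ * x ^ 2 - c * y ^ 2), mul_nonneg (sq_nonneg x) (sq_nonneg y)]
  refine abs_le_of_sq_le_sq' ?_ (by positivity) |>.2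
  have k3 := k2 p q hp hq
  have k4 := k2 p' q' hp' hq'
  set S := Λ * p ^ 2 + c * q ^ 2
  set S' := Λ * p' ^ 2 + c * q' ^ 2
  have k5 : C ^ 2 * (p * q) * (p' * q') ≤ S * S' / 4 := by
    have : (2 * |C| * (p * q)) * (2 * |C| * (p' * q')) ≤ S * S' := by
      refine mul_le_mul k3 k4 (by positivity) (by positivity)
    have h7 : (2 * |C| * (p * q)) * (2 * |C| * (p' * q')) = 4 * (C ^ 2 * (p * q) * (p' * q')) := by
      rw [← sq_abs C]; ring
    linarith
  nlinarith [sq_nonneg (S - S')]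

/-- `u` solves `(ι† ι u)' + B u = F(u) + f`, `u(0) = u₀`. -/
def IsNonlinearEvolution (τ : ℝ) (ι : V →L[ℝ] H) (B : V →L[ℝ] V) (F : V → V) (f : ℝ → V)
    (u₀ : H) (u : ℝ → V) : Prop :=
  MemLp u 2 (volume.restrict (Ioo 0 τ)) ∧
    IsWeakTimeDeriv τ (fun t => gram ι (u t)) (fun t => F (u t) + f t - B (u t)) ∧
    HasInitialValue τ (fun t => ι (u t)) u₀

/-- The function v = e^{-lt} u solves a problem of the same kind with B replaced by B + l ι† ι. For
large l the elliptic part dominates the estimate of the nonlinearity, and Picard iteration contracts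
on the whole interval. -/
theorem existsUnique_nonlinear_evolution {ι : V →L[ℝ] H} {B : V →L[ℝ] V} {F : V → V} {c C : ℝ}
    (hτ : 0 < τ) (hι : DenseRange ι) (hc : 0 < c)
    (hB : ∀ x, c * ‖x‖ ^ 2 ≤ inner ℝ (B x) x + c * ‖ι x‖ ^ 2)
    (hF : ∀ u v w, inner ℝ (F u - F v) w ^ 2 ≤
      C ^ 2 * (‖ι (u - v)‖ * ‖u - v‖ * (‖ι w‖ * ‖w‖)))
    {f : ℝ → V} (hf : MemLp f 2 (volume.restrict (Ioo 0 τ))) (u₀ : H) :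
    ∃ u, IsNonlinearEvolution τ ι B F f u₀ u ∧
      ∀ u', IsNonlinearEvolution τ ι B F f u₀ u' → u' =ᵐ[volume.restrict (Ioo 0 τ)] u := by
  have hK := norm_sub_le_of_inner_sq_le hF
  set Λ := C ^ 2 / c with hΛdef
  have hΛ : 0 ≤ Λ := by positivity
  have hΛc : C ^ 2 ≤ Λ * c := by rw [hΛdef]; field_simp; exact le_rfl
  -- The summand c turns the Gårding inequality into coercivity; the summand Λ produces the H-norm
  -- part of the energy A, which controls the nonlinearity.
  set l := c + Λ with hl
  set N : L2T τ V → L2T τ V := expConj hK l with hN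
  set fl : L2T τ V := (memLp_exp_smul (-l) hf).toLp with hfl
  set B' : V →L[ℝ] V := B + c • gram ι with hB'
  set Bl : V →L[ℝ] V := B' + Λ • gram ι with hBl
  have hB1 : ∀ x, c * ‖x‖ ^ 2 ≤ inner ℝ (B' x) x := by
    intro x
    rw [hB', add_apply, inner_add_left, smul_apply, real_inner_smul_left, inner_gram,
      real_inner_self_eq_norm_sq]
    exact hB x
  have hBl1 : ∀ x, c * ‖x‖ ^ 2 + Λ * ‖ι x‖ ^ 2 ≤ inner ℝ (Bl x) x := by
    intro x
    rw [hBl, add_apply, inner_add_left, smul_apply, real_inner_smul_left, inner_gram,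
      real_inner_self_eq_norm_sq]
    linarith [hB1 x]
  have hBl2 : ∀ x, c * ‖x‖ ^ 2 ≤ inner ℝ (Bl x) x := fun x =>
    le_trans (le_add_of_nonneg_right (by positivity)) (hBl1 x)
  set A : L2T τ V → ℝ := fun d => Λ * ‖lift τ ι d‖ ^ 2 + c * ‖d‖ ^ 2 with hA
  have hA0 : ∀ d, 0 ≤ A d := fun d => by positivity
  have hAB : ∀ d, A d ≤ inner ℝ (lift τ Bl d) d := by
    intro d
    have h1 := inner_lift_self_ge hB1 d
    have h2 : inner ℝ (lift τ (gram ι) d) d = ‖lift τ ι d‖ ^ 2 := by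
      rw [gram, compLpL_comp_apply, inner_compLpL, ContinuousLinearMap.adjoint_adjoint,
        real_inner_self_eq_norm_sq]
    have h3 : lift τ Bl d = lift τ B' d + Λ • lift τ (gram ι) d := by
      rw [hBl]
      simp only [lift, ContinuousLinearMap.add_compLpL, ContinuousLinearMap.smul_compLpL,
        add_apply, smul_apply]
    rw [h3, inner_add_left, real_inner_smul_left, h2]
    simp only [hA]
    linarith
  -- The energy inequality gives A(x - y) ≤ ⟨N a - N b, x - y⟩ ≤ (A(a - b) + A(x - y))/4, hence the
  -- factor 1/3. It is stated for arbitrary solutions x and y, so that it also yields uniqueness.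
  have hcontr : ∀ a b x y : L2T τ V, IsEvolution ι u₀ x (N a + fl - lift τ Bl x) →
      IsEvolution ι u₀ y (N b + fl - lift τ Bl y) → A (x - y) ≤ A (a - b) / 3 := by
    intro a b x y hx hy
    have h1 := (hx.sub hy)
    rw [sub_self] at h1
    have h2 := h1.inner_nonneg hτ hι
    have h3 : N a + fl - lift τ Bl x - (N b + fl - lift τ Bl y) =
        (N a - N b) - lift τ Bl (x - y) := by rw [map_sub]; abel
    rw [h3, inner_sub_left] at h2
    have h4 := abs_inner_expConj_sub_le hK hF hc hΛ hΛc l a b (x - y)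
    have h5 := hAB (x - y)
    change _ ≤ (A (a - b) + A (x - y)) / 4 at h4
    linarith
  choose Φ hΦ hΦ0 _ using fun v : L2T τ V =>
    exists_linear_evolution hτ hc hBl2 hι (N v + fl) u₀
  have hΦc : ∀ a b, A (Φ a - Φ b) ≤ A (a - b) / 3 := fun a b => hcontr a b _ _ (hΦ a) (hΦ b)
  have hcA : ∀ d, c * ‖d‖ ^ 2 ≤ A d := fun d => le_add_of_nonneg_left (by positivity)
  have hAcont : Continuous A := by fun_prop
  obtain ⟨v, hv⟩ : ∃ v, Φ v = v := by
    set x : ℕ → L2T τ V := fun n => Φ^[n] 0 with hx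
    have hxs : ∀ n, x (n + 1) = Φ (x n) := fun n => Function.iterate_succ_apply' Φ n 0
    -- A is quadratic, so the rate in norm is 1/√3; the rational number 3/5 is admissible because
    -- (3/5)² ≥ 1/3.
    have hAn : ∀ n, A (x n - x (n + 1)) ≤ A (x 0 - x 1) * ((3 / 5) ^ n) ^ 2 := by
      intro n
      induction n with
      | zero => simp
      | succ n ih =>
        have h1 := hΦc (x n) (x (n + 1))
        rw [← hxs, ← hxs] at h1
        rw [pow_succ (3 / 5 : ℝ) n, mul_pow]
        nlinarith [hA0 (x n - x (n + 1))]
    have hcau : CauchySeq x := by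
      refine cauchySeq_of_le_geometric (3 / 5) (Real.sqrt (A (x 0 - x 1) / c)) (by norm_num)
        fun n => ?_
      rw [dist_eq_norm]
      refine abs_le_of_sq_le_sq' ?_ (by positivity) |>.2
      rw [mul_pow, Real.sq_sqrt (div_nonneg (hA0 _) hc.le), div_mul_eq_mul_div, le_div_iff₀ hc]
      linarith [hcA (x n - x (n + 1)), hAn n]
    obtain ⟨v, hv⟩ := cauchySeq_tendsto_of_complete hcau
    refine ⟨v, ?_⟩
    have h1 : Tendsto (fun n => A (x n - v)) atTop (𝓝 0) := by
      have : Tendsto (fun n => A (x n - v)) atTop (𝓝 (A (v - v))) :=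
        (hAcont.tendsto _).comp (hv.sub_const v)
      simpa [hA] using this
    have h2 : Tendsto (fun n => A (x (n + 1) - Φ v)) atTop (𝓝 0) := by
      refine squeeze_zero (fun _ => hA0 _) (fun n => ?_) h1
      rw [hxs]
      linarith [hΦc (x n) v, hA0 (x n - v)]
    have h3 : Tendsto (fun n => A (x (n + 1) - Φ v)) atTop (𝓝 (A (v - Φ v))) :=
      (hAcont.tendsto _).comp (((tendsto_add_atTop_iff_nat 1).2 hv).sub_const _)
    have h4 := tendsto_nhds_unique h3 h2
    have h5 : ‖v - Φ v‖ ^ 2 ≤ 0 := by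
      have := hcA (v - Φ v)
      rw [h4] at this
      by_contra hcon
      nlinarith
    have h6 : ‖v - Φ v‖ = 0 := by nlinarith [norm_nonneg (v - Φ v)]
    exact (sub_eq_zero.1 (norm_eq_zero.1 h6)).symm
  have hBlx : ∀ x, Bl x = B x + l • gram ι x := fun x => by
    rw [hBl, hB', hl, add_apply, add_apply, smul_apply, smul_apply, add_smul, add_assoc]
  have hfl1 : fl =ᵐ[volume.restrict (Ioo 0 τ)] fun t => Real.exp (-l * t) • f t :=
    (memLp_exp_smul (-l) hf).coeFn_toLp
  have hN1 : ∀ z : L2T τ V, N z =ᵐ[volume.restrict (Ioo 0 τ)]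
      fun t => Real.exp (-l * t) • F (Real.exp (l * t) • z t) := fun z =>
    (memLp_exp_smul (-l)
      (memLp_comp_of_lipschitz hK (memLp_exp_smul l (Lp.memLp z)))).coeFn_toLp
  have hW : ∀ z : L2T τ V, (N z + fl - lift τ Bl z : L2T τ V) =ᵐ[volume.restrict (Ioo 0 τ)]
      fun t => Real.exp (-l * t) • F (Real.exp (l * t) • z t) + Real.exp (-l * t) • f t -
        (B (z t) + l • gram ι (z t)) := by
    intro z
    filter_upwards [Lp.coeFn_sub (N z + fl) (lift τ Bl z), Lp.coeFn_add (N z) fl, hfl1, hN1 z,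
      Bl.coeFn_compLpL (p := 2) z] with t h1 h2 h3 h4 h5
    rw [h1, Pi.sub_apply, h2, Pi.add_apply, h3, h4, h5, hBlx]
  have hEE : ∀ t, Real.exp (l * t) * Real.exp (-l * t) = 1 := fun t => by
    rw [← Real.exp_add]; simp
  have hev := hΦ v
  rw [hv] at hev
  refine ⟨fun t => Real.exp (l * t) • v t, ⟨memLp_exp_smul l (Lp.memLp v), ?_, ?_⟩, ?_⟩
  · refine ((hev.isWeakTimeDeriv hτ).exp_smul l ((gram ι).comp_memLp v)
      (Lp.memLp (N v + fl - lift τ Bl v))).congr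
      (Eventually.of_forall fun t => (map_smul (gram ι) _ _).symm) ?_
    filter_upwards [hW v] with t ht
    rw [ht, smul_sub, smul_add, smul_smul, hEE, one_smul, smul_smul, hEE, one_smul, smul_add,
      smul_comm (Real.exp (l * t)) l, map_smul, Function.comp_apply]
    abel
  · have := (hΦ0 v).exp_smul l
    rw [hv] at this
    simpa only [map_smul] using this
  -- Any other solution, multiplied by e^{-lt}, is again a fixed point z, and `hcontr` then gives
  -- A(z - v) ≤ A(z - v)/3.
  · rintro u ⟨hu, hud, hui⟩
    set z : L2T τ V := (memLp_exp_smul (-l) hu).toLp with hz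
    have hz1 : z =ᵐ[volume.restrict (Ioo 0 τ)] fun t => Real.exp (-l * t) • u t :=
      (memLp_exp_smul (-l) hu).coeFn_toLp
    have hze : IsEvolution ι u₀ z (N z + fl - lift τ Bl z) := by
      refine isEvolution_of_isWeakTimeDeriv hτ ?_ ?_
      · refine (hud.exp_smul (-l) ((gram ι).comp_memLp' hu)
          (((memLp_comp_of_lipschitz hK hu).add hf).sub (B.comp_memLp' hu))).congr ?_ ?_
        · filter_upwards [hz1] with t ht
          rw [ht, map_smul, Function.comp_apply]
        · filter_upwards [hz1, hW z] with t h1 h2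
          rw [h2, h1, smul_smul (Real.exp (l * t)), hEE, one_smul, map_smul, map_smul, neg_smul,
            Pi.sub_apply, Pi.add_apply, Function.comp_apply, Function.comp_apply, smul_sub,
            smul_add]
          abel
      · refine (hui.exp_smul (-l)).congr ?_
        filter_upwards [hz1] with t ht
        rw [ht, map_smul]
    have h1 := hcontr z v z v hze hev
    have h2 : A (z - v) = 0 := by linarith [hA0 (z - v)]
    have h3 : ‖z - v‖ ^ 2 ≤ 0 := by
      have := hcA (z - v)
      rw [h2] at this
      by_contra hcon
      nlinarith
    have h4 : ‖z - v‖ = 0 := by nlinarith [norm_nonneg (z - v)]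
    have h5 : z = v := sub_eq_zero.1 (norm_eq_zero.1 h4)
    rw [h5] at hz1
    filter_upwards [hz1] with t ht
    rw [ht, smul_smul, hEE, one_smul]

end NonlinearEvolution

/-! ### The measure r dr dz. -/

section WeightedMeasure

variable {D : Set Plane}

theorem isOpen_halfPlane : IsOpen {x : Plane | 0 < x 0} :=
  isOpen_lt continuous_const (by fun_prop)

theorem ae_rMeasure_iff (hDm : MeasurableSet D) (hD : D ⊆ {x | 0 < x 0}) {p : Plane → Prop} :
    (∀ᵐ x ∂(rMeasure D), p x) ↔ ∀ᵐ x ∂(volume.restrict D), p x := by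
  rw [rMeasure, ae_withDensity_iff (by fun_prop)]
  constructor
  · intro h
    filter_upwards [h, ae_restrict_mem hDm] with x hx hxD
    exact hx (by simpa using hD hxD)
  · intro h
    filter_upwards [h] with x hx _ using hx

theorem lintegral_rMeasure (f : Plane → ENNReal) :
    ∫⁻ x, f x ∂(rMeasure D) = ∫⁻ x in D, ENNReal.ofReal (x 0) * f x := by
  rw [rMeasure, lintegral_withDensity_eq_lintegral_mul_non_measurable _ (by fun_prop)
    (Eventually.of_forall fun x => ENNReal.ofReal_lt_top)]
  rfl

theorem integral_rMeasure {F : Type*} [NormedAddCommGroup F] [NormedSpace ℝ F]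
    (hDm : MeasurableSet D) (hD : D ⊆ {x | 0 < x 0}) (f : Plane → F) :
    ∫ x, f x ∂(rMeasure D) = ∫ x in D, x 0 • f x := by
  rw [rMeasure, integral_withDensity_eq_integral_toReal_smul (by fun_prop)
    (Eventually.of_forall fun x => ENNReal.ofReal_lt_top)]
  refine setIntegral_congr_fun hDm fun x hx => ?_
  simp only [ENNReal.toReal_ofReal (hD hx).le]

theorem isFiniteMeasure_rMeasure (hb : Bornology.IsBounded D) : IsFiniteMeasure (rMeasure D) := by
  refine ⟨?_⟩
  obtain ⟨M, hM⟩ := (hb.isCompact_closure.image (f := fun x : Plane => x 0) (by fun_prop)).bddAbove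
  rw [← lintegral_one, lintegral_rMeasure]
  calc ∫⁻ x in D, ENNReal.ofReal (x 0) * 1 ≤ ∫⁻ x in closure D, ENNReal.ofReal (x 0) * 1 :=
        lintegral_mono_set subset_closure
    _ ≤ ∫⁻ x in closure D, ENNReal.ofReal M :=
        setLIntegral_mono measurable_const fun x hx => by
          rw [mul_one]; exact ENNReal.ofReal_le_ofReal (hM ⟨x, hx, rfl⟩)
    _ < ⊤ := by
        rw [setLIntegral_const]
        exact ENNReal.mul_lt_top ENNReal.ofReal_lt_top hb.isCompact_closure.measure_lt_top

theorem rMeasure_mono {D' : Set Plane} (h : D ⊆ D') : rMeasure D ≤ rMeasure D' :=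
  Measure.le_iff.2 fun s hs => by
    rw [rMeasure, rMeasure, withDensity_apply _ hs, withDensity_apply _ hs]
    exact lintegral_mono' (Measure.restrict_mono le_rfl (Measure.restrict_mono h le_rfl)) le_rfl

theorem memLp_rMeasure_of_continuous {F : Type*} [NormedAddCommGroup F]
    (hb : Bornology.IsBounded D) {φ : Plane → F} (hφ : Continuous φ) :
    MemLp φ 2 (rMeasure D) := by
  have := isFiniteMeasure_rMeasure hb
  obtain ⟨C, hC⟩ := hb.isCompact_closure.exists_bound_of_continuousOn hφ.continuousOn
  refine MemLp.of_bound hφ.aestronglyMeasurable C ?_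
  have h1 : ∀ᵐ x ∂(rMeasure (closure D)), x ∈ closure D := by
    rw [rMeasure, ae_withDensity_iff (by fun_prop)]
    filter_upwards [ae_restrict_mem isClosed_closure.measurableSet] with x hx _ using hx
  filter_upwards [ae_mono (rMeasure_mono subset_closure) h1] with x hx using hC x hx

end WeightedMeasure

/-! ### Weak derivatives, completeness of the weighted spaces, density of test functions in L²₁. -/

section WeakPartial

variable {D : Set Plane} {𝕜 : Type*} [RCLike 𝕜]

theorem continuous_div_coord {ψ : Plane → ℝ} (hc : Continuous ψ)
    (hs : tsupport ψ ⊆ D ∩ {x | 0 < x 0}) : Continuous fun x => ψ x / x 0 := by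
  have hx0 : Continuous fun x : Plane => x 0 := by fun_prop
  rw [continuous_iff_continuousAt]
  intro x
  by_cases hx : x ∈ tsupport ψ
  · exact hc.continuousAt.div hx0.continuousAt (ne_of_gt (hs hx).2)
  · have : (fun x => ψ x / x 0) =ᶠ[𝓝 x] fun _ => 0 := by
      filter_upwards [notMem_tsupport_iff_eventuallyEq.1 hx] with y hy
      simp [hy]
    exact (continuousAt_const (y := (0 : ℝ))).congr this.symm

/-- Integration against a continuous function with compact support in `D ∩ {r > 0}` is an inner
product in `L²₁(D)`. -/
theorem exists_inner_eq_integral_smul (hDm : MeasurableSet D) (hD : D ⊆ {x | 0 < x 0})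
    (hb : Bornology.IsBounded D) {ψ : Plane → ℝ} (hc : Continuous ψ)
    (hs : tsupport ψ ⊆ D ∩ {x | 0 < x 0}) :
    ∃ g : Lp 𝕜 2 (rMeasure D), ∀ u : Lp 𝕜 2 (rMeasure D), ∫ x in D, ψ x • u x = inner 𝕜 g u := by
  have hcd := continuous_div_coord hc hs
  have hm : MemLp (fun x => ((ψ x / x 0 : ℝ) : 𝕜)) 2 (rMeasure D) :=
    memLp_rMeasure_of_continuous hb (RCLike.continuous_ofReal.comp hcd)
  set g : Lp 𝕜 2 (rMeasure D) := hm.toLp with hg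
  refine ⟨g, fun u => ?_⟩
  rw [L2.inner_def]
  have h1 : ∫ x, inner 𝕜 (g x) (u x) ∂(rMeasure D) =
      ∫ x, (ψ x / x 0) • u x ∂(rMeasure D) := by
    refine integral_congr_ae ?_
    filter_upwards [hm.coeFn_toLp] with x hx
    rw [hx, RCLike.inner_apply, RCLike.conj_ofReal, RCLike.real_smul_eq_coe_mul, mul_comm]
  rw [h1, integral_rMeasure hDm hD]
  refine setIntegral_congr_fun hDm fun x hx => ?_
  have : x 0 ≠ 0 := (hD hx).ne'
  simp only [smul_smul]
  rw [mul_div_cancel₀ _ this]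

theorem Lp.locallyIntegrableOn (hDo : IsOpen D) (hD : D ⊆ {x | 0 < x 0})
    (u : Lp 𝕜 2 (rMeasure D)) : LocallyIntegrableOn u D volume := by
  rw [locallyIntegrableOn_iff hDo.isLocallyClosed]
  intro K hKD hK
  obtain ⟨ψ, h1, h2, h3, -⟩ := exists_continuousMap_one_of_isCompact_subset_isOpen hK hDo hKD
  have h4 := integrable_smul_of_support (D := D) ψ.continuous h2
    (h3.trans fun x hx => ⟨hx, hD hx⟩) u
  have h5 : IntegrableOn (fun x => ψ x • u x) K := IntegrableOn.mono_set h4 hKD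
  refine h5.congr_fun (fun x hx => ?_) hK.measurableSet
  simp [h1 hx]

theorem ae_eq_zero_of_test_integral {F : Type*} [NormedAddCommGroup F] [NormedSpace ℝ F]
    [CompleteSpace F] (hDo : IsOpen D)
    (hD : D ⊆ {x | 0 < x 0}) {u : Plane → F} (hu : LocallyIntegrableOn u D volume)
    (h : ∀ φ : Plane → ℝ, IsTest D φ → ∫ x in D, φ x • u x = 0) :
    u =ᵐ[volume.restrict D] 0 := by
  have key := hDo.ae_eq_zero_of_integral_contDiff_smul_eq_zero hu fun ψ h1 h2 h3 => by
    rw [← h ψ ⟨h1, h2, fun x hx => ⟨h3 hx, hD (h3 hx)⟩⟩]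
    refine (setIntegral_eq_integral_of_forall_compl_eq_zero fun t ht => ?_).symm
    rw [image_eq_zero_of_notMem_tsupport fun h => ht (h3 h), zero_smul]
  rw [EventuallyEq, ae_restrict_iff' hDo.measurableSet]
  exact key

theorem integrable_test_smul {F : Type*} [NormedAddCommGroup F] [NormedSpace ℝ F]
    {u : Plane → F} (hu : LocallyIntegrableOn u D volume) {ψ : Plane → ℝ} (hc : Continuous ψ)
    (hK : HasCompactSupport ψ) (hs : tsupport ψ ⊆ D) :
    Integrable (fun x => ψ x • u x) (volume.restrict D) := by
  obtain ⟨C, hC⟩ := hK.exists_bound_of_continuous hc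
  have h1 : IntegrableOn u (tsupport ψ) := hu.integrableOn_compact_subset hs hK
  have h2 : IntegrableOn (fun x => ψ x • u x) (tsupport ψ) :=
    Integrable.bdd_smul (hf := h1) C hc.aestronglyMeasurable (Eventually.of_forall hC)
  have h3 : Integrable (fun x => ψ x • u x) volume := by
    rwa [integrableOn_iff_integrable_of_support_subset] at h2
    intro x hx
    by_contra h
    exact hx (by simp [image_eq_zero_of_notMem_tsupport h])
  exact h3.restrict

theorem IsWeakPartial.unique {F : Type*} [NormedAddCommGroup F] [NormedSpace ℝ F]
    [CompleteSpace F] (hDo : IsOpen D) (hD : D ⊆ {x | 0 < x 0}) {i : Fin 2} {u u' v v' : Plane → F}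
    (h : IsWeakPartial D i u v) (h' : IsWeakPartial D i u' v')
    (huu : u =ᵐ[volume.restrict D] u') (hv : LocallyIntegrableOn v D volume)
    (hv' : LocallyIntegrableOn v' D volume) : v =ᵐ[volume.restrict D] v' := by
  have := ae_eq_zero_of_test_integral hDo hD (hv.sub hv') fun φ hφ => by
    have hsD : tsupport φ ⊆ D := hφ.2.2.trans inter_subset_left
    simp only [Pi.sub_apply, smul_sub]
    rw [integral_sub (integrable_test_smul hv hφ.1.continuous hφ.2.1 hsD)
      (integrable_test_smul hv' hφ.1.continuous hφ.2.1 hsD), sub_eq_zero]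
    refine neg_injective ((h φ hφ).symm.trans (Eq.trans (integral_congr_ae ?_) (h' φ hφ)))
    filter_upwards [huu] with x hx
    rw [hx]
  filter_upwards [this] with x hx using sub_eq_zero.1 hx

theorem isWeakPartial_of_contDiff {F : Type*} [NormedAddCommGroup F] [NormedSpace ℝ F]
    {φ : Plane → F} (hφ : ContDiff ℝ ∞ φ) (i : Fin 2) :
    IsWeakPartial D i φ fun x => fderiv ℝ φ x (EuclideanSpace.single i 1) := by
  intro ψ hψ
  have hd : Continuous fun x => fderiv ℝ φ x (EuclideanSpace.single i 1) :=
    (hφ.continuous_fderiv (by simp)).clm_apply continuous_const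
  obtain ⟨p1, p2, p3⟩ := hψ.partial i
  have e1 : ∫ x in D, fderiv ℝ ψ x (EuclideanSpace.single i 1) • φ x =
      ∫ x, fderiv ℝ ψ x (EuclideanSpace.single i 1) • φ x :=
    setIntegral_eq_integral_of_forall_compl_eq_zero fun x hx => by
      rw [image_eq_zero_of_notMem_tsupport
        (f := fun x => fderiv ℝ ψ x (EuclideanSpace.single i 1)) fun h => hx (p3 h).1, zero_smul]
  have e2 : ∫ x in D, ψ x • fderiv ℝ φ x (EuclideanSpace.single i 1) =
      ∫ x, ψ x • fderiv ℝ φ x (EuclideanSpace.single i 1) :=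
    setIntegral_eq_integral_of_forall_compl_eq_zero fun x hx => by
      rw [image_eq_zero_of_notMem_tsupport fun h => hx (hψ.2.2 h).1, zero_smul]
  rw [e1, e2, integral_smul_fderiv_eq_neg_fderiv_smul_of_integrable, neg_neg]
  · exact (p1.smul hφ.continuous).integrable_of_hasCompactSupport p2.smul_right
  · exact (hψ.1.continuous.smul hd).integrable_of_hasCompactSupport hψ.2.1.smul_right
  · exact (hψ.1.continuous.smul hφ.continuous).integrable_of_hasCompactSupport hψ.2.1.smul_right
  · exact fun x _ => hψ.1.differentiable (by simp) x
  · exact fun x _ => hφ.differentiable (by simp) x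

/-- For each test function the defining identity equates two inner products with fixed elements of
L²₁(D): test functions stay away from the axis, so division by r does no harm. -/
theorem isClosed_isWeakPartial (hDm : MeasurableSet D) (hD : D ⊆ {x | 0 < x 0})
    (hb : Bornology.IsBounded D) (i : Fin 2) :
    IsClosed {p : Lp 𝕜 2 (rMeasure D) × Lp 𝕜 2 (rMeasure D) | IsWeakPartial D i p.1 p.2} := by
  have : {p : Lp 𝕜 2 (rMeasure D) × Lp 𝕜 2 (rMeasure D) | IsWeakPartial D i p.1 p.2} =
      ⋂ φ : Plane → ℝ, ⋂ _ : IsTest D φ, {p |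
        ∫ x in D, (fderiv ℝ φ x (EuclideanSpace.single i 1)) • p.1 x = -∫ x in D, φ x • p.2 x} := by
    ext p
    simp [IsWeakPartial]
  rw [this]
  refine isClosed_iInter fun φ => isClosed_iInter fun hφ => ?_
  obtain ⟨g1, hg1⟩ := exists_inner_eq_integral_smul (𝕜 := 𝕜) hDm hD hb (hφ.partial i).1
    (hφ.partial i).2.2
  obtain ⟨g2, hg2⟩ := exists_inner_eq_integral_smul (𝕜 := 𝕜) hDm hD hb hφ.1.continuous hφ.2.2
  simp only [hg1, hg2]
  exact isClosed_eq (by fun_prop) (by fun_prop)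

theorem isClosed_H1 (hDm : MeasurableSet D) (hD : D ⊆ {x | 0 < x 0})
    (hb : Bornology.IsBounded D) : IsClosed (H1 D : Set (PiLp 2 fun _ : Fin 3 => Lp ℝ 2 (rMeasure D))) := by
  have h1 := (isClosed_isWeakPartial (𝕜 := ℝ) hDm hD hb 0).preimage
    (f := fun U : PiLp 2 fun _ : Fin 3 => Lp ℝ 2 (rMeasure D) => (U 0, U 1)) (by fun_prop)
  have h2 := (isClosed_isWeakPartial (𝕜 := ℝ) hDm hD hb 1).preimage
    (f := fun U : PiLp 2 fun _ : Fin 3 => Lp ℝ 2 (rMeasure D) => (U 0, U 2)) (by fun_prop)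
  exact h1.inter h2

theorem completeSpace_H1 (hDm : MeasurableSet D) (hD : D ⊆ {x | 0 < x 0})
    (hb : Bornology.IsBounded D) : CompleteSpace (H1 D) :=
  (isClosed_H1 hDm hD hb).completeSpace_coe

theorem isClosed_HTilde (hDm : MeasurableSet D) (hD : D ⊆ {x | 0 < x 0})
    (hb : Bornology.IsBounded D) :
    IsClosed (HTilde D : Set (PiLp 2 fun _ : Fin 4 => Lp ℂ 2 (rMeasure D))) := by
  have h1 := (isClosed_isWeakPartial (𝕜 := ℂ) hDm hD hb 0).preimage
    (f := fun U : PiLp 2 fun _ : Fin 4 => Lp ℂ 2 (rMeasure D) => (U 0, U 1)) (by fun_prop)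
  have h2 := (isClosed_isWeakPartial (𝕜 := ℂ) hDm hD hb 1).preimage
    (f := fun U : PiLp 2 fun _ : Fin 4 => Lp ℂ 2 (rMeasure D) => (U 0, U 2)) (by fun_prop)
  have h3 : IsClosed {U : PiLp 2 fun _ : Fin 4 => Lp ℂ 2 (rMeasure D) |
      ∀ᵐ x ∂(rMeasure D), U 3 x = U 0 x / (x 0 : ℂ)} := by
    refine IsSeqClosed.isClosed fun U V hU hV => ?_
    have c0 : Tendsto (fun n => U n 0) atTop (𝓝 (V 0)) :=
      ((by fun_prop : Continuous fun W : PiLp 2 fun _ : Fin 4 => Lp ℂ 2 (rMeasure D) =>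
        W 0).tendsto V).comp hV
    have c3 : Tendsto (fun n => U n 3) atTop (𝓝 (V 3)) :=
      ((by fun_prop : Continuous fun W : PiLp 2 fun _ : Fin 4 => Lp ℂ 2 (rMeasure D) =>
        W 3).tendsto V).comp hV
    -- The second subsequence is extracted from the first, so that both components converge almost
    -- everywhere along the same indices.
    obtain ⟨n1, hn1, ha1⟩ := exists_subseq_ae_tendsto c0
    obtain ⟨n2, hn2, ha2⟩ := exists_subseq_ae_tendsto (c3.comp hn1.tendsto_atTop)
    filter_upwards [ha1, ha2, ae_all_iff.2 hU] with x e1 e2 e3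
    refine tendsto_nhds_unique e2 ?_
    refine ((e1.comp hn2.tendsto_atTop).div_const (x 0 : ℂ)).congr fun n => ?_
    exact (e3 _).symm
  have h4 := h1.inter (h2.inter h3)
  exact h4

theorem completeSpace_HTilde (hDm : MeasurableSet D) (hD : D ⊆ {x | 0 < x 0})
    (hb : Bornology.IsBounded D) : CompleteSpace (HTilde D) :=
  (isClosed_HTilde hDm hD hb).completeSpace_coe

/-- The element of `H¹₁(D)` given by a smooth function. -/
def H1.ofSmooth (hb : Bornology.IsBounded D) (φ : Plane → ℝ) (hφ : ContDiff ℝ ∞ φ) : H1 D :=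
  have hd : ∀ i : Fin 2, Continuous fun x => fderiv ℝ φ x (EuclideanSpace.single i 1) := fun _ =>
    (hφ.continuous_fderiv (by simp)).clm_apply continuous_const
  ⟨WithLp.toLp 2 ![(memLp_rMeasure_of_continuous hb hφ.continuous).toLp,
      (memLp_rMeasure_of_continuous hb (hd 0)).toLp,
      (memLp_rMeasure_of_continuous hb (hd 1)).toLp], by
    have key : ∀ i : Fin 2, IsWeakPartial D i
        ((memLp_rMeasure_of_continuous hb hφ.continuous).toLp : Lp ℝ 2 (rMeasure D))
        ((memLp_rMeasure_of_continuous hb (hd i)).toLp : Lp ℝ 2 (rMeasure D)) := by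
      intro i ψ hψ
      rw [integral_congr_ae (smul_congr_of_support (hψ.partial i).2.2
        (memLp_rMeasure_of_continuous hb hφ.continuous).coeFn_toLp),
        integral_congr_ae (smul_congr_of_support hψ.2.2
          (memLp_rMeasure_of_continuous hb (hd i)).coeFn_toLp)]
      exact isWeakPartial_of_contDiff hφ i ψ hψ
    exact ⟨key 0, key 1⟩⟩

theorem H1.ofSmooth_zero (hb : Bornology.IsBounded D) {φ : Plane → ℝ} (hφ : ContDiff ℝ ∞ φ) :
    (H1.ofSmooth hb φ hφ).1 0 =ᵐ[rMeasure D] φ :=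
  (memLp_rMeasure_of_continuous hb hφ.continuous).coeFn_toLp

theorem H1.ae_eq_partial (hDo : IsOpen D) (hD : D ⊆ {x | 0 < x 0}) {U : H1 D} {φ : Plane → ℝ}
    (hφ : ContDiff ℝ ∞ φ) (h : U.1 0 =ᵐ[rMeasure D] φ) :
    (U.1 1 =ᵐ[rMeasure D] fun x => fderiv ℝ φ x (EuclideanSpace.single 0 1)) ∧
      U.1 2 =ᵐ[rMeasure D] fun x => fderiv ℝ φ x (EuclideanSpace.single 1 1) := by
  have hd : ∀ i : Fin 2, Continuous fun x => fderiv ℝ φ x (EuclideanSpace.single i 1) := fun _ =>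
    (hφ.continuous_fderiv (by simp)).clm_apply continuous_const
  have h' := (ae_rMeasure_iff hDo.measurableSet hD).1 h
  exact ⟨(ae_rMeasure_iff hDo.measurableSet hD).2 (IsWeakPartial.unique hDo hD U.2.1
      (isWeakPartial_of_contDiff hφ 0) h' (Lp.locallyIntegrableOn hDo hD _)
      ((hd 0).locallyIntegrable.locallyIntegrableOn D)),
    (ae_rMeasure_iff hDo.measurableSet hD).2 (IsWeakPartial.unique hDo hD U.2.2
      (isWeakPartial_of_contDiff hφ 1) h' (Lp.locallyIntegrableOn hDo hD _)
      ((hd 1).locallyIntegrable.locallyIntegrableOn D))⟩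

theorem HTilde.ae_eq_partial (hDo : IsOpen D) (hD : D ⊆ {x | 0 < x 0}) {U : HTilde D}
    {φ : Plane → ℂ} (hφ : ContDiff ℝ ∞ φ) (h : U.1 0 =ᵐ[rMeasure D] φ) :
    (U.1 1 =ᵐ[rMeasure D] fun x => fderiv ℝ φ x (EuclideanSpace.single 0 1)) ∧
      U.1 2 =ᵐ[rMeasure D] fun x => fderiv ℝ φ x (EuclideanSpace.single 1 1) := by
  have hd : ∀ i : Fin 2, Continuous fun x => fderiv ℝ φ x (EuclideanSpace.single i 1) := fun _ =>
    (hφ.continuous_fderiv (by simp)).clm_apply continuous_const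
  have h' := (ae_rMeasure_iff hDo.measurableSet hD).1 h
  exact ⟨(ae_rMeasure_iff hDo.measurableSet hD).2 (IsWeakPartial.unique hDo hD U.2.1
      (isWeakPartial_of_contDiff hφ 0) h' (Lp.locallyIntegrableOn hDo hD _)
      ((hd 0).locallyIntegrable.locallyIntegrableOn D)),
    (ae_rMeasure_iff hDo.measurableSet hD).2 (IsWeakPartial.unique hDo hD U.2.2.1
      (isWeakPartial_of_contDiff hφ 1) h' (Lp.locallyIntegrableOn hDo hD _)
      ((hd 1).locallyIntegrable.locallyIntegrableOn D))⟩

/-- The inner product carries the weight r, so the fundamental lemma applies to r u, and r is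
nonzero on D. -/
theorem eq_zero_of_inner_test {u : Lp ℝ 2 (rMeasure D)} (hDo : IsOpen D) (hD : D ⊆ {x | 0 < x 0})
    (hb : Bornology.IsBounded D)
    (h : ∀ (φ : Plane → ℝ) (hφ : IsTest D φ),
      inner ℝ (memLp_rMeasure_of_continuous hb hφ.1.continuous).toLp u = 0) : u = 0 := by
  have hx0 : Continuous fun x : Plane => x 0 := by fun_prop
  have hloc : LocallyIntegrableOn (fun x => x 0 • u x) D volume :=
    (Lp.locallyIntegrableOn hDo hD u).continuousOn_smul hDo.isLocallyClosed hx0.continuousOn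
  have key := ae_eq_zero_of_test_integral hDo hD hloc fun φ hφ => by
    rw [← h φ hφ, L2.inner_def]
    have : ∫ x, inner ℝ (((memLp_rMeasure_of_continuous hb hφ.1.continuous).toLp : Lp ℝ 2 _) x) (u x)
        ∂(rMeasure D) = ∫ x, φ x • u x ∂(rMeasure D) := by
      refine integral_congr_ae ?_
      filter_upwards [(memLp_rMeasure_of_continuous hb hφ.1.continuous).coeFn_toLp] with x hx
      rw [hx]
      simp [mul_comm]
    rw [this, integral_rMeasure hDo.measurableSet hD]
    exact integral_congr_ae (Eventually.of_forall fun x => smul_comm _ _ _)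
  refine (Lp.eq_zero_iff_ae_eq_zero).2 ((ae_rMeasure_iff hDo.measurableSet hD).2 ?_)
  filter_upwards [key, ae_restrict_mem hDo.measurableSet] with x hx hxD
  rcases smul_eq_zero.1 hx with h0 | h0
  · exact absurd h0 (hD hxD).ne'
  · exact h0

/-- The test functions are dense in `L²₁(D)`. -/
theorem dense_test (hDo : IsOpen D) (hD : D ⊆ {x | 0 < x 0}) (hb : Bornology.IsBounded D) :
    Dense {u : Lp ℝ 2 (rMeasure D) | ∃ φ, IsTest D φ ∧ u =ᵐ[rMeasure D] φ} := by
  let S : Submodule ℝ (Lp ℝ 2 (rMeasure D)) :=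
    { carrier := {u | ∃ φ, IsTest D φ ∧ u =ᵐ[rMeasure D] φ}
      zero_mem' := ⟨0, ⟨contDiff_const, HasCompactSupport.zero, by simp [tsupport]⟩,
        Lp.coeFn_zero _ _ _⟩
      add_mem' := by
        rintro u v ⟨φ, hφ, h1⟩ ⟨ψ, hψ, h2⟩
        exact ⟨φ + ψ, ⟨hφ.1.add hψ.1, hφ.2.1.add hψ.2.1,
          (tsupport_add φ ψ).trans (union_subset hφ.2.2 hψ.2.2)⟩,
          (Lp.coeFn_add u v).trans (h1.add h2)⟩
      smul_mem' := by
        rintro c u ⟨φ, hφ, h1⟩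
        exact ⟨c • φ, ⟨hφ.1.const_smul c, hφ.2.1.smul_left,
          (closure_mono (Function.support_const_smul_subset c φ)).trans hφ.2.2⟩,
          (Lp.coeFn_smul c u).trans (h1.const_smul c)⟩ }
  have key : Sᗮ = ⊥ := by
    rw [eq_bot_iff]
    intro u hu
    rw [Submodule.mem_orthogonal] at hu
    rw [Submodule.mem_bot]
    exact eq_zero_of_inner_test hDo hD hb fun φ hφ => hu _ ⟨φ, hφ, MemLp.coeFn_toLp _⟩
  exact (Submodule.dense_iff_topologicalClosure_eq_top).2
    ((Submodule.topologicalClosure_eq_top_iff).2 key)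

theorem H1.denseRange_toL2 (hDo : IsOpen D) (hD : D ⊆ {x | 0 < x 0})
    (hb : Bornology.IsBounded D) : DenseRange (H1.toL2 D) := by
  refine (dense_test hDo hD hb).mono ?_
  rintro u ⟨φ, hφ, h⟩
  exact ⟨H1.ofSmooth hb φ hφ.1, Lp.ext ((H1.ofSmooth_zero hb hφ.1).trans h.symm)⟩

theorem H1.norm_sq (U : H1 D) : ‖U‖ ^ 2 = ‖U.1 0‖ ^ 2 + ‖U.1 1‖ ^ 2 + ‖U.1 2‖ ^ 2 := by
  rw [Submodule.coe_norm, PiLp.norm_sq_eq_of_L2, Fin.sum_univ_three]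

theorem HTilde.norm_sq (U : HTilde D) :
    ‖U‖ ^ 2 = ‖U.1 0‖ ^ 2 + ‖U.1 1‖ ^ 2 + ‖U.1 2‖ ^ 2 + ‖U.1 3‖ ^ 2 := by
  rw [Submodule.coe_norm, PiLp.norm_sq_eq_of_L2, Fin.sum_univ_four]

end WeakPartial

/-! ### Lipschitz charts adapted to the distance from the axis. -/

section Chart

theorem abs_coord_le_norm (y : Plane) (i : Fin 2) : |y i| ≤ ‖y‖ := PiLp.norm_apply_le y i

theorem norm_frame_smul_add_le (b : OrthonormalBasis (Fin 2) ℝ Plane) (s t : ℝ) :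
    ‖s • b 0 + t • b 1‖ ≤ |s| + |t| := by
  refine (norm_add_le _ _).trans ?_
  simp [norm_smul]

/-- `b`, `γ`, `δ` describe the set `D` near the point `x` as one side of a Lipschitz graph, and
the distance to the axis essentially increases in a cone around the direction `b 1`. -/
structure IsChart (D : Set Plane) (x : Plane) (b : OrthonormalBasis (Fin 2) ℝ Plane) (γ : ℝ → ℝ)
    (K : ℝ≥0) (δ c : ℝ) : Prop where
  lipschitz : LipschitzWith K γ
  pos : 0 < δ
  cone_pos : 0 < c
  cone_le : c ≤ 1 / 2
  cone_mul_le : (K + 1) * c ≤ 1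
  mem_iff : ∀ s t : ℝ, |s| < δ → |t| < δ → (x + s • b 0 + t • b 1 ∈ D ↔ γ s < t)
  radius_le : ∀ (y y' : Plane) (ε : ℝ), ‖y - x‖ < 2 * δ → ‖y' - x‖ < 2 * δ → 0 ≤ ε → 0 ≤ y 0 →
    ‖y' - y - ε • b 1‖ ≤ c * ε → y 0 + c * ε ≤ 5 * y' 0

/-- With x₀ the distance from x to the axis, 2δ ≤ x₀/2 gives y₀ ≤ 3x₀/2 and y'₀ ≥ x₀/2. Moreover ε ≤
4δ + cε ≤ 4δ + ε/2, so cε ≤ 4δ ≤ x₀. The sum y₀ + cε is at most 5x₀/2, which is the origin of the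
constant 5. -/
theorem radius_le_of_pos {x : Plane} {δ c : ℝ} (hδ : 4 * δ ≤ x 0) (hc : 0 < c) (hc2 : c ≤ 1 / 2)
    (e : Plane) (he : ‖e‖ = 1)
    (y y' : Plane) (ε : ℝ) (h1 : ‖y - x‖ < 2 * δ) (h2 : ‖y' - x‖ < 2 * δ) (h3 : 0 ≤ ε)
    (h4 : ‖y' - y - ε • e‖ ≤ c * ε) : y 0 + c * ε ≤ 5 * y' 0 := by
  have a1 := (abs_le.1 ((abs_coord_le_norm (y - x) 0).trans h1.le)).2
  have a2 := (abs_le.1 ((abs_coord_le_norm (y' - x) 0).trans h2.le)).1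
  simp only [PiLp.sub_apply] at a1 a2
  have a3 : ε ≤ ‖y' - x‖ + ‖y - x‖ + c * ε := by
    have : ε • e = (y' - x) - (y - x) - (y' - y - ε • e) := by abel
    calc ε = ‖ε • e‖ := by rw [norm_smul, he, Real.norm_of_nonneg h3, mul_one]
      _ = ‖(y' - x) - (y - x) - (y' - y - ε • e)‖ := congrArg norm this
      _ ≤ ‖(y' - x) - (y - x)‖ + ‖y' - y - ε • e‖ := norm_sub_le _ _
      _ ≤ _ := add_le_add (norm_sub_le _ _) h4
  nlinarith

theorem exists_chart_of_mem {D : Set Plane} (hDo : IsOpen D) (hD : D ⊆ {x | 0 < x 0}) {x : Plane}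
    (hx : x ∈ D) : ∃ b γ K δ c, IsChart D x b γ K δ c := by
  obtain ⟨ρ, hρ, hball⟩ := Metric.isOpen_iff.1 hDo x hx
  have hx0 : 0 < x 0 := hD hx
  set δ := min (ρ / 2) (x 0 / 4) with hδ
  have hδ0 : 0 < δ := lt_min (by positivity) (by positivity)
  have hδ1 : δ ≤ ρ / 2 := min_le_left _ _
  have hδ2 : δ ≤ x 0 / 4 := min_le_right _ _
  -- At an interior point the graph is placed below the chart, so that every point with |t| < δ lies
  -- above it.
  refine ⟨EuclideanSpace.basisFun (Fin 2) ℝ, fun _ => -2 * δ, 0, δ, 1 / 2, LipschitzWith.const _,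
    hδ0, by norm_num, le_rfl, by norm_num, ?_, ?_⟩
  · intro s t hs ht
    refine ⟨fun _ => by linarith [(abs_lt.1 ht).1], fun _ => hball ?_⟩
    rw [Metric.mem_ball, dist_eq_norm, add_assoc, add_sub_cancel_left]
    exact (norm_frame_smul_add_le _ s t).trans_lt (by linarith)
  · intro y y' ε h1 h2 h3 _ h4
    exact radius_le_of_pos (by linarith) (by norm_num) le_rfl _ (OrthonormalBasis.norm_eq_one _ _)
      y y' ε h1 h2 h3 h4

theorem exists_chart_of_frontier {D : Set Plane} (hp : IsPolygon D) (hD : D ⊆ {x | 0 < x 0})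
    {x : Plane} (hx : x ∈ frontier D) : ∃ b γ K δ c, IsChart D x b γ K δ c := by
  obtain ⟨b, γ, K, δ, hγ, hδ, hiff⟩ := hp.lipschitz x hx
  have hx0 : 0 ≤ x 0 := by
    have : closure D ⊆ {y : Plane | 0 ≤ y 0} :=
      closure_minimal (fun y hy => le_of_lt (show 0 < y 0 from hD hy)) (isClosed_le continuous_const (by fun_prop))
    exact this (frontier_subset_closure hx)
  rcases hx0.lt_or_eq with h0 | h0
  · set δ' := min δ (x 0 / 4)
    have hδ1 : δ' ≤ δ := min_le_left _ _
    have hδ2 : δ' ≤ x 0 / 4 := min_le_right _ _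
    set c : ℝ := min (1 / 2) (1 / (K + 1)) with hc
    have hc0 : 0 < c := lt_min (by norm_num) (by positivity)
    refine ⟨b, γ, K, δ', c, hγ, lt_min hδ (by positivity), hc0, min_le_left _ _, ?_,
      fun s t hs ht => hiff s t (hs.trans_le hδ1) (ht.trans_le hδ1), ?_⟩
    · calc (K + 1 : ℝ) * c ≤ (K + 1) * (1 / (K + 1)) := by gcongr; exact min_le_right _ _
        _ = 1 := by field_simp
    · intro y y' ε h1 h2 h3 _ h4
      exact radius_le_of_pos (by linarith) hc0 (min_le_left _ _) _
        (OrthonormalBasis.norm_eq_one _ _) y y' ε h1 h2 h3 h4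
  -- x lies on the axis. It cannot lie strictly below the graph, since by continuity nearby points
  -- of D would then lie below it too.
  · have hγ0 : γ 0 ≤ 0 := by
      by_contra! hneg
      have hcont : Continuous fun y : Plane =>
          γ (inner ℝ (b 0) (y - x)) - inner ℝ (b 1) (y - x) := by
        have := hγ.continuous
        fun_prop
      have h1 : ∀ᶠ y in 𝓝 x, 0 < γ (inner ℝ (b 0) (y - x)) - inner ℝ (b 1) (y - x) := by
        refine hcont.tendsto x |>.eventually_const_lt ?_
        simpa using hneg
      obtain ⟨y, hyD, hy1, hy2⟩ := ((mem_closure_iff_frequently.1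
        (frontier_subset_closure hx)).and_eventually
          (h1.and (Metric.ball_mem_nhds x hδ))).exists
      rw [dist_eq_norm] at hy2
      have e1 : ∀ i, |inner ℝ (b i) (y - x)| < δ := fun i => by
        refine (abs_real_inner_le_norm _ _).trans_lt ?_
        rwa [OrthonormalBasis.norm_eq_one, one_mul]
      have e2 := b.sum_repr' (y - x)
      rw [Fin.sum_univ_two] at e2
      have e3 := (hiff _ _ (e1 0) (e1 1)).1 (by rw [add_assoc, e2, add_sub_cancel]; exact hyD)
      linarith
    -- The point x + (δ/2) b₁ lies above the graph, hence in D, hence at positive distance from the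
    -- axis, while x is on the axis: the direction b₁ points away from the axis.
    have hb : 0 < (b 1) 0 := by
      have h1 := hD ((hiff 0 (δ / 2) (by simpa using hδ) (by
        rw [abs_of_pos (by positivity)]; linarith)).2 (by linarith))
      simp only [mem_ofPred_eq, PiLp.add_apply, PiLp.smul_apply, smul_eq_mul, ← h0, zero_mul,
        zero_add] at h1
      exact pos_of_mul_pos_right h1 (by positivity)
    -- The last bound makes the cone so narrow that a displacement of size ε in it increases r by at
    -- least ε (b₁)₀/2 ≥ cε.
    set c : ℝ := min (min (1 / 2) (1 / (K + 1))) ((b 1) 0 / 2) with hc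
    have hc0 : 0 < c := lt_min (lt_min (by norm_num) (by positivity)) (by positivity)
    have hcb : c ≤ (b 1) 0 / 2 := min_le_right _ _
    refine ⟨b, γ, K, δ, c, hγ, hδ, hc0, (min_le_left _ _).trans (min_le_left _ _), ?_,
      hiff, ?_⟩
    · calc (K + 1 : ℝ) * c ≤ (K + 1) * (1 / (K + 1)) := by
            gcongr; exact (min_le_left _ _).trans (min_le_right _ _)
        _ = 1 := by field_simp
    · intro y y' ε h1 h2 h3 hy h4
      have a1 := (abs_le.1 ((abs_coord_le_norm _ 0).trans h4)).1
      simp only [PiLp.sub_apply, PiLp.smul_apply, smul_eq_mul] at a1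
      have : c * ε ≤ (b 1) 0 / 2 * ε := by gcongr
      have : 0 ≤ c * ε := by positivity
      nlinarith

theorem exists_chart {D : Set Plane} (hp : IsPolygon D) (hD : D ⊆ {x | 0 < x 0})
    {x : Plane} (hx : x ∈ closure D) : ∃ b γ K δ c, IsChart D x b γ K δ c := by
  by_cases h : x ∈ D
  · exact exists_chart_of_mem hp.isOpen hD h
  · exact exists_chart_of_frontier hp hD ⟨hx, fun h' => h (interior_subset h')⟩

theorem point_eq_of_frame (b : OrthonormalBasis (Fin 2) ℝ Plane) (x y : Plane) :
    x + inner ℝ (b 0) (y - x) • b 0 + inner ℝ (b 1) (y - x) • b 1 = y := by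
  have e2 := b.sum_repr' (y - x)
  rw [Fin.sum_univ_two] at e2
  rw [add_assoc, e2, add_sub_cancel]

theorem abs_inner_frame_le (b : OrthonormalBasis (Fin 2) ℝ Plane) (v : Plane) (i : Fin 2) :
    |inner ℝ (b i) v| ≤ ‖v‖ := by
  refine (abs_real_inner_le_norm _ _).trans ?_
  rw [OrthonormalBasis.norm_eq_one, one_mul]

theorem measurePreserving_frame (b : OrthonormalBasis (Fin 2) ℝ Plane) (x : Plane) :
    MeasurePreserving (fun p : ℝ × ℝ => x + p.1 • b 0 + p.2 • b 1) volume volume := by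
  have h1 := (volume_preserving_finTwoArrow ℝ).symm
  have h2 := PiLp.volume_preserving_toLp (Fin 2)
  have h3 := b.repr.symm.measurePreserving
  have h4 := measurePreserving_add_left (volume : Measure Plane) x
  have h5 := h4.comp (h3.comp (h2.comp h1))
  convert h5 using 1
  ext1 p
  simp only [Function.comp]
  rw [add_assoc]
  congr 1
  rw [← OrthonormalBasis.sum_repr_symm]
  simp [Fin.sum_univ_two]

theorem lintegral_frame (b : OrthonormalBasis (Fin 2) ℝ Plane) (x : Plane) {f : Plane → ENNReal}
    (hf : Measurable f) :
    ∫⁻ y, f y = ∫⁻ s : ℝ, ∫⁻ t : ℝ, f (x + s • b 0 + t • b 1) := by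
  rw [← (measurePreserving_frame b x).lintegral_comp hf, Measure.volume_eq_prod, lintegral_prod]
  exact (hf.comp (measurePreserving_frame b x).measurable).aemeasurable

theorem lintegral_frame_swap (b : OrthonormalBasis (Fin 2) ℝ Plane) (x : Plane)
    {f : Plane → ENNReal} (hf : Measurable f) :
    ∫⁻ y, f y = ∫⁻ t : ℝ, ∫⁻ s : ℝ, f (x + s • b 0 + t • b 1) := by
  rw [← (measurePreserving_frame b x).lintegral_comp hf, Measure.volume_eq_prod, lintegral_prod_symm]
  exact (hf.comp (measurePreserving_frame b x).measurable).aemeasurable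

end Chart

/-! ### One-dimensional estimates along the fibers of a chart. -/

section Fiber

/-- Average f(t)² ≤ f(s)² + ∫ 2|f||f'| over s in [t, t + h]. -/
theorem sq_le_integral_fiber {f f' : ℝ → ℝ} (hf : ∀ t, HasDerivAt f (f' t) t)
    (hf' : Continuous f') {h : ℝ} (hh : 0 < h) (t : ℝ) :
    f t ^ 2 ≤ ∫ s in t..t + h, (f s ^ 2 / h + 2 * |f s| * |f' s|) := by
  have hc : Continuous f := continuous_iff_continuousAt.2 fun t => (hf t).continuousAt
  have hth : t ≤ t + h := by linarith
  have c1 : Continuous fun s => 2 * |f s| * |f' s| := by fun_prop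
  have c2 : Continuous fun s => f s ^ 2 := by fun_prop
  set I := ∫ s in t..t + h, 2 * |f s| * |f' s| with hI
  have key : ∀ s ∈ Icc t (t + h), f t ^ 2 ≤ f s ^ 2 + I := by
    intro s hs
    have e1 : ∫ x in t..s, 2 * f x * f' x = f s ^ 2 - f t ^ 2 := by
      refine intervalIntegral.integral_eq_sub_of_hasDerivAt (f := fun x => f x ^ 2) (fun x _ => ?_)
        ((by fun_prop : Continuous fun x => 2 * f x * f' x).intervalIntegrable _ _)
      have := (hf x).fun_pow 2
      simpa using this
    have e2 : |∫ x in t..s, 2 * f x * f' x| ≤ ∫ x in t..s, 2 * |f x| * |f' x| := by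
      refine (intervalIntegral.abs_integral_le_integral_abs hs.1).trans (le_of_eq ?_)
      simp [abs_mul]
    have e3 : ∫ x in t..s, 2 * |f x| * |f' x| ≤ I :=
      intervalIntegral.integral_mono_interval le_rfl hs.1 hs.2
        (Eventually.of_forall fun x => by positivity) (c1.intervalIntegrable _ _)
    rw [e1] at e2
    linarith [neg_abs_le (f s ^ 2 - f t ^ 2)]
  have e4 : ∫ s in t..t + h, f t ^ 2 ≤ ∫ s in t..t + h, (f s ^ 2 + I) :=
    intervalIntegral.integral_mono_on hth (by simp) ((by fun_prop :
      Continuous fun s => f s ^ 2 + I).intervalIntegrable _ _) key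
  rw [intervalIntegral.integral_const, intervalIntegral.integral_add (c2.intervalIntegrable _ _)
    (by simp), intervalIntegral.integral_const] at e4
  rw [intervalIntegral.integral_add ((c2.div_const h).intervalIntegrable _ _)
    (c1.intervalIntegrable _ _), intervalIntegral.integral_div, ← hI]
  simp only [add_sub_cancel_left, smul_eq_mul] at e4
  have : h * f t ^ 2 ≤ h * ((∫ s in t..t + h, f s ^ 2) / h + I) := by
    rw [mul_add, mul_div_cancel₀ _ hh.ne']; exact e4
  exact le_of_mul_le_mul_left this hh

/-- A majorant of the derivative of `φ²` along unit directions, plus `φ² / h`. -/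
def fiberDensity (h : ℝ) (φ : Plane → ℝ) (y : Plane) : ℝ :=
  φ y ^ 2 / h + 2 * |φ y| * (|fderiv ℝ φ y (EuclideanSpace.single 0 1)| +
    |fderiv ℝ φ y (EuclideanSpace.single 1 1)|)

theorem fiberDensity_nonneg {h : ℝ} (hh : 0 < h) (φ : Plane → ℝ) (y : Plane) :
    0 ≤ fiberDensity h φ y := by
  unfold fiberDensity; positivity

theorem continuous_fiberDensity (h : ℝ) {φ : Plane → ℝ} (hφ : ContDiff ℝ ∞ φ) :
    Continuous (fiberDensity h φ) := by
  have hd : ∀ i : Fin 2, Continuous fun x => fderiv ℝ φ x (EuclideanSpace.single i 1) := fun _ =>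
    (hφ.continuous_fderiv (by simp)).clm_apply continuous_const
  have h0 := hd 0
  have h1 := hd 1
  have := hφ.continuous
  unfold fiberDensity
  fun_prop

theorem norm_clm_le_sum {F : Type*} [NormedAddCommGroup F] [NormedSpace ℝ F]
    (T : Plane →L[ℝ] F) {e : Plane} (he : ‖e‖ = 1) :
    ‖T e‖ ≤ ‖T (EuclideanSpace.single 0 1)‖ + ‖T (EuclideanSpace.single 1 1)‖ := by
  have e1 : e = e 0 • EuclideanSpace.single 0 1 + e 1 • EuclideanSpace.single 1 1 := by
    ext i; fin_cases i <;> simp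
  have h0 : |e 0| ≤ 1 := he ▸ abs_coord_le_norm e 0
  have h1 : |e 1| ≤ 1 := he ▸ abs_coord_le_norm e 1
  calc ‖T e‖ = ‖e 0 • T (EuclideanSpace.single 0 1) + e 1 • T (EuclideanSpace.single 1 1)‖ := by
        conv_lhs => rw [e1, map_add, map_smul, map_smul]
    _ ≤ |e 0| * ‖T (EuclideanSpace.single 0 1)‖ + |e 1| * ‖T (EuclideanSpace.single 1 1)‖ := by
        refine (norm_add_le _ _).trans ?_
        rw [norm_smul, norm_smul]; rfl
    _ ≤ 1 * ‖T (EuclideanSpace.single 0 1)‖ + 1 * ‖T (EuclideanSpace.single 1 1)‖ := by gcongr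
    _ = _ := by rw [one_mul, one_mul]

variable {D : Set Plane} {x : Plane} {b : OrthonormalBasis (Fin 2) ℝ Plane} {γ : ℝ → ℝ} {K : ℝ≥0}
  {δ c : ℝ}

/-- The integral of the fiber density, with weight `r`, over a fiber of a chart. -/
def fiberIntegral (D : Set Plane) (x : Plane) (b : OrthonormalBasis (Fin 2) ℝ Plane) (h : ℝ)
    (φ : Plane → ℝ) (s : ℝ) : ENNReal :=
  5 * ∫⁻ t : ℝ, D.indicator (fun y => ENNReal.ofReal (y 0 * fiberDensity h φ y))
    (x + s • b 0 + t • b 1)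

theorem measurable_fiberIntegrand (hDo : IsOpen D) (h : ℝ) {φ : Plane → ℝ} (hφ : ContDiff ℝ ∞ φ) :
    Measurable (D.indicator fun y => ENNReal.ofReal (y 0 * fiberDensity h φ y)) := by
  have := continuous_fiberDensity h hφ
  exact Measurable.indicator (by fun_prop) hDo.measurableSet

theorem measurable_fiberIntegral (hDo : IsOpen D) (h : ℝ) {φ : Plane → ℝ} (hφ : ContDiff ℝ ∞ φ) :
    Measurable (fiberIntegral D x b h φ) := by
  have h1 : Measurable fun p : ℝ × ℝ => D.indicator
      (fun y => ENNReal.ofReal (y 0 * fiberDensity h φ y)) (x + p.1 • b 0 + p.2 • b 1) :=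
    (measurable_fiberIntegrand hDo h hφ).comp (measurePreserving_frame b x).measurable
  exact (h1.lintegral_prod_right').const_mul 5

/-- The fiber above a point on or over the graph stays in D for the length δ/2, and r at its foot is
at most 5 times r along it. So the weight moves inside the integral of the fiber density, and the
bound depends on s only. -/
theorem ofReal_mul_sq_le_fiberIntegral (hC : IsChart D x b γ K δ c) {φ : Plane → ℝ}
    (hφ : ContDiff ℝ ∞ φ) {s t : ℝ} (hs : |s| < δ) (ht : |t| < δ / 2) (hst : γ s ≤ t)
    (h0 : 0 ≤ (x + s • b 0 + t • b 1) 0) :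
    ENNReal.ofReal ((x + s • b 0 + t • b 1) 0 * φ (x + s • b 0 + t • b 1) ^ 2) ≤
      fiberIntegral D x b (δ / 2) φ s := by
  have hδ := hC.pos
  have hd2 : 0 < δ / 2 := by positivity
  set p : ℝ → Plane := fun t' => x + s • b 0 + t' • b 1 with hp
  have hpd : ∀ t', HasDerivAt p (b 1) t' := fun t' => by
    have := ((hasDerivAt_id t').smul_const (b 1)).const_add (x + s • b 0)
    rwa [one_smul] at this
  have hpc : Continuous p := by fun_prop
  have hb1 : ‖b 1‖ = 1 := b.norm_eq_one 1
  have hfd : ∀ t', HasDerivAt (fun t' => φ (p t')) (fderiv ℝ φ (p t') (b 1)) t' := fun t' =>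
    ((hφ.differentiable (by simp) (p t')).hasFDerivAt).comp_hasDerivAt t' (hpd t')
  have hfc : Continuous fun t' => fderiv ℝ φ (p t') (b 1) :=
    ((hφ.continuous_fderiv (by simp)).comp hpc).clm_apply continuous_const
  have hdc : Continuous fun t' => fiberDensity (δ / 2) φ (p t') :=
    (continuous_fiberDensity _ hφ).comp hpc
  have h1 := sq_le_integral_fiber hfd hfc hd2 t
  have hφc := hφ.continuous
  have h2 : φ (p t) ^ 2 ≤ ∫ t' in t..t + δ / 2, fiberDensity (δ / 2) φ (p t') := by
    refine h1.trans (intervalIntegral.integral_mono_on (by linarith)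
      (Continuous.intervalIntegrable (by fun_prop) _ _) (hdc.intervalIntegrable _ _) fun t' _ => ?_)
    unfold fiberDensity
    have := norm_clm_le_sum (fderiv ℝ φ (p t')) hb1
    simp only [Real.norm_eq_abs] at this
    gcongr
  have ht' := abs_lt.1 ht
  have key : ∀ t' ∈ Ioo t (t + δ / 2), p t' ∈ D ∧ (p t) 0 ≤ 5 * (p t') 0 := by
    intro t' h3
    have a1 : |t'| < δ := abs_lt.2 ⟨by linarith [h3.1], by linarith [h3.2]⟩
    refine ⟨(hC.mem_iff s t' hs a1).2 (hst.trans_lt h3.1), ?_⟩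
    have a2 := hC.radius_le (p t) (p t') (t' - t) ?_ ?_ (by linarith [h3.1]) h0 ?_
    · have : 0 ≤ c * (t' - t) := mul_nonneg hC.cone_pos.le (by linarith [h3.1])
      linarith
    · simp only [hp]
      rw [add_assoc, add_sub_cancel_left]
      exact (norm_frame_smul_add_le b s t).trans_lt (by linarith)
    · simp only [hp]
      rw [add_assoc, add_sub_cancel_left]
      exact (norm_frame_smul_add_le b s t').trans_lt (by linarith)
    · have : p t' - p t - (t' - t) • b 1 = 0 := by
        simp only [hp, sub_smul]; abel
      rw [this, norm_zero]
      exact mul_nonneg hC.cone_pos.le (by linarith [h3.1])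
  have hint : IntegrableOn (fun t' => (p t) 0 / 5 * fiberDensity (δ / 2) φ (p t'))
      (Ioo t (t + δ / 2)) :=
    ((by fun_prop : Continuous fun t' => (p t) 0 / 5 * fiberDensity (δ / 2) φ (p t')).integrableOn_Icc
      ).mono_set Ioo_subset_Icc_self
  calc ENNReal.ofReal ((p t) 0 * φ (p t) ^ 2)
      ≤ ENNReal.ofReal (5 * ∫ t' in Ioo t (t + δ / 2),
          (p t) 0 / 5 * fiberDensity (δ / 2) φ (p t')) := by
        refine ENNReal.ofReal_le_ofReal ?_
        rw [integral_const_mul, ← integral_Ioc_eq_integral_Ioo,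
          ← intervalIntegral.integral_of_le (by linarith)]
        have := mul_le_mul_of_nonneg_left h2 h0
        linarith
    _ = 5 * ∫⁻ t' in Ioo t (t + δ / 2),
          ENNReal.ofReal ((p t) 0 / 5 * fiberDensity (δ / 2) φ (p t')) := by
        rw [ENNReal.ofReal_mul (by norm_num), ofReal_integral_eq_lintegral_ofReal hint
          (Eventually.of_forall fun t' => mul_nonneg (by positivity) (fiberDensity_nonneg hd2 _ _))]
        norm_num
    _ ≤ 5 * ∫⁻ t' in Ioo t (t + δ / 2),
          D.indicator (fun y => ENNReal.ofReal (y 0 * fiberDensity (δ / 2) φ y)) (p t') := by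
        refine mul_le_mul_right (setLIntegral_mono' measurableSet_Ioo fun t' h3 => ?_) _
        rw [indicator_of_mem (key t' h3).1]
        refine ENNReal.ofReal_le_ofReal (mul_le_mul_of_nonneg_right ?_
          (fiberDensity_nonneg hd2 _ _))
        linarith [(key t' h3).2]
    _ ≤ _ := mul_le_mul_right (setLIntegral_le_lintegral _ _) _

theorem lintegral_fiberIntegral (hDo : IsOpen D) (hD : D ⊆ {x | 0 < x 0}) (h : ℝ) {φ : Plane → ℝ}
    (hφ : ContDiff ℝ ∞ φ) : ∫⁻ s, fiberIntegral D x b h φ s =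
      5 * ∫⁻ y, ENNReal.ofReal (fiberDensity h φ y) ∂(rMeasure D) := by
  unfold fiberIntegral
  rw [lintegral_const_mul, ← lintegral_frame b x (measurable_fiberIntegrand hDo h hφ),
    lintegral_indicator hDo.measurableSet, lintegral_rMeasure]
  · congr 1
    refine setLIntegral_congr_fun hDo.measurableSet fun y hy => ?_
    rw [← ENNReal.ofReal_mul (le_of_lt (show 0 < y 0 from hD hy))]
  · exact Measurable.lintegral_prod_right'
      (f := fun p : ℝ × ℝ => D.indicator
      (fun y => ENNReal.ofReal (y 0 * fiberDensity h φ y)) (x + p.1 • b 0 + p.2 • b 1))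
      ((measurable_fiberIntegrand hDo h hφ).comp (measurePreserving_frame b x).measurable)

theorem lintegral_norm_mul_norm_le {α 𝕜 : Type*} [RCLike 𝕜] [MeasurableSpace α] {μ : Measure α}
    (f g : Lp 𝕜 2 μ) : ∫⁻ y, ‖f y‖ₑ * ‖g y‖ₑ ∂μ ≤ ENNReal.ofReal (‖f‖ * ‖g‖) := by
  have h1 : Integrable (fun y => ‖f y‖ * ‖g y‖) μ :=
    (Lp.memLp f).norm.integrable_mul (Lp.memLp g).norm
  have h2 : ∫⁻ y, ‖f y‖ₑ * ‖g y‖ₑ ∂μ = ENNReal.ofReal (∫ y, ‖f y‖ * ‖g y‖ ∂μ) := by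
    rw [ofReal_integral_eq_lintegral_ofReal h1 (Eventually.of_forall fun y => by positivity)]
    refine lintegral_congr fun y => ?_
    rw [ENNReal.ofReal_mul (norm_nonneg _), ofReal_norm, ofReal_norm]
  rw [h2]
  exact ENNReal.ofReal_le_ofReal (integral_norm_mul_norm_le f g)

/-- Cauchy–Schwarz in L²₁(D): the term φ²/h contributes 1/h, and each of the two partial derivatives
contributes 2. One factor remains an L² norm; the later estimates depend on this. -/
theorem lintegral_fiberDensity_le (hDo : IsOpen D) (hD : D ⊆ {x | 0 < x 0}) {h : ℝ} (hh : 0 < h)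
    {φ : Plane → ℝ} (hφ : ContDiff ℝ ∞ φ) {U : H1 D} (hU : U.1 0 =ᵐ[rMeasure D] φ) :
    ∫⁻ y, ENNReal.ofReal (fiberDensity h φ y) ∂(rMeasure D) ≤
      ENNReal.ofReal ((1 / h + 4) * (‖U.1 0‖ * ‖U‖)) := by
  obtain ⟨h1, h2⟩ := H1.ae_eq_partial hDo hD hφ hU
  have e1 : ∀ᵐ y ∂(rMeasure D), ENNReal.ofReal (fiberDensity h φ y) =
      ENNReal.ofReal (1 / h) * (‖U.1 0 y‖ₑ * ‖U.1 0 y‖ₑ) + ENNReal.ofReal 2 * (‖U.1 0 y‖ₑ * ‖U.1 1 y‖ₑ) +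
        ENNReal.ofReal 2 * (‖U.1 0 y‖ₑ * ‖U.1 2 y‖ₑ) := by
    filter_upwards [h1, h2, hU] with y a1 a2 a3
    simp only [← ofReal_norm, Real.norm_eq_abs]
    rw [← ENNReal.ofReal_mul (by positivity), ← ENNReal.ofReal_mul (by positivity),
      ← ENNReal.ofReal_mul (by positivity), ← ENNReal.ofReal_mul (by positivity),
      ← ENNReal.ofReal_mul (by positivity), ← ENNReal.ofReal_mul (by positivity),
      ← ENNReal.ofReal_add (by positivity) (by positivity),
      ← ENNReal.ofReal_add (by positivity) (by positivity)]
    unfold fiberDensity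
    rw [← a1, ← a2, ← a3, ← sq_abs]
    congr 1
    ring
  have n : ∀ i, ‖U.1 i‖ ≤ ‖U‖ := fun i => PiLp.norm_apply_le U.1 i
  have m : ∀ i, AEMeasurable (fun y => ‖U.1 0 y‖ₑ * ‖U.1 i y‖ₑ) (rMeasure D) := fun i =>
    (Lp.aestronglyMeasurable _).enorm.mul (Lp.aestronglyMeasurable _).enorm
  have q : ∀ i, ∫⁻ y, ‖U.1 0 y‖ₑ * ‖U.1 i y‖ₑ ∂(rMeasure D) ≤ ENNReal.ofReal (‖U.1 0‖ * ‖U‖) :=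
    fun i => (lintegral_norm_mul_norm_le _ _).trans (ENNReal.ofReal_le_ofReal
      (mul_le_mul_of_nonneg_left (n i) (norm_nonneg _)))
  rw [lintegral_congr_ae e1, lintegral_add_right' _ ((m 2).const_mul _),
    lintegral_add_right' _ ((m 1).const_mul _), lintegral_const_mul'' _ (m 0),
    lintegral_const_mul'' _ (m 1), lintegral_const_mul'' _ (m 2)]
  have e4 : ENNReal.ofReal ((1 / h + 4) * (‖U.1 0‖ * ‖U‖)) = ENNReal.ofReal (1 / h) *
      ENNReal.ofReal (‖U.1 0‖ * ‖U‖) + ENNReal.ofReal 2 * ENNReal.ofReal (‖U.1 0‖ * ‖U‖) +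
      ENNReal.ofReal 2 * ENNReal.ofReal (‖U.1 0‖ * ‖U‖) := by
    rw [← ENNReal.ofReal_mul (by positivity), ← ENNReal.ofReal_mul (by positivity),
      ← ENNReal.ofReal_add (by positivity) (by positivity),
      ← ENNReal.ofReal_add (by positivity) (by positivity)]
    congr 1
    ring
  rw [e4]
  gcongr
  · exact q 0
  · exact q 1
  · exact q 2

end Fiber

/-! ### The trace inequality for smooth functions. -/

section LocalEstimates

variable {D : Set Plane} {x : Plane} {b : OrthonormalBasis (Fin 2) ℝ Plane} {γ : ℝ → ℝ} {K : ℝ≥0}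
  {δ c : ℝ}

theorem IsChart.le_of_mem_closure (hC : IsChart D x b γ K δ c) {y : Plane} (hy : y ∈ closure D)
    (hyx : ‖y - x‖ < δ) : γ (inner ℝ (b 0) (y - x)) ≤ inner ℝ (b 1) (y - x) := by
  by_contra! hneg
  have hcont : Continuous fun y : Plane =>
      γ (inner ℝ (b 0) (y - x)) - inner ℝ (b 1) (y - x) := by
    have := hC.lipschitz.continuous
    fun_prop
  have h1 : ∀ᶠ y in 𝓝 y, 0 < γ (inner ℝ (b 0) (y - x)) - inner ℝ (b 1) (y - x) :=
    hcont.tendsto y |>.eventually_const_lt (by linarith)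
  have h2 : ∀ᶠ y in 𝓝 y, ‖y - x‖ < δ :=
    (by fun_prop : Continuous fun y : Plane => ‖y - x‖).tendsto y |>.eventually_lt_const hyx
  obtain ⟨z, hzD, hz1, hz2⟩ := ((mem_closure_iff_frequently.1 hy).and_eventually
    (h1.and h2)).exists
  have e3 := (hC.mem_iff _ _ ((abs_inner_frame_le b (z - x) 0).trans_lt hz2)
    ((abs_inner_frame_le b (z - x) 1).trans_lt hz2)).1 (by rw [point_eq_of_frame]; exact hzD)
  linarith

theorem inner_frame_zero (b : OrthonormalBasis (Fin 2) ℝ Plane) (x : Plane) (s t : ℝ) :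
    inner ℝ (b 0) (x + s • b 0 + t • b 1 - x) = s := by
  have h := b.orthonormal.2 (show (0 : Fin 2) ≠ 1 by decide)
  rw [add_assoc, add_sub_cancel_left, inner_add_right, inner_smul_right, inner_smul_right, h]
  simp

theorem coord_nonneg_of_mem_closure (hD : D ⊆ {x | 0 < x 0}) {y : Plane} (hy : y ∈ closure D) :
    0 ≤ y 0 := by
  have : closure D ⊆ {y : Plane | 0 ≤ y 0} :=
    closure_minimal (fun y hy => le_of_lt (show 0 < y 0 from hD hy))
      (isClosed_le continuous_const (by fun_prop))
  exact this hy

theorem IsChart.ofReal_le_fiberIntegral (hC : IsChart D x b γ K δ c) (hD : D ⊆ {x | 0 < x 0})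
    {φ : Plane → ℝ} (hφ : ContDiff ℝ ∞ φ) {y : Plane} (hy : y ∈ closure D)
    (hyx : ‖y - x‖ < δ / 2) : ENNReal.ofReal (y 0 * φ y ^ 2) ≤
      fiberIntegral D x b (δ / 2) φ (inner ℝ (b 0) (y - x)) := by
  have hδ := hC.pos
  have h1 := ofReal_mul_sq_le_fiberIntegral hC hφ
    ((abs_inner_frame_le b (y - x) 0).trans_lt (hyx.trans (by linarith)))
    ((abs_inner_frame_le b (y - x) 1).trans_lt hyx)
    (hC.le_of_mem_closure hy (hyx.trans (by linarith)))
  rw [point_eq_of_frame] at h1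
  exact h1 (coord_nonneg_of_mem_closure hD hy)

/-- Near x the boundary lies on the image of the Lipschitz curve s ↦ x + s b₀ + γ(s) b₁. Hence its
arc length, projected to the parameter s, is at most 1 + K times Lebesgue measure. -/
theorem lintegral_frontier_le (hC : IsChart D x b γ K δ c) (hDo : IsOpen D)
    {g : ℝ → ENNReal} (hg : Measurable g) :
    ∫⁻ y in frontier D ∩ {y | ‖y - x‖ < δ / 2}, g (inner ℝ (b 0) (y - x))
      ∂(Measure.hausdorffMeasure 1 : Measure Plane) ≤ (1 + K : ℝ≥0) * ∫⁻ s, g s := by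
  have hδ := hC.pos
  set E := frontier D ∩ {y | ‖y - x‖ < δ / 2} with hE
  set π : Plane → ℝ := fun y => inner ℝ (b 0) (y - x) with hπ
  have hπc : Measurable π := by
    have : Continuous π := by fun_prop
    exact this.measurable
  have hΦ : LipschitzWith (1 + K) fun s : ℝ => x + s • b 0 + γ s • b 1 := by
    refine LipschitzWith.of_dist_le_mul fun s s' => ?_
    rw [dist_eq_norm]
    have e1 : x + s • b 0 + γ s • b 1 - (x + s' • b 0 + γ s' • b 1) =
        (s - s') • b 0 + (γ s - γ s') • b 1 := by
      simp only [sub_smul]; abel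
    have e2 := hC.lipschitz.dist_le_mul s s'
    rw [Real.dist_eq, Real.dist_eq] at e2
    rw [e1, Real.dist_eq]
    refine (norm_frame_smul_add_le b _ _).trans ?_
    push_cast
    linarith
  have hgr : ∀ y ∈ E, x + π y • b 0 + γ (π y) • b 1 = y := by
    intro y hy
    have h1 := hC.le_of_mem_closure (frontier_subset_closure hy.1) (hy.2.trans (by linarith))
    have h2 : y ∉ D := fun h => hy.1.2 (by rwa [hDo.interior_eq])
    have h3 : ‖y - x‖ < δ := hy.2.trans (by linarith)
    have h4 := (hC.mem_iff (inner ℝ (b 0) (y - x)) (inner ℝ (b 1) (y - x))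
      ((abs_inner_frame_le b (y - x) 0).trans_lt h3)
      ((abs_inner_frame_le b (y - x) 1).trans_lt h3)).not
    rw [point_eq_of_frame] at h4
    have h5 : γ (π y) = inner ℝ (b 1) (y - x) := le_antisymm h1 (not_lt.1 (h4.1 h2))
    rw [h5]
    exact point_eq_of_frame b x y
  have hmap : ((Measure.hausdorffMeasure 1 : Measure Plane).restrict E).map π ≤
      ((1 + K : ℝ≥0) : ENNReal) • volume := by
    refine Measure.le_iff.2 fun S hS => ?_
    rw [Measure.map_apply hπc hS, Measure.restrict_apply (hπc hS)]
    have h1 : π ⁻¹' S ∩ E ⊆ (fun s : ℝ => x + s • b 0 + γ s • b 1) '' S := by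
      rintro y ⟨hy1, hy2⟩
      exact ⟨π y, hy1, hgr y hy2⟩
    refine (measure_mono h1).trans ((hΦ.hausdorffMeasure_image_le zero_le_one S).trans ?_)
    rw [hausdorffMeasure_real]
    simp
  calc ∫⁻ y in E, g (π y) ∂(Measure.hausdorffMeasure 1 : Measure Plane)
      = ∫⁻ s, g s ∂(((Measure.hausdorffMeasure 1 : Measure Plane).restrict E).map π) :=
        (lintegral_map hg hπc).symm
    _ ≤ ∫⁻ s, g s ∂(((1 + K : ℝ≥0) : ENNReal) • volume) := lintegral_mono' hmap le_rfl
    _ = _ := lintegral_smul_measure _ _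

/-- On the boundary r φ² is bounded by the fiber integral over the same parameter s, and integrating
over s recovers an integral over D. -/
theorem exists_trace_bound_local (hp : IsPolygon D) (hD : D ⊆ {x | 0 < x 0})
    (hx : x ∈ closure D) : ∃ t ∈ 𝓝[closure D] x, ∃ C : ℝ, 0 ≤ C ∧ ∀ φ : Plane → ℝ,
      ContDiff ℝ ∞ φ → ∀ U : H1 D, U.1 0 =ᵐ[rMeasure D] φ →
      ∫⁻ y in t, ENNReal.ofReal (φ y ^ 2) ∂(rBoundaryMeasure D) ≤
        ENNReal.ofReal (C * (‖U.1 0‖ * ‖U‖)) := by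
  obtain ⟨b, γ, K, δ, c, hC⟩ := exists_chart hp hD hx
  have hδ := hC.pos
  refine ⟨{y | ‖y - x‖ < δ / 2}, mem_nhdsWithin_of_mem_nhds ?_,
    (1 + K : ℝ≥0) * (5 * (1 / (δ / 2) + 4)), by positivity, fun φ hφ U hU => ?_⟩
  · exact (isOpen_lt (by fun_prop) continuous_const).mem_nhds (by simpa using hδ)
  have hB : MeasurableSet {y : Plane | ‖y - x‖ < δ / 2} :=
    (isOpen_lt (by fun_prop) continuous_const).measurableSet
  have hφc := hφ.continuous
  have hF : MeasurableSet (frontier D) := isClosed_frontier.measurableSet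
  rw [rBoundaryMeasure, setLIntegral_withDensity_eq_setLIntegral_mul _ (by fun_prop)
    (by fun_prop) hB, Measure.restrict_restrict hB]
  calc _ ≤ ∫⁻ y in frontier D ∩ {y | ‖y - x‖ < δ / 2},
        fiberIntegral D x b (δ / 2) φ (inner ℝ (b 0) (y - x))
          ∂(Measure.hausdorffMeasure 1 : Measure Plane) := by
        refine (lintegral_mono_set (t := frontier D ∩ {y | ‖y - x‖ < δ / 2})
          fun y hy => ⟨hy.2.1, hy.1⟩).trans (setLIntegral_mono' (hF.inter hB) fun y hy => ?_)
        have hy0 := frontier_subset_closure hy.1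
        rw [Pi.mul_apply, ← ENNReal.ofReal_mul (coord_nonneg_of_mem_closure hD hy0)]
        exact hC.ofReal_le_fiberIntegral hD hφ hy0 hy.2
    _ ≤ (1 + K : ℝ≥0) * ∫⁻ s, fiberIntegral D x b (δ / 2) φ s :=
        lintegral_frontier_le hC hp.isOpen (measurable_fiberIntegral hp.isOpen _ hφ)
    _ ≤ (1 + K : ℝ≥0) * (5 * ENNReal.ofReal ((1 / (δ / 2) + 4) * (‖U.1 0‖ * ‖U‖))) := by
        rw [lintegral_fiberIntegral hp.isOpen hD _ hφ]
        gcongr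
        exact lintegral_fiberDensity_le hp.isOpen hD (by positivity) hφ hU
    _ = _ := by
        have e : ENNReal.ofReal ((1 + K : ℝ≥0) : ℝ) = (1 + K : ℝ≥0) := ENNReal.ofReal_coe_nnreal
        have e5 : (5 : ENNReal) = ENNReal.ofReal 5 := by norm_num
        rw [← e, e5, ← ENNReal.ofReal_mul (by norm_num), ← ENNReal.ofReal_mul (by positivity)]
        congr 1
        ring

/-- Trace inequality for smooth functions. -/
theorem exists_trace_bound (hp : IsPolygon D) (hD : D ⊆ {x | 0 < x 0}) :
    ∃ C : ℝ, 0 ≤ C ∧ ∀ φ : Plane → ℝ,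
      ContDiff ℝ ∞ φ → ∀ U : H1 D, U.1 0 =ᵐ[rMeasure D] φ →
      ∫⁻ y, ENNReal.ofReal (φ y ^ 2) ∂(rBoundaryMeasure D) ≤
        ENNReal.ofReal (C * (‖U.1 0‖ * ‖U‖)) := by
  -- Such bounds pass to subsets and add up over unions, so compactness reduces the claim to small
  -- neighborhoods of points.
  obtain ⟨C, hC0, hC⟩ := hp.isBounded.isCompact_closure.induction_on
    (p := fun t => ∃ C : ℝ, 0 ≤ C ∧ ∀ φ : Plane → ℝ,
      ContDiff ℝ ∞ φ → ∀ U : H1 D, U.1 0 =ᵐ[rMeasure D] φ →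
      ∫⁻ y in t, ENNReal.ofReal (φ y ^ 2) ∂(rBoundaryMeasure D) ≤
        ENNReal.ofReal (C * (‖U.1 0‖ * ‖U‖)))
    ⟨0, le_rfl, fun φ _ U _ => by simp⟩
    (fun s t hst ⟨C, h0, h⟩ => ⟨C, h0, fun φ hφ U hU =>
      (lintegral_mono_set hst).trans (h φ hφ U hU)⟩)
    (fun s t ⟨C, h0, h⟩ ⟨C', h0', h'⟩ => ⟨C + C', add_nonneg h0 h0', fun φ hφ U hU => by
      refine (lintegral_union_le _ _ _).trans ?_
      rw [add_mul, ENNReal.ofReal_add (by positivity) (by positivity)]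
      exact add_le_add (h φ hφ U hU) (h' φ hφ U hU)⟩)
    (fun x hx => exists_trace_bound_local hp hD hx)
  refine ⟨C, hC0, fun φ hφ U hU => ?_⟩
  refine le_trans (le_of_eq ?_) (hC φ hφ U hU)
  have : ∀ᵐ y ∂(rBoundaryMeasure D), y ∈ closure D := by
    rw [rBoundaryMeasure]
    refine (withDensity_absolutelyContinuous _ _).ae_le ?_
    filter_upwards [ae_restrict_mem (isClosed_frontier.measurableSet.inter
      isOpen_halfPlane.measurableSet)] with y hy using frontier_subset_closure hy.1
  rw [Measure.restrict_eq_self_of_ae_mem this]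

end LocalEstimates

/-! ### The product estimate for smooth functions. -/

section ProductEstimate

variable {D Ω : Set Plane} {x : Plane} {b : OrthonormalBasis (Fin 2) ℝ Plane} {γ : ℝ → ℝ} {K : ℝ≥0}
  {δ c : ℝ}

/-- The fundamental theorem of calculus for |g|² on a half-line, where compact support removes the
boundary term. -/
theorem enorm_sq_le_lintegral {g : ℝ → ℂ} (hg : ContDiff ℝ 1 g) (hc : HasCompactSupport g) (s : ℝ) :
    ‖g s‖ₑ ^ 2 ≤ ∫⁻ s, 2 * (‖g s‖ₑ * ‖deriv g s‖ₑ) := by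
  have h1 : ContDiff ℝ 1 fun s => ‖g s‖ ^ 2 := hg.norm_sq ℝ
  have h2 : HasCompactSupport fun s => ‖g s‖ ^ 2 :=
    hc.comp_left (g := fun z : ℂ => ‖z‖ ^ 2) (by simp)
  have h3 := h2.enorm_le_lintegral_Ici_deriv h1 s
  have h4 : ‖(‖g s‖ ^ 2 : ℝ)‖ₑ = ‖g s‖ₑ ^ 2 := by rw [enorm_pow, enorm_norm]
  rw [h4] at h3
  refine h3.trans ((setLIntegral_le_lintegral _ _).trans (lintegral_mono fun t => ?_))
  have h5 := ((hg.differentiable (by simp) t).hasDerivAt).norm_sq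
  have h6 : deriv (fun s => ‖g s‖ ^ 2) t = 2 * inner ℝ (g t) (deriv g t) := h5.deriv
  rw [h6, ← ofReal_norm, ← ofReal_norm, ← ofReal_norm]
  have : (2 : ENNReal) = ENNReal.ofReal 2 := by norm_num
  rw [this, ← ENNReal.ofReal_mul (norm_nonneg _), ← ENNReal.ofReal_mul (by norm_num)]
  refine ENNReal.ofReal_le_ofReal ?_
  rw [norm_mul, Real.norm_ofNat]
  gcongr
  exact norm_inner_le_norm _ _

/-- A majorant of the derivative of `|a|²` along unit directions. -/
def lineDensity (a : Plane → ℂ) (y : Plane) : ENNReal :=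
  2 * (‖a y‖ₑ * (‖fderiv ℝ a y (EuclideanSpace.single 0 1)‖ₑ +
    ‖fderiv ℝ a y (EuclideanSpace.single 1 1)‖ₑ))

theorem measurable_lineDensity {a : Plane → ℂ} (ha : ContDiff ℝ ∞ a) :
    Measurable (lineDensity a) := by
  have hd : ∀ i : Fin 2, Continuous fun x => fderiv ℝ a x (EuclideanSpace.single i 1) := fun _ =>
    (ha.continuous_fderiv (by simp)).clm_apply continuous_const
  exact ((ha.continuous.measurable.enorm).mul
    ((hd 0).measurable.enorm.add (hd 1).measurable.enorm)).const_mul 2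

theorem enorm_sq_le_lintegral_lineDensity {a : Plane → ℂ} (ha : ContDiff ℝ ∞ a)
    (hc : HasCompactSupport a) (s t : ℝ) :
    ‖a (x + s • b 0 + t • b 1)‖ₑ ^ 2 ≤ ∫⁻ s : ℝ, lineDensity a (x + s • b 0 + t • b 1) := by
  set p : ℝ → Plane := fun s => x + s • b 0 + t • b 1 with hp
  have hpd : ∀ s', HasDerivAt p (b 0) s' := fun s' => by
    have := (((hasDerivAt_id s').smul_const (b 0)).const_add x).add_const (t • b 1)
    rwa [one_smul] at this
  have hpi : Isometry p := Isometry.of_dist_eq fun s s' => by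
    have : p s - p s' = (s - s') • b 0 := by simp only [hp, sub_smul]; abel
    rw [dist_eq_norm, this, norm_smul, b.norm_eq_one, mul_one, dist_eq_norm]
  have hps : ContDiff ℝ 1 p := by fun_prop
  have h1 := enorm_sq_le_lintegral (g := a ∘ p) ((ha.of_le (by simp)).comp hps)
    (hc.comp_isClosedEmbedding hpi.isClosedEmbedding) s
  refine h1.trans (lintegral_mono fun s' => ?_)
  have h2 : deriv (a ∘ p) s' = fderiv ℝ a (p s') (b 0) :=
    (((ha.differentiable (by simp) (p s')).hasFDerivAt).comp_hasDerivAt s' (hpd s')).deriv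
  rw [h2]
  unfold lineDensity
  simp only [Function.comp]
  gcongr
  have h3 := norm_clm_le_sum (fderiv ℝ a (p s')) (b.norm_eq_one 0)
  rw [← ofReal_norm, ← ofReal_norm, ← ofReal_norm,
    ← ENNReal.ofReal_add (norm_nonneg _) (norm_nonneg _)]
  exact ENNReal.ofReal_le_ofReal h3

/-- The measure here is dr dz without a weight: |a||∇a| = |a/r||∇a| r, and a/r is the fourth
component of the element of H̃¹₁. This is the only place where the product estimate uses the L²₋₁
norm. -/
theorem lintegral_lineDensity_le (hΩo : IsOpen Ω) (hΩ : Ω ⊆ {x | 0 < x 0}) {a : Plane → ℂ}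
    (ha : IsTest Ω a) {A : HTilde Ω} (hA : A.1 0 =ᵐ[rMeasure Ω] a) :
    ∫⁻ y, lineDensity a y ≤ ENNReal.ofReal (4 * ‖A‖ ^ 2) := by
  have e0 : ∫⁻ y, lineDensity a y = ∫⁻ y in Ω, lineDensity a y := by
    refine (setLIntegral_eq_of_support_subset fun y hy => ?_).symm
    by_contra h
    refine hy ?_
    have : a y = 0 := image_eq_zero_of_notMem_tsupport fun h' => h (ha.2.2 h').1
    simp [lineDensity, this]
  obtain ⟨h1, h2⟩ := HTilde.ae_eq_partial hΩo hΩ ha.1 hA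
  have q : ∀ i, ∫⁻ y, ‖A.1 3 y‖ₑ * ‖A.1 i y‖ₑ ∂(rMeasure Ω) ≤ ENNReal.ofReal (‖A‖ ^ 2) := fun i =>
    (lintegral_norm_mul_norm_le _ _).trans (ENNReal.ofReal_le_ofReal (by
      rw [sq]
      have n : ∀ i, ‖A.1 i‖ ≤ ‖A‖ := fun i => PiLp.norm_apply_le A.1 i
      exact mul_le_mul (n 3) (n i) (norm_nonneg _) (norm_nonneg _)))
  have m : ∀ i, AEMeasurable (fun y => ‖A.1 3 y‖ₑ * ‖A.1 i y‖ₑ) (rMeasure Ω) := fun i =>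
    (Lp.aestronglyMeasurable _).enorm.mul (Lp.aestronglyMeasurable _).enorm
  have e1 : ∫⁻ y in Ω, lineDensity a y = ∫⁻ y, (2 * (‖A.1 3 y‖ₑ * ‖A.1 1 y‖ₑ) +
      2 * (‖A.1 3 y‖ₑ * ‖A.1 2 y‖ₑ)) ∂(rMeasure Ω) := by
    rw [lintegral_rMeasure]
    refine lintegral_congr_ae ?_
    filter_upwards [(ae_rMeasure_iff hΩo.measurableSet hΩ).1 h1,
      (ae_rMeasure_iff hΩo.measurableSet hΩ).1 h2, (ae_rMeasure_iff hΩo.measurableSet hΩ).1 hA,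
      (ae_rMeasure_iff hΩo.measurableSet hΩ).1 A.2.2.2, ae_restrict_mem hΩo.measurableSet]
      with y a1 a2 a3 a4 hy
    have hy0 : 0 < y 0 := hΩ hy
    have e2 : ‖a y‖ₑ = ENNReal.ofReal (y 0) * ‖A.1 3 y‖ₑ := by
      rw [← ofReal_norm, ← ofReal_norm, ← ENNReal.ofReal_mul hy0.le, a4, a3, norm_div,
        Complex.norm_real, Real.norm_of_nonneg hy0.le, mul_div_cancel₀ _ hy0.ne']
    rw [lineDensity, ← a1, ← a2, e2]
    ring
  rw [e0, e1, lintegral_add_right' _ ((m 2).const_mul _), lintegral_const_mul'' _ (m 1),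
    lintegral_const_mul'' _ (m 2)]
  calc _ ≤ 2 * ENNReal.ofReal (‖A‖ ^ 2) + 2 * ENNReal.ofReal (‖A‖ ^ 2) := by
        gcongr
        · exact q 1
        · exact q 2
    _ = _ := by
        rw [ENNReal.ofReal_mul (by norm_num), ← add_mul]
        norm_num

/-- In the coordinates of a chart r φ² ≤ Φ(s) by the fiber estimate, and |a|² ≤ Λ(t) by integration
along the lines t = const, which may leave D because a lives on Ω and extends by zero. So ∫∫ r φ²
|a|² ≤ ∫ Φ ds · ∫ Λ dt. -/
theorem exists_product_bound_local (hp : IsPolygon D) (hD : D ⊆ {x | 0 < x 0}) (hΩo : IsOpen Ω)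
    (hΩ : Ω ⊆ {x | 0 < x 0}) (hx : x ∈ closure D) :
    ∃ t ∈ 𝓝[closure D] x, ∃ C : ℝ, 0 ≤ C ∧ ∀ φ : Plane → ℝ,
      ContDiff ℝ ∞ φ → ∀ U : H1 D, U.1 0 =ᵐ[rMeasure D] φ → ∀ a, IsTest Ω a → ∀ A : HTilde Ω,
      A.1 0 =ᵐ[rMeasure Ω] a →
      ∫⁻ y in t, ENNReal.ofReal (φ y ^ 2) * ‖a y‖ₑ ^ 2 ∂(rMeasure D) ≤
        ENNReal.ofReal (C * (‖U.1 0‖ * ‖U‖ * ‖A‖ ^ 2)) := by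
  obtain ⟨b, γ, K, δ, c, hC⟩ := exists_chart hp hD hx
  have hδ := hC.pos
  have hBo : IsOpen {y : Plane | ‖y - x‖ < δ / 2} := isOpen_lt (by fun_prop) continuous_const
  refine ⟨{y | ‖y - x‖ < δ / 2}, mem_nhdsWithin_of_mem_nhds ?_,
    (5 * (1 / (δ / 2) + 4)) * 4, by positivity, fun φ hφ U hU a ha A hA => ?_⟩
  · exact hBo.mem_nhds (by simpa using hδ)
  have hB := hBo.measurableSet
  have hDm := hp.isOpen.measurableSet
  have hφc := hφ.continuous
  have hac := ha.1.continuous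
  have hm : Measurable fun y : Plane => ENNReal.ofReal (φ y ^ 2) * ‖a y‖ₑ ^ 2 :=
    (by fun_prop : Measurable fun y : Plane => ENNReal.ofReal (φ y ^ 2)).mul
      (hac.measurable.enorm.pow_const 2)
  have hm' : Measurable fun y : Plane =>
      ENNReal.ofReal (y 0) * (ENNReal.ofReal (φ y ^ 2) * ‖a y‖ₑ ^ 2) :=
    (by fun_prop : Measurable fun y : Plane => ENNReal.ofReal (y 0)).mul hm
  have hmF : Measurable fun t : ℝ => ∫⁻ s : ℝ, lineDensity a (x + s • b 0 + t • b 1) :=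
    Measurable.lintegral_prod_left' (f := fun p : ℝ × ℝ => lineDensity a (x + p.1 • b 0 + p.2 • b 1))
      ((measurable_lineDensity ha.1).comp (measurePreserving_frame b x).measurable)
  calc ∫⁻ y in {y | ‖y - x‖ < δ / 2}, ENNReal.ofReal (φ y ^ 2) * ‖a y‖ₑ ^ 2 ∂(rMeasure D)
      = ∫⁻ y, ({y | ‖y - x‖ < δ / 2} ∩ D).indicator (fun y =>
          ENNReal.ofReal (y 0) * (ENNReal.ofReal (φ y ^ 2) * ‖a y‖ₑ ^ 2)) y := by
        rw [lintegral_indicator (hB.inter hDm), rMeasure, setLIntegral_withDensity_eq_setLIntegral_mul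
          _ (by fun_prop) hm hB, Measure.restrict_restrict hB]
        rfl
    _ = ∫⁻ s : ℝ, ∫⁻ t : ℝ, ({y | ‖y - x‖ < δ / 2} ∩ D).indicator (fun y =>
          ENNReal.ofReal (y 0) * (ENNReal.ofReal (φ y ^ 2) * ‖a y‖ₑ ^ 2))
            (x + s • b 0 + t • b 1) := lintegral_frame b x (hm'.indicator (hB.inter hDm))
    _ ≤ ∫⁻ s : ℝ, ∫⁻ t : ℝ, fiberIntegral D x b (δ / 2) φ s *
          ∫⁻ s' : ℝ, lineDensity a (x + s' • b 0 + t • b 1) := by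
        refine lintegral_mono fun s => lintegral_mono fun t => ?_
        refine indicator_apply_le' (fun hy => ?_) fun _ => zero_le
        rw [← mul_assoc, ← ENNReal.ofReal_mul (le_of_lt (show 0 < _ from hD hy.2))]
        refine mul_le_mul' ?_ (enorm_sq_le_lintegral_lineDensity ha.1 ha.2.1 s t)
        have := hC.ofReal_le_fiberIntegral hD hφ (subset_closure hy.2) hy.1
        rwa [inner_frame_zero] at this
    _ = (∫⁻ s : ℝ, fiberIntegral D x b (δ / 2) φ s) *
          ∫⁻ t : ℝ, ∫⁻ s' : ℝ, lineDensity a (x + s' • b 0 + t • b 1) := by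
        rw [← lintegral_mul_const _ (measurable_fiberIntegral hp.isOpen _ hφ)]
        exact lintegral_congr fun s => lintegral_const_mul _ hmF
    _ ≤ 5 * ENNReal.ofReal ((1 / (δ / 2) + 4) * (‖U.1 0‖ * ‖U‖)) *
          ENNReal.ofReal (4 * ‖A‖ ^ 2) := by
        rw [lintegral_fiberIntegral hp.isOpen hD _ hφ,
          ← lintegral_frame_swap b x (measurable_lineDensity ha.1)]
        gcongr
        · exact lintegral_fiberDensity_le hp.isOpen hD (by positivity) hφ hU
        · exact lintegral_lineDensity_le hΩo hΩ ha hA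
    _ = _ := by
        have : (5 : ENNReal) = ENNReal.ofReal 5 := by norm_num
        rw [this, ← ENNReal.ofReal_mul (by norm_num), ← ENNReal.ofReal_mul (by positivity)]
        congr 1
        ring

/-- A product estimate for smooth functions. -/
theorem exists_product_bound (hp : IsPolygon D) (hD : D ⊆ {x | 0 < x 0}) (hΩo : IsOpen Ω)
    (hΩ : Ω ⊆ {x | 0 < x 0}) :
    ∃ C : ℝ, 0 ≤ C ∧ ∀ φ : Plane → ℝ,
      ContDiff ℝ ∞ φ → ∀ U : H1 D, U.1 0 =ᵐ[rMeasure D] φ → ∀ a, IsTest Ω a → ∀ A : HTilde Ω,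
      A.1 0 =ᵐ[rMeasure Ω] a →
      ∫⁻ y, ENNReal.ofReal (φ y ^ 2) * ‖a y‖ₑ ^ 2 ∂(rMeasure D) ≤
        ENNReal.ofReal (C * (‖U.1 0‖ * ‖U‖ * ‖A‖ ^ 2)) := by
  obtain ⟨C, hC0, hC⟩ := hp.isBounded.isCompact_closure.induction_on
    (p := fun t => ∃ C : ℝ, 0 ≤ C ∧ ∀ φ : Plane → ℝ,
      ContDiff ℝ ∞ φ → ∀ U : H1 D, U.1 0 =ᵐ[rMeasure D] φ → ∀ a, IsTest Ω a → ∀ A : HTilde Ω,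
      A.1 0 =ᵐ[rMeasure Ω] a →
      ∫⁻ y in t, ENNReal.ofReal (φ y ^ 2) * ‖a y‖ₑ ^ 2 ∂(rMeasure D) ≤
        ENNReal.ofReal (C * (‖U.1 0‖ * ‖U‖ * ‖A‖ ^ 2)))
    ⟨0, le_rfl, fun φ _ U _ a _ A _ => by simp⟩
    (fun s t hst ⟨C, h0, h⟩ => ⟨C, h0, fun φ hφ U hU a ha A hA =>
      (lintegral_mono_set hst).trans (h φ hφ U hU a ha A hA)⟩)
    (fun s t ⟨C, h0, h⟩ ⟨C', h0', h'⟩ => ⟨C + C', add_nonneg h0 h0', fun φ hφ U hU a ha A hA => by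
      refine (lintegral_union_le _ _ _).trans ?_
      rw [add_mul, ENNReal.ofReal_add (by positivity) (by positivity)]
      exact add_le_add (h φ hφ U hU a ha A hA) (h' φ hφ U hU a ha A hA)⟩)
    (fun x hx => exists_product_bound_local hp hD hΩo hΩ hx)
  refine ⟨C, hC0, fun φ hφ U hU a ha A hA => ?_⟩
  refine le_trans (le_of_eq ?_) (hC φ hφ U hU a ha A hA)
  have : ∀ᵐ y ∂(rMeasure D), y ∈ closure D := by
    rw [ae_rMeasure_iff hp.isOpen.measurableSet hD]
    filter_upwards [ae_restrict_mem hp.isOpen.measurableSet] with y hy using subset_closure hy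
  rw [Measure.restrict_eq_self_of_ae_mem this]

end ProductEstimate

/-! ### Mollification after a shift into the domain. -/

section ShiftMollify

open ContinuousLinearMap (lsmul)
open scoped Convolution

variable {D : Set Plane} {x : Plane} {b : OrthonormalBasis (Fin 2) ℝ Plane} {γ : ℝ → ℝ} {K : ℝ≥0}
  {δ c : ℝ}

/-- From y to y' the height above the base increases by at least ε - cε, while the graph rises by at
most K cε. Since (K + 1) c ≤ 1, the point stays above the graph. -/
theorem IsChart.shift_mem (hC : IsChart D x b γ K δ c) (hD : D ⊆ {x | 0 < x 0}) {y y' : Plane}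
    {ε : ℝ} (hy : y ∈ D)
    (hyx : ‖y' - x‖ < δ / 2) (hε : 0 < ε) (hεδ : ε ≤ δ / 4) (h : ‖y' - (y + ε • b 1)‖ ≤ c * ε) :
    y' ∈ D ∧ y 0 + c * ε ≤ 5 * y' 0 := by
  have hδ := hC.pos
  have hc2 := hC.cone_le
  rw [← sub_sub] at h
  have hn : ‖ε • b 1‖ = ε := by rw [norm_smul, b.norm_eq_one, mul_one, Real.norm_of_nonneg hε.le]
  have hcε : c * ε ≤ ε / 2 := by nlinarith
  have h1 : ‖y - x‖ < δ := by
    have : y - x = (y' - x) - (y' - y - ε • b 1) - ε • b 1 := by abel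
    rw [this]
    refine (norm_sub_le _ _).trans_lt ?_
    rw [hn]
    have := norm_sub_le (y' - x) (y' - y - ε • b 1)
    linarith
  have h2 : ‖y' - x‖ < δ := hyx.trans (by linarith)
  refine ⟨?_, hC.radius_le y y' ε (by linarith) (by linarith) hε.le
    (le_of_lt (show 0 < y 0 from hD hy)) h⟩
  have m1 := hC.mem_iff _ _ ((abs_inner_frame_le b (y - x) 0).trans_lt h1)
    ((abs_inner_frame_le b (y - x) 1).trans_lt h1)
  have m2 := hC.mem_iff _ _ ((abs_inner_frame_le b (y' - x) 0).trans_lt h2)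
    ((abs_inner_frame_le b (y' - x) 1).trans_lt h2)
  rw [point_eq_of_frame] at m1 m2
  refine m2.2 ?_
  have m3 := m1.1 hy
  have hort := b.orthonormal.2 (show (0 : Fin 2) ≠ 1 by decide)
  have e0 := (abs_inner_frame_le b (y' - y - ε • b 1) 0).trans h
  have e1 := (abs_inner_frame_le b (y' - y - ε • b 1) 1).trans h
  have hd : y' - y - ε • b 1 = (y' - x) - (y - x) - ε • b 1 := by abel
  rw [hd, inner_sub_right, inner_sub_right, inner_smul_right, hort, mul_zero, sub_zero] at e0
  rw [hd, inner_sub_right, inner_sub_right, inner_smul_right, real_inner_self_eq_norm_sq,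
    b.norm_eq_one, one_pow, mul_one] at e1
  have e2 := hC.lipschitz.dist_le_mul (inner ℝ (b 0) (y' - x)) (inner ℝ (b 0) (y - x))
  rw [Real.dist_eq, Real.dist_eq] at e2
  have e3 := (le_abs_self _).trans (e2.trans (mul_le_mul_of_nonneg_left e0 K.2))
  have e4 := (abs_le.1 e1).1
  have e5 := mul_le_mul_of_nonneg_right hC.cone_mul_le hε.le
  have e6 : (K : ℝ) * (c * ε) + c * ε ≤ ε := by linarith
  have e7 : K.1 * (c * ε) = (K : ℝ) * (c * ε) := rfl
  linarith

/-- The restriction of `h` to the part of `D` at distance more than `m` from the axis. -/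
def cutoff (D : Set Plane) (m : ℝ) (h : Plane → ℝ) : Plane → ℝ :=
  (D ∩ {z | m < z 0}).indicator h

theorem cutoff_eq_zero {m : ℝ} {h : Plane → ℝ} {t : Plane} (ht : h t = 0) : cutoff D m h t = 0 :=
  indicator_apply_eq_zero.2 fun _ => ht

theorem enorm_cutoff_le (m : ℝ) (h : Plane → ℝ) (t : Plane) : ‖cutoff D m h t‖ₑ ≤ ‖h t‖ₑ :=
  enorm_indicator_le_enorm_self _ _

theorem measurableSet_cutoff (hDo : IsOpen D) (m : ℝ) : MeasurableSet (D ∩ {z : Plane | m < z 0}) :=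
  (hDo.inter (isOpen_lt continuous_const (by fun_prop))).measurableSet

/-- Integrability against r dr dz does not give local integrability near the axis, which convolution
needs. On {r > m} the weight is bounded below. -/
theorem integrable_cutoff (hDo : IsOpen D) {m : ℝ} (hm : 0 < m) {h : Plane → ℝ}
    (hh : Integrable h (rMeasure D)) : Integrable (cutoff D m h) := by
  have h1 := (integrable_withDensity_iff_integrable_smul' (μ := volume.restrict D)
    (f := fun x : Plane => ENNReal.ofReal (x 0)) (by fun_prop)
    (Eventually.of_forall fun x => ENNReal.ofReal_lt_top)).1 hh
  have hms := measurableSet_cutoff hDo m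
  rw [cutoff, integrable_indicator_iff hms]
  have h2 : IntegrableOn (fun y : Plane => (ENNReal.ofReal (y 0)).toReal • h y)
    (D ∩ {z | m < z 0}) := IntegrableOn.mono_set h1 inter_subset_left
  have h3 : IntegrableOn (fun y : Plane => (y 0)⁻¹ • ((ENNReal.ofReal (y 0)).toReal • h y))
      (D ∩ {z | m < z 0}) := by
    refine Integrable.bdd_smul (hf := h2) m⁻¹ (by
      have : Measurable fun y : Plane => (y 0)⁻¹ := by fun_prop
      exact this.aestronglyMeasurable) ?_
    filter_upwards [ae_restrict_mem hms] with y hy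
    have : m < y 0 := hy.2
    rw [norm_inv, Real.norm_of_nonneg (hm.trans this).le]
    exact inv_anti₀ hm this.le
  refine h3.congr_fun (fun y hy => ?_) hms
  have : 0 < y 0 := hm.trans hy.2
  simp only [ENNReal.toReal_ofReal this.le, smul_eq_mul]
  rw [inv_mul_cancel_left₀ this.ne']

/-- Shift by `v` and mollification of the restriction of `h` to `D ∩ {r > m}`. -/
def shiftMollify (D : Set Plane) (ρ : ContDiffBump (0 : Plane)) (v : Plane) (m : ℝ)
    (h : Plane → ℝ) (y : Plane) : ℝ :=
  (ρ.normed volume ⋆[lsmul ℝ ℝ, volume] cutoff D m h) (y + v)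

variable {ρ : ContDiffBump (0 : Plane)} {v : Plane} {m : ℝ} {h h' : Plane → ℝ}

theorem shiftMollify_eq (y : Plane) : shiftMollify D ρ v m h y =
    ∫ t, ρ.normed volume (y + v - t) * cutoff D m h t := by
  rw [shiftMollify, convolution_lsmul_swap]
  rfl

theorem contDiff_shiftMollify (hDo : IsOpen D) (hm : 0 < m) (hh : Integrable h (rMeasure D)) :
    ContDiff ℝ ∞ (shiftMollify D ρ v m h) := by
  have h1 : ContDiff ℝ ∞ (ρ.normed volume ⋆[lsmul ℝ ℝ, volume] cutoff D m h) :=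
    ρ.hasCompactSupport_normed.contDiff_convolution_left (n := ⊤) (lsmul ℝ ℝ) ρ.contDiff_normed
      (integrable_cutoff hDo hm hh).locallyIntegrable
  exact h1.comp (by fun_prop : ContDiff ℝ ∞ fun y : Plane => y + v)

theorem shiftMollify_add (hDo : IsOpen D) (hm : 0 < m) (hh : Integrable h (rMeasure D))
    (hh' : Integrable h' (rMeasure D)) (y : Plane) :
    shiftMollify D ρ v m (fun y => h y + h' y) y =
      shiftMollify D ρ v m h y + shiftMollify D ρ v m h' y := by
  have e : cutoff D m (fun y => h y + h' y) = cutoff D m h + cutoff D m h' := indicator_add _ _ _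
  unfold shiftMollify
  rw [e]
  exact ConvolutionExistsAt.distrib_add
    (ρ.hasCompactSupport_normed.convolutionExists_left _ ρ.continuous_normed
      (integrable_cutoff hDo hm hh).locallyIntegrable _)
    (ρ.hasCompactSupport_normed.convolutionExists_left _ ρ.continuous_normed
      (integrable_cutoff hDo hm hh').locallyIntegrable _)

theorem fderiv_shiftMollify (hDo : IsOpen D) (hm : 0 < m) (hh : Integrable h (rMeasure D))
    (y e : Plane) : fderiv ℝ (shiftMollify D ρ v m h) y e =
      ∫ t, fderiv ℝ (ρ.normed volume) (y + v - t) e * cutoff D m h t := by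
  have hi := (integrable_cutoff hDo hm hh).locallyIntegrable
  have hρ : ContDiff ℝ 1 (ρ.normed volume) := ρ.contDiff_normed (n := 1)
  have h1 := ρ.hasCompactSupport_normed.hasFDerivAt_convolution_right (lsmul ℝ ℝ).flip hi hρ (y + v)
  rw [convolution_flip] at h1
  have h2 : HasFDerivAt (shiftMollify D ρ v m h) _ y := (hasFDerivAt_comp_add_right v).2 h1
  rw [h2.fderiv, convolution_precompR_apply _ hi (ρ.hasCompactSupport_normed.fderiv ℝ)
    (hρ.continuous_fderiv one_ne_zero)]
  rfl

theorem lintegral_mollifier (z : Plane) :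
    ∫⁻ y, ENNReal.ofReal (ρ.normed volume (y - z)) = 1 := by
  rw [lintegral_sub_right_eq_self (fun y => ENNReal.ofReal (ρ.normed volume y)) z,
    ← ofReal_integral_eq_lintegral_ofReal ρ.integrable_normed
      (Eventually.of_forall fun y => ρ.nonneg_normed y), ρ.integral_normed]
  simp

/-- Jensen's inequality for the probability measure given by the mollifier centered at y + v. -/
theorem enorm_shiftMollify_sq_le (hDo : IsOpen D) (hh : Measurable h) (y : Plane) :
    ‖shiftMollify D ρ v m h y‖ₑ ^ 2 ≤
      ∫⁻ t, ENNReal.ofReal (ρ.normed volume (y + v - t)) * ‖cutoff D m h t‖ₑ ^ 2 := by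
  have hk : Measurable fun t => ENNReal.ofReal (ρ.normed volume (y + v - t)) := by
    have : Continuous (ρ.normed volume) := ρ.continuous_normed
    fun_prop
  have hcm : Measurable (cutoff D m h) := hh.indicator (measurableSet_cutoff hDo m)
  set μ : Measure Plane :=
    volume.withDensity fun t => ENNReal.ofReal (ρ.normed volume (y + v - t)) with hμ
  have hprob : IsProbabilityMeasure μ := by
    refine ⟨?_⟩
    rw [hμ, withDensity_apply _ MeasurableSet.univ, Measure.restrict_univ]
    have := lintegral_mollifier (ρ := ρ) (y + v)
    rw [← this]
    refine lintegral_congr fun t => ?_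
    rw [← ρ.normed_neg, neg_sub]
  have h1 : ‖shiftMollify D ρ v m h y‖ₑ ≤ eLpNorm (cutoff D m h) 1 μ := by
    rw [eLpNorm_one_eq_lintegral_enorm, hμ, lintegral_withDensity_eq_lintegral_mul _ hk hcm.enorm,
      shiftMollify_eq]
    refine (enorm_integral_le_lintegral_enorm _).trans (lintegral_mono fun t => ?_)
    rw [Pi.mul_apply, enorm_mul, Real.enorm_of_nonneg (ρ.nonneg_normed _)]
  have h2 : eLpNorm (cutoff D m h) 1 μ ≤ eLpNorm (cutoff D m h) 2 μ :=
    eLpNorm_le_eLpNorm_of_exponent_le (by norm_num) hcm.aestronglyMeasurable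
  have h3 := eLpNorm_nnreal_pow_eq_lintegral (f := cutoff D m h) (μ := μ) (p := 2) (by norm_num)
  norm_num at h3
  calc _ ≤ eLpNorm (cutoff D m h) 2 μ ^ 2 := pow_le_pow_left' (h1.trans h2) 2
    _ = ∫⁻ t, ‖cutoff D m h t‖ₑ ^ 2 ∂μ := h3
    _ = _ := by
      rw [hμ, lintegral_withDensity_eq_lintegral_mul _ hk (hcm.enorm.pow_const 2)]
      rfl

theorem norm_le_of_mollifier_ne_zero {r : ℝ} (hρ : ρ.rOut = r) {y t : Plane}
    (ht : ρ.normed volume (y + v - t) ≠ 0) : ‖t - (y + v)‖ < r := by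
  have : y + v - t ∈ Function.support (ρ.normed volume) := ht
  rw [ρ.support_normed_eq, mem_ball_zero_iff, hρ] at this
  rwa [norm_sub_rev]

/-- A point t that contributes to the value at y lies in the cone above y, so y₀ ≤ 5 t₀: after
Jensen's inequality the weight at y is exchanged for the weight at t, and the mollifier integrates
to 1 in y. The bound does not depend on ε or m. -/
theorem lintegral_shiftMollify_sq_le (hC : IsChart D x b γ K δ c) (hDo : IsOpen D)
    (hD : D ⊆ {x | 0 < x 0}) (hh : Measurable h) (hs : ∀ y, h y ≠ 0 → ‖y - x‖ < δ / 2) {ε : ℝ}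
    (hε : 0 < ε) (hεδ : ε ≤ δ / 4) (hρ : ρ.rOut = c * ε) :
    ∫⁻ y, ‖shiftMollify D ρ (ε • b 1) m h y‖ₑ ^ 2 ∂(rMeasure D) ≤
      5 * ∫⁻ y, ‖h y‖ₑ ^ 2 ∂(rMeasure D) := by
  have hcm : Measurable (cutoff D m h) := hh.indicator (measurableSet_cutoff hDo m)
  have hρc : Continuous (ρ.normed volume) := ρ.continuous_normed
  have hk : Measurable fun p : Plane × Plane =>
      ENNReal.ofReal (ρ.normed volume (p.1 + ε • b 1 - p.2)) := by fun_prop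
  have hcε : 0 < c * ε := mul_pos hC.cone_pos hε
  have hmeas : Measurable fun p : Plane × Plane =>
      ENNReal.ofReal (ρ.normed volume (p.1 + ε • b 1 - p.2)) *
        (5 * ENNReal.ofReal (p.2 0) * ‖cutoff D m h p.2‖ₑ ^ 2) :=
    hk.mul ((by fun_prop : Measurable fun p : Plane × Plane => 5 * ENNReal.ofReal (p.2 0)).mul
      ((hcm.comp measurable_snd).enorm.pow_const 2))
  calc ∫⁻ y, ‖shiftMollify D ρ (ε • b 1) m h y‖ₑ ^ 2 ∂(rMeasure D)
      = ∫⁻ y in D, ENNReal.ofReal (y 0) * ‖shiftMollify D ρ (ε • b 1) m h y‖ₑ ^ 2 :=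
        lintegral_rMeasure _
    _ ≤ ∫⁻ y in D, ∫⁻ t, ENNReal.ofReal (ρ.normed volume (y + ε • b 1 - t)) *
          (5 * ENNReal.ofReal (t 0) * ‖cutoff D m h t‖ₑ ^ 2) := by
        refine setLIntegral_mono' hDo.measurableSet fun y hy => ?_
        refine (mul_le_mul_right (enorm_shiftMollify_sq_le hDo hh y) _).trans ?_
        rw [← lintegral_const_mul']
        · refine lintegral_mono fun t => ?_
          by_cases h1 : ρ.normed volume (y + ε • b 1 - t) = 0
          · simp [h1]
          by_cases h2 : h t = 0
          · simp [cutoff_eq_zero h2]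
          obtain ⟨-, h4⟩ := hC.shift_mem hD hy (hs t h2) hε hεδ
            (norm_le_of_mollifier_ne_zero hρ h1).le
          have h5 : ENNReal.ofReal (y 0) ≤ 5 * ENNReal.ofReal (t 0) := by
            have : (5 : ENNReal) = ENNReal.ofReal 5 := by norm_num
            rw [this, ← ENNReal.ofReal_mul (by norm_num)]
            exact ENNReal.ofReal_le_ofReal (by linarith)
          calc _ = ENNReal.ofReal (ρ.normed volume (y + ε • b 1 - t)) *
                (ENNReal.ofReal (y 0) * ‖cutoff D m h t‖ₑ ^ 2) := by ring
            _ ≤ _ := by gcongr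
        · exact ENNReal.ofReal_ne_top
    _ ≤ ∫⁻ y, ∫⁻ t, ENNReal.ofReal (ρ.normed volume (y + ε • b 1 - t)) *
          (5 * ENNReal.ofReal (t 0) * ‖cutoff D m h t‖ₑ ^ 2) := setLIntegral_le_lintegral _ _
    _ = ∫⁻ t, ∫⁻ y, ENNReal.ofReal (ρ.normed volume (y + ε • b 1 - t)) *
          (5 * ENNReal.ofReal (t 0) * ‖cutoff D m h t‖ₑ ^ 2) :=
        lintegral_lintegral_swap hmeas.aemeasurable
    _ = ∫⁻ t, 5 * ENNReal.ofReal (t 0) * ‖cutoff D m h t‖ₑ ^ 2 := by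
        refine lintegral_congr fun t => ?_
        rw [lintegral_mul_const]
        · have := lintegral_mollifier (ρ := ρ) (t - ε • b 1)
          simp only [sub_sub_eq_add_sub] at this
          rw [this, one_mul]
        · fun_prop
    _ ≤ ∫⁻ t in D, 5 * (ENNReal.ofReal (t 0) * ‖h t‖ₑ ^ 2) := by
        rw [← lintegral_indicator hDo.measurableSet]
        refine lintegral_mono fun t => ?_
        by_cases ht : t ∈ D
        · rw [indicator_of_mem ht, mul_assoc]
          gcongr
          exact enorm_cutoff_le m h t
        · simp [cutoff, ht]
    _ = _ := by
        rw [lintegral_const_mul' _ _ (by norm_num), lintegral_rMeasure]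

theorem eLpNorm_shiftMollify_le (hC : IsChart D x b γ K δ c) (hDo : IsOpen D)
    (hD : D ⊆ {x | 0 < x 0}) (hh : Measurable h) (hs : ∀ y, h y ≠ 0 → ‖y - x‖ < δ / 2) {ε : ℝ}
    (hε : 0 < ε) (hεδ : ε ≤ δ / 4) (hρ : ρ.rOut = c * ε) :
    eLpNorm (shiftMollify D ρ (ε • b 1) m h) 2 (rMeasure D) ≤ 3 * eLpNorm h 2 (rMeasure D) := by
  have h1 := eLpNorm_nnreal_pow_eq_lintegral (f := shiftMollify D ρ (ε • b 1) m h)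
    (μ := rMeasure D) (p := 2) (by norm_num)
  have h2 := eLpNorm_nnreal_pow_eq_lintegral (f := h)
    (μ := rMeasure D) (p := 2) (by norm_num)
  norm_num at h1 h2
  have h3 := lintegral_shiftMollify_sq_le (m := m) hC hDo hD hh hs hε hεδ hρ
  rw [← h1, ← h2] at h3
  have h4 : eLpNorm (shiftMollify D ρ (ε • b 1) m h) 2 (rMeasure D) ^ 2 ≤
      (3 * eLpNorm h 2 (rMeasure D)) ^ 2 := by
    refine h3.trans ?_
    rw [mul_pow]
    gcongr
    norm_num
  exact (ENNReal.pow_le_pow_left_iff two_ne_zero).1 h4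

/-- On the support of k and h one has 5 t₀ ≥ y₀ + cε > cε = 10 m, so t₀ > m and t ∈ D: the cutoff
does not act. -/
theorem integral_cutoff_eq (hC : IsChart D x b γ K δ c) (hDo : IsOpen D) (hD : D ⊆ {x | 0 < x 0})
    (hs : ∀ y, h y ≠ 0 → ‖y - x‖ < δ / 2) {ε : ℝ}
    (hε : 0 < ε) (hεδ : ε ≤ δ / 4) {y : Plane} (hy : y ∈ D) {k : Plane → ℝ}
    (hk : ∀ t, k t ≠ 0 → ‖t - (y + ε • b 1)‖ ≤ c * ε) (hm : 10 * m = c * ε) :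
    ∫ t, k t * cutoff D m h t = ∫ t in D, k t * h t := by
  rw [← integral_indicator hDo.measurableSet]
  refine integral_congr_ae (Eventually.of_forall fun t => ?_)
  have hcε : 0 < c * ε := mul_pos hC.cone_pos hε
  classical
  simp only [cutoff, indicator_apply]
  by_cases h1 : k t = 0
  · simp [h1]
  by_cases h2 : h t = 0
  · simp [h2]
  obtain ⟨h3, h4⟩ := hC.shift_mem hD hy (hs t h2) hε hεδ (hk t h1)
  have h5 : 0 < y 0 := hD hy
  rw [if_pos ⟨h3, show m < t 0 by linarith⟩, if_pos h3]

/-- On `D`, the derivatives of a shifted mollification are shifted mollifications of the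
distributional derivatives. -/
theorem fderiv_shiftMollify_of_isWeakPartial (hC : IsChart D x b γ K δ c) (hDo : IsOpen D)
    (hD : D ⊆ {x | 0 < x 0}) (hb : Bornology.IsBounded D) {χ : Plane → ℝ} (hχ : ContDiff ℝ ∞ χ)
    (hχs : tsupport χ ⊆ {y | ‖y - x‖ < δ / 2}) {i : Fin 2} {u w : Lp ℝ 2 (rMeasure D)}
    (huw : IsWeakPartial D i u w) {ε : ℝ}
    (hε : 0 < ε) (hεδ : ε ≤ δ / 4) (hρ : ρ.rOut = c * ε) (hm : 10 * m = c * ε)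
    {y : Plane} (hy : y ∈ D) :
    fderiv ℝ (shiftMollify D ρ (ε • b 1) m fun y => χ y * u y) y (EuclideanSpace.single i 1) =
      shiftMollify D ρ (ε • b 1) m (fun y => χ y * w y +
        fderiv ℝ χ y (EuclideanSpace.single i 1) * u y) y := by
  have hcε : 0 < c * ε := mul_pos hC.cone_pos hε
  have hm0 : 0 < m := by linarith
  have := isFiniteMeasure_rMeasure hb
  have hint : Integrable (fun y => χ y * u y) (rMeasure D) :=
    ((memLp_rMeasure_of_continuous hb hχ.continuous).integrable_mul (Lp.memLp u))
  set e : Plane := EuclideanSpace.single i 1 with he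
  have hρs : ContDiff ℝ ∞ (ρ.normed volume) := ρ.contDiff_normed (n := ⊤)
  have hs0 : ∀ t, χ t ≠ 0 → ‖t - x‖ < δ / 2 := fun t ht => hχs (subset_tsupport _ ht)
  have hs1 : ∀ t, fderiv ℝ χ t e ≠ 0 → ‖t - x‖ < δ / 2 := fun t ht =>
    hχs (tsupport_fderiv_apply_subset ℝ e (subset_tsupport _ ht))
  have hρ0 : ∀ t, ρ.normed volume (y + ε • b 1 - t) ≠ 0 → ‖t - (y + ε • b 1)‖ ≤ c * ε :=
    fun t ht => (norm_le_of_mollifier_ne_zero hρ ht).le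
  have hρ1 : ∀ t, fderiv ℝ (ρ.normed volume) (y + ε • b 1 - t) e ≠ 0 →
      ‖t - (y + ε • b 1)‖ ≤ c * ε := fun t ht => by
    have : y + ε • b 1 - t ∈ tsupport (ρ.normed volume) :=
      tsupport_fderiv_apply_subset ℝ e (subset_tsupport _ ht)
    rw [ρ.tsupport_normed_eq, mem_closedBall_zero_iff, hρ] at this
    rwa [norm_sub_rev]
  rw [fderiv_shiftMollify hDo hm0 hint, shiftMollify_eq,
    integral_cutoff_eq hC hDo hD (fun t ht => hs0 t (left_ne_zero_of_mul ht)) hε hεδ hy hρ1 hm,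
    integral_cutoff_eq hC hDo hD (fun t ht => ?_) hε hεδ hy hρ0 hm]
  swap
  · by_contra hcon
    have h1 : χ t = 0 := by by_contra h; exact hcon (hs0 t h)
    have h2 : fderiv ℝ χ t e = 0 := by by_contra h; exact hcon (hs1 t h)
    exact ht (by rw [h1, h2]; ring)
  set k : Plane → ℝ := fun t => ρ.normed volume (y + ε • b 1 - t) with hkdef
  have hk : ContDiff ℝ ∞ k := hρs.comp (by fun_prop)
  have hkd : ∀ t, HasFDerivAt k (-fderiv ℝ (ρ.normed volume) (y + ε • b 1 - t)) t := fun t => by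
    have h1 := ((hρs.differentiable (by simp) (y + ε • b 1 - t)).hasFDerivAt).comp t
      ((hasFDerivAt_id t).const_sub (y + ε • b 1))
    refine h1.congr_fderiv ?_
    ext z
    simp
  -- As a function of t, the shifted kernel times χ is supported in the cone above y, inside D,
  -- although y may be close to the boundary. It is therefore a legitimate test function for the
  -- weak derivative of u.
  set ψ : Plane → ℝ := fun t => k t * χ t with hψdef
  have hclosed : IsClosed {t : Plane | ‖t - (y + ε • b 1)‖ ≤ c * ε} :=
    isClosed_le (by fun_prop) continuous_const
  have hcpt : IsCompact {t : Plane | ‖t - (y + ε • b 1)‖ ≤ c * ε} := by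
    have : {t : Plane | ‖t - (y + ε • b 1)‖ ≤ c * ε} = Metric.closedBall (y + ε • b 1) (c * ε) := by
      ext t; simp [dist_eq_norm]
    rw [this]
    exact isCompact_closedBall _ _
  have key : ∀ g : Plane → ℝ, (∀ t, g t ≠ 0 → ‖t - (y + ε • b 1)‖ ≤ c * ε ∧ t ∈ tsupport χ) →
      HasCompactSupport g ∧ tsupport g ⊆ D ∩ {x | 0 < x 0} := by
    intro g hg
    have hsub : tsupport g ⊆ {t | ‖t - (y + ε • b 1)‖ ≤ c * ε} ∩ tsupport χ :=
      closure_minimal (fun t ht => hg t ht) (hclosed.inter (isClosed_tsupport χ))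
    refine ⟨hcpt.of_isClosed_subset (isClosed_tsupport g) (hsub.trans inter_subset_left), ?_⟩
    intro t ht
    have := (hC.shift_mem hD hy (hχs (hsub ht).2) hε hεδ (hsub ht).1).1
    exact ⟨this, hD this⟩
  obtain ⟨k1, k2⟩ := key ψ fun t ht =>
    ⟨hρ0 t (left_ne_zero_of_mul ht), subset_tsupport _ (right_ne_zero_of_mul ht)⟩
  obtain ⟨k3, k4⟩ := key (fun t => fderiv ℝ (ρ.normed volume) (y + ε • b 1 - t) e * χ t)
    fun t ht => ⟨hρ1 t (left_ne_zero_of_mul ht), subset_tsupport _ (right_ne_zero_of_mul ht)⟩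
  obtain ⟨k5, k6⟩ := key (fun t => k t * fderiv ℝ χ t e) fun t ht =>
    ⟨hρ0 t (left_ne_zero_of_mul ht),
      tsupport_fderiv_apply_subset ℝ e (subset_tsupport _ (right_ne_zero_of_mul ht))⟩
  have hχ1c : Continuous fun t => fderiv ℝ χ t e :=
    (hχ.continuous_fderiv (by simp)).clm_apply continuous_const
  have hρ1c : Continuous fun t => fderiv ℝ (ρ.normed volume) (y + ε • b 1 - t) e :=
    ((hρs.continuous_fderiv (by simp)).comp (by fun_prop)).clm_apply continuous_const
  have i1 : Integrable (fun t => (k t * χ t) • w t) (volume.restrict D) :=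
    integrable_smul_of_support (hk.continuous.mul hχ.continuous) k1 k2 w
  have i2 : Integrable (fun t => (fderiv ℝ (ρ.normed volume) (y + ε • b 1 - t) e * χ t) • u t)
      (volume.restrict D) := integrable_smul_of_support (hρ1c.mul hχ.continuous) k3 k4 u
  have i3 : Integrable (fun t => (k t * fderiv ℝ χ t e) • u t) (volume.restrict D) :=
    integrable_smul_of_support (hk.continuous.mul hχ1c) k5 k6 u
  have hweak := huw ψ ⟨hk.mul hχ, k1, k2⟩
  have hψd : ∀ t, fderiv ℝ ψ t e =
      k t * fderiv ℝ χ t e - fderiv ℝ (ρ.normed volume) (y + ε • b 1 - t) e * χ t := fun t => by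
    have h1 := (hkd t).mul (hχ.differentiable (by simp) t).hasFDerivAt
    have h2 : fderiv ℝ ψ t = _ := h1.fderiv
    rw [h2]
    simp
    ring
  simp only [← he, hψd, sub_smul] at hweak
  rw [integral_sub i3 i2] at hweak
  have e1 : ∫ t in D, k t * (χ t * w t + fderiv ℝ χ t e * u t) =
      (∫ t in D, (k t * χ t) • w t) + ∫ t in D, (k t * fderiv ℝ χ t e) • u t := by
    rw [← integral_add i1 i3]
    refine integral_congr_ae (Eventually.of_forall fun t => ?_)
    simp only [smul_eq_mul]
    ring
  have e2 : ∫ t in D, fderiv ℝ (ρ.normed volume) (y + ε • b 1 - t) e * (χ t * u t) =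
      ∫ t in D, (fderiv ℝ (ρ.normed volume) (y + ε • b 1 - t) e * χ t) • u t := by
    refine integral_congr_ae (Eventually.of_forall fun t => ?_)
    simp only [smul_eq_mul]
    ring
  rw [e1, e2]
  linarith

end ShiftMollify

/-! ### Density of smooth functions in H¹₁. -/

section Density

open scoped Manifold

variable {D : Set Plane} {x : Plane} {b : OrthonormalBasis (Fin 2) ℝ Plane} {γ : ℝ → ℝ} {K : ℝ≥0}
  {δ c : ℝ}

/-- For y in D only values of h at distance at most ε + cε from y enter, unaffected by the cutoff,
and h is uniformly continuous. -/
theorem eventually_dist_shiftMollify_le (hC : IsChart D x b γ K δ c) (hDo : IsOpen D)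
    (hD : D ⊆ {x | 0 < x 0}) {h : Plane → ℝ} (hc : Continuous h) (hK : HasCompactSupport h)
    (hs : ∀ y, h y ≠ 0 → ‖y - x‖ < δ / 2) {η : ℝ} (hη : 0 < η) :
    ∀ᶠ ε in 𝓝[>] (0 : ℝ), ∀ ρ : ContDiffBump (0 : Plane), ρ.rOut = c * ε → ∀ y ∈ D,
      dist (shiftMollify D ρ (ε • b 1) (c * ε / 10) h y) (h y) ≤ η := by
  have hδ := hC.pos
  obtain ⟨δ', hδ', hu⟩ := Metric.uniformContinuous_iff.1 (hK.uniformContinuous_of_continuous hc) η hη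
  have h1 : ∀ᶠ ε in 𝓝[>] (0 : ℝ), ε < min (δ / 4) (δ' / 2) :=
    (eventually_lt_nhds (lt_min (by positivity) (by positivity))).filter_mono nhdsWithin_le_nhds
  filter_upwards [h1, self_mem_nhdsWithin] with ε h2 hε ρ hρ y hy
  have hε : 0 < ε := hε
  have h3 : ε < δ / 4 := h2.trans_le (min_le_left _ _)
  have h4 : ε < δ' / 2 := h2.trans_le (min_le_right _ _)
  have hcε : 0 < c * ε := mul_pos hC.cone_pos hε
  have hce : c * ε ≤ ε / 2 := by nlinarith [hC.cone_le]
  unfold shiftMollify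
  refine dist_convolution_le hη.le (R := c * ε) ?_ ρ.nonneg_normed ρ.integral_normed
    ((hc.aestronglyMeasurable).indicator (measurableSet_cutoff hDo _)) fun t ht => ?_
  · rw [ρ.support_normed_eq, hρ]
  rw [Metric.mem_ball, dist_eq_norm] at ht
  have h5 : cutoff D (c * ε / 10) h t = h t := by
    by_cases h0 : h t = 0
    · rw [cutoff_eq_zero h0, h0]
    · obtain ⟨h6, h7⟩ := hC.shift_mem hD hy (hs t h0) hε h3.le ht.le
      have h8 : 0 < y 0 := hD hy
      have h9 : t ∈ D ∩ {z | c * ε / 10 < z 0} := ⟨h6, show c * ε / 10 < t 0 by linarith⟩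
      exact indicator_of_mem h9 h
  rw [h5]
  refine (hu ?_).le
  have h9 : t - y = t - (y + ε • b 1) + ε • b 1 := by abel
  rw [dist_eq_norm, h9]
  refine (norm_add_le _ _).trans_lt ?_
  rw [norm_smul, b.norm_eq_one, mul_one, Real.norm_of_nonneg hε.le]
  linarith

theorem eventually_eLpNorm_shiftMollify_sub_le (hC : IsChart D x b γ K δ c) (hDo : IsOpen D)
    (hD : D ⊆ {x | 0 < x 0}) (hb : Bornology.IsBounded D) {χ : Plane → ℝ} (hχ : Continuous χ)
    (hχK : HasCompactSupport χ) (hχs : tsupport χ ⊆ {y | ‖y - x‖ < δ / 2})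
    (g : Lp ℝ 2 (rMeasure D)) {η : ℝ} (hη : 0 < η) :
    ∀ᶠ ε in 𝓝[>] (0 : ℝ), ∀ ρ : ContDiffBump (0 : Plane), ρ.rOut = c * ε →
      eLpNorm (fun y => shiftMollify D ρ (ε • b 1) (c * ε / 10) (fun y => χ y * g y) y - χ y * g y) 2
        (rMeasure D) ≤ ENNReal.ofReal η := by
  have hδ := hC.pos
  have := isFiniteMeasure_rMeasure hb
  obtain ⟨M, hM⟩ := hχK.exists_bound_of_continuous hχ
  have hM0 : 0 ≤ M := (norm_nonneg _).trans (hM 0)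
  have hs0 : ∀ t, χ t ≠ 0 → ‖t - x‖ < δ / 2 := fun t ht => hχs (subset_tsupport _ ht)
  -- g is replaced by a test function ψ up to a remainder d = χ(g - ψ) of norm at most η/8. Its
  -- mollification has norm at most 3η/8, the smooth part contributes η/2, and η/8 + 3η/8 + η/2 = η.
  obtain ⟨u, hu, ψ, hψ, huψ⟩ := Metric.dense_iff.1 (dense_test hDo hD hb) g (η / (8 * (M + 1)))
    (by positivity)
  rw [Metric.mem_ball, dist_comm, dist_eq_norm] at hu
  set V : ℝ := ((rMeasure D) univ).toReal ^ (2 : ℝ)⁻¹ with hV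
  have hV0 : 0 ≤ V := by positivity
  have hψc := hψ.1.continuous
  have hχψ : HasCompactSupport fun y => χ y * ψ y := hχK.mul_right
  filter_upwards [eventually_dist_shiftMollify_le hC hDo hD (hχ.mul hψc) hχψ
    (fun y hy => hs0 y (left_ne_zero_of_mul hy)) (η := η / (2 * (V + 1))) (by positivity),
    (eventually_lt_nhds (show (0 : ℝ) < δ / 4 by positivity)).filter_mono nhdsWithin_le_nhds,
    self_mem_nhdsWithin] with ε h1 h2 hε ρ hρ
  have hε : 0 < ε := hε
  have hcε : 0 < c * ε := mul_pos hC.cone_pos hε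
  have hm : 0 < c * ε / 10 := by positivity
  set d : Plane → ℝ := fun y => χ y * (g y - ψ y) with hd
  have hψm : MemLp ψ 2 (rMeasure D) := memLp_rMeasure_of_continuous hb hψc
  have hχm : MemLp χ 2 (rMeasure D) := memLp_rMeasure_of_continuous hb hχ
  have hdi : Integrable d (rMeasure D) := hχm.integrable_mul ((Lp.memLp g).sub hψm)
  have hχψi : Integrable (fun y => χ y * ψ y) (rMeasure D) := hχm.integrable_mul hψm
  have hgm : Measurable g := (Lp.stronglyMeasurable g).measurable
  have hdm : Measurable d := hχ.measurable.mul (hgm.sub hψc.measurable)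
  have hsplit : (fun y => χ y * g y) = fun y => d y + χ y * ψ y := by
    ext y; simp only [hd]; ring
  have e1 : eLpNorm d 2 (rMeasure D) ≤ ENNReal.ofReal (η / 8) := by
    have h3 : eLpNorm d 2 (rMeasure D) ≤ ENNReal.ofReal M *
        eLpNorm (fun y => g y - ψ y) 2 (rMeasure D) := by
      refine eLpNorm_le_mul_eLpNorm_of_ae_le_mul (Eventually.of_forall fun y => ?_) 2
      rw [hd, norm_mul]
      exact mul_le_mul_of_nonneg_right (hM y) (norm_nonneg _)
    have h4 : eLpNorm (fun y => g y - ψ y) 2 (rMeasure D) = ENNReal.ofReal ‖g - u‖ := by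
      rw [Lp.norm_def, ENNReal.ofReal_toReal (Lp.eLpNorm_ne_top _)]
      refine eLpNorm_congr_ae ?_
      filter_upwards [Lp.coeFn_sub g u, huψ] with y a1 a2
      rw [a1, Pi.sub_apply, a2]
    rw [h4, ← ENNReal.ofReal_mul hM0] at h3
    refine h3.trans (ENNReal.ofReal_le_ofReal ?_)
    calc M * ‖g - u‖ ≤ (M + 1) * (η / (8 * (M + 1))) := by gcongr; linarith
      _ = η / 8 := by field_simp
  have e2 : eLpNorm (shiftMollify D ρ (ε • b 1) (c * ε / 10) d) 2 (rMeasure D) ≤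
      ENNReal.ofReal (3 * (η / 8)) := by
    refine (eLpNorm_shiftMollify_le hC hDo hD hdm (fun y hy => hs0 y (left_ne_zero_of_mul hy)) hε h2.le
      hρ).trans ?_
    rw [ENNReal.ofReal_mul (by norm_num)]
    norm_num
    gcongr
  have hS1 := (contDiff_shiftMollify (ρ := ρ) (v := ε • b 1) hDo hm hdi).continuous
  have hS2 := (contDiff_shiftMollify (ρ := ρ) (v := ε • b 1) hDo hm hχψi).continuous
  have e3 : eLpNorm (fun y => shiftMollify D ρ (ε • b 1) (c * ε / 10) (fun y => χ y * ψ y) y -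
      χ y * ψ y) 2 (rMeasure D) ≤ ENNReal.ofReal (η / 2) := by
    refine (eLpNorm_le_of_ae_bound (C := η / (2 * (V + 1))) ?_).trans ?_
    · refine (ae_rMeasure_iff hDo.measurableSet hD).2 ?_
      filter_upwards [ae_restrict_mem hDo.measurableSet] with y hy
      rw [← dist_eq_norm]
      exact h1 ρ hρ y hy
    · have h5 : (rMeasure D univ) ^ (2 : ENNReal).toReal⁻¹ = ENNReal.ofReal V := by
        rw [hV, ENNReal.toReal_ofNat, ← ENNReal.ofReal_rpow_of_nonneg ENNReal.toReal_nonneg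
          (by norm_num), ENNReal.ofReal_toReal (measure_ne_top _ _)]
      rw [h5, ← ENNReal.ofReal_mul hV0]
      refine ENNReal.ofReal_le_ofReal ?_
      calc V * (η / (2 * (V + 1))) ≤ (V + 1) * (η / (2 * (V + 1))) := by gcongr; linarith
        _ = η / 2 := by field_simp
  have e4 : (fun y => shiftMollify D ρ (ε • b 1) (c * ε / 10) (fun y => χ y * g y) y - χ y * g y) =
      (shiftMollify D ρ (ε • b 1) (c * ε / 10) d + fun y =>
        shiftMollify D ρ (ε • b 1) (c * ε / 10) (fun y => χ y * ψ y) y - χ y * ψ y) - d := by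
    ext y
    rw [hsplit, shiftMollify_add hDo hm hdi hχψi]
    simp only [Pi.add_apply, Pi.sub_apply, hd]
    ring
  rw [e4]
  refine (eLpNorm_sub_le ((hS1.aestronglyMeasurable).add
    (hS2.sub (hχ.mul hψc)).aestronglyMeasurable) hdm.aestronglyMeasurable (by norm_num)).trans ?_
  refine (add_le_add_left (eLpNorm_add_le hS1.aestronglyMeasurable
    (hS2.sub (hχ.mul hψc)).aestronglyMeasurable (by norm_num)) _).trans ?_
  refine (add_le_add (add_le_add e2 e3) e1).trans ?_
  rw [← ENNReal.ofReal_add (by positivity) (by positivity),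
    ← ENNReal.ofReal_add (by positivity) (by positivity)]
  exact ENNReal.ofReal_le_ofReal (by linarith)

theorem exists_smooth_approx_local (hC : IsChart D x b γ K δ c) (hDo : IsOpen D)
    (hD : D ⊆ {x | 0 < x 0}) (hb : Bornology.IsBounded D) {χ : Plane → ℝ} (hχ : ContDiff ℝ ∞ χ)
    (hχs : tsupport χ ⊆ {y | ‖y - x‖ < δ / 2}) (U : H1 D) {η : ℝ} (hη : 0 < η) :
    ∃ φ : Plane → ℝ, ContDiff ℝ ∞ φ ∧
      eLpNorm (fun y => φ y - χ y * U.1 0 y) 2 (rMeasure D) ≤ ENNReal.ofReal η ∧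
      eLpNorm (fun y => fderiv ℝ φ y (EuclideanSpace.single 0 1) - (χ y * U.1 1 y +
        fderiv ℝ χ y (EuclideanSpace.single 0 1) * U.1 0 y)) 2 (rMeasure D) ≤ ENNReal.ofReal η ∧
      eLpNorm (fun y => fderiv ℝ φ y (EuclideanSpace.single 1 1) - (χ y * U.1 2 y +
        fderiv ℝ χ y (EuclideanSpace.single 1 1) * U.1 0 y)) 2 (rMeasure D) ≤ ENNReal.ofReal η := by
  have hδ := hC.pos
  have := isFiniteMeasure_rMeasure hb
  have hK : HasCompactSupport χ := by
    refine Metric.isCompact_of_isClosed_isBounded (isClosed_tsupport χ)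
      (Metric.isBounded_ball.subset (t := Metric.ball x (δ / 2)) fun y hy => ?_)
    rw [Metric.mem_ball, dist_eq_norm]
    exact hχs hy
  have hd : ∀ i : Fin 2, Continuous fun x => fderiv ℝ χ x (EuclideanSpace.single i 1) := fun _ =>
    (hχ.continuous_fderiv (by simp)).clm_apply continuous_const
  have ev := fun g : Lp ℝ 2 (rMeasure D) => eventually_eLpNorm_shiftMollify_sub_le hC hDo hD hb
    hχ.continuous hK hχs g (half_pos hη)
  have ev' := fun (i : Fin 2) (g : Lp ℝ 2 (rMeasure D)) =>
    eventually_eLpNorm_shiftMollify_sub_le hC hDo hD hb (hd i) (hK.fderiv_apply ℝ _)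
      ((tsupport_fderiv_apply_subset ℝ _).trans hχs) g (half_pos hη)
  -- A single ε serves all five functions: χ times the three components of U, and the two partial
  -- derivatives of χ times U.
  obtain ⟨ε, h0, h1, h2, h3, h4, hεδ, hε⟩ := ((ev (U.1 0)).and ((ev (U.1 1)).and ((ev (U.1 2)).and
    ((ev' 0 (U.1 0)).and ((ev' 1 (U.1 0)).and (((eventually_lt_nhds
      (show (0 : ℝ) < δ / 4 by positivity)).filter_mono nhdsWithin_le_nhds).and
        self_mem_nhdsWithin)))))).exists
  have hε : 0 < ε := hε
  have hcε : 0 < c * ε := mul_pos hC.cone_pos hε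
  have hm : 0 < c * ε / 10 := by positivity
  let ρ : ContDiffBump (0 : Plane) := ⟨c * ε / 2, c * ε, by positivity, by linarith⟩
  have hχm : MemLp χ 2 (rMeasure D) := memLp_rMeasure_of_continuous hb hχ.continuous
  have hi : ∀ g : Lp ℝ 2 (rMeasure D), Integrable (fun y => χ y * g y) (rMeasure D) :=
    fun g => hχm.integrable_mul (Lp.memLp g)
  have hi' : ∀ (i : Fin 2) (g : Lp ℝ 2 (rMeasure D)),
      Integrable (fun y => fderiv ℝ χ y (EuclideanSpace.single i 1) * g y) (rMeasure D) :=
    fun i g => (memLp_rMeasure_of_continuous hb (hd i)).integrable_mul (Lp.memLp g)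
  have key : ∀ (i : Fin 2) (w : Lp ℝ 2 (rMeasure D)), IsWeakPartial D i (U.1 0) w →
      eLpNorm (fun y => shiftMollify D ρ (ε • b 1) (c * ε / 10) (fun y => χ y * w y) y -
        χ y * w y) 2 (rMeasure D) ≤ ENNReal.ofReal (η / 2) →
      eLpNorm (fun y => shiftMollify D ρ (ε • b 1) (c * ε / 10)
        (fun y => fderiv ℝ χ y (EuclideanSpace.single i 1) * U.1 0 y) y -
        fderiv ℝ χ y (EuclideanSpace.single i 1) * U.1 0 y) 2 (rMeasure D) ≤
          ENNReal.ofReal (η / 2) →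
      eLpNorm (fun y => fderiv ℝ (shiftMollify D ρ (ε • b 1) (c * ε / 10) fun y => χ y * U.1 0 y) y
        (EuclideanSpace.single i 1) - (χ y * w y +
        fderiv ℝ χ y (EuclideanSpace.single i 1) * U.1 0 y)) 2 (rMeasure D) ≤ ENNReal.ofReal η := by
    intro i w hw a1 a2
    have e : (fun y => fderiv ℝ (shiftMollify D ρ (ε • b 1) (c * ε / 10) fun y => χ y * U.1 0 y) y
        (EuclideanSpace.single i 1) - (χ y * w y +
        fderiv ℝ χ y (EuclideanSpace.single i 1) * U.1 0 y)) =ᵐ[rMeasure D]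
        (fun y => shiftMollify D ρ (ε • b 1) (c * ε / 10) (fun y => χ y * w y) y -
        χ y * w y) + fun y => shiftMollify D ρ (ε • b 1) (c * ε / 10)
        (fun y => fderiv ℝ χ y (EuclideanSpace.single i 1) * U.1 0 y) y -
        fderiv ℝ χ y (EuclideanSpace.single i 1) * U.1 0 y := by
      refine (ae_rMeasure_iff hDo.measurableSet hD).2 ?_
      filter_upwards [ae_restrict_mem hDo.measurableSet] with y hy
      rw [fderiv_shiftMollify_of_isWeakPartial hC hDo hD hb hχ hχs hw hε hεδ.le rfl (by ring) hy,
        shiftMollify_add hDo hm (hi w) (hi' i _), Pi.add_apply]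
      ring
    rw [eLpNorm_congr_ae e]
    refine (eLpNorm_add_le
      ((contDiff_shiftMollify hDo hm (hi w)).continuous.aestronglyMeasurable.sub
        (hi w).aestronglyMeasurable)
      ((contDiff_shiftMollify hDo hm (hi' i _)).continuous.aestronglyMeasurable.sub
        (hi' i _).aestronglyMeasurable) (by norm_num)).trans ?_
    refine (add_le_add a1 a2).trans ?_
    rw [← ENNReal.ofReal_add (by positivity) (by positivity), add_halves]
  exact ⟨shiftMollify D ρ (ε • b 1) (c * ε / 10) fun y => χ y * U.1 0 y,
    contDiff_shiftMollify hDo hm (hi _),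
    (h0 ρ rfl).trans (ENNReal.ofReal_le_ofReal (by linarith)),
    key 0 _ U.2.1 (h1 ρ rfl) (h3 ρ rfl), key 1 _ U.2.2 (h2 ρ rfl) (h4 ρ rfl)⟩

theorem exists_finite_smooth_partition {S : Set Plane} (hS : IsCompact S) {r : Plane → ℝ}
    (hr : ∀ x ∈ S, 0 < r x) : ∃ (t : Finset Plane) (χ : t → Plane → ℝ), (∀ i ∈ t, i ∈ S) ∧
      (∀ i, ContDiff ℝ ∞ (χ i)) ∧ (∀ i, tsupport (χ i) ⊆ Metric.ball (i : Plane) (r i)) ∧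
      ∀ x ∈ S, ∑ i, χ i x = 1 := by
  obtain ⟨t, ht, hcov⟩ := hS.elim_nhds_subcover (fun x => Metric.ball x (r x))
    fun x hx => Metric.ball_mem_nhds x (hr x hx)
  obtain ⟨f, hf⟩ := SmoothPartitionOfUnity.exists_isSubordinate 𝓘(ℝ, Plane) hS.isClosed
    (fun i : t => Metric.ball (i : Plane) (r i)) (fun i => Metric.isOpen_ball) (by
      intro y hy
      obtain ⟨i, hi, hyi⟩ := mem_iUnion₂.1 (hcov hy)
      exact mem_iUnion.2 ⟨⟨i, hi⟩, hyi⟩)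
  refine ⟨t, fun i => f i, ht, fun i => (f i).contMDiff.contDiff, hf, fun y hy => ?_⟩
  rw [← finsum_eq_sum_of_fintype]
  exact f.sum_eq_one hy

/-- The smooth functions are dense in `H¹₁(D)`. -/
theorem H1.dense_smooth (hp : IsPolygon D) (hD : D ⊆ {x | 0 < x 0}) :
    Dense {U : H1 D | ∃ φ : Plane → ℝ, ContDiff ℝ ∞ φ ∧ U.1 0 =ᵐ[rMeasure D] φ} := by
  have hDo := hp.isOpen
  have hb := hp.isBounded
  choose! B G K δ c hC using fun x (hx : x ∈ closure D) => exists_chart hp hD hx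
  obtain ⟨t, χ, ht, hχ, hχs, hsum⟩ := exists_finite_smooth_partition hb.isCompact_closure
    (r := fun x => δ x / 2) fun x hx => half_pos (hC x hx).pos
  refine Metric.dense_iff.2 fun U η hη => ?_
  set N : ℝ := t.card + 1 with hN
  have hN0 : 0 < N := by positivity
  choose φ hφ h0 h1 h2 using fun i : t => exists_smooth_approx_local (hC i (ht i i.2)) hDo hD hb (hχ i)
    (fun y hy => by simpa [dist_eq_norm] using hχs i hy) U (η := η / (2 * N)) (by positivity)
  set Φ : Plane → ℝ := fun y => ∑ i, φ i y with hΦ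
  have hΦs : ContDiff ℝ ∞ Φ := ContDiff.sum fun i _ => hφ i
  refine ⟨H1.ofSmooth hb Φ hΦs, ?_, Φ, hΦs, H1.ofSmooth_zero hb hΦs⟩
  rw [Metric.mem_ball, dist_eq_norm]
  have hd : ∀ y e, fderiv ℝ Φ y e = ∑ i, fderiv ℝ (φ i) y e := fun y e => by
    rw [hΦ, fderiv_fun_sum fun i _ => (hφ i).differentiable (by simp) y]
    simp
  -- The partition sums to 1 in a neighborhood of y, so the product rule terms with derivatives of χ
  -- cancel in the sum.
  have hχd : ∀ y ∈ D, ∀ e, ∑ i, fderiv ℝ (χ i) y e = 0 := fun y hy e => by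
    have a1 : fderiv ℝ (fun y => ∑ i, χ i y) y = ∑ i, fderiv ℝ (χ i) y :=
      fderiv_fun_sum fun i _ => (hχ i).differentiable (by simp) y
    have a2 : (fun y => ∑ i, χ i y) =ᶠ[𝓝 y] fun _ => 1 := by
      filter_upwards [hDo.mem_nhds hy] with z hz using hsum z (subset_closure hz)
    rw [a2.fderiv_eq] at a1
    have := congrArg (fun T : Plane →L[ℝ] ℝ => T e) a1
    simpa using this.symm
  have comp : ∀ (k : Fin 3) (F : t → Plane → ℝ), (∀ i, AEStronglyMeasurable (F i) (rMeasure D)) →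
      (∀ i, eLpNorm (F i) 2 (rMeasure D) ≤ ENNReal.ofReal (η / (2 * N))) →
      (∀ᵐ y ∂(rMeasure D), (H1.ofSmooth hb Φ hΦs).1 k y - U.1 k y = ∑ i, F i y) →
      ‖(H1.ofSmooth hb Φ hΦs).1 k - U.1 k‖ ≤ η / 2 := by
    intro k F hF1 hF2 hF3
    rw [Lp.norm_def]
    refine ENNReal.toReal_le_of_le_ofReal (by positivity) ?_
    have a1 : eLpNorm ((H1.ofSmooth hb Φ hΦs).1 k - U.1 k : Lp ℝ 2 (rMeasure D)) 2 (rMeasure D) =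
        eLpNorm (∑ i, F i) 2 (rMeasure D) := by
      refine eLpNorm_congr_ae ?_
      filter_upwards [Lp.coeFn_sub ((H1.ofSmooth hb Φ hΦs).1 k) (U.1 k), hF3] with y b1 b2
      rw [b1, Pi.sub_apply, b2, Finset.sum_apply]
    rw [a1]
    refine (eLpNorm_sum_le (fun i _ => hF1 i) (by norm_num)).trans ?_
    refine (Finset.sum_le_sum fun i _ => hF2 i).trans ?_
    rw [Finset.sum_const, Finset.card_univ, Fintype.card_coe, nsmul_eq_mul,
      ← ENNReal.ofReal_natCast, ← ENNReal.ofReal_mul (by positivity)]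
    refine ENNReal.ofReal_le_ofReal ?_
    calc (t.card : ℝ) * (η / (2 * N)) ≤ N * (η / (2 * N)) := by gcongr; simp [hN]
      _ = η / 2 := by field_simp
  have hχdc : ∀ (i : t) (j : Fin 2),
      Continuous fun x => fderiv ℝ (χ i) x (EuclideanSpace.single j 1) := fun i _ =>
    ((hχ i).continuous_fderiv (by simp)).clm_apply continuous_const
  have hφdc : ∀ (i : t) (j : Fin 2),
      Continuous fun x => fderiv ℝ (φ i) x (EuclideanSpace.single j 1) := fun i _ =>
    ((hφ i).continuous_fderiv (by simp)).clm_apply continuous_const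
  have hUm : ∀ k, AEStronglyMeasurable (U.1 k) (rMeasure D) := fun k => Lp.aestronglyMeasurable _
  have hD' : ∀ᵐ y ∂(rMeasure D), y ∈ D :=
    (ae_rMeasure_iff hDo.measurableSet hD).2 (ae_restrict_mem hDo.measurableSet)
  obtain ⟨p1, p2⟩ := H1.ae_eq_partial hDo hD hΦs (H1.ofSmooth_zero hb hΦs)
  have c0 := comp 0 (fun i y => φ i y - χ i y * U.1 0 y)
    (fun i => (hφ i).continuous.aestronglyMeasurable.sub
      ((hχ i).continuous.aestronglyMeasurable.mul (hUm 0))) h0 (by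
      filter_upwards [H1.ofSmooth_zero hb hΦs, hD'] with y b1 b2
      rw [b1, Finset.sum_sub_distrib, ← Finset.sum_mul, hsum y (subset_closure b2), one_mul])
  have c1 := comp 1 _ (fun i => (hφdc i 0).aestronglyMeasurable.sub
      (((hχ i).continuous.aestronglyMeasurable.mul (hUm 1)).add
        ((hχdc i 0).aestronglyMeasurable.mul (hUm 0)))) h1 (by
      filter_upwards [p1, hD'] with y b1 b2
      simp only [Pi.sub_apply, Pi.add_apply, Pi.mul_apply]
      rw [b1, hd, Finset.sum_sub_distrib, Finset.sum_add_distrib, ← Finset.sum_mul, ← Finset.sum_mul,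
        hsum y (subset_closure b2), hχd y b2, one_mul, zero_mul, add_zero])
  have c2 := comp 2 _ (fun i => (hφdc i 1).aestronglyMeasurable.sub
      (((hχ i).continuous.aestronglyMeasurable.mul (hUm 2)).add
        ((hχdc i 1).aestronglyMeasurable.mul (hUm 0)))) h2 (by
      filter_upwards [p2, hD'] with y b1 b2
      simp only [Pi.sub_apply, Pi.add_apply, Pi.mul_apply]
      rw [b1, hd, Finset.sum_sub_distrib, Finset.sum_add_distrib, ← Finset.sum_mul, ← Finset.sum_mul,
        hsum y (subset_closure b2), hχd y b2, one_mul, zero_mul, add_zero])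
  have hns := H1.norm_sq (H1.ofSmooth hb Φ hΦs - U)
  have s0 := pow_le_pow_left₀ (norm_nonneg _) c0 2
  have s1 := pow_le_pow_left₀ (norm_nonneg _) c1 2
  have s2 := pow_le_pow_left₀ (norm_nonneg _) c2 2
  have hns' : ‖H1.ofSmooth hb Φ hΦs - U‖ ^ 2 ≤ 3 * (η / 2) ^ 2 := by
    rw [hns]
    change ‖(H1.ofSmooth hb Φ hΦs).1 0 - U.1 0‖ ^ 2 + ‖(H1.ofSmooth hb Φ hΦs).1 1 - U.1 1‖ ^ 2 +
      ‖(H1.ofSmooth hb Φ hΦs).1 2 - U.1 2‖ ^ 2 ≤ _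
    linarith
  exact lt_of_pow_lt_pow_left₀ 2 hη.le (by nlinarith)

end Density

/-! ### The trace map and the product estimate on the Sobolev spaces. -/

section Trace

variable {D Ω : Set Plane}

/-- The graph of the trace map on smooth functions. -/
def smoothTraceGraph (D : Set Plane) : Submodule ℝ (H1 D × Lp ℝ 2 (rBoundaryMeasure D)) where
  carrier := {p | ∃ φ : Plane → ℝ, ContDiff ℝ ∞ φ ∧
    p.1.1 0 =ᵐ[rMeasure D] φ ∧ p.2 =ᵐ[rBoundaryMeasure D] φ}
  zero_mem' := ⟨0, contDiff_const, Lp.coeFn_zero _ _ _, Lp.coeFn_zero _ _ _⟩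
  add_mem' := by
    rintro p q ⟨φ, hφ, h1, h2⟩ ⟨ψ, hψ, h3, h4⟩
    exact ⟨φ + ψ, hφ.add hψ, (Lp.coeFn_add (p.1.1 0) (q.1.1 0)).trans (h1.add h3),
      (Lp.coeFn_add p.2 q.2).trans (h2.add h4)⟩
  smul_mem' := by
    rintro a p ⟨φ, hφ, h1, h2⟩
    exact ⟨a • φ, hφ.const_smul a, (Lp.coeFn_smul a (p.1.1 0)).trans (h1.const_smul a),
      (Lp.coeFn_smul a p.2).trans (h2.const_smul a)⟩

theorem continuous_H1_zero : Continuous fun U : H1 D => U.1 0 := (H1.toL2 D).continuous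

theorem norm_sq_eq_of_ae_eq {μ : Measure Plane} {g : Lp ℝ 2 μ} {φ : Plane → ℝ} (h : g =ᵐ[μ] φ) :
    ENNReal.ofReal (‖g‖ ^ 2) = ∫⁻ y, ENNReal.ofReal (φ y ^ 2) ∂μ := by
  have h1 := eLpNorm_nnreal_pow_eq_lintegral (f := g) (μ := μ) (p := 2) (by norm_num)
  norm_num at h1
  rw [Lp.norm_def, ENNReal.ofReal_pow ENNReal.toReal_nonneg,
    ENNReal.ofReal_toReal (Lp.eLpNorm_ne_top g), h1]
  refine lintegral_congr_ae ?_
  filter_upwards [h] with y hy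
  rw [hy, ← ofReal_norm, ← ENNReal.ofReal_pow (norm_nonneg _), Real.norm_eq_abs, sq_abs]

theorem exists_isTrace_norm_sq_le (hp : IsPolygon D) (hD : D ⊆ {x | 0 < x 0}) :
    ∃ C : ℝ, 0 ≤ C ∧ ∀ U g, IsTrace (D := D) U g → ‖g‖ ^ 2 ≤ C * (‖U.1 0‖ * ‖U‖) := by
  obtain ⟨C, hC0, hC⟩ := exists_trace_bound hp hD
  refine ⟨C, hC0, fun U g hg => ?_⟩
  have hcl : IsClosed {p : H1 D × Lp ℝ 2 (rBoundaryMeasure D) |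
      ‖p.2‖ ^ 2 ≤ C * (‖p.1.1 0‖ * ‖p.1‖)} :=
    isClosed_le (continuous_snd.norm.pow 2) (continuous_const.mul
      (((continuous_H1_zero.comp continuous_fst).norm).mul continuous_fst.norm))
  have hsub : {p : H1 D × Lp ℝ 2 (rBoundaryMeasure D) | ∃ φ : Plane → ℝ, ContDiff ℝ ∞ φ ∧
      p.1.1 0 =ᵐ[rMeasure D] φ ∧ p.2 =ᵐ[rBoundaryMeasure D] φ} ⊆
        {p | ‖p.2‖ ^ 2 ≤ C * (‖p.1.1 0‖ * ‖p.1‖)} := ?_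
  · have h := closure_minimal hsub hcl (show (U, g) ∈ _ from hg)
    rwa [mem_ofPred_eq] at h
  rintro p ⟨φ, hφ, h1, h2⟩
  have h3 := hC φ hφ p.1 h1
  rw [← norm_sq_eq_of_ae_eq h2] at h3
  rw [mem_ofPred_eq]
  exact (ENNReal.ofReal_le_ofReal_iff (mul_nonneg hC0 (mul_nonneg (norm_nonneg _) (norm_nonneg _)))).1 h3

/-- The trace map. -/
theorem exists_trace_map (hp : IsPolygon D) (hD : D ⊆ {x | 0 < x 0}) :
    ∃ tr : H1 D →L[ℝ] Lp ℝ 2 (rBoundaryMeasure D), ∀ U g, IsTrace U g ↔ g = tr U := by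
  obtain ⟨C, hC0, hC⟩ := exists_isTrace_norm_sq_le hp hD
  set S := (smoothTraceGraph D).topologicalClosure with hS
  have n0 : ∀ U : H1 D, ‖U.1 0‖ ≤ ‖U‖ := fun U => PiLp.norm_apply_le U.1 0
  have hC' : ∀ U g, IsTrace (D := D) U g → ‖g‖ ≤ Real.sqrt C * ‖U‖ := fun U g h => by
    refine le_of_sq_le_sq ?_ (by positivity)
    rw [mul_pow, Real.sq_sqrt hC0]
    refine (hC U g h).trans ?_
    rw [sq]
    gcongr
    exact n0 U
  have hsub : ∀ {U U' g g'}, IsTrace (D := D) U g → IsTrace U' g' → IsTrace (U - U') (g - g') :=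
    fun h h' => S.sub_mem h h'
  -- The trace inequality survives the closure that defines `IsTrace`; at U = 0 it says that the
  -- closed graph is single valued.
  have huniq : ∀ {U g g'}, IsTrace (D := D) U g → IsTrace U g' → g = g' := fun h h' => by
    have := hC' _ _ (hsub h h')
    rw [sub_self, norm_zero, mul_zero] at this
    exact sub_eq_zero.1 (norm_le_zero_iff.1 this)
  have hex : ∀ U : H1 D, ∃ g, IsTrace U g := by
    intro U
    obtain ⟨V, hV, hVU⟩ := mem_closure_iff_seq_limit.1 ((H1.dense_smooth hp hD) U)
    choose φ hφ hVφ using hV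
    obtain ⟨C', hC0', hC''⟩ := exists_trace_bound hp hD
    have hm : ∀ n, MemLp (φ n) 2 (rBoundaryMeasure D) := fun n => by
      refine ⟨(hφ n).continuous.aestronglyMeasurable, ?_⟩
      have h1 := eLpNorm_nnreal_pow_eq_lintegral (f := φ n) (μ := rBoundaryMeasure D) (p := 2)
        (by norm_num)
      norm_num at h1
      have h2 : eLpNorm (φ n) 2 (rBoundaryMeasure D) ^ 2 < ⊤ := by
        rw [h1]
        refine lt_of_le_of_lt (le_of_eq ?_) ((hC'' (φ n) (hφ n) (V n) (hVφ n)).trans_lt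
          ENNReal.ofReal_lt_top)
        refine lintegral_congr fun y => ?_
        rw [← ofReal_norm, ← ENNReal.ofReal_pow (norm_nonneg _), Real.norm_eq_abs, sq_abs]
      exact (ENNReal.pow_lt_top_iff).1 h2 |>.resolve_right (by norm_num)
    have htr : ∀ n, IsTrace (V n) (hm n).toLp := fun n =>
      subset_closure ⟨φ n, hφ n, hVφ n, (hm n).coeFn_toLp⟩
    have hcau : CauchySeq fun n => ((hm n).toLp : Lp ℝ 2 (rBoundaryMeasure D)) := by
      refine cauchySeq_of_dist_le_mul (K := Real.sqrt C) hVU.cauchySeq fun n k => ?_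
      rw [dist_eq_norm, dist_eq_norm]
      exact hC' _ _ (hsub (htr n) (htr k))
    obtain ⟨g, hg⟩ := cauchySeq_tendsto_of_complete hcau
    exact ⟨g, isClosed_closure.mem_of_tendsto (hVU.prodMk_nhds hg)
      (Eventually.of_forall fun n => htr n)⟩
  choose T hT using hex
  let L : H1 D →ₗ[ℝ] Lp ℝ 2 (rBoundaryMeasure D) :=
    { toFun := T
      map_add' := fun U V => huniq (hT (U + V)) (S.add_mem (hT U) (hT V))
      map_smul' := fun a U => huniq (hT (a • U)) (S.smul_mem a (hT U)) }
  refine ⟨L.mkContinuous (Real.sqrt C) fun U => hC' U _ (hT U), fun U g => ⟨fun h => ?_, fun h => ?_⟩⟩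
  · exact huniq h (hT U)
  · rw [h]; exact hT U

/-- Product estimate: multiplication by elements of `H̃¹_{1,Γ}(Ω)` maps `H¹₁(D)` to `L²₁(D)`. -/
theorem exists_product_estimate (hp : IsPolygon D) (hD : D ⊆ {x | 0 < x 0}) (hΩo : IsOpen Ω)
    (hΩ : Ω ⊆ {x | 0 < x 0}) (hDΩ : D ⊆ Ω) :
    ∃ C : ℝ, 0 ≤ C ∧ ∀ (U : H1 D), ∀ A ∈ HTildeZero Ω,
      ∫⁻ y, ‖U.1 0 y‖ₑ ^ 2 * ‖A.1 0 y‖ₑ ^ 2 ∂(rMeasure D) ≤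
        ENNReal.ofReal (C * (‖U.1 0‖ * ‖U‖ * ‖A‖ ^ 2)) := by
  obtain ⟨C, hC0, hC⟩ := exists_product_bound hp hD hΩo hΩ
  refine ⟨C, hC0, fun U A hA => ?_⟩
  obtain ⟨V, hV, hVU⟩ := mem_closure_iff_seq_limit.1 ((H1.dense_smooth hp hD) U)
  obtain ⟨Z, hZ, hZA⟩ := mem_closure_iff_seq_limit.1 hA
  choose φ hφ hVφ using hV
  choose a ha hZa using hZ
  have c0 : Tendsto (fun n => (V n).1 0) atTop (𝓝 (U.1 0)) := (continuous_H1_zero.tendsto U).comp hVU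
  have hcz : Continuous fun A : HTilde Ω => A.1 0 :=
    (by fun_prop : Continuous fun A : PiLp 2 fun _ : Fin 4 => Lp ℂ 2 (rMeasure Ω) => A 0).comp
      continuous_subtype_val
  have c1 : Tendsto (fun n => (Z n).1 0) atTop (𝓝 (A.1 0)) := (hcz.tendsto A).comp hZA
  obtain ⟨n1, hn1, h1⟩ := exists_subseq_ae_tendsto c0
  obtain ⟨n2, hn2, h2⟩ := exists_subseq_ae_tendsto (c1.comp hn1.tendsto_atTop)
  have hac : ∀ {p : Plane → Prop}, (∀ᵐ y ∂(rMeasure Ω), p y) → ∀ᵐ y ∂(rMeasure D), p y :=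
    fun h => ae_mono (rMeasure_mono hDΩ) h
  have hn := hn1.comp hn2
  set F : ℕ → Plane → ENNReal := fun k y =>
    ENNReal.ofReal (φ (n1 (n2 k)) y ^ 2) * ‖a (n1 (n2 k)) y‖ₑ ^ 2 with hF
  have hFm : ∀ k, Measurable (F k) := fun k => by
    have e1 := (hφ (n1 (n2 k))).continuous
    have e2 := (ha (n1 (n2 k))).1.continuous
    exact (by fun_prop : Measurable fun y => ENNReal.ofReal (φ (n1 (n2 k)) y ^ 2)).mul
      (e2.measurable.enorm.pow_const 2)
  have hlim : ∀ᵐ y ∂(rMeasure D), ‖U.1 0 y‖ₑ ^ 2 * ‖A.1 0 y‖ₑ ^ 2 =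
      liminf (fun k => F k y) atTop := by
    filter_upwards [h1, hac h2, ae_all_iff.2 hVφ, hac (ae_all_iff.2 hZa)] with y e1 e2 e3 e4
    refine (Tendsto.liminf_eq ?_).symm
    have e5 : ∀ k, F k y = ENNReal.ofReal (‖(V (n1 (n2 k))).1 0 y‖ ^ 2 *
        ‖(Z (n1 (n2 k))).1 0 y‖ ^ 2) := fun k => by
      simp only [hF]
      rw [← e3, ← e4, ← ofReal_norm, ← ENNReal.ofReal_pow (norm_nonneg _),
        ← ENNReal.ofReal_mul (sq_nonneg _), Real.norm_eq_abs, sq_abs]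
    simp only [e5]
    rw [← ofReal_norm, ← ofReal_norm, ← ENNReal.ofReal_pow (norm_nonneg _),
      ← ENNReal.ofReal_pow (norm_nonneg _), ← ENNReal.ofReal_mul (sq_nonneg _)]
    exact (ENNReal.continuous_ofReal.tendsto _).comp
      (((e1.comp hn2.tendsto_atTop).norm.pow 2).mul (e2.norm.pow 2))
  -- Fatou's lemma along a subsequence on which both approximations converge almost everywhere.
  rw [lintegral_congr_ae hlim]
  refine (lintegral_liminf_le hFm).trans ?_
  refine (liminf_le_liminf (Eventually.of_forall fun k =>
    hC _ (hφ (n1 (n2 k))) _ (hVφ _) _ (ha (n1 (n2 k))) _ (hZa _))).trans (le_of_eq ?_)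
  refine Tendsto.liminf_eq ((ENNReal.continuous_ofReal.tendsto _).comp ?_)
  exact Tendsto.const_mul C (((c0.comp hn.tendsto_atTop).norm.mul
    (hVU.comp hn.tendsto_atTop).norm).mul ((hZA.comp hn.tendsto_atTop).norm.pow 2))

end Trace

/-! ### Superposition operators and strongly monotone maps. -/

section Superposition

variable {α : Type*} [MeasurableSpace α] {μ : Measure α}

/-- Composition of a Carathéodory function with a measurable function. -/
theorem aemeasurable_caratheodory_comp {f : α → ℝ → ℝ} (hf : ∀ u, AEMeasurable (fun x => f x u) μ)
    (hc : ∀ᵐ x ∂μ, Continuous (f x)) {T : α → ℝ} (hT : StronglyMeasurable T) :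
    AEMeasurable (fun x => f x (T x)) μ := by
  refine aemeasurable_of_tendsto_metrizable_ae atTop (f := fun n x => f x (hT.approx n x))
    (fun n => ?_) ?_
  -- On each level set of a simple function the composition is f(·, u) with constant u, hence
  -- measurable; continuity in u gives the limit.
  · have hU : (⋃ i : (hT.approx n).range, hT.approx n ⁻¹' {(i : ℝ)}) = univ := by
      refine eq_univ_of_forall fun x => mem_iUnion.2 ⟨⟨hT.approx n x, ?_⟩, rfl⟩
      exact SimpleFunc.mem_range_self _ x
    rw [← Measure.restrict_univ (μ := μ), ← hU, aemeasurable_iUnion_iff]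
    intro i
    refine (((hf i).restrict (s := hT.approx n ⁻¹' {(i : ℝ)}))).congr ?_
    filter_upwards [ae_restrict_mem ((hT.approx n).measurableSet_preimage {(i : ℝ)})] with x hx
    have hx : hT.approx n x = i := hx
    simp only [hx]
  · filter_upwards [hc] with x hx
    exact (hx.tendsto (T x)).comp (hT.tendsto_approx x)

/-- Multiplication by a bounded function. -/
theorem exists_mul_operator {𝕜 : Type*} [RCLike 𝕜] {k : α → 𝕜} (hk : AEStronglyMeasurable k μ)
    {C : ℝ} (hC : ∀ᵐ x ∂μ, ‖k x‖ ≤ C) : ∃ M : Lp 𝕜 2 μ →L[𝕜] Lp 𝕜 2 μ,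
      (∀ u, M u =ᵐ[μ] fun x => k x * u x) ∧ ∀ u, ‖M u‖ ≤ C * ‖u‖ := by
  have hm : ∀ u : Lp 𝕜 2 μ, MemLp (fun x => k x * u x) 2 μ := fun u =>
    MemLp.of_le_mul (c := C) (Lp.memLp u) (hk.mul (Lp.aestronglyMeasurable u)) (by
      filter_upwards [hC] with x hx
      rw [norm_mul]
      exact mul_le_mul_of_nonneg_right hx (norm_nonneg _))
  have hn : ∀ u : Lp 𝕜 2 μ, ‖((hm u).toLp : Lp 𝕜 2 μ)‖ ≤ C * ‖u‖ := fun u =>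
    Lp.norm_le_mul_norm_of_ae_le_mul (by
      filter_upwards [hC, (hm u).coeFn_toLp] with x hx h1
      rw [h1, norm_mul]
      exact mul_le_mul_of_nonneg_right hx (norm_nonneg _))
  let L : Lp 𝕜 2 μ →ₗ[𝕜] Lp 𝕜 2 μ :=
    { toFun := fun u => (hm u).toLp
      map_add' := fun u v => Lp.ext (by
        filter_upwards [(hm u).coeFn_toLp, (hm v).coeFn_toLp, (hm (u + v)).coeFn_toLp,
          Lp.coeFn_add u v, Lp.coeFn_add ((hm u).toLp : Lp 𝕜 2 μ) ((hm v).toLp : Lp 𝕜 2 μ)]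
          with x h1 h2 h3 h4 h5
        rw [h3, h5, Pi.add_apply, h1, h2, h4, Pi.add_apply, mul_add])
      map_smul' := fun a u => Lp.ext (by
        filter_upwards [(hm u).coeFn_toLp, (hm (a • u)).coeFn_toLp,
          Lp.coeFn_smul a u, Lp.coeFn_smul a ((hm u).toLp : Lp 𝕜 2 μ)]
          with x h1 h3 h4 h5
        rw [h3, RingHom.id_apply, h5, Pi.smul_apply, h1, h4, Pi.smul_apply, smul_eq_mul, smul_eq_mul]
        ring) }
  exact ⟨L.mkContinuous C hn, fun u => (hm u).coeFn_toLp, hn⟩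

variable {W : Type*} [NormedAddCommGroup W] [InnerProductSpace ℂ W]

theorem norm_sub_sq_eq (a b : W) : ‖a - b‖ ^ 2 =
    (‖a‖ - ‖b‖) ^ 2 + 2 * (‖a‖ * ‖b‖ - RCLike.re (inner ℂ a b)) := by
  rw [norm_sub_sq (𝕜 := ℂ)]; ring

theorem re_inner_le_norm_mul (a b : W) : RCLike.re (inner ℂ a b) ≤ ‖a‖ * ‖b‖ :=
  (RCLike.re_le_norm _).trans (norm_inner_le_norm a b)

/-- ‖s a - t b‖² = (s‖a‖ - t‖b‖)² + 2st(‖a‖‖b‖ - Re⟨a, b⟩): the radial part is controlled by the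
scalar Lipschitz bound, the angular part by st ≤ L². -/
theorem norm_smul_sub_smul_le {s t ξ n L : ℝ} (hs : 0 ≤ s) (ht : 0 ≤ t) (hsn : s ≤ n) (htn : t ≤ n)
    (hξL : ξ ≤ L) (hξ : 0 ≤ ξ) (hnL : n ≤ L) {a b : W} (h : |s * ‖a‖ - t * ‖b‖| ≤ ξ * |‖a‖ - ‖b‖|) :
    ‖(s : ℂ) • a - (t : ℂ) • b‖ ≤ L * ‖a - b‖ := by
  have hL : 0 ≤ L := hξ.trans hξL
  refine le_of_sq_le_sq ?_ (by positivity)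
  have h1 := re_inner_le_norm_mul a b
  rw [norm_sub_sq_eq, mul_pow, norm_sub_sq_eq, norm_smul, norm_smul, inner_smul_left,
    inner_smul_right, Complex.norm_real, Complex.norm_real, Real.norm_of_nonneg hs,
    Real.norm_of_nonneg ht, Complex.conj_ofReal]
  have h2 : RCLike.re ((s : ℂ) * ((t : ℂ) * inner ℂ a b)) = s * t * RCLike.re (inner ℂ a b) := by
    rw [mul_assoc s t]
    exact (RCLike.re_ofReal_mul _ _).trans (congrArg _ (RCLike.re_ofReal_mul _ _))
  rw [h2]
  have h3 : (s * ‖a‖ - t * ‖b‖) ^ 2 ≤ L ^ 2 * (‖a‖ - ‖b‖) ^ 2 := by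
    rw [← sq_abs, ← sq_abs (‖a‖ - ‖b‖), ← mul_pow]
    exact pow_le_pow_left₀ (abs_nonneg _) (h.trans (mul_le_mul_of_nonneg_right hξL (abs_nonneg _))) 2
  have h4 : s * t ≤ L ^ 2 := by
    rw [sq]; exact mul_le_mul (hsn.trans hnL) (htn.trans hnL) ht hL
  have h5 := mul_le_mul_of_nonneg_right h4 (sub_nonneg.2 h1)
  linarith

/-- Re⟨s a - t b, a - b⟩ = (s‖a‖ - t‖b‖)(‖a‖ - ‖b‖) + (s + t)(‖a‖‖b‖ - Re⟨a, b⟩), and ‖a - b‖²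
decomposes in the same way. -/
theorem le_re_inner_smul_sub_smul {s t ρ n l : ℝ} (hsn : n ≤ s) (htn : n ≤ t)
    (hl : l ≤ ρ) (hln : l ≤ n) {a b : W}
    (h : ρ * |‖a‖ - ‖b‖| ^ 2 ≤ (s * ‖a‖ - t * ‖b‖) * (‖a‖ - ‖b‖)) :
    l * ‖a - b‖ ^ 2 ≤ RCLike.re (inner ℂ ((s : ℂ) • a - (t : ℂ) • b) (a - b)) := by
  have h1 := re_inner_le_norm_mul a b
  have e1 : RCLike.re (inner ℂ ((s : ℂ) • a - (t : ℂ) • b) (a - b)) =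
      s * ‖a‖ ^ 2 - s * RCLike.re (inner ℂ a b) - t * RCLike.re (inner ℂ a b) + t * ‖b‖ ^ 2 := by
    rw [inner_sub_left, inner_sub_right, inner_sub_right, inner_smul_left, inner_smul_left,
      inner_smul_left, inner_smul_left, Complex.conj_ofReal, Complex.conj_ofReal,
      map_sub, map_sub, map_sub]
    have h2 : ∀ (s : ℝ) (z : ℂ), RCLike.re ((s : ℂ) * z) = s * RCLike.re z :=
      fun s z => RCLike.re_ofReal_mul s z
    rw [h2, h2, h2, h2, inner_self_eq_norm_sq, inner_self_eq_norm_sq,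
      show RCLike.re (inner ℂ b a) = RCLike.re (inner ℂ a b) from inner_re_symm b a]
    ring
  rw [e1, norm_sub_sq_eq]
  rw [sq_abs] at h
  have h3 := mul_le_mul_of_nonneg_right hl (sq_nonneg (‖a‖ - ‖b‖))
  have h4 := mul_le_mul_of_nonneg_right (hln.trans hsn) (sub_nonneg.2 h1)
  have h5 := mul_le_mul_of_nonneg_right (hln.trans htn) (sub_nonneg.2 h1)
  nlinarith

/-- Superposition operators inherit Lipschitz continuity and strong monotonicity. -/
theorem exists_superposition {n : α → W → W} {L l : ℝ}
    (hn0 : ∀ x, n x 0 = 0) (hL : ∀ x a b, ‖n x a - n x b‖ ≤ L * ‖a - b‖)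
    (hl : ∀ x a b, l * ‖a - b‖ ^ 2 ≤ RCLike.re (inner ℂ (n x a - n x b) (a - b)))
    (hm : ∀ c : Lp W 2 μ, AEStronglyMeasurable (fun x => n x (c x)) μ) :
    ∃ N : Lp W 2 μ → Lp W 2 μ, (∀ c, N c =ᵐ[μ] fun x => n x (c x)) ∧ N 0 = 0 ∧
      (∀ c d, ‖N c - N d‖ ≤ L * ‖c - d‖) ∧
      ∀ c d, l * ‖c - d‖ ^ 2 ≤ RCLike.re (inner ℂ (N c - N d) (c - d)) := by
  have hmem : ∀ c : Lp W 2 μ, MemLp (fun x => n x (c x)) 2 μ := fun c =>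
    MemLp.of_le_mul (c := L) (Lp.memLp c) (hm c) (Eventually.of_forall fun x => by
      have := hL x (c x) 0
      rwa [hn0, sub_zero, sub_zero] at this)
  have hN : ∀ c : Lp W 2 μ, ((hmem c).toLp : Lp W 2 μ) =ᵐ[μ] fun x => n x (c x) := fun c =>
    (hmem c).coeFn_toLp
  have hsub : ∀ c d : Lp W 2 μ, ∀ᵐ x ∂μ,
      ((hmem c).toLp - (hmem d).toLp : Lp W 2 μ) x = n x (c x) - n x (d x) ∧
      (c - d : Lp W 2 μ) x = c x - d x := fun c d => by
    filter_upwards [hN c, hN d, Lp.coeFn_sub ((hmem c).toLp : Lp W 2 μ) ((hmem d).toLp : Lp W 2 μ),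
      Lp.coeFn_sub c d] with x h1 h2 h3 h4
    rw [h3, h4, Pi.sub_apply, h1, h2, Pi.sub_apply]
    exact ⟨rfl, rfl⟩
  refine ⟨fun c => (hmem c).toLp, hN, ?_, fun c d => ?_, fun c d => ?_⟩
  · refine (Lp.eq_zero_iff_ae_eq_zero).2 ?_
    filter_upwards [hN 0, Lp.coeFn_zero W 2 μ] with x h1 h2
    rw [h1, h2, Pi.zero_apply, hn0]
  · refine Lp.norm_le_mul_norm_of_ae_le_mul ?_
    filter_upwards [hsub c d] with x hx
    rw [hx.1, hx.2]
    exact hL x _ _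
  · have e1 : ‖c - d‖ ^ 2 = ∫ x, ‖(c - d : Lp W 2 μ) x‖ ^ 2 ∂μ := by
      rw [← inner_self_eq_norm_sq (𝕜 := ℂ), L2.inner_def, ← integral_re (L2.integrable_inner _ _)]
      exact integral_congr_ae (Eventually.of_forall fun x => inner_self_eq_norm_sq _)
    rw [e1, L2.inner_def, ← integral_re (L2.integrable_inner _ _), ← integral_const_mul]
    refine integral_mono_ae ?_ (L2.integrable_inner _ _).re ?_
    · exact ((Lp.memLp (c - d)).integrable_norm_pow two_ne_zero).const_mul l
    · filter_upwards [hsub c d] with x hx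
      rw [hx.1, hx.2]
      exact hl x _ _

/-- A Lipschitz continuous and strongly monotone map of a Hilbert space is bijective. -/
theorem bijective_of_strongly_monotone {X : Type*} [NormedAddCommGroup X] [InnerProductSpace ℂ X]
    [CompleteSpace X] {Φ : X → X} {L l : ℝ} (hl0 : 0 < l) (hL : ∀ u v, ‖Φ u - Φ v‖ ≤ L * ‖u - v‖)
    (hl : ∀ u v, l * ‖u - v‖ ^ 2 ≤ RCLike.re (inner ℂ (Φ u - Φ v) (u - v))) :
    Function.Bijective Φ := by
  constructor
  · intro u v huv
    have h1 := hl u v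
    rw [huv, sub_self, inner_zero_left, map_zero] at h1
    have h2 : ‖u - v‖ ^ 2 ≤ 0 := by nlinarith [sq_nonneg ‖u - v‖]
    exact sub_eq_zero.1 (norm_eq_zero.1 (pow_eq_zero_iff two_ne_zero |>.1
      (le_antisymm h2 (sq_nonneg _))))
  · intro f
    set M : ℝ := max L l with hM
    have hM0 : 0 < M := hl0.trans_le (le_max_right _ _)
    -- This step size minimizes 1 - 2tl + t²M², the bound for the squared Lipschitz constant of u ↦
    -- u - t(Φ u - f), with minimum q = 1 - l²/M². Taking M ≥ l keeps q nonnegative.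
    set t : ℝ := l / M ^ 2 with ht
    have ht0 : 0 < t := by positivity
    set q : ℝ := 1 - l ^ 2 / M ^ 2 with hq
    have hq0 : 0 ≤ q := by
      rw [hq, sub_nonneg, div_le_one (by positivity)]
      exact pow_le_pow_left₀ hl0.le (le_max_right _ _) 2
    have hq1 : q < 1 := by
      have : 0 < l ^ 2 / M ^ 2 := by positivity
      linarith
    let Ψ : X → X := fun u => u - (t : ℂ) • (Φ u - f)
    have key : ∀ u v, ‖Ψ u - Ψ v‖ ≤ Real.sqrt q * ‖u - v‖ := by
      intro u v
      refine le_of_sq_le_sq ?_ (by positivity)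
      have e1 : Ψ u - Ψ v = (u - v) - (t : ℂ) • (Φ u - Φ v) := by
        simp only [Ψ, smul_sub]; abel
      rw [e1, norm_sub_sq (𝕜 := ℂ), inner_smul_right, norm_smul, Complex.norm_real,
        Real.norm_of_nonneg ht0.le, mul_pow, mul_pow, Real.sq_sqrt hq0]
      have e2 : RCLike.re ((t : ℂ) * inner ℂ (u - v) (Φ u - Φ v)) =
          t * RCLike.re (inner ℂ (Φ u - Φ v) (u - v)) := by
        rw [show RCLike.re (inner ℂ (Φ u - Φ v) (u - v)) = RCLike.re (inner ℂ (u - v) (Φ u - Φ v))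
          from inner_re_symm _ _]
        exact RCLike.re_ofReal_mul _ _
      rw [e2]
      have e3 := mul_le_mul_of_nonneg_left (hl u v) ht0.le
      have e4 : ‖Φ u - Φ v‖ ^ 2 ≤ M ^ 2 * ‖u - v‖ ^ 2 := by
        rw [← mul_pow]
        exact pow_le_pow_left₀ (norm_nonneg _) ((hL u v).trans
          (mul_le_mul_of_nonneg_right (le_max_left _ _) (norm_nonneg _))) 2
      have e5 := mul_le_mul_of_nonneg_left e4 (sq_nonneg t)
      have e6 : t ^ 2 * (M ^ 2 * ‖u - v‖ ^ 2) = l ^ 2 / M ^ 2 * ‖u - v‖ ^ 2 := by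
        rw [ht]; field_simp
      have e7 : t * (l * ‖u - v‖ ^ 2) = l ^ 2 / M ^ 2 * ‖u - v‖ ^ 2 := by
        rw [ht]; field_simp
      rw [hq, sub_mul, one_mul]
      linarith
    have hcon : ContractingWith (Real.sqrt q).toNNReal Ψ := by
      refine ⟨?_, LipschitzWith.of_dist_le_mul fun u v => ?_⟩
      · rw [← NNReal.coe_lt_coe, Real.coe_toNNReal _ (Real.sqrt_nonneg _), NNReal.coe_one]
        exact (Real.sqrt_lt' one_pos).2 (by simpa using hq1)
      · rw [dist_eq_norm, dist_eq_norm, Real.coe_toNNReal _ (Real.sqrt_nonneg _)]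
        exact key u v
    have hfix := hcon.fixedPoint_isFixedPt
    set u := ContractingWith.fixedPoint Ψ hcon
    refine ⟨u, ?_⟩
    have h1 : u - (t : ℂ) • (Φ u - f) = u := hfix
    have h2 := sub_eq_self.1 h1
    rcases smul_eq_zero.1 h2 with h3 | h3
    · exact absurd (Complex.ofReal_eq_zero.1 h3) ht0.ne'
    · exact sub_eq_zero.1 h3

end Superposition

/-! ### Elementary facts on the domain and its subsets. -/

section Geometry

theorem isOpen_rectangle (R L : ℝ) : IsOpen (rectangle R L) :=
  (isOpen_Ioo.preimage (by fun_prop : Continuous fun x : Plane => x 0)).inter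
    (isOpen_Ioo.preimage (by fun_prop : Continuous fun x : Plane => x 1))

theorem norm_le_abs_add_abs (x : Plane) : ‖x‖ ≤ |x 0| + |x 1| := by
  have e1 : x = x 0 • EuclideanSpace.single 0 1 + x 1 • EuclideanSpace.single 1 1 := by
    ext i; fin_cases i <;> simp
  conv_lhs => rw [e1]
  refine (norm_add_le _ _).trans (le_of_eq ?_)
  simp [norm_smul]

theorem isBounded_rectangle (R L : ℝ) : Bornology.IsBounded (rectangle R L) := by
  refine isBounded_iff_forall_norm_le.2 ⟨R + L, fun x hx => (norm_le_abs_add_abs x).trans ?_⟩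
  rw [abs_of_pos hx.1.1, abs_of_pos hx.2.1]
  exact add_le_add hx.1.2.le hx.2.2.le

variable {m : ℕ} (G : Geometry m)

theorem Geometry.isOpen_domain : IsOpen G.domain := isOpen_rectangle _ _

theorem Geometry.isBounded_domain : Bornology.IsBounded G.domain := isBounded_rectangle _ _

theorem Geometry.domain_subset : G.domain ⊆ {x | 0 < x 0} := fun _ hx => hx.1.1

theorem Geometry.workpiece_subset_pos : G.workpiece ⊆ {x | 0 < x 0} :=
  G.workpiece_subset.trans G.domain_subset

theorem Geometry.isOpen_conductors : IsOpen G.conductors :=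
  G.workpiece_polygon.isOpen.union (isOpen_iUnion fun k => G.coil_open k)

theorem Geometry.conductors_subset : G.conductors ⊆ G.domain :=
  union_subset G.workpiece_subset (iUnion_subset fun k => G.coil_subset k)

theorem rMeasure_restrict {D C : Set Plane} (hC : MeasurableSet C) (hCD : C ⊆ D) :
    (rMeasure D).restrict C = rMeasure C := by
  rw [rMeasure, rMeasure, restrict_withDensity hC, Measure.restrict_restrict hC,
    inter_eq_self_of_subset_left hCD]

end Geometry

/-! ### The curl and its coercivity on functions vanishing on the boundary. -/

section Curl

variable {D : Set Plane}

/-- The space of values of the curl. -/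
abbrev CurlSpace := EuclideanSpace ℂ (Fin 2)

/-- The components of an element of `H̃¹₁(D)`. -/
def HTilde.component (D : Set Plane) (i : Fin 4) : HTilde D →L[ℂ] Lp ℂ 2 (rMeasure D) :=
  (PiLp.proj 2 (fun _ : Fin 4 => Lp ℂ 2 (rMeasure D)) i).comp (HTilde D).subtypeL

theorem HTilde.norm_component_le (i : Fin 4) (U : HTilde D) : ‖U.1 i‖ ≤ ‖U‖ :=
  PiLp.norm_apply_le U.1 i

/-- The curl `(∂_r U + U / r, ∂_z U)`. -/
def curlL (D : Set Plane) : HTilde D →L[ℂ] Lp CurlSpace 2 (rMeasure D) :=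
  ((ContinuousLinearMap.smulRight (1 : ℂ →L[ℂ] ℂ)
      (EuclideanSpace.single 0 1 : CurlSpace)).compLpL 2 (rMeasure D)).comp
    (HTilde.component D 1 + HTilde.component D 3) +
  ((ContinuousLinearMap.smulRight (1 : ℂ →L[ℂ] ℂ)
      (EuclideanSpace.single 1 1 : CurlSpace)).compLpL 2 (rMeasure D)).comp (HTilde.component D 2)

theorem curlL_ae (U : HTilde D) : ∀ᵐ x ∂(rMeasure D), curlL D U x =
    (curlZ U x) • (EuclideanSpace.single 0 1 : CurlSpace) +
      (partialZ U x) • (EuclideanSpace.single 1 1 : CurlSpace) := by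
  set e0 := ContinuousLinearMap.smulRight (1 : ℂ →L[ℂ] ℂ) (EuclideanSpace.single 0 1 : CurlSpace)
  set e1 := ContinuousLinearMap.smulRight (1 : ℂ →L[ℂ] ℂ) (EuclideanSpace.single 1 1 : CurlSpace)
  have h0 : curlL D U = e0.compLpL 2 (rMeasure D) (U.1 1 + U.1 3) +
    e1.compLpL 2 (rMeasure D) (U.1 2) := rfl
  filter_upwards [Lp.coeFn_add (e0.compLpL 2 (rMeasure D) (U.1 1 + U.1 3))
    (e1.compLpL 2 (rMeasure D) (U.1 2)), e0.coeFn_compLpL (p := 2) (U.1 1 + U.1 3),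
    e1.coeFn_compLpL (p := 2) (U.1 2), Lp.coeFn_add (U.1 1) (U.1 3), U.2.2.2] with x a1 a2 a3 a4 a5
  rw [h0, a1, Pi.add_apply, a2, a3, a4, Pi.add_apply, a5]
  rfl

theorem inner_curl_values (a b a' b' : ℂ) :
    inner ℂ (a • (EuclideanSpace.single 0 1 : CurlSpace) + b • (EuclideanSpace.single 1 1 : CurlSpace))
      (a' • (EuclideanSpace.single 0 1 : CurlSpace) + b' • (EuclideanSpace.single 1 1 : CurlSpace)) =
      a' * conj a + b' * conj b := by
  simp [PiLp.inner_apply]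

theorem norm_sq_curl_values (a b : ℂ) :
    ‖a • (EuclideanSpace.single 0 1 : CurlSpace) + b • (EuclideanSpace.single 1 1 : CurlSpace)‖ ^ 2 =
      ‖a‖ ^ 2 + ‖b‖ ^ 2 := by
  rw [EuclideanSpace.norm_sq_eq]
  simp [Fin.sum_univ_two]

theorem norm_curlL_ae (U : HTilde D) : ∀ᵐ x ∂(rMeasure D), ‖curlL D U x‖ = curlNorm U x := by
  filter_upwards [curlL_ae U] with x hx
  rw [curlNorm, hx, ← norm_sq_curl_values, Real.sqrt_sq (norm_nonneg _)]

theorem norm_curlL_sq (U : HTilde D) : ‖curlL D U‖ ^ 2 = ‖U.1 1 + U.1 3‖ ^ 2 + ‖U.1 2‖ ^ 2 := by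
  have e : ∀ {V : Type} [NormedAddCommGroup V] [InnerProductSpace ℂ V] (f : Lp V 2 (rMeasure D)),
      ‖f‖ ^ 2 = ∫ x, ‖f x‖ ^ 2 ∂(rMeasure D) := fun f => by
    rw [← inner_self_eq_norm_sq (𝕜 := ℂ), L2.inner_def, ← integral_re (L2.integrable_inner _ _)]
    exact integral_congr_ae (Eventually.of_forall fun x => inner_self_eq_norm_sq _)
  rw [e, e, e, ← integral_add ((Lp.memLp _).integrable_norm_pow two_ne_zero)
    ((Lp.memLp _).integrable_norm_pow two_ne_zero)]
  refine integral_congr_ae ?_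
  filter_upwards [curlL_ae U, Lp.coeFn_add (U.1 1) (U.1 3), U.2.2.2] with x a1 a2 a3
  rw [a1, norm_sq_curl_values, a2, Pi.add_apply, a3]
  rfl

/-- `H̃¹_{1,Γ}(D)` as a closed subspace. -/
def testSubmodule (D : Set Plane) : Submodule ℂ (HTilde D) where
  carrier := {U | ∃ φ : Plane → ℂ, IsTest D φ ∧ U.1 0 =ᵐ[rMeasure D] φ}
  zero_mem' := ⟨0, ⟨contDiff_const, HasCompactSupport.zero, by simp [tsupport]⟩,
    Lp.coeFn_zero _ _ _⟩
  add_mem' := by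
    rintro u v ⟨φ, hφ, h1⟩ ⟨ψ, hψ, h2⟩
    exact ⟨φ + ψ, ⟨hφ.1.add hψ.1, hφ.2.1.add hψ.2.1,
      (tsupport_add φ ψ).trans (union_subset hφ.2.2 hψ.2.2)⟩,
      (Lp.coeFn_add (u.1 0) (v.1 0)).trans (h1.add h2)⟩
  smul_mem' := by
    rintro c u ⟨φ, hφ, h1⟩
    exact ⟨c • φ, ⟨hφ.1.const_smul c, hφ.2.1.smul_left,
      (closure_mono (Function.support_const_smul_subset c φ)).trans hφ.2.2⟩,
      (Lp.coeFn_smul c (u.1 0)).trans (h1.const_smul c)⟩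

/-- `H̃¹_{1,Γ}(D)` as a closed subspace of `H̃¹₁(D)`. -/
def zeroSubmodule (D : Set Plane) : Submodule ℂ (HTilde D) := (testSubmodule D).topologicalClosure

theorem completeSpace_zeroSubmodule (hDm : MeasurableSet D) (hD : D ⊆ {x | 0 < x 0})
    (hb : Bornology.IsBounded D) : CompleteSpace (zeroSubmodule D) := by
  have := completeSpace_HTilde hDm hD hb
  exact (Submodule.isClosed_topologicalClosure (testSubmodule D)).completeSpace_coe

/-- For a test function φ, the weight r cancels the denominator: Re ∫ conj(φ/r) ∂_r φ r dr dz = ½ ∫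
∂_r |φ|² dr dz = 0. The condition is closed. -/
theorem re_inner_component_eq_zero (hDo : IsOpen D) (hD : D ⊆ {x | 0 < x 0}) {U : HTilde D}
    (hU : U ∈ HTildeZero D) : RCLike.re (inner ℂ (U.1 3) (U.1 1)) = 0 := by
  have hcl : IsClosed {U : HTilde D | RCLike.re (inner ℂ (U.1 3) (U.1 1)) = 0} :=
    isClosed_eq (RCLike.continuous_re.comp
      ((HTilde.component D 3).continuous.inner (HTilde.component D 1).continuous)) continuous_const
  have hsub : {U : HTilde D | ∃ φ : Plane → ℂ, IsTest D φ ∧ U.1 0 =ᵐ[rMeasure D] φ} ⊆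
      {U : HTilde D | RCLike.re (inner ℂ (U.1 3) (U.1 1)) = 0} := by
    rintro U ⟨φ, hφ, h⟩
    rw [mem_ofPred_eq]
    have hDm := hDo.measurableSet
    obtain ⟨h1, -⟩ := HTilde.ae_eq_partial hDo hD hφ.1 h
    have hψ : IsTest D fun x => ‖φ x‖ ^ 2 := by
      refine ⟨hφ.1.norm_sq ℝ, hφ.2.1.comp_left (g := fun z : ℂ => ‖z‖ ^ 2) (by simp), ?_⟩
      refine (closure_mono fun x hx => ?_).trans hφ.2.2
      intro h0
      exact hx (by simp [h0])
    -- The constant 1 has weak derivative 0; tested with |φ|², this says that ∂_r |φ|² integrates to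
    -- zero.
    have h2 := isWeakPartial_of_contDiff (D := D) (φ := fun _ : Plane => (1 : ℝ)) contDiff_const 0 _ hψ
    simp only [fderiv_fun_const, Pi.zero_apply, zero_apply, smul_eq_mul, mul_one] at h2
    rw [L2.inner_def, ← integral_re (L2.integrable_inner _ _), integral_rMeasure hDm hD]
    have h3 : ∫ x in D, x 0 • RCLike.re (inner ℂ (U.1 3 x) (U.1 1 x)) =
        ∫ x in D, 2⁻¹ * fderiv ℝ (fun x => ‖φ x‖ ^ 2) x (EuclideanSpace.single 0 1) := by
      refine integral_congr_ae ?_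
      filter_upwards [(ae_rMeasure_iff hDm hD).1 h, (ae_rMeasure_iff hDm hD).1 h1,
        (ae_rMeasure_iff hDm hD).1 U.2.2.2, ae_restrict_mem hDm] with x a1 a2 a3 hx
      have hx0 : x 0 ≠ 0 := (hD hx).ne'
      have a4 := ((hφ.1.differentiable (by simp) x).hasFDerivAt).norm_sq
      have a5 : fderiv ℝ (fun x => ‖φ x‖ ^ 2) x = _ := a4.fderiv
      have a6 : fderiv ℝ (fun x => ‖φ x‖ ^ 2) x (EuclideanSpace.single 0 1) =
          2 * inner ℝ (φ x) (fderiv ℝ φ x (EuclideanSpace.single 0 1)) := by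
        rw [a5]; simp; ring
      rw [a6, a3, a2, a1, ← mul_assoc, inv_mul_cancel₀ two_ne_zero, one_mul, div_eq_inv_mul,
        ← smul_eq_mul ((x 0 : ℂ)⁻¹), inner_smul_left, ← Complex.ofReal_inv, Complex.conj_ofReal,
        smul_eq_mul]
      have a7 : RCLike.re ((((x 0)⁻¹ : ℝ) : ℂ) * inner ℂ (φ x)
          (fderiv ℝ φ x (EuclideanSpace.single 0 1))) = (x 0)⁻¹ * RCLike.re (inner ℂ (φ x)
          (fderiv ℝ φ x (EuclideanSpace.single 0 1))) := RCLike.re_ofReal_mul _ _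
      rw [a7, mul_inv_cancel_left₀ hx0]
      rfl
    rw [h3, integral_const_mul, h2]
    simp
  have h := closure_minimal hsub hcl (show U ∈ _ from hU)
  rwa [mem_ofPred_eq] at h

theorem norm_zero_component_le {R : ℝ} (hDm : MeasurableSet D)
    (hD : D ⊆ {x | 0 < x 0 ∧ x 0 < R}) (U : HTilde D) : ‖U.1 0‖ ≤ R * ‖U.1 3‖ := by
  have hD' : D ⊆ {x | 0 < x 0} := fun x hx => (hD hx).1
  refine Lp.norm_le_mul_norm_of_ae_le_mul ?_
  filter_upwards [U.2.2.2, (ae_rMeasure_iff hDm hD').2 (ae_restrict_mem hDm)] with x h1 h2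
  have h3 := hD h2
  have h4 : 0 < x 0 := h3.1
  rw [h1, norm_div, Complex.norm_real, Real.norm_of_nonneg h4.le, mul_div_assoc', le_div_iff₀ h4,
    mul_comm]
  exact mul_le_mul_of_nonneg_right h3.2.le (norm_nonneg _)

/-- Coercivity of the curl on `H̃¹_{1,Γ}(D)`. -/
theorem norm_sq_le_curlL {R : ℝ} (hDo : IsOpen D) (hD : D ⊆ {x | 0 < x 0 ∧ x 0 < R}) {U : HTilde D}
    (hU : U ∈ HTildeZero D) : ‖U‖ ^ 2 ≤ (1 + R ^ 2) * ‖curlL D U‖ ^ 2 := by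
  have h1 := re_inner_component_eq_zero hDo (fun x hx => (hD hx).1) hU
  rw [norm_curlL_sq, norm_add_sq (𝕜 := ℂ), HTilde.norm_sq,
    show RCLike.re (inner ℂ (U.1 1) (U.1 3)) = RCLike.re (inner ℂ (U.1 3) (U.1 1)) from
      inner_re_symm _ _, h1]
  have h2 := pow_le_pow_left₀ (norm_nonneg _) (norm_zero_component_le hDo.measurableSet hD U) 2
  rw [mul_pow] at h2
  nlinarith [sq_nonneg ‖U.1 1‖, sq_nonneg ‖U.1 2‖, sq_nonneg R,
    mul_nonneg (sq_nonneg R) (sq_nonneg ‖U.1 1‖), mul_nonneg (sq_nonneg R) (sq_nonneg ‖U.1 2‖)]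

end Curl

/-! ### The conductivity and the reluctivity as operators. -/

section Conductivity

variable {D Ω : Set Plane}

/-- The product of a function in `H¹₁(D)` and a function in `H̃¹_{1,Γ}(Ω)` as an element of
`L²₁(D)`. -/
theorem exists_product_map (hp : IsPolygon D) (hD : D ⊆ {x | 0 < x 0}) (hΩo : IsOpen Ω)
    (hΩ : Ω ⊆ {x | 0 < x 0}) (hDΩ : D ⊆ Ω) :
    ∃ (Q : H1 D → HTilde Ω → Lp ℂ 2 (rMeasure D)) (C : ℝ), 0 ≤ C ∧ ∀ U, ∀ A ∈ HTildeZero Ω,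
      (Q U A =ᵐ[rMeasure D] fun y => (U.1 0 y : ℂ) * A.1 0 y) ∧
      ‖Q U A‖ ≤ C * Real.sqrt (‖U.1 0‖ * ‖U‖) * ‖A‖ := by
  obtain ⟨C, hC0, hC⟩ := exists_product_estimate hp hD hΩo hΩ hDΩ
  have hbound : ∀ U : H1 D, ∀ A ∈ HTildeZero Ω,
      eLpNorm (fun y => (U.1 0 y : ℂ) * A.1 0 y) 2 (rMeasure D) ^ 2 ≤
        ENNReal.ofReal (C * (‖U.1 0‖ * ‖U‖ * ‖A‖ ^ 2)) := fun U A hA => by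
    have h1 := eLpNorm_nnreal_pow_eq_lintegral (f := fun y => (U.1 0 y : ℂ) * A.1 0 y)
      (μ := rMeasure D) (p := 2) (by norm_num)
    norm_num at h1
    rw [h1]
    refine le_trans (le_of_eq (lintegral_congr fun y => ?_)) (hC U A hA)
    rw [← mul_pow, ← ofReal_norm, ← ofReal_norm, ← ofReal_norm, Complex.norm_real]
  have hm : ∀ U : H1 D, ∀ A ∈ HTildeZero Ω,
      MemLp (fun y => (U.1 0 y : ℂ) * A.1 0 y) 2 (rMeasure D) := fun U A hA => by
    refine ⟨?_, ?_⟩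
    · exact (Complex.continuous_ofReal.comp_aestronglyMeasurable (Lp.aestronglyMeasurable _)).mul
        ((Lp.aestronglyMeasurable (A.1 0)).mono_measure (rMeasure_mono hDΩ))
    · exact (ENNReal.pow_lt_top_iff).1 ((hbound U A hA).trans_lt ENNReal.ofReal_lt_top)
        |>.resolve_right (by norm_num)
  classical
  refine ⟨fun U A => if hA : A ∈ HTildeZero Ω then (hm U A hA).toLp else 0, Real.sqrt C,
    Real.sqrt_nonneg _, fun U A hA => ?_⟩
  simp only [dif_pos hA]
  refine ⟨(hm U A hA).coeFn_toLp, ?_⟩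
  refine le_of_sq_le_sq ?_ (by positivity)
  rw [mul_pow, mul_pow, Real.sq_sqrt hC0, Real.sq_sqrt (by positivity), Lp.norm_toLp, mul_assoc]
  have h2 := ENNReal.toReal_mono ENNReal.ofReal_ne_top (hbound U A hA)
  rwa [ENNReal.toReal_ofReal (by positivity), ENNReal.toReal_pow] at h2

theorem norm_le_of_indicator {α V V' : Type*} [MeasurableSpace α] {μ ν : Measure α}
    [NormedAddCommGroup V] [NormedAddCommGroup V'] {s : Set α} (hs : MeasurableSet s)
    (hν : μ.restrict s = ν) {f : Lp V 2 μ} {g : Lp V' 2 ν} {c : ℝ} (hc : 0 ≤ c)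
    (h : ∀ᵐ x ∂μ, ‖f x‖ ≤ c * ‖s.indicator g x‖) : ‖f‖ ≤ c * ‖g‖ := by
  have h1 := eLpNorm_le_mul_eLpNorm_of_ae_le_mul h 2
  rw [eLpNorm_indicator_eq_eLpNorm_restrict hs, hν] at h1
  rw [Lp.norm_def, Lp.norm_def, ← ENNReal.toReal_ofReal hc, ← ENNReal.toReal_mul]
  exact ENNReal.toReal_mono (ENNReal.mul_ne_top ENNReal.ofReal_ne_top (Lp.eLpNorm_ne_top g)) h1

variable {m : ℕ} {G : Geometry m} {P : ProblemData G}

theorem ae_conductors_of {p : Plane → Prop} (h0 : ∀ᵐ x ∂(volume.restrict G.workpiece), p x)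
    (hk : ∀ k, ∀ᵐ x ∂(volume.restrict (G.coil k)), p x) :
    ∀ᵐ x ∂(volume.restrict G.conductors), p x := by
  rw [Geometry.conductors, ae_restrict_union_iff, ae_restrict_iUnion_iff]
  exact ⟨h0, hk⟩

theorem exists_sigma_bound (hP : P.Admissible) : ∃ s : ℝ, 0 ≤ s ∧
    ∀ᵐ x ∂(volume.restrict G.conductors), ∀ u, 0 ≤ P.σ x u ∧ P.σ x u ≤ s := by
  obtain ⟨a, b, ha, hab⟩ := hP.σ_bounds
  have hsum : 0 ≤ ∑ k, P.σcoil k := Finset.sum_nonneg fun k _ => (hP.σcoil_pos k).le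
  refine ⟨|b| + ∑ k, P.σcoil k, by positivity, ae_conductors_of ?_ fun k => ?_⟩
  · filter_upwards [hab] with x hx u
    have := hx u
    exact ⟨ha.le.trans this.1, by linarith [le_abs_self b]⟩
  · filter_upwards [hP.σ_coil k] with x hx u
    rw [hx]
    refine ⟨(hP.σcoil_pos k).le, ?_⟩
    have := Finset.single_le_sum (f := P.σcoil) (fun k _ => (hP.σcoil_pos k).le) (Finset.mem_univ k)
    linarith [abs_nonneg b]

theorem aemeasurable_sigma (hP : P.Admissible) (T : Lp ℝ 2 (rMeasure G.workpiece)) :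
    AEMeasurable (fun x => P.σ x (T x)) (volume.restrict G.domain) :=
  aemeasurable_caratheodory_comp hP.σ_caratheodory.1 hP.σ_caratheodory.2 (Lp.stronglyMeasurable T)

theorem withDensity_ac (D : Set Plane) : rMeasure D ≪ volume.restrict D :=
  withDensity_absolutelyContinuous _ _

/-- Multiplication by the conductivity at temperature `T`, extended by zero. -/
theorem exists_sigma_operator (hP : P.Admissible) : ∃ (s : ℝ)
    (M : Lp ℝ 2 (rMeasure G.workpiece) → Lp ℂ 2 (rMeasure G.domain) →L[ℂ] Lp ℂ 2 (rMeasure G.domain)),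
    0 ≤ s ∧ (∀ T u, M T u =ᵐ[rMeasure G.domain]
      fun x => G.conductors.indicator (fun x => (P.σ x (T x) : ℂ)) x * u x) ∧
    ∀ T u, ‖M T u‖ ≤ s * ‖u‖ := by
  obtain ⟨s, hs0, hs⟩ := exists_sigma_bound hP
  have key := fun T : Lp ℝ 2 (rMeasure G.workpiece) =>
    exists_mul_operator (𝕜 := ℂ) (μ := rMeasure G.domain)
      (k := G.conductors.indicator fun x => (P.σ x (T x) : ℂ)) (C := s) (by
        refine AEStronglyMeasurable.indicator ?_ G.isOpen_conductors.measurableSet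
        exact Complex.continuous_ofReal.comp_aestronglyMeasurable
          ((aemeasurable_sigma hP T).mono_ac (withDensity_ac _)).aestronglyMeasurable) (by
        refine (withDensity_ac _).ae_le ?_
        rw [ae_restrict_iff' G.isOpen_conductors.measurableSet] at hs
        filter_upwards [ae_restrict_of_ae hs] with x hx
        by_cases hxc : x ∈ G.conductors
        · rw [indicator_of_mem hxc, Complex.norm_real, Real.norm_of_nonneg (hx hxc _).1]
          exact (hx hxc _).2
        · rw [indicator_of_notMem hxc, norm_zero]
          exact hs0)
  choose M hM hM' using key
  exact ⟨s, M, hs0, hM, hM'⟩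

theorem ae_sigma_sub_le {σp : ℝ} (hσ0 : 0 ≤ σp) (hP : P.Admissible)
    (hσ : ∀ᵐ x ∂(volume.restrict G.workpiece), ∀ u v : ℝ, |P.σ x u - P.σ x v| ≤ σp * |u - v|) :
    ∀ᵐ x ∂(rMeasure G.domain), ∀ u v : ℝ,
      ‖G.conductors.indicator (fun x => (P.σ x u : ℂ)) x -
        G.conductors.indicator (fun x => (P.σ x v : ℂ)) x‖ ≤
        σp * ‖G.workpiece.indicator (fun _ => (u - v : ℝ)) x‖ := by
  have h1 : ∀ᵐ x ∂(volume.restrict G.conductors), ∀ u v : ℝ, |P.σ x u - P.σ x v| ≤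
      σp * ‖G.workpiece.indicator (fun _ => (u - v : ℝ)) x‖ := by
    refine ae_conductors_of ?_ fun k => ?_
    · filter_upwards [hσ, ae_restrict_mem G.workpiece_polygon.isOpen.measurableSet] with x hx hm u v
      rw [indicator_of_mem hm]
      exact hx u v
    · filter_upwards [hP.σ_coil k] with x hx u v
      rw [hx, hx, sub_self, abs_zero]
      positivity
  rw [ae_restrict_iff' G.isOpen_conductors.measurableSet] at h1
  refine (withDensity_ac _).ae_le ?_
  filter_upwards [ae_restrict_of_ae h1] with x hx u v
  by_cases hxc : x ∈ G.conductors
  · rw [indicator_of_mem hxc, indicator_of_mem hxc, ← Complex.ofReal_sub, Complex.norm_real]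
    exact hx hxc u v
  · rw [indicator_of_notMem hxc, indicator_of_notMem hxc, sub_zero, norm_zero]
    positivity

/-- The magnetic form as a monotone and Lipschitz continuous operator on the curls. -/
theorem exists_magnetic_operator (hP : P.Admissible) :
    ∃ (N : Lp CurlSpace 2 (rMeasure G.domain) → Lp CurlSpace 2 (rMeasure G.domain)) (L l : ℝ),
      0 ≤ L ∧ 0 < l ∧ N 0 = 0 ∧ (∀ c d, ‖N c - N d‖ ≤ L * ‖c - d‖) ∧
      (∀ c d, l * ‖c - d‖ ^ 2 ≤ RCLike.re (inner ℂ (N c - N d) (c - d))) ∧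
      ∀ U Z : HTilde G.domain,
        inner ℂ (curlL G.domain Z) (N (curlL G.domain U)) = P.magneticForm U Z := by
  obtain ⟨νmin, hν0, hν⟩ := hP.νC_bounds
  obtain ⟨ξ, hξ0, hξ⟩ := hP.νC_lipschitz
  obtain ⟨ρ, hρ0, hρ⟩ := hP.νC_monotone
  have hνν : νmin ≤ P.ν₀ := (hν 0 le_rfl).1.trans (hν 0 le_rfl).2
  set n : Plane → CurlSpace → CurlSpace := fun x a => (P.reluctivity x ‖a‖ : ℂ) • a with hn
  set L := max ξ P.ν₀ with hL
  set l := min ρ νmin with hl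
  have hL0 : 0 ≤ L := hξ0.le.trans (le_max_left _ _)
  have n1 : ∀ x ∈ G.conductors, ∀ a, n x a = (P.νC ‖a‖ : ℂ) • a := fun x hx a => by
    simp only [hn, ProblemData.reluctivity, if_pos hx]
  have n2 : ∀ x ∉ G.conductors, ∀ a, n x a = (P.ν₀ : ℂ) • a := fun x hx a => by
    simp only [hn, ProblemData.reluctivity, if_neg hx]
  have k1 : ∀ a b : CurlSpace, ‖(P.νC ‖a‖ : ℂ) • a - (P.νC ‖b‖ : ℂ) • b‖ ≤ L * ‖a - b‖ :=
    fun a b => norm_smul_sub_smul_le (hν0.le.trans (hν _ (norm_nonneg a)).1)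
      (hν0.le.trans (hν _ (norm_nonneg b)).1) (hν _ (norm_nonneg a)).2 (hν _ (norm_nonneg b)).2
      (le_max_left _ _) hξ0.le (le_max_right _ _) (hξ _ _ (norm_nonneg a) (norm_nonneg b))
  have hLip : ∀ x a b, ‖n x a - n x b‖ ≤ L * ‖a - b‖ := fun x a b => by
    by_cases hx : x ∈ G.conductors
    · rw [n1 x hx, n1 x hx]; exact k1 a b
    · rw [n2 x hx, n2 x hx, ← smul_sub, norm_smul, Complex.norm_real,
        Real.norm_of_nonneg hP.ν₀_pos.le]
      exact mul_le_mul_of_nonneg_right (le_max_right _ _) (norm_nonneg _)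
  have hmon : ∀ x a b, l * ‖a - b‖ ^ 2 ≤ RCLike.re (inner ℂ (n x a - n x b) (a - b)) :=
    fun x a b => by
    by_cases hx : x ∈ G.conductors
    · rw [n1 x hx, n1 x hx]
      exact le_re_inner_smul_sub_smul (hν _ (norm_nonneg a)).1 (hν _ (norm_nonneg b)).1
        (min_le_left _ _) (min_le_right _ _) (hρ _ _ (norm_nonneg a) (norm_nonneg b))
    · rw [n2 x hx, n2 x hx, ← smul_sub, inner_smul_left, Complex.conj_ofReal]
      have h1 : RCLike.re ((P.ν₀ : ℂ) * inner ℂ (a - b) (a - b)) =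
          P.ν₀ * RCLike.re (inner ℂ (a - b) (a - b)) := RCLike.re_ofReal_mul _ _
      rw [h1, inner_self_eq_norm_sq]
      exact mul_le_mul_of_nonneg_right ((min_le_right _ _).trans hνν) (sq_nonneg _)
  have hmeas : ∀ c : Lp CurlSpace 2 (rMeasure G.domain),
      AEStronglyMeasurable (fun x => n x (c x)) (rMeasure G.domain) := fun c => by
    -- ν_C itself need not be continuous; it is the map a ↦ ν_C(|a|) a that is Lipschitz.
    have g1 : Continuous fun a : CurlSpace => (P.νC ‖a‖ : ℂ) • a :=
      (LipschitzWith.of_dist_le_mul (K := L.toNNReal) fun a b => by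
        rw [dist_eq_norm, dist_eq_norm, Real.coe_toNNReal _ hL0]; exact k1 a b).continuous
    have hc := Lp.stronglyMeasurable c
    have hsm := ((g1.comp_stronglyMeasurable hc).indicator G.isOpen_conductors.measurableSet).add
      ((hc.const_smul (P.ν₀ : ℂ)).indicator G.isOpen_conductors.measurableSet.compl)
    refine hsm.aestronglyMeasurable.congr (Eventually.of_forall fun x => ?_)
    by_cases hx : x ∈ G.conductors
    · have hx' : x ∉ G.conductorsᶜ := fun h => h hx
      simp only [Pi.add_apply, indicator_of_mem hx, indicator_of_notMem hx', n1 x hx, add_zero]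
    · have hx' : x ∈ G.conductorsᶜ := hx
      simp only [Pi.add_apply, indicator_of_mem hx', indicator_of_notMem hx, n2 x hx, zero_add]
      rfl
  obtain ⟨N, hN, hN0, hN1, hN2⟩ := exists_superposition (μ := rMeasure G.domain)
    (fun x => by simp only [hn, smul_zero]) hLip hmon hmeas
  refine ⟨N, L, l, hL0, lt_min hρ0 hν0, hN0, hN1, hN2, fun U Z => ?_⟩
  rw [L2.inner_def, ProblemData.magneticForm]
  refine integral_congr_ae ?_
  filter_upwards [hN (curlL G.domain U), curlL_ae U, curlL_ae Z, norm_curlL_ae U] with x h1 h2 h3 h4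
  rw [h1, hn]
  simp only [h4]
  rw [inner_smul_right, h2, h3, inner_curl_values]

end Conductivity

/-! ### The potential as a function of the temperature. -/

section Potential

open ContinuousLinearMap (adjoint adjoint_inner_right)

variable {m : ℕ} {G : Geometry m} {P : ProblemData G}

theorem ae_workpiece_imp {p : Plane → Prop} (h : ∀ᵐ x ∂(rMeasure G.workpiece), p x) :
    ∀ᵐ x ∂(rMeasure G.domain), x ∈ G.workpiece → p x := by
  rwa [← rMeasure_restrict G.workpiece_polygon.isOpen.measurableSet G.workpiece_subset,
    ae_restrict_iff' G.workpiece_polygon.isOpen.measurableSet] at h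

/-- The conductivities differ only in the workpiece, and there by at most σ_p |T - T'|. So the
difference of the currents is bounded by a product (T - T') w, to which the product estimate will
apply. -/
theorem norm_sigma_sub_le {σp : ℝ} (hσ0 : 0 ≤ σp) (hP : P.Admissible)
    (hσ : ∀ᵐ x ∂(volume.restrict G.workpiece), ∀ u v : ℝ, |P.σ x u - P.σ x v| ≤ σp * |u - v|)
    {T T' : H1 G.workpiece} {w g g' : Lp ℂ 2 (rMeasure G.domain)}
    {q : Lp ℂ 2 (rMeasure G.workpiece)}
    (hg : g =ᵐ[rMeasure G.domain]
      fun x => G.conductors.indicator (fun x => (P.σ x (T.1 0 x) : ℂ)) x * w x)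
    (hg' : g' =ᵐ[rMeasure G.domain]
      fun x => G.conductors.indicator (fun x => (P.σ x (T'.1 0 x) : ℂ)) x * w x)
    (hq : q =ᵐ[rMeasure G.workpiece] fun x => ((T - T').1 0 x : ℂ) * w x) :
    ‖g - g'‖ ≤ σp * ‖q‖ := by
  have hr : (rMeasure G.domain).restrict G.workpiece = rMeasure G.workpiece :=
    rMeasure_restrict G.workpiece_polygon.isOpen.measurableSet G.workpiece_subset
  refine norm_le_of_indicator G.workpiece_polygon.isOpen.measurableSet hr hσ0 ?_
  have hs : ((T - T').1 0 : Plane → ℝ) =ᵐ[rMeasure G.workpiece]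
      fun x => T.1 0 x - T'.1 0 x := Lp.coeFn_sub (T.1 0) (T'.1 0)
  filter_upwards [Lp.coeFn_sub g g', hg, hg', ae_sigma_sub_le hσ0 hP hσ, ae_workpiece_imp hq,
    ae_workpiece_imp hs] with x h1 h2 h3 h4 h5 h6
  have h7 := h4 (T.1 0 x) (T'.1 0 x)
  have e : ∀ u : Plane → ℝ, G.conductors.indicator (fun y => (P.σ y (u y) : ℂ)) x =
      G.conductors.indicator (fun y => (P.σ y (u x) : ℂ)) x := fun u => by
    by_cases hx : x ∈ G.conductors
    · rw [indicator_of_mem hx, indicator_of_mem hx]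
    · rw [indicator_of_notMem hx, indicator_of_notMem hx]
  rw [h1, Pi.sub_apply, h2, h3, ← sub_mul, norm_mul, e, e]
  refine (mul_le_mul_of_nonneg_right h7 (norm_nonneg _)).trans (le_of_eq ?_)
  by_cases hx : x ∈ G.workpiece
  · rw [indicator_of_mem hx, indicator_of_mem hx, h5 hx, h6 hx, norm_mul, Complex.norm_real,
      mul_assoc]
  · rw [indicator_of_notMem hx, indicator_of_notMem hx]
    simp

theorem inner_sigma_eq {T : Plane → ℝ} {w z g : Lp ℂ 2 (rMeasure G.domain)}
    (hg : g =ᵐ[rMeasure G.domain]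
      fun x => G.conductors.indicator (fun x => (P.σ x (T x) : ℂ)) x * w x) :
    inner ℂ z g = ∫ x, (P.σ x (T x) : ℂ) * w x * conj (z x) ∂(rMeasure G.conductors) := by
  rw [← rMeasure_restrict G.isOpen_conductors.measurableSet G.conductors_subset,
    ← integral_indicator G.isOpen_conductors.measurableSet, L2.inner_def]
  refine integral_congr_ae ?_
  filter_upwards [hg] with x hx
  rw [hx, RCLike.inner_apply]
  by_cases hc : x ∈ G.conductors
  · rw [indicator_of_mem hc, indicator_of_mem hc]
  · rw [indicator_of_notMem hc, indicator_of_notMem hc, zero_mul, zero_mul]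

/-- The load has no weight r, and Z = (Z/r) r: it is an inner product in L²₁ of the component Z/r
with a constant on the coil. -/
theorem exists_coil_load (P : ProblemData G) (k : Fin m) :
    ∃ h : Lp ℂ 2 (rMeasure G.domain), ∀ Z : HTilde G.domain,
      inner ℂ (Z.1 3) h = ∫ x in G.coil k, (P.σcoil k : ℂ) * P.V k * conj (Z.1 0 x) := by
  have hfin := isFiniteMeasure_rMeasure G.isBounded_domain
  have hm := (G.coil_open k).measurableSet
  refine ⟨indicatorConstLp 2 hm (measure_ne_top _ _) ((P.σcoil k : ℂ) * P.V k), fun Z => ?_⟩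
  have hpos : G.coil k ⊆ {x | 0 < x 0} := (G.coil_subset k).trans G.domain_subset
  have hr : (rMeasure G.domain).restrict (G.coil k) = rMeasure (G.coil k) :=
    rMeasure_restrict hm (G.coil_subset k)
  rw [← inner_conj_symm, L2.inner_indicatorConstLp_eq_setIntegral_inner, hr, integral_rMeasure hm hpos, ← integral_conj]
  have h3 : ∀ᵐ x ∂(rMeasure (G.coil k)), Z.1 3 x = Z.1 0 x / (x 0 : ℂ) := by
    rw [← hr]
    exact ae_restrict_of_ae Z.2.2.2
  rw [ae_rMeasure_iff hm hpos] at h3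
  refine integral_congr_ae ?_
  filter_upwards [h3, ae_restrict_mem hm] with x hx hxk
  have hx0 : (x 0 : ℂ) ≠ 0 := by
    have : 0 < x 0 := hpos hxk
    exact_mod_cast this.ne'
  rw [hx, RCLike.inner_apply, RCLike.real_smul_eq_coe_mul]
  simp only [map_mul, map_div₀, Complex.conj_conj]
  simp only [Complex.conj_ofReal, Complex.coe_algebraMap]
  field_simp

/-- Solutions of a family of monotone problems `c† N c u + i θ p† M_i p u = f` with symmetric
`M_i`. -/
theorem exists_solution_family {ι X Y H : Type*} [NormedAddCommGroup X] [InnerProductSpace ℂ X]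
    [CompleteSpace X] [NormedAddCommGroup Y] [InnerProductSpace ℂ Y] [CompleteSpace Y]
    [NormedAddCommGroup H] [InnerProductSpace ℂ H] [CompleteSpace H]
    {c : X →L[ℂ] Y} {N : Y → Y} {p : X →L[ℂ] H} {M : ι → H →L[ℂ] H} {L l a s θ : ℝ}
    (hθ : 0 ≤ θ) (ha0 : 0 < a) (hs0 : 0 ≤ s) (hL0 : 0 ≤ L) (hN0 : N 0 = 0)
    (hNL : ∀ c d, ‖N c - N d‖ ≤ L * ‖c - d‖)
    (hNl : ∀ c d, l * ‖c - d‖ ^ 2 ≤ RCLike.re (inner ℂ (N c - N d) (c - d)))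
    (hcn : ∀ u, a * ‖u‖ ^ 2 ≤ l * ‖c u‖ ^ 2) (hpn : ∀ u, ‖p u‖ ≤ ‖u‖)
    (hMs : ∀ i w, ‖M i w‖ ≤ s * ‖w‖)
    (hreal : ∀ i w, conj (inner ℂ w (M i w)) = inner ℂ w (M i w)) (f : X) :
    ∃ S : ι → X, (∀ i, ‖S i‖ ≤ ‖f‖ / a) ∧
      (∀ i u, (∀ z, Complex.I * (θ : ℂ) * inner ℂ (p z) (M i (p u)) + inner ℂ (c z) (N (c u)) =
        inner ℂ z f) ↔ u = S i) ∧
      ∀ i j, ‖S i - S j‖ ≤ θ / a * ‖M i (p (S j)) - M j (p (S j))‖ := by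
  set Φ : ι → X → X := fun i u =>
    adjoint c (N (c u)) + (Complex.I * (θ : ℂ)) • adjoint p (M i (p u)) with hΦ
  have hsub : ∀ T u v, Φ T u - Φ T v = adjoint c (N (c u) - N (c v)) +
      (Complex.I * (θ : ℂ)) • adjoint p (M T (p (u - v))) := fun T u v => by
    simp only [hΦ, map_sub, smul_sub]
    abel
  have hmono : ∀ T u v, a * ‖u - v‖ ^ 2 ≤ RCLike.re (inner ℂ (Φ T u - Φ T v) (u - v)) :=
    fun T u v => by
    rw [hsub, inner_add_left, inner_smul_left, ContinuousLinearMap.adjoint_inner_left,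
      ContinuousLinearMap.adjoint_inner_left, ← inner_conj_symm (M T (p (u - v))), hreal,
      map_add]
    -- ⟨w, M w⟩ is real, so the conductivity term is imaginary and drops out of the monotonicity.
    have h2 : RCLike.re (conj (Complex.I * (θ : ℂ)) *
        inner ℂ (p (u - v)) (M T (p (u - v)))) = 0 := by
      have h3 := Complex.conj_eq_iff_im.1 (hreal T (p (u - v)))
      show Complex.re _ = 0
      rw [Complex.mul_re, h3]
      simp
    rw [h2, add_zero]
    refine (hcn (u - v)).trans ?_
    rw [map_sub]
    exact hNl _ _
  have hlip : ∀ T u v, ‖Φ T u - Φ T v‖ ≤ (‖adjoint c‖ * (L * ‖c‖) +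
      θ * (‖adjoint p‖ * s)) * ‖u - v‖ := fun T u v => by
    rw [hsub, add_mul]
    refine (norm_add_le _ _).trans (add_le_add ?_ ?_)
    · calc _ ≤ ‖adjoint c‖ * ‖N (c u) - N (c v)‖ := ContinuousLinearMap.le_opNorm _ _
        _ ≤ ‖adjoint c‖ * (L * (‖c‖ * ‖u - v‖)) := by
          gcongr
          refine (hNL _ _).trans ?_
          rw [← map_sub]
          gcongr
          exact ContinuousLinearMap.le_opNorm _ _
        _ = _ := by ring
    · rw [norm_smul, norm_mul, Complex.norm_I, one_mul, Complex.norm_real,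
        Real.norm_of_nonneg hθ, mul_assoc, mul_assoc]
      refine mul_le_mul_of_nonneg_left ?_ hθ
      refine (ContinuousLinearMap.le_opNorm _ _).trans ?_
      refine mul_le_mul_of_nonneg_left ?_ (norm_nonneg _)
      exact (hMs _ _).trans (mul_le_mul_of_nonneg_left (hpn _) hs0)
  have hbij := fun T => bijective_of_strongly_monotone ha0 (hlip T) (hmono T)
  have hcancel : ∀ {v : X} {b : ℝ}, 0 ≤ b → a * ‖v‖ ^ 2 ≤ b * ‖v‖ → a * ‖v‖ ≤ b :=
    fun {v b} hb h => by
    rcases (norm_nonneg v).eq_or_lt with h0 | h0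
    · rwa [← h0, mul_zero]
    · exact le_of_mul_le_mul_right (by linarith [h]) h0
  choose S hS using fun T => (hbij T).2 f
  refine ⟨S, fun T => ?_, fun T u => ?_, fun T T' => ?_⟩
  · have h1 := hmono T (S T) 0
    have hzero : Φ T 0 = 0 := by simp only [hΦ, map_zero, hN0, smul_zero, add_zero]
    rw [hS, hzero, sub_zero, sub_zero] at h1
    rw [le_div_iff₀ ha0, mul_comm]
    exact hcancel (norm_nonneg _)
      (h1.trans ((RCLike.re_le_norm _).trans (norm_inner_le_norm f (S T))))
  · have h2 : ∀ z, inner ℂ z (Φ T u) = Complex.I * (θ : ℂ) * inner ℂ (p z) (M T (p u)) +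
        inner ℂ (c z) (N (c u)) := fun z => by
      simp only [hΦ]
      rw [inner_add_right, inner_smul_right, adjoint_inner_right, adjoint_inner_right, add_comm]
    rw [← (hbij T).1.eq_iff, hS]
    constructor
    · intro h
      exact ext_inner_left ℂ fun z => (h2 z).trans (h z)
    · intro h z
      rw [← h2, h]
  · set u := S T with hu
    set v := S T' with hv
    have h1 := hmono T u v
    -- Since Φ_T(u) = f = Φ_{T'}(v), comparing u and v under the same Φ_T leaves only the change of
    -- conductivity, applied to v.
    have h2 : Φ T u - Φ T v = (Complex.I * (θ : ℂ)) •
        adjoint p (M T' (p v) - M T (p v)) := by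
      rw [hu, hS, ← hS T', ← hv]
      simp only [hΦ, map_sub, smul_sub]
      abel
    rw [h2, inner_smul_left, ContinuousLinearMap.adjoint_inner_left] at h1
    rw [div_mul_eq_mul_div, le_div_iff₀ ha0, mul_comm]
    refine hcancel (by positivity) (h1.trans ((RCLike.re_le_norm _).trans ?_))
    rw [norm_mul, RCLike.norm_conj, norm_mul, Complex.norm_I, one_mul, Complex.norm_real,
      Real.norm_of_nonneg hθ, mul_assoc, norm_sub_rev (M T (p v))]
    refine mul_le_mul_of_nonneg_left ?_ hθ
    exact (norm_inner_le_norm _ _).trans (mul_le_mul_of_nonneg_left (hpn _) (norm_nonneg _))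

/-- The space `H̃¹_{1,Γ}(D)` with its Hilbert space structure. -/
def ZeroSpace (D : Set Plane) : Type := zeroSubmodule D

instance (D : Set Plane) : NormedAddCommGroup (ZeroSpace D) :=
  inferInstanceAs (NormedAddCommGroup (zeroSubmodule D))

instance (D : Set Plane) : InnerProductSpace ℂ (ZeroSpace D) :=
  inferInstanceAs (InnerProductSpace ℂ (zeroSubmodule D))

/-- The inclusion of `H̃¹_{1,Γ}(D)` in `H̃¹₁(D)`. -/
def ZeroSpace.incl (D : Set Plane) : ZeroSpace D →L[ℂ] HTilde D := (zeroSubmodule D).subtypeL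

/-- The magnetic equation determines the potential as a function of the temperature. -/
theorem exists_potential_map (hP : P.Admissible) (hσ : P.HSigma) :
    ∃ (S : H1 G.workpiece → HTilde G.domain) (K C : ℝ), 0 ≤ K ∧ 0 ≤ C ∧
      (∀ T, S T ∈ HTildeZero G.domain) ∧ (∀ T, ‖S T‖ ≤ K) ∧
      (∀ T, ∀ A ∈ HTildeZero G.domain, P.MagneticEq A T ↔ A = S T) ∧
      ∀ T T', ‖S T - S T'‖ ≤ C * Real.sqrt (‖(T - T').1 0‖ * ‖T - T'‖) := by
  obtain ⟨N, L, l, hL0, hl0, hN0, hNL, hNl, hN⟩ := exists_magnetic_operator hP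
  obtain ⟨s, M, hs0, hM, hMs⟩ := exists_sigma_operator hP
  obtain ⟨Q, q, hq0, hQ⟩ := exists_product_map G.workpiece_polygon G.workpiece_subset_pos
    G.isOpen_domain G.domain_subset G.workpiece_subset
  obtain ⟨σp, hσp, hσ⟩ := hσ
  choose h hh using exists_coil_load P
  have : CompleteSpace (ZeroSpace G.domain) := completeSpace_zeroSubmodule G.isOpen_domain.measurableSet G.domain_subset
    G.isBounded_domain
  have ha0 : 0 < l / (1 + G.R ^ 2) := by positivity
  have hcn : ∀ u : ZeroSpace G.domain, l / (1 + G.R ^ 2) * ‖u‖ ^ 2 ≤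
      l * ‖((curlL G.domain).comp (ZeroSpace.incl G.domain)) u‖ ^ 2 := fun u => by
    have h1 : ‖u‖ ^ 2 ≤ (1 + G.R ^ 2) *
        ‖((curlL G.domain).comp (ZeroSpace.incl G.domain)) u‖ ^ 2 :=
      norm_sq_le_curlL (R := G.R) G.isOpen_domain (fun x hx => ⟨hx.1.1, hx.1.2⟩) u.2
    rw [div_mul_eq_mul_div, div_le_iff₀ (by positivity), mul_assoc, mul_comm _ (1 + G.R ^ 2)]
    exact mul_le_mul_of_nonneg_left h1 hl0.le
  obtain ⟨S, hS1, hS2, hS3⟩ := exists_solution_family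
    (p := (HTilde.component G.domain 0).comp (ZeroSpace.incl G.domain))
    (M := fun T : H1 G.workpiece => M (T.1 0)) hP.freq_pos.le ha0 hs0 hL0
    hN0 hNL hNl hcn (fun u => HTilde.norm_component_le 0 u.1) (fun T w => hMs _ w)
    (fun T w => by
      rw [inner_sigma_eq (hM (T.1 0) w), ← integral_conj]
      refine integral_congr_ae (Eventually.of_forall fun x => ?_)
      simp only [map_mul, Complex.conj_ofReal, Complex.conj_conj]
      ring)
    (∑ k, adjoint (𝕜 := ℂ) ((HTilde.component G.domain 3).comp (ZeroSpace.incl G.domain))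
      (h k))
  set f := ∑ k, adjoint (𝕜 := ℂ)
    ((HTilde.component G.domain 3).comp (ZeroSpace.incl G.domain)) (h k) with hf
  refine ⟨fun T => (S T).1, ‖f‖ / (l / (1 + G.R ^ 2)),
    P.freq / (l / (1 + G.R ^ 2)) * (σp * (q * (‖f‖ / (l / (1 + G.R ^ 2))))), by positivity,
    by have := hP.freq_pos; positivity, fun T => (S T).2, hS1, fun T A hA => ?_, fun T T' => ?_⟩
  · have h3 : ∀ Z : ZeroSpace G.domain, inner ℂ Z f =
        ∑ k, ∫ x in G.coil k, (P.σcoil k : ℂ) * P.V k * conj (Z.1.1 0 x) := fun Z => by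
      rw [hf, inner_sum]
      refine Finset.sum_congr rfl fun k _ => ?_
      rw [adjoint_inner_right]
      exact hh k Z.1
    have h4 : ∀ Z : HTilde G.domain, inner ℂ (Z.1 0) (M (T.1 0) (A.1 0)) =
        ∫ x, (P.σ x (T.1 0 x) : ℂ) * A.1 0 x * conj (Z.1 0 x) ∂(rMeasure G.conductors) :=
      fun Z => inner_sigma_eq (hM (T.1 0) (A.1 0))
    have h7 : (⟨A, hA⟩ : ZeroSpace G.domain) = S T ↔ A = (S T).1 := Subtype.ext_iff
    have h5 := (hS2 T ⟨A, hA⟩).trans h7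
    refine Iff.trans ?_ h5
    constructor
    · intro hA' Z
      rw [h3, ← hA' Z.1 Z.2, ← h4, ← hN]
      rfl
    · intro hA' Z hZ
      have h6 := (hA' ⟨Z, hZ⟩).trans (h3 ⟨Z, hZ⟩)
      rw [← h4, ← hN]
      exact h6
  · refine (hS3 T T').trans ?_
    rw [mul_assoc]
    refine mul_le_mul_of_nonneg_left ?_ (by have := hP.freq_pos; positivity)
    refine (norm_sigma_sub_le hσp.le hP hσ (hM (T.1 0) ((S T').1.1 0))
      (hM (T'.1 0) ((S T').1.1 0)) (hQ (T - T') (S T').1 (S T').2).1).trans ?_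
    have h5 := (hQ (T - T') (S T').1 (S T').2).2
    calc σp * ‖Q (T - T') (S T').1‖
        ≤ σp * (q * Real.sqrt (‖(T - T').1 0‖ * ‖T - T'‖) * (‖f‖ / (l / (1 + G.R ^ 2)))) := by
          refine mul_le_mul_of_nonneg_left (h5.trans ?_) hσp.le
          exact mul_le_mul_of_nonneg_left (hS1 T') (by positivity)
      _ = _ := by ring

end Potential

/-! ### The Joule heat as a functional of the temperature. -/

section Heat

open ContinuousLinearMap (adjoint adjoint_inner_right adjoint_inner_left)

variable {m : ℕ} {G : Geometry m} {P : ProblemData G}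

theorem exists_restriction {D Ω : Set Plane} (hDΩ : D ⊆ Ω) :
    ∃ ρ : Lp ℂ 2 (rMeasure Ω) → Lp ℂ 2 (rMeasure D), (∀ u, ρ u =ᵐ[rMeasure D] u) ∧
      (∀ u, ‖ρ u‖ ≤ ‖u‖) ∧ ∀ u v, ρ (u - v) = ρ u - ρ v := by
  have hm : ∀ u : Lp ℂ 2 (rMeasure Ω), MemLp u 2 (rMeasure D) := fun u =>
    (Lp.memLp u).mono_measure (rMeasure_mono hDΩ)
  have hae : ∀ u, ((hm u).toLp : Lp ℂ 2 (rMeasure D)) =ᵐ[rMeasure D] u := fun u =>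
    (hm u).coeFn_toLp
  have hac : rMeasure D ≪ rMeasure Ω := (rMeasure_mono hDΩ).absolutelyContinuous
  refine ⟨fun u => (hm u).toLp, hae, fun u => ?_, fun u v => Lp.ext ?_⟩
  · rw [Lp.norm_toLp, Lp.norm_def]
    exact ENNReal.toReal_mono (Lp.eLpNorm_ne_top u) (eLpNorm_mono_measure _ (rMeasure_mono hDΩ))
  · filter_upwards [hae (u - v), hac.ae_le (Lp.coeFn_sub u v), hae u, hae v,
      Lp.coeFn_sub ((hm u).toLp : Lp ℂ 2 (rMeasure D)) (hm v).toLp] with x h1 h2 h3 h4 h5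
    rw [h1, h2, h5, Pi.sub_apply, Pi.sub_apply, h3, h4]

/-- The functionals `w ↦ b Re ⟪Q w (S u), a u (S u)⟫` for bilinear maps `Q`, and their
dependence on `u`. -/
theorem exists_source_functional {V X H : Type*} [NormedAddCommGroup V] [NormedSpace ℝ V]
    [NormedAddCommGroup X] [NormedAddCommGroup H] [InnerProductSpace ℂ H] {Z : Set X}
    {Q : V → X → H} {a : V → X → H} {S : V → X} {n : V → ℝ} {K C s q σp b : ℝ}
    (hK0 : 0 ≤ K) (hC0 : 0 ≤ C) (hs0 : 0 ≤ s) (hq0 : 0 ≤ q) (hσp : 0 ≤ σp) (hb : 0 ≤ b)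
    (hn0 : ∀ u, 0 ≤ n u) (hn : ∀ u, n u ≤ ‖u‖)
    (hZ : ∀ A ∈ Z, ∀ A' ∈ Z, A - A' ∈ Z)
    (hQadd : ∀ u v, ∀ A ∈ Z, Q (u + v) A = Q u A + Q v A)
    (hQsmul : ∀ (r : ℝ) u, ∀ A ∈ Z, Q (r • u) A = (r : ℂ) • Q u A)
    (hQsub : ∀ u, ∀ A ∈ Z, ∀ A' ∈ Z, Q u (A - A') = Q u A - Q u A')
    (hQ : ∀ u, ∀ A ∈ Z, ‖Q u A‖ ≤ q * n u * ‖A‖)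
    (ha : ∀ u A, ‖a u A‖ ≤ s * ‖A‖) (has : ∀ u A A', a u (A - A') = a u A - a u A')
    (haσ : ∀ u v, ∀ A ∈ Z, ‖a u A - a v A‖ ≤ σp * ‖Q (u - v) A‖)
    (hS : ∀ u, S u ∈ Z) (hK : ∀ u, ‖S u‖ ≤ K) (hC : ∀ u v, ‖S u - S v‖ ≤ C * n (u - v)) :
    ∃ (F : V → StrongDual ℝ V) (c : ℝ),
      (∀ u w, F u w = b * RCLike.re (inner ℂ (Q w (S u)) (a u (S u)))) ∧
      ∀ u v w, |F u w - F v w| ≤ c * (n (u - v) * n w) := by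
  set F : V → StrongDual ℝ V := fun T =>
    LinearMap.mkContinuous
      { toFun := fun W => b * RCLike.re (inner ℂ (Q W (S T)) (a T (S T)))
        map_add' := fun W W' => by
          rw [hQadd _ _ _ (hS T), inner_add_left, map_add, mul_add]
        map_smul' := fun r W => by
          have h1 : RCLike.re (conj (r : ℂ) * inner ℂ (Q W (S T)) (a T (S T))) =
              r * RCLike.re (inner ℂ (Q W (S T)) (a T (S T))) := by
            rw [Complex.conj_ofReal]
            exact RCLike.re_ofReal_mul _ _
          rw [hQsmul _ _ _ (hS T), inner_smul_left, h1, RingHom.id_apply, smul_eq_mul]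
          ring }
      (b * (q * ‖S T‖ * ‖a T (S T)‖)) (fun W => by
        show ‖b * RCLike.re (inner ℂ (Q W (S T)) (a T (S T)))‖ ≤ _
        rw [norm_mul, Real.norm_of_nonneg hb, mul_assoc]
        refine mul_le_mul_of_nonneg_left ?_ hb
        calc ‖RCLike.re (inner ℂ (Q W (S T)) (a T (S T)))‖ ≤ ‖inner ℂ (Q W (S T)) (a T (S T))‖ :=
              RCLike.abs_re_le_norm _
          _ ≤ ‖Q W (S T)‖ * ‖a T (S T)‖ := norm_inner_le_norm _ _
          _ ≤ q * ‖W‖ * ‖S T‖ * ‖a T (S T)‖ := by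
              gcongr
              refine (hQ W _ (hS T)).trans ?_
              gcongr
              exact hn W
          _ = _ := by ring) with hF
  have hFv : ∀ T W, F T W = b * RCLike.re (inner ℂ (Q W (S T)) (a T (S T))) :=
    fun T W => rfl
  refine ⟨F, b * (q * K * (σp * (q * K)) + 2 * (q * C * (s * K))), hFv, fun u v w => ?_⟩
  have hX0 := hn0 (u - v)
  have hY0 := hn0 w
  have b1 : ‖a u (S u) - a v (S u)‖ ≤ σp * (q * n (u - v) * K) :=
    (haσ u v _ (hS u)).trans (mul_le_mul_of_nonneg_left ((hQ (u - v) _ (hS u)).trans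
      (mul_le_mul_of_nonneg_left (hK u) (by positivity))) hσp)
  have b2 : ‖a v (S u)‖ ≤ s * K := (ha _ _).trans (mul_le_mul_of_nonneg_left (hK u) hs0)
  have b3 : ‖a v (S u) - a v (S v)‖ ≤ s * (C * n (u - v)) := by
    rw [← has]
    exact (ha _ _).trans (mul_le_mul_of_nonneg_left (hC u v) hs0)
  have c1 : ∀ T, ‖Q w (S T)‖ ≤ q * n w * K := fun T =>
    (hQ w _ (hS T)).trans (mul_le_mul_of_nonneg_left (hK T) (by positivity))
  have c3 : ‖Q w (S u) - Q w (S v)‖ ≤ q * n w * (C * n (u - v)) := by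
    rw [← hQsub w _ (hS u) _ (hS v)]
    exact (hQ w _ (hZ _ (hS u) _ (hS v))).trans
      (mul_le_mul_of_nonneg_left (hC u v) (by positivity))
  -- The source is quadratic in the potential and also depends on u through the conductivity. One
  -- ingredient is changed at a time; each difference yields n(u - v), and the test function yields
  -- n(w).
  have e : inner ℂ (Q w (S u)) (a u (S u)) - inner ℂ (Q w (S v)) (a v (S v)) =
      inner ℂ (Q w (S u)) (a u (S u) - a v (S u)) +
      (inner ℂ (Q w (S u) - Q w (S v)) (a v (S u)) +
        inner ℂ (Q w (S v)) (a v (S u) - a v (S v))) := by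
    rw [inner_sub_right, inner_sub_left, inner_sub_right]
    ring
  have d : ‖inner ℂ (Q w (S u)) (a u (S u)) - inner ℂ (Q w (S v)) (a v (S v))‖ ≤
      (q * K * (σp * (q * K)) + 2 * (q * C * (s * K))) * (n (u - v) * n w) := by
    rw [e]
    calc _ ≤ ‖Q w (S u)‖ * ‖a u (S u) - a v (S u)‖ +
          (‖Q w (S u) - Q w (S v)‖ * ‖a v (S u)‖ +
            ‖Q w (S v)‖ * ‖a v (S u) - a v (S v)‖) :=
          (norm_add_le _ _).trans (add_le_add (norm_inner_le_norm _ _)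
            ((norm_add_le _ _).trans (add_le_add (norm_inner_le_norm _ _)
              (norm_inner_le_norm _ _))))
      _ ≤ q * n w * K * (σp * (q * n (u - v) * K)) +
          (q * n w * (C * n (u - v)) * (s * K) + q * n w * K * (s * (C * n (u - v)))) := by
        gcongr
        · exact c1 u
        · exact c1 v
      _ = _ := by ring
  rw [hFv, hFv, ← mul_sub, ← map_sub, abs_mul, abs_of_nonneg hb, mul_assoc]
  exact mul_le_mul_of_nonneg_left ((RCLike.abs_re_le_norm _).trans d) hb

/-- The product of a function in `H¹₁(D)` and a function in `H̃¹_{1,Γ}(Ω)` is bilinear. -/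
theorem product_map_bilinear {D Ω : Set Plane} (hDΩ : D ⊆ Ω)
    {Q : H1 D → HTilde Ω → Lp ℂ 2 (rMeasure D)}
    (hQ : ∀ U, ∀ A ∈ HTildeZero Ω, Q U A =ᵐ[rMeasure D] fun y => (U.1 0 y : ℂ) * A.1 0 y) :
    (∀ A ∈ HTildeZero Ω, ∀ A' ∈ HTildeZero Ω, A - A' ∈ HTildeZero Ω) ∧
    (∀ U U', ∀ A ∈ HTildeZero Ω, Q (U + U') A = Q U A + Q U' A) ∧
    (∀ (r : ℝ) U, ∀ A ∈ HTildeZero Ω, Q (r • U) A = (r : ℂ) • Q U A) ∧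
    ∀ U, ∀ A ∈ HTildeZero Ω, ∀ A' ∈ HTildeZero Ω, Q U (A - A') = Q U A - Q U A' := by
  have hac : rMeasure D ≪ rMeasure Ω := (rMeasure_mono hDΩ).absolutelyContinuous
  have hZsub : ∀ A ∈ HTildeZero Ω, ∀ A' ∈ HTildeZero Ω, A - A' ∈ HTildeZero Ω :=
    fun A h A' h' => (zeroSubmodule Ω).sub_mem (x := A) (y := A') h h'
  refine ⟨hZsub, fun U U' A hA => Lp.ext ?_, fun r U A hA => Lp.ext ?_,
    fun U A hA A' hA' => Lp.ext ?_⟩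
  · have e : ((U + U').1 0 : Plane → ℝ) =ᵐ[rMeasure D] fun x => U.1 0 x + U'.1 0 x :=
      Lp.coeFn_add (U.1 0) (U'.1 0)
    filter_upwards [hQ (U + U') A hA, hQ U A hA, hQ U' A hA, e,
      Lp.coeFn_add (Q U A) (Q U' A)] with x h1 h2 h3 h4 h5
    rw [h1, h5, Pi.add_apply, h2, h3, h4]
    push_cast
    ring
  · have e : ((r • U).1 0 : Plane → ℝ) =ᵐ[rMeasure D] fun x => r * U.1 0 x :=
      Lp.coeFn_smul r (U.1 0)
    filter_upwards [hQ (r • U) A hA, hQ U A hA, e,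
      Lp.coeFn_smul (r : ℂ) (Q U A)] with x h1 h2 h3 h4
    rw [h1, h4, Pi.smul_apply, h2, h3, smul_eq_mul]
    push_cast
    ring
  · have e : ((A - A').1 0 : Plane → ℂ) =ᵐ[rMeasure Ω] fun x => A.1 0 x - A'.1 0 x :=
      Lp.coeFn_sub (A.1 0) (A'.1 0)
    filter_upwards [hQ U _ (hZsub A hA A' hA'), hQ U A hA, hQ U A' hA', hac.ae_le e,
      Lp.coeFn_sub (Q U A) (Q U A')] with x h1 h2 h3 h4 h5
    rw [h1, h5, Pi.sub_apply, h2, h3, h4]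
    ring

/-- The heat source as a functional on `H¹₁(Ω₀)`. -/
theorem exists_source_map (hP : P.Admissible) (hσ : P.HSigma)
    {S : H1 G.workpiece → HTilde G.domain} {K C : ℝ} (hK0 : 0 ≤ K) (hC0 : 0 ≤ C)
    (hS : ∀ T, S T ∈ HTildeZero G.domain) (hK : ∀ T, ‖S T‖ ≤ K)
    (hC : ∀ T T', ‖S T - S T'‖ ≤ C * Real.sqrt (‖(T - T').1 0‖ * ‖T - T'‖)) :
    ∃ (F : H1 G.workpiece → StrongDual ℝ (H1 G.workpiece)) (c : ℝ),
      (∀ T W, F T W = 1 / 2 * ∫ x, P.freq ^ 2 * P.σ x (T.1 0 x) * ‖(S T).1 0 x‖ ^ 2 * W.1 0 x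
        ∂(rMeasure G.workpiece)) ∧
      ∀ u v w, (F u w - F v w) ^ 2 ≤
        c ^ 2 * (‖(u - v).1 0‖ * ‖u - v‖ * (‖w.1 0‖ * ‖w‖)) := by
  have hsub : G.workpiece ⊆ G.domain := G.workpiece_subset
  obtain ⟨s, M, hs0, hM, hMs⟩ := exists_sigma_operator hP
  obtain ⟨Q, q, hq0, hQ⟩ := exists_product_map G.workpiece_polygon G.workpiece_subset_pos
    G.isOpen_domain G.domain_subset hsub
  obtain ⟨σp, hσp, hσ⟩ := hσ
  obtain ⟨ρ, hρ, hρn, hρs⟩ := exists_restriction hsub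
  have hac : rMeasure G.workpiece ≪ rMeasure G.domain :=
    (rMeasure_mono hsub).absolutelyContinuous
  obtain ⟨z1, z2, z3, z4⟩ := product_map_bilinear hsub fun U A hA => (hQ U A hA).1
  -- Here n(U) is the square root of ‖U‖_H ‖U‖_V, the quantity that controls both the product
  -- estimate and the dependence of S on the temperature. The integrand σ |A|² W is read as the
  -- inner product of W A and σ A, both square integrable.
  obtain ⟨F, c, hF, hc⟩ := exists_source_functional (Z := HTildeZero G.domain) (Q := Q)
    (a := fun T A => ρ (M (T.1 0) (A.1 0))) (S := S)
    (n := fun U => Real.sqrt (‖U.1 0‖ * ‖U‖)) (b := P.freq ^ 2 / 2)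
    hK0 hC0 hs0 hq0 hσp.le (by positivity) (fun U => Real.sqrt_nonneg _)
    (fun U => by
      have h1 : ‖U.1 0‖ ≤ ‖U‖ := PiLp.norm_apply_le U.1 0
      calc Real.sqrt (‖U.1 0‖ * ‖U‖) ≤ Real.sqrt (‖U‖ * ‖U‖) := by gcongr
        _ = ‖U‖ := Real.sqrt_mul_self (norm_nonneg _))
    z1 z2 z3 z4 (fun U A hA => (hQ U A hA).2)
    (fun U A => (hρn _).trans ((hMs _ _).trans (mul_le_mul_of_nonneg_left
      (HTilde.norm_component_le 0 A) hs0)))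
    (fun U A A' => by
      rw [← hρs, ← map_sub]
      rfl)
    (fun U V A hA => by
      rw [← hρs]
      exact (hρn _).trans (norm_sigma_sub_le hσp.le hP hσ (hM (U.1 0) (A.1 0))
        (hM (V.1 0) (A.1 0)) (hQ (U - V) A hA).1))
    hS hK hC
  refine ⟨F, c, fun T W => ?_, fun u v w => ?_⟩
  · rw [hF, L2.inner_def]
    have h1 : ∫ x, inner ℂ (Q W (S T) x) (ρ (M (T.1 0) ((S T).1 0)) x) ∂(rMeasure G.workpiece) =
        ∫ x, ((P.σ x (T.1 0 x) * ‖(S T).1 0 x‖ ^ 2 * W.1 0 x : ℝ) : ℂ)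
          ∂(rMeasure G.workpiece) := by
      refine integral_congr_ae ?_
      have hmem : ∀ᵐ x ∂(rMeasure G.workpiece), x ∈ G.workpiece :=
        (withDensity_ac _).ae_le (ae_restrict_mem G.workpiece_polygon.isOpen.measurableSet)
      filter_upwards [(hQ W _ (hS T)).1, hρ (M (T.1 0) ((S T).1 0)),
        hac.ae_le (hM (T.1 0) ((S T).1 0)), hmem] with x h1 h2 h3 h4
      have h5 : x ∈ G.conductors := Or.inl h4
      rw [h1, h2, h3, indicator_of_mem h5, RCLike.inner_apply]
      push_cast
      rw [← Complex.mul_conj', map_mul, Complex.conj_ofReal]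
      ring
    have h2 : ∫ x, ((P.σ x (T.1 0 x) * ‖(S T).1 0 x‖ ^ 2 * W.1 0 x : ℝ) : ℂ)
        ∂(rMeasure G.workpiece) = ((∫ x, P.σ x (T.1 0 x) * ‖(S T).1 0 x‖ ^ 2 * W.1 0 x
        ∂(rMeasure G.workpiece) : ℝ) : ℂ) := integral_ofReal
    have h3 : ∀ x, P.freq ^ 2 * P.σ x (T.1 0 x) * ‖(S T).1 0 x‖ ^ 2 * W.1 0 x =
      P.freq ^ 2 * (P.σ x (T.1 0 x) * ‖(S T).1 0 x‖ ^ 2 * W.1 0 x) := fun x => by ring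
    simp only [h3]
    rw [integral_const_mul, h1, h2]
    show P.freq ^ 2 / 2 * (∫ x, P.σ x (T.1 0 x) * ‖(S T).1 0 x‖ ^ 2 * W.1 0 x
        ∂(rMeasure G.workpiece)) = _
    ring
  · have h1 := hc u v w
    have h2 := sq_le_sq' (abs_le.1 h1).1 (abs_le.1 h1).2
    rwa [mul_pow, mul_pow (Real.sqrt _), Real.sq_sqrt (by positivity),
      Real.sq_sqrt (by positivity)] at h2

end Heat

/-! ### The elliptic part of the heat equation. -/

section HeatOperator

open ContinuousLinearMap (adjoint adjoint_inner_left)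

theorem integrable_mul_of_ae_eq {α : Type*} [MeasurableSpace α] {μ : Measure α} {k : α → ℝ}
    {u w g : Lp ℝ 2 μ} (hg : g =ᵐ[μ] fun x => k x * u x) :
    Integrable (fun x => k x * u x * w x) μ ∧ inner ℝ g w = ∫ x, k x * u x * w x ∂μ := by
  have e : (fun x => inner ℝ (g x) (w x)) =ᵐ[μ] fun x => k x * u x * w x := by
    filter_upwards [hg] with x hx
    rw [hx]
    simp [mul_comm]
  exact ⟨(L2.integrable_inner g w).congr e, by rw [L2.inner_def]; exact integral_congr_ae e⟩

theorem le_inner_of_ae_eq {α : Type*} [MeasurableSpace α] {μ : Measure α} {k : α → ℝ} {a : ℝ}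
    {u g : Lp ℝ 2 μ} (hg : g =ᵐ[μ] fun x => k x * u x) (hk : ∀ᵐ x ∂μ, a ≤ k x) :
    a * ‖u‖ ^ 2 ≤ inner ℝ g u := by
  obtain ⟨h1, h2⟩ := integrable_mul_of_ae_eq (w := u) hg
  rw [h2, ← real_inner_self_eq_norm_sq, L2.inner_def, ← integral_const_mul]
  refine integral_mono_ae ((L2.integrable_inner u u).const_mul a) h1 ?_
  filter_upwards [hk] with x hx
  simp only [real_inner_self_eq_norm_sq, Real.norm_eq_abs, sq_abs]
  nlinarith [mul_le_mul_of_nonneg_right hx (sq_nonneg (u x))]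

/-- The `i`-th component of an element of `H¹₁(D)`. -/
def H1.component (D : Set Plane) (i : Fin 3) : H1 D →L[ℝ] Lp ℝ 2 (rMeasure D) :=
  (PiLp.proj 2 (fun _ : Fin 3 => Lp ℝ 2 (rMeasure D)) i).comp (H1 D).subtypeL

/-- The operators of the form `p† M p + q† M q + r† N r`. -/
theorem exists_sum_adjoint {V H K : Type*} [NormedAddCommGroup V] [InnerProductSpace ℝ V]
    [CompleteSpace V] [NormedAddCommGroup H] [InnerProductSpace ℝ H] [CompleteSpace H]
    [NormedAddCommGroup K] [InnerProductSpace ℝ K] [CompleteSpace K]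
    (p q : V →L[ℝ] H) (r : V →L[ℝ] K) (M : H →L[ℝ] H) (N : K →L[ℝ] K) :
    ∃ (B : V →L[ℝ] V) (E : K →L[ℝ] V),
      (∀ u w, inner ℝ (B u) w = inner ℝ (M (p u)) (p w) + inner ℝ (M (q u)) (q w) +
        inner ℝ (N (r u)) (r w)) ∧ ∀ g w, inner ℝ (E g) w = inner ℝ (N g) (r w) := by
  refine ⟨adjoint p ∘L M ∘L p + adjoint q ∘L M ∘L q + adjoint r ∘L N ∘L r, adjoint r ∘L N,
    fun u w => ?_, fun g w => ?_⟩
  · simp only [_root_.add_apply, ContinuousLinearMap.comp_apply, inner_add_left,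
      adjoint_inner_left]
  · rw [ContinuousLinearMap.comp_apply, adjoint_inner_left]

variable {m : ℕ} {G : Geometry m} {P : ProblemData G}

/-- Take for c the lower bound of κ. The gradient terms bound c‖T‖² except for its L² part, and the
boundary term has a favorable sign, so a Gårding inequality holds. -/
theorem exists_heat_operator [CompleteSpace (H1 G.workpiece)] (hP : P.Admissible)
    {κ₀ : Plane → ℝ} (hκ : P.HKappa κ₀)
    (tr : H1 G.workpiece →L[ℝ] Lp ℝ 2 (rBoundaryMeasure G.workpiece)) :
    ∃ (B : H1 G.workpiece →L[ℝ] H1 G.workpiece)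
      (E : Lp ℝ 2 (rBoundaryMeasure G.workpiece) →L[ℝ] H1 G.workpiece) (c : ℝ), 0 < c ∧
      (∀ T, c * ‖T‖ ^ 2 ≤ inner ℝ (B T) T + c * ‖T.1 0‖ ^ 2) ∧
      (∀ T W, inner ℝ (B T) W =
        ∫ x, κ₀ x * (T.1 1 x * W.1 1 x + T.1 2 x * W.1 2 x) ∂(rMeasure G.workpiece)
        + ∫ x, P.η x * tr T x * tr W x ∂(rBoundaryMeasure G.workpiece)) ∧
      ∀ g W, inner ℝ (E g) W = ∫ x, P.η x * g x * tr W x ∂(rBoundaryMeasure G.workpiece) := by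
  obtain ⟨a, b, ha, hab⟩ := hP.κ_bounds
  obtain ⟨a', b', ha', hab'⟩ := hP.η_bounds
  have hk : ∀ᵐ x ∂(rMeasure G.workpiece), a ≤ κ₀ x ∧ κ₀ x ≤ b := by
    refine (withDensity_ac _).ae_le ?_
    filter_upwards [hab, hκ] with x h1 h2
    have := h1 0
    rwa [h2 0] at this
  have hkm : AEStronglyMeasurable κ₀ (rMeasure G.workpiece) := by
    refine AEMeasurable.aestronglyMeasurable (AEMeasurable.mono_ac ?_ (withDensity_ac _))
    refine (hP.κ_caratheodory.1 0).congr ?_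
    filter_upwards [hκ] with x hx
    exact hx 0
  obtain ⟨Mκ, hMκ, -⟩ := exists_mul_operator (𝕜 := ℝ) hkm (C := b) (by
    filter_upwards [hk] with x hx
    rw [Real.norm_of_nonneg (ha.le.trans hx.1)]
    exact hx.2)
  obtain ⟨Mη, hMη, -⟩ := exists_mul_operator (𝕜 := ℝ) hP.η_measurable.aestronglyMeasurable
    (C := b') (by
      filter_upwards [hab'] with x hx
      rw [Real.norm_of_nonneg (ha'.le.trans hx.1)]
      exact hx.2)
  obtain ⟨B, E, hB, hE⟩ := exists_sum_adjoint (H1.component G.workpiece 1)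
    (H1.component G.workpiece 2) tr Mκ Mη
  have hB' : ∀ T W : H1 G.workpiece, inner ℝ (B T) W =
      inner ℝ (Mκ (T.1 1)) (W.1 1) + inner ℝ (Mκ (T.1 2)) (W.1 2) +
        inner ℝ (Mη (tr T)) (tr W) := hB
  refine ⟨B, E, a, ha, fun T => ?_, fun T W => ?_, fun g W => ?_⟩
  · rw [hB', H1.norm_sq]
    have h1 := le_inner_of_ae_eq (hMκ (T.1 1)) (hk.mono fun x hx => hx.1)
    have h2 := le_inner_of_ae_eq (hMκ (T.1 2)) (hk.mono fun x hx => hx.1)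
    have h3 := le_inner_of_ae_eq (hMη (tr T)) (hab'.mono fun x hx => hx.1)
    have h4 : 0 ≤ a' * ‖tr T‖ ^ 2 := by positivity
    linarith
  · obtain ⟨h1, h1'⟩ := integrable_mul_of_ae_eq (w := W.1 1) (hMκ (T.1 1))
    obtain ⟨h2, h2'⟩ := integrable_mul_of_ae_eq (w := W.1 2) (hMκ (T.1 2))
    rw [hB', (integrable_mul_of_ae_eq (w := tr W) (hMη (tr T))).2, h1', h2', ← integral_add h1 h2]
    congr 1
    exact integral_congr_ae (Eventually.of_forall fun x => by ring)
  · rw [hE, (integrable_mul_of_ae_eq (w := tr W) (hMη g)).2]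

end HeatOperator

/-! ### From functionals on V to elements of V. -/

section Dual

theorem memLp_clm_comp {α X Y : Type*} [MeasurableSpace α] {μ : Measure α}
    [NormedAddCommGroup X] [NormedSpace ℝ X] [NormedAddCommGroup Y] [NormedSpace ℝ Y]
    (T : X →L[ℝ] Y) {u : α → X} (hu : MemLp u 2 μ) : MemLp (fun t => T (u t)) 2 μ :=
  T.comp_memLp' hu

variable {V H : Type*} [NormedAddCommGroup V] [InnerProductSpace ℝ V] [CompleteSpace V]
  [NormedAddCommGroup H] [InnerProductSpace ℝ H] [CompleteSpace H] {τ : ℝ}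

theorem exists_inner_map (V : Type*) [NormedAddCommGroup V] [InnerProductSpace ℝ V] :
    ∃ J : V →L[ℝ] StrongDual ℝ V, ∀ u v, J u v = inner ℝ u v := by
  refine ⟨LinearMap.mkContinuous
    { toFun := fun u => innerSL ℝ u
      map_add' := fun u u' => by
        ext v
        simp
      map_smul' := fun r u => by
        ext v
        simp } 1 (fun u => ?_), fun u v => rfl⟩
  rw [one_mul]
  exact (innerSL_apply_norm ℝ u).le

theorem exists_riesz_map (V : Type*) [NormedAddCommGroup V] [InnerProductSpace ℝ V]
    [CompleteSpace V] :
    ∃ J : StrongDual ℝ V →L[ℝ] V, ∀ f v, inner ℝ (J f) v = f v := by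
  have key : ∀ (f : StrongDual ℝ V) v, inner ℝ ((InnerProductSpace.toDual ℝ V).symm f) v = f v :=
    fun f v => InnerProductSpace.toDual_symm_apply
  refine ⟨LinearMap.mkContinuous
    { toFun := fun f => (InnerProductSpace.toDual ℝ V).symm f
      map_add' := fun f g => map_add _ _ _
      map_smul' := fun r f => ext_inner_right ℝ fun v => by
        rw [RingHom.id_apply, real_inner_smul_left, key, key]
        rfl } 1 (fun f => ?_), key⟩
  rw [one_mul]
  exact ((InnerProductSpace.toDual ℝ V).symm.norm_map f).le

/-- Under the Riesz isomorphism of V' with V, the functional ⟨ι u, ι ·⟩ becomes ι† ι u, so the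
equation in V' and the abstract equation in V are the same. -/
theorem isNonlinearEvolution_iff_dual {ι : V →L[ℝ] H} {B : V →L[ℝ] V} {F : V → V} {K : ℝ}
    (hF : ∀ u v, ‖F u - F v‖ ≤ K * ‖u - v‖) {f : ℝ → V}
    (hf : MemLp f 2 (volume.restrict (Ioo 0 τ))) {u₀ : H} {J : H → StrongDual ℝ V}
    (hJ : ∀ h v, J h v = inner ℝ h (ι v)) (u : ℝ → V) :
    IsNonlinearEvolution τ ι B F f u₀ u ↔ MemLp u 2 (volume.restrict (Ioo 0 τ)) ∧
      ∃ w : ℝ → StrongDual ℝ V, MemLp w 2 (volume.restrict (Ioo 0 τ)) ∧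
        IsWeakTimeDeriv τ (fun t => J (ι (u t))) w ∧
        (∀ᵐ t ∂(volume.restrict (Ioo 0 τ)),
          ∀ v, w t v + inner ℝ (B (u t)) v = inner ℝ (F (u t)) v + inner ℝ (f t) v) ∧
        HasInitialValue τ (fun t => ι (u t)) u₀ := by
  obtain ⟨j, hj⟩ := exists_inner_map V
  obtain ⟨k, hk⟩ := exists_riesz_map V
  have hjg : ∀ x, j (gram ι x) = J (ι x) := fun x => by
    ext v
    rw [hj, hJ, inner_gram]
  have hkg : ∀ x, k (J (ι x)) = gram ι x := fun x => ext_inner_right ℝ fun v => by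
    rw [hk, hJ, inner_gram]
  constructor
  · rintro ⟨hu, hw, h0⟩
    have hr : MemLp (fun t => F (u t) + f t - B (u t)) 2 (volume.restrict (Ioo 0 τ)) :=
      ((memLp_comp_of_lipschitz hF hu).add hf).sub (memLp_clm_comp B hu)
    refine ⟨hu, fun t => j (F (u t) + f t - B (u t)), memLp_clm_comp j hr, ?_, ?_, h0⟩
    · have h1 := hw.clm_comp j (memLp_clm_comp (gram ι) hu) hr
      simpa only [Function.comp_def, hjg] using h1
    · refine Eventually.of_forall fun t v => ?_
      rw [hj, inner_sub_left, inner_add_left]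
      ring
  · rintro ⟨hu, w, hw, hd, he, h0⟩
    refine ⟨hu, ?_, h0⟩
    have hJm : MemLp (fun t => J (ι (u t))) 2 (volume.restrict (Ioo 0 τ)) := by
      have := memLp_clm_comp j (memLp_clm_comp (gram ι) hu)
      simpa only [Function.comp_def, hjg] using this
    have h1 := hd.clm_comp k hJm hw
    refine h1.congr (Eventually.of_forall fun t => hkg _) ?_
    filter_upwards [he] with t ht
    refine ext_inner_right ℝ fun v => ?_
    rw [hk, inner_sub_left, inner_add_left]
    linarith [ht v]

end Dual

/-! ### The coupled problem. -/

section Coupled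

variable {m : ℕ} {G : Geometry m} {P : ProblemData G}

/-- Traces exist and are unique, so the quantifiers over traces in `ProblemData.HeatEq` amount to
inserting the trace operator. -/
theorem exists_heatEq_iff [CompleteSpace (H1 G.workpiece)] (hP : P.Admissible)
    {κ₀ : Plane → ℝ} (hκ : P.HKappa κ₀) {S : H1 G.workpiece → HTilde G.domain}
    {F : H1 G.workpiece → StrongDual ℝ (H1 G.workpiece)}
    (hF : ∀ T W, F T W = 1 / 2 * ∫ x, P.freq ^ 2 * P.σ x (T.1 0 x) * ‖(S T).1 0 x‖ ^ 2 * W.1 0 x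
      ∂(rMeasure G.workpiece)) :
    ∃ (B : H1 G.workpiece →L[ℝ] H1 G.workpiece)
      (E : Lp ℝ 2 (rBoundaryMeasure G.workpiece) →L[ℝ] H1 G.workpiece) (c : ℝ), 0 < c ∧
      (∀ T, c * ‖T‖ ^ 2 ≤ inner ℝ (B T) T + c * ‖T.1 0‖ ^ 2) ∧
      ∀ T w Tc, P.HeatEq κ₀ (S T) T w Tc ↔
        ∀ v, w v + inner ℝ (B T) v = F T v + inner ℝ (E Tc) v := by
  obtain ⟨tr, htr⟩ := exists_trace_map G.workpiece_polygon G.workpiece_subset_pos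
  obtain ⟨B, E, c, hc, hB1, hB, hE⟩ := exists_heat_operator hP hκ tr
  refine ⟨B, E, c, hc, hB1, fun T w Tc => ⟨?_, fun h => ⟨tr T, (htr T _).2 rfl, fun W z hz => ?_⟩⟩⟩
  · rintro ⟨g, hg, h⟩ v
    have h1 := h v (tr v) ((htr v _).2 rfl)
    rw [(htr T g).1 hg] at h1
    rw [hB T v, hF T v, hE Tc v]
    exact h1
  · rw [(htr W z).1 hz, ← hB T W, ← hF T W, ← hE Tc W]
    exact h W

/-- The elimination of the potential. Conversely, S is Lipschitz, so t ↦ S(T(t)) is automatically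
square integrable in time. -/
theorem exists_isSolution_iff [CompleteSpace (H1 G.workpiece)] (hP : P.Admissible)
    {κ₀ : Plane → ℝ} (hκ : P.HKappa κ₀) (hσ : P.HSigma) :
    ∃ (S : H1 G.workpiece → HTilde G.domain) (B : H1 G.workpiece →L[ℝ] H1 G.workpiece)
      (F : H1 G.workpiece → H1 G.workpiece) (f : ℝ → H1 G.workpiece) (c C : ℝ), 0 < c ∧
      (∀ x, c * ‖x‖ ^ 2 ≤ inner ℝ (B x) x + c * ‖H1.toL2 G.workpiece x‖ ^ 2) ∧
      (∀ u v w, inner ℝ (F u - F v) w ^ 2 ≤ C ^ 2 * (‖H1.toL2 G.workpiece (u - v)‖ * ‖u - v‖ *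
        (‖H1.toL2 G.workpiece w‖ * ‖w‖))) ∧
      MemLp f 2 (volume.restrict (Ioo 0 P.τ)) ∧
      ∀ A T, P.IsSolution κ₀ A T ↔
        IsNonlinearEvolution P.τ (H1.toL2 G.workpiece) B F f P.T₀ T ∧
        A =ᵐ[volume.restrict (Ioo 0 P.τ)] fun t => S (T t) := by
  obtain ⟨S, K, C, hK0, hC0, hS, hSK, hSeq, hSC⟩ := exists_potential_map hP hσ
  obtain ⟨F', c', hF', hc'⟩ := exists_source_map hP hσ hK0 hC0 hS hSK hSC
  obtain ⟨B, E, c, hc, hB1, hheat⟩ := exists_heatEq_iff hP hκ hF'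
  obtain ⟨k, hk⟩ := exists_riesz_map (H1 G.workpiece)
  have hF : ∀ u v w, inner ℝ (k (F' u) - k (F' v)) w ^ 2 ≤ c' ^ 2 *
      (‖H1.toL2 G.workpiece (u - v)‖ * ‖u - v‖ * (‖H1.toL2 G.workpiece w‖ * ‖w‖)) :=
    fun u v w => by
    rw [inner_sub_left, hk, hk]
    exact hc' u v w
  have hf : MemLp (fun t => E (P.Tc t)) 2 (volume.restrict (Ioo 0 P.τ)) := memLp_clm_comp E hP.Tc_mem
  have hSm : ∀ {T : ℝ → H1 G.workpiece}, MemLp T 2 (volume.restrict (Ioo 0 P.τ)) →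
      MemLp (fun t => S (T t)) 2 (volume.restrict (Ioo 0 P.τ)) := fun {T} hT => by
    refine memLp_comp_of_lipschitz (K := C) (fun u v => (hSC u v).trans ?_) hT
    have h1 : ‖(u - v).1 0‖ ≤ ‖u - v‖ := PiLp.norm_apply_le (u - v).1 0
    refine mul_le_mul_of_nonneg_left ?_ hC0
    calc Real.sqrt (‖(u - v).1 0‖ * ‖u - v‖) ≤ Real.sqrt (‖u - v‖ * ‖u - v‖) := by gcongr
      _ = ‖u - v‖ := Real.sqrt_mul_self (norm_nonneg _)
  refine ⟨S, B, fun T => k (F' T), fun t => E (P.Tc t), c, c', hc, hB1, hF, hf, fun A T => ?_⟩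
  have hiff := isNonlinearEvolution_iff_dual (ι := H1.toL2 G.workpiece) (B := B)
    (F := fun T => k (F' T)) (norm_sub_le_of_inner_sq_le (ι := H1.toL2 G.workpiece) hF) hf
    (u₀ := P.T₀) (J := pairing) (fun h v => rfl) T
  refine Iff.trans ?_ (and_congr_left' hiff.symm)
  constructor
  · rintro ⟨hA, hA0, hT, w, hw, hd, he, h0⟩
    have hAS : A =ᵐ[volume.restrict (Ioo 0 P.τ)] fun t => S (T t) := by
      filter_upwards [hA0, he] with t h1 h2
      exact (hSeq _ _ h1).1 h2.1
    refine ⟨⟨hT, w, hw, hd, ?_, h0⟩, hAS⟩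
    filter_upwards [hAS, he] with t h1 h2
    have h3 := h2.2
    rw [h1] at h3
    intro v
    rw [hk]
    exact (hheat _ _ _).1 h3 v
  · rintro ⟨⟨hT, w, hw, hd, he, h0⟩, hAS⟩
    refine ⟨(hSm hT).ae_eq hAS.symm, ?_, hT, w, hw, hd, ?_, h0⟩
    · filter_upwards [hAS] with t h1
      rw [h1]
      exact hS _
    · filter_upwards [hAS, he] with t h1 h2
      rw [h1]
      exact ⟨(hSeq _ _ (hS _)).2 rfl, (hheat _ _ _).2 fun v => by rw [← hk (F' (T t))]; exact h2 v⟩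

theorem exists_pairing_map (D : Set Plane) :
    ∃ J : Lp ℝ 2 (rMeasure D) →L[ℝ] StrongDual ℝ (H1 D), ∀ h, J h = pairing h := by
  refine ⟨LinearMap.mkContinuous
    { toFun := pairing
      map_add' := fun h h' => by
        ext v
        show inner ℝ (h + h') (H1.toL2 D v) = inner ℝ h (H1.toL2 D v) + inner ℝ h' (H1.toL2 D v)
        exact inner_add_left _ _ _
      map_smul' := fun r h => by
        ext v
        show inner ℝ (r • h) (H1.toL2 D v) = r * inner ℝ h (H1.toL2 D v)
        exact real_inner_smul_left _ _ _ }
    ‖H1.toL2 D‖ (fun h => ?_), fun h => rfl⟩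
  refine (ContinuousLinearMap.opNorm_comp_le _ _).trans ?_
  rw [innerSL_apply_norm, mul_comm]

/-- The embedding of L²₁ in the dual of H¹₁ carries a derivative in L²₁ to a derivative in the dual.
As distributional derivatives are unique, it is the one in the equation. -/
theorem isRegularSolution_iff (κ₀ : Plane → ℝ) (A : ℝ → HTilde G.domain)
    (T : ℝ → H1 G.workpiece) :
    P.IsRegularSolution κ₀ A T ↔ P.IsSolution κ₀ A T ∧
      ∃ T' : ℝ → Lp ℝ 2 (rMeasure G.workpiece), L2Time P.τ T' ∧
        IsWeakTimeDeriv P.τ (fun t => H1.toL2 G.workpiece (T t)) T' := by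
  obtain ⟨J, hJ⟩ := exists_pairing_map G.workpiece
  have key : ∀ T' : ℝ → Lp ℝ 2 (rMeasure G.workpiece), L2Time P.τ T → L2Time P.τ T' →
      IsWeakTimeDeriv P.τ (fun t => H1.toL2 G.workpiece (T t)) T' →
      L2Time P.τ (fun t => pairing (T' t)) ∧
      IsWeakTimeDeriv P.τ (fun t => pairing (H1.toL2 G.workpiece (T t)))
        (fun t => pairing (T' t)) := fun T' hT hT' hd => by
    simp only [← hJ]
    have k1 : MemLp (fun t => J (T' t)) 2 (volume.restrict (Ioo 0 P.τ)) :=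
      memLp_clm_comp (X := Lp ℝ 2 (rMeasure G.workpiece))
        (Y := StrongDual ℝ (H1 G.workpiece)) J hT'
    exact ⟨k1, IsWeakTimeDeriv.clm_comp (X := Lp ℝ 2 (rMeasure G.workpiece))
        (Y := StrongDual ℝ (H1 G.workpiece)) J
        (memLp_clm_comp (H1.toL2 G.workpiece) hT) hT' hd⟩
  constructor
  · rintro ⟨hA, hA0, hT, T', hT', hd, he, h0⟩
    obtain ⟨k1, k2⟩ := key T' hT hT' hd
    exact ⟨⟨hA, hA0, hT, fun t => pairing (T' t), k1, k2, he, h0⟩, T', hT', hd⟩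
  · rintro ⟨⟨hA, hA0, hT, w, hw, hdw, he, h0⟩, T', hT', hd⟩
    obtain ⟨k1, k2⟩ := key T' hT hT' hd
    refine ⟨hA, hA0, hT, T', hT', hd, ?_, h0⟩
    filter_upwards [he, isWeakTimeDeriv_unique (integrableOn_of_memLp hw)
      (integrableOn_of_memLp k1) hdw k2] with t h1 h2
    rw [← h2]
    exact h1

theorem existsUnique_solution (hP : P.Admissible) {κ₀ : Plane → ℝ} (hκ : P.HKappa κ₀)
    (hσ : P.HSigma) :
    ∃ A T, P.IsSolution κ₀ A T ∧
      ∀ A' T', P.IsSolution κ₀ A' T' →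
        A' =ᵐ[volume.restrict (Ioo 0 P.τ)] A ∧ T' =ᵐ[volume.restrict (Ioo 0 P.τ)] T := by
  have := completeSpace_H1 G.workpiece_polygon.isOpen.measurableSet G.workpiece_subset_pos
    G.workpiece_polygon.isBounded
  obtain ⟨S, B, F, f, c, C, hc, hB, hF, hf, hiff⟩ := exists_isSolution_iff hP hκ hσ
  obtain ⟨T, hT, huniq⟩ := existsUnique_nonlinear_evolution hP.τ_pos
    (H1.denseRange_toL2 G.workpiece_polygon.isOpen G.workpiece_subset_pos
      G.workpiece_polygon.isBounded) hc hB hF hf P.T₀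
  refine ⟨fun t => S (T t), T, (hiff _ _).2 ⟨hT, EventuallyEq.rfl⟩, fun A' T' h => ?_⟩
  obtain ⟨h1, h2⟩ := (hiff _ _).1 h
  have h3 := huniq T' h1
  refine ⟨?_, h3⟩
  filter_upwards [h2, h3] with t h4 h5
  rw [h4, h5]

end Coupled

end InductionHeating

end

theorem mainTheorem2 {m : ℕ} (G : InductionHeating.Geometry m)
    (P : InductionHeating.ProblemData G) (hP : P.Admissible)
    (κ₀ : InductionHeating.Plane → ℝ) (hκ : P.HKappa κ₀) (hσ : P.HSigma) :
    (∃ A T, P.IsSolution κ₀ A T ∧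
      ∀ A' T', P.IsSolution κ₀ A' T' →
        A' =ᵐ[volume.restrict (Ioo 0 P.τ)] A ∧ T' =ᵐ[volume.restrict (Ioo 0 P.τ)] T) ∧
    (∀ A T, P.IsRegularSolution κ₀ A T ↔
      P.IsSolution κ₀ A T ∧ ∃ T' : ℝ → Lp ℝ 2 (InductionHeating.rMeasure G.workpiece),
        InductionHeating.L2Time P.τ T' ∧ InductionHeating.IsWeakTimeDeriv P.τ
          (fun t => InductionHeating.H1.toL2 G.workpiece (T t)) T') ∧
    (∀ A₁ T₁ A₂ T₂, P.IsRegularSolution κ₀ A₁ T₁ → P.IsRegularSolution κ₀ A₂ T₂ →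
      A₁ =ᵐ[volume.restrict (Ioo 0 P.τ)] A₂ ∧ T₁ =ᵐ[volume.restrict (Ioo 0 P.τ)] T₂) := by
  have hex := InductionHeating.existsUnique_solution hP hκ hσ
  refine ⟨hex, InductionHeating.isRegularSolution_iff κ₀, fun A₁ T₁ A₂ T₂ h₁ h₂ => ?_⟩
  obtain ⟨A, T, -, huniq⟩ := hex
  obtain ⟨a₁, t₁⟩ := huniq _ _ ((InductionHeating.isRegularSolution_iff κ₀ _ _).1 h₁).1
  obtain ⟨a₂, t₂⟩ := huniq _ _ ((InductionHeating.isRegularSolution_iff κ₀ _ _).1 h₂).1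
  exact ⟨a₁.trans a₂.symm, t₁.trans t₂.symm⟩
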